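/- **Setting.** Let $S$ be a compact connected complex manifold with real symmetric 2-tensors $g_a$, $a\in\mathcal A$ ($\mathcal A$ finite), such that near each point $S$ is holomorphically a product of domains $S_a\subset\mathbb C^{d_a}$ and each $g_a$ is the pull-back of a positive or negative definite Kähler metric on $S_a$ of constant scalar curvature $2d_as_a$ (with the convention $Scal(-g)=-Scal(g)$). Put $\omega_a=g_a(i\cdot,\cdot)$. Let $E_0,E_\infty\to S$ be holomorphic vector bundles of ranks $d_0+1$, $d_\infty+1$ with projectively flat hermitian metrics (near each point there is a holomorphic frame in which the metric is $e^{2\varphi}$ times the standard one; the Chern curvature is then the scalar form $\Omega=-dd^c\varphi$, in the normalization $2\pi c_1=(\mathrm{rank})[\Omega]$), whose curvature forms satisfy $\Omega_\infty-\Omega_0=\sum_{a\in\mathcal A}\omega_a$. Let $M=P(E_0\oplus E_\infty)$ and let $x_a\in(-1,1)$, $a\in\mathcal A$, be such that $x_ag_a>0$. Put $x_0=1$, $x_\infty=-1$, $s_0=d_0+1$, $s_\infty=-(d_\infty+1)$ and $\hat{\mathcal A}=\mathcal A\cup\{0,\infty\}$ (an index with $d_a=0$ contributes nothing). On $M$ let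 $z=(|v_0|^2-|v_\infty|^2)/(|v_0|^2+|v_\infty|^2)$ at $[v_0+v_\infty]$, let $M_0=\{-1<z<1\}$, and on $M_0$ let $\theta=d^c\log(|v_0|/|v_\infty|)$, where $(d^cf)(X)=-df(iX)$. Let $\omega_0$ and $-\omega_\infty$ be the Fubini–Study forms $dd^c\log|v_0|$, $dd^c\log|v_\infty|$ computed in frames as above, with metrics $g_0$, $-g_\infty$. The admissible form $\omega$ with parameters $x$ is the smooth 2-form on $M$ equal on $M_0$ to $\sum_{a\in\hat{\mathcal A}}\frac{1+x_az}{x_a}\omega_a+dz\wedge\theta$; its class is the admissible class $\Omega_x$. Given a smooth $\Theta$ on $[-1,1]$ with $\Theta>0$ on $(-1,1)$, $\Theta(\pm1)=0$, $\Theta'(\pm1)=\mp2$, the corresponding admissible metric in $\Omega_x$ is the smooth metric $g$ on $M$ equal on $M_0$ to $\sum_{a\in\hat{\mathcal A}}\frac{1+x_az}{x_a}g_a+\frac{dz^2}{\Theta(z)}+\Theta(z)\theta^2$, with Kähler form $\omega$ and complex structure $J$, $\omega=g(J\cdot,\cdot)$. For a positive Killing potential $f$ (i.e. $J\,\mathrm{grad}_g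 f$ is a Killing field) and $p\in\mathbb R$ let $$Scal_{f,p}(g)=f^2\,Scal(g)-2(p-1)f\Delta_gf-p(p-1)|df|_g^2,\qquad \Delta_g=\delta d .$$ A Kähler metric $g$ is $(f,p)$-extremal if $Scal_{f,p}(g)$ is a Killing potential, and $(f,p)$-CSCK if it is constant. For real $a>1$ and $p$ put $p_c(z)=\prod_{b\in\hat{\mathcal A}}(1+x_bz)^{d_b}$ and $$\alpha_{r,q}=\int_{-1}^1(t+a)^qt^rp_c(t)\,dt,$$ $$\beta_{r,q}=\int_{-1}^1\Big(\sum_{b\in\hat{\mathcal A}}\frac{x_bd_bs_b}{1+x_bt}\Big)t^rp_c(t)(t+a)^q\,dt+(-1)^r(a-1)^qp_c(-1)+(1+a)^qp_c(1).$$ **Proposition.** The form $\omega$ above extends smoothly to $M$, and for all real $a>1$ and $p$ the following hold. 1. $\alpha_{1,-(1+p)}^2<\alpha_{0,-(1+p)}\,\alpha_{2,-(1+p)}$, and the system $$\alpha_{1,-(1+p)}A_1+\alpha_{0,-(1+p)}A_2=2\beta_{0,1-p},\qquad \alpha_{2,-(1+p)}A_1+\alpha_{1,-(1+p)}A_2=2\beta_{1,1-p}$$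 has a unique solution $(A_1,A_2)$. 2. For this solution let $$Q(z)=\frac{p_c(z)}{(z+a)^{p-1}}\sum_{b\in\hat{\mathcal A}}\frac{2d_bs_bx_b}{1+x_bz}-\frac{(A_1z+A_2)p_c(z)}{(z+a)^{p+1}},$$ $$G(z)=\frac{2p_c(-1)}{(a-1)^{p-1}}(z+1)+\int_{-1}^zQ(t)(z-t)\,dt,\qquad F(z)=(z+a)^{p-1}G(z).$$ Then $F$ is smooth on $[-1,1]$, $\big(F/(z+a)^{p-1}\big)''=Q$ on $(-1,1)$, $F(\pm1)=0$ and $F'(\pm1)=\mp2p_c(\pm1)$. 3. If $F>0$ on $(-1,1)$, then $\Theta=F/p_c$ extends to a smooth function on $[-1,1]$ with $\Theta>0$ on $(-1,1)$, $\Theta(\pm1)=0$, $\Theta'(\pm1)=\mp2$, and the corresponding admissible metric $g$ exists on $M$, is Kähler with Kähler form $\omega$ (so lies in $\Omega_x$), and is $(z+a,p)$-extremal; moreover $Scal_{z+a,p}(g)=A_1z+A_2$, and $g$ is $(z+a,p)$-CSCK if and only if $A_1=0$. -/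

import Mathlib

open Set Bundle
open scoped Manifold ContDiff Topology

noncomputable section

/-! ## Riemannian and Kähler geometry in a coordinate domain

`V` is a finite dimensional real vector space (the coordinate space), `G` a metric on (an open
subset of) `V`. All formulas are pointwise at `u`. -/

namespace LocalGeometry

variable {V : Type*} [NormedAddCommGroup V] [NormedSpace ℝ V]

/-- The vector dual to a covector with respect to the metric. -/
def sharp (G : V → V →L[ℝ] V →L[ℝ] ℝ) (u : V) (α : V →L[ℝ] ℝ) : V :=
  (G u).inverse α

/-- Christoffel symbols `Γ(v, w)` of the Levi-Civita connection:
`G (Γ(v, w), k) = (∂_v G(w, k) + ∂_w G(v, k) - ∂_k G(v, w)) / 2`. -/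
def christoffel (G : V → V →L[ℝ] V →L[ℝ] ℝ) (u v w : V) : V :=
  sharp G u ((1 / 2 : ℝ) • (fderiv ℝ G u v w + fderiv ℝ G u w v
    - ((fderiv ℝ G u).flip v).flip w))

/-- The curvature `R(v, w) k = ∇_v ∇_w k - ∇_w ∇_v k` (for constant fields `v, w, k`). -/
def riemann (G : V → V →L[ℝ] V →L[ℝ] ℝ) (u v w k : V) : V :=
  fderiv ℝ (fun u' => christoffel G u' w k) u v - fderiv ℝ (fun u' => christoffel G u' v k) u w
    + christoffel G u v (christoffel G u w k) - christoffel G u w (christoffel G u v k)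

/-- The squared norm `|df|²` of the differential of a function. -/
def normSqDiff (G : V → V →L[ℝ] V →L[ℝ] ℝ) (f : V → ℝ) (u : V) : ℝ :=
  fderiv ℝ f u (sharp G u (fderiv ℝ f u))

variable [FiniteDimensional ℝ V]

/-- A covector of the basis dual to a fixed basis of `V` (used only to take traces). -/
def coord (V : Type*) [NormedAddCommGroup V] [NormedSpace ℝ V] [FiniteDimensional ℝ V]
    (i : Fin (Module.finrank ℝ V)) : V →L[ℝ] ℝ :=
  LinearMap.toContinuousLinearMap ((Module.finBasis ℝ V).coord i)

/-- The Ricci tensor `Ric(w, k) = trace (v ↦ R(v, w) k)`. -/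
def ricci (G : V → V →L[ℝ] V →L[ℝ] ℝ) (u w k : V) : ℝ :=
  ∑ i, coord V i (riemann G u (Module.finBasis ℝ V i) w k)

/-- The scalar curvature, the metric trace of the Ricci tensor. -/
def scal (G : V → V →L[ℝ] V →L[ℝ] ℝ) (u : V) : ℝ :=
  ∑ i, ricci G u (Module.finBasis ℝ V i) (sharp G u (coord V i))

/-- The Riemannian Hessian of a function. -/
def hessian (G : V → V →L[ℝ] V →L[ℝ] ℝ) (f : V → ℝ) (u v w : V) : ℝ :=
  fderiv ℝ (fderiv ℝ f) u v w - fderiv ℝ f u (christoffel G u v w)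

/-- The (nonnegative) Laplacian `Δ f = - trace (Hess f) = δ d f`. -/
def laplacian (G : V → V →L[ℝ] V →L[ℝ] ℝ) (f : V → ℝ) (u : V) : ℝ :=
  - ∑ i, hessian G f u (Module.finBasis ℝ V i) (sharp G u (coord V i))

/-- The weighted scalar curvature
`Scal_{f,p} = f² Scal - 2 (p - 1) f Δ f - p (p - 1) |df|²`. -/
def weightedScal (G : V → V →L[ℝ] V →L[ℝ] ℝ) (f : V → ℝ) (p : ℝ) (u : V) : ℝ :=
  f u ^ 2 * scal G u - 2 * (p - 1) * f u * laplacian G f u - p * (p - 1) * normSqDiff G f u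

end LocalGeometry

namespace LocalGeometry

variable {V : Type*} [NormedAddCommGroup V] [NormedSpace ℝ V]

/-- The endomorphism field `J` determined by a metric `G` and a 2-form `W` through
`W(v, w) = G(J v, w)`. -/
def complexStr (G W : V → V →L[ℝ] V →L[ℝ] ℝ) (u : V) : V →L[ℝ] V :=
  (G u).inverse ∘L W u

/-- The Nijenhuis tensor `[Jv, Jw] - J [Jv, w] - J [v, Jw] - [v, w]` (for constant fields `v, w`)
of an endomorphism field. -/
def nijenhuis (J : V → V →L[ℝ] V) (u v w : V) : V :=
  fderiv ℝ J u (J u v) w - fderiv ℝ J u (J u w) v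
    + J u (fderiv ℝ J u w v) - J u (fderiv ℝ J u v w)

/-- `dW = 0` at `u`, for a 2-form `W`. -/
def IsClosedFormAt (W : V → V →L[ℝ] V →L[ℝ] ℝ) (u : V) : Prop :=
  ∀ v w k, fderiv ℝ W u v w k + fderiv ℝ W u w k v + fderiv ℝ W u k v w = 0

/-- The metric `G` and the 2-form `W` are smooth near `u`, and form at `u` a Kähler structure
(with integrable complex structure `J`, `W(v, w) = G(J v, w)`). -/
structure IsKahlerAt (G W : V → V →L[ℝ] V →L[ℝ] ℝ) (u : V) : Prop where
  smooth_metric : ContDiffAt ℝ ∞ G u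
  smooth_form : ContDiffAt ℝ ∞ W u
  symm : ∀ v w, G u v w = G u w v
  pos : ∀ v, v ≠ 0 → 0 < G u v v
  alt : ∀ v, W u v v = 0
  closed : IsClosedFormAt W u
  sq : ∀ v, complexStr G W u (complexStr G W u v) = -v
  integrable : ∀ v w, nijenhuis (complexStr G W) u v w = 0

/-- The Killing equation at `u` for the vector field `J grad f` of the Kähler structure `(G, W)`:
the Lie derivative of `G` along it vanishes. -/
def IsKillingPotentialAt (G W : V → V →L[ℝ] V →L[ℝ] ℝ) (f : V → ℝ) (u : V) : Prop :=
  let X : V → V := fun u' => complexStr G W u' (sharp G u' (fderiv ℝ f u'))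
  ∀ v w, fderiv ℝ G u (X u) v w + G u (fderiv ℝ X u v) w + G u v (fderiv ℝ X u w) = 0

/-- `dd^c f`, where `(d^c f)(v) = - df (i v)`, as a 2-form on a complex vector space. -/
def ddc {V : Type*} [NormedAddCommGroup V] [NormedSpace ℂ V] (f : V → ℝ) (u v w : V) : ℝ :=
  fderiv ℝ (fderiv ℝ f) u w (Complex.I • v) - fderiv ℝ (fderiv ℝ f) u v (Complex.I • w)

/-- The pull-back to `ℂⁿ ∖ 0` of the Fubini-Study metric on `ℂPⁿ⁻¹` with Kähler form
`dd^c log ‖v‖`; its scalar curvature is `2 (n - 1) n`. -/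
def fubiniStudy {n : ℕ} (v X Y : EuclideanSpace ℂ (Fin n)) : ℝ :=
  2 * (inner ℂ X Y * (‖v‖ : ℂ) ^ 2 - inner ℂ X v * inner ℂ v Y).re / ‖v‖ ^ 4

end LocalGeometry

/-! ## Tensor fields and Kähler structures on a manifold -/

namespace ManifoldGeometry

/-- A field of real bilinear forms on the tangent spaces of a manifold. -/
abbrev Tensor2 (V : Type*) [NormedAddCommGroup V] [NormedSpace ℝ V]
    (M : Type*) [TopologicalSpace M] [ChartedSpace V M] :=
  ∀ x : M, TangentSpace 𝓘(ℝ, V) x →L[ℝ] TangentSpace 𝓘(ℝ, V) x →L[ℝ] ℝ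

variable {V : Type*} [NormedAddCommGroup V] [NormedSpace ℝ V]
  {M : Type*} [TopologicalSpace M] [ChartedSpace V M]

/-- The pull-back of a field of bilinear forms by a map from a vector space. -/
def pullback {X : Type*} [NormedAddCommGroup X] [NormedSpace ℝ X]
    (T : Tensor2 V M) (Φ : X → M) (u : X) : X →L[ℝ] X →L[ℝ] ℝ :=
  ContinuousLinearMap.bilinearComp (E := V) (F := V) (G := ℝ) (T (Φ u))
    (mfderiv 𝓘(ℝ, X) 𝓘(ℝ, V) Φ u) (mfderiv 𝓘(ℝ, X) 𝓘(ℝ, V) Φ u)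

/-- The expression of a field of bilinear forms in the preferred chart at `x`. -/
def inChart (T : Tensor2 V M) (x : M) : V → V →L[ℝ] V →L[ℝ] ℝ :=
  pullback T (chartAt V x).symm

/-- `g` is a smooth Riemannian metric and `om` a smooth closed 2-form on `M`, which together with
the endomorphism field `J`, `om(v, w) = g(J v, w)`, form a Kähler structure. -/
def IsKahler (g om : Tensor2 V M) : Prop :=
  ∀ x : M, LocalGeometry.IsKahlerAt (inChart g x) (inChart om x) (chartAt V x x)

/-- The vector field `J grad f` is Killing. -/
def IsKillingPotential (g om : Tensor2 V M) (f : M → ℝ) : Prop :=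
  ContMDiff 𝓘(ℝ, V) 𝓘(ℝ) ∞ f ∧
  ∀ x : M, LocalGeometry.IsKillingPotentialAt (inChart g x) (inChart om x)
    (f ∘ (chartAt V x).symm) (chartAt V x x)

variable [FiniteDimensional ℝ V]

/-- The `(f, p)`-scalar curvature of a Riemannian metric. -/
def weightedScal (g : Tensor2 V M) (f : M → ℝ) (p : ℝ) (x : M) : ℝ :=
  LocalGeometry.weightedScal (inChart g x) (f ∘ (chartAt V x).symm) p (chartAt V x x)

/-- `(g, om)` is an `(f, p)`-extremal Kähler metric: `f` is a positive Killing potential and the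
`(f, p)`-scalar curvature is a Killing potential. -/
def IsWeightedExtremal (g om : Tensor2 V M) (f : M → ℝ) (p : ℝ) : Prop :=
  IsKahler g om ∧ IsKillingPotential g om f ∧ (∀ x, 0 < f x) ∧
    IsKillingPotential g om (weightedScal g f p)

/-- `(g, om)` is an `(f, p)`-CSCK metric: `f` is a positive Killing potential and the
`(f, p)`-scalar curvature is constant. -/
def IsWeightedCSCK (g om : Tensor2 V M) (f : M → ℝ) (p : ℝ) : Prop :=
  IsKahler g om ∧ IsKillingPotential g om f ∧ (∀ x, 0 < f x) ∧
    ∃ c : ℝ, ∀ x, weightedScal g f p x = c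

end ManifoldGeometry

/-! ## The numerical data of an admissible manifold and class, and the function `F` -/

/-- `d a`, `s a`: complex dimensions and normalized scalar curvatures of the factors of the base;
`d₀ + 1`, `d₁ + 1`: the ranks of `E₀` and `E_∞`; `x a`: the parameters of the admissible class. -/
structure AdmissibleParams (ι : Type*) where
  d : ι → ℕ
  d₀ : ℕ
  d₁ : ℕ
  s : ι → ℝ
  x : ι → ℝ

namespace AdmissibleParams

variable {ι : Type*} [Fintype ι] (P : AdmissibleParams ι)

/-- `p_c(z) = ∏ (1 + x_a z)^{d_a}` over the extended index set, where `x_0 = 1`, `x_∞ = -1` (a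
factor with exponent zero is `1`). -/
def pc (z : ℝ) : ℝ :=
  (∏ a, (1 + P.x a * z) ^ P.d a) * (1 + z) ^ P.d₀ * (1 - z) ^ P.d₁

/-- `∑ x_a d_a s_a / (1 + x_a z)` over the extended index set, where `x_0 = 1`, `s_0 = d_0 + 1`,
`x_∞ = -1`, `s_∞ = -(d_∞ + 1)` (a summand with `d_a = 0` vanishes). -/
def curvSum (z : ℝ) : ℝ :=
  (∑ a, P.x a * P.d a * P.s a / (1 + P.x a * z)) + P.d₀ * (P.d₀ + 1) / (1 + z)
    + P.d₁ * (P.d₁ + 1) / (1 - z)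

/-- `α_{r,q} = ∫_{-1}^1 (t + a)^q t^r p_c(t) dt`. -/
def alpha (a : ℝ) (r : ℕ) (q : ℝ) : ℝ :=
  ∫ t in (-1 : ℝ)..1, (t + a) ^ q * t ^ r * P.pc t

/-- `β_{r,q} = ∫_{-1}^1 (∑ x_a d_a s_a / (1 + x_a t)) t^r p_c(t) (t + a)^q dt
+ (-1)^r (a - 1)^q p_c(-1) + (a + 1)^q p_c(1)`. -/
def beta (a : ℝ) (r : ℕ) (q : ℝ) : ℝ :=
  (∫ t in (-1 : ℝ)..1, P.curvSum t * t ^ r * P.pc t * (t + a) ^ q)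
    + ((-1) ^ r * (a - 1) ^ q * P.pc (-1) + (1 + a) ^ q * P.pc 1)

/-- The linear system for the constants `A₁`, `A₂`. -/
def SolvesSystem (a p A₁ A₂ : ℝ) : Prop :=
  P.alpha a 1 (-(1 + p)) * A₁ + P.alpha a 0 (-(1 + p)) * A₂ = 2 * P.beta a 0 (1 - p) ∧
  P.alpha a 2 (-(1 + p)) * A₁ + P.alpha a 1 (-(1 + p)) * A₂ = 2 * P.beta a 1 (1 - p)

/-- `Q(z) = p_c(z) (z + a)^{1-p} ∑ 2 d_a s_a x_a / (1 + x_a z) - (A₁ z + A₂) p_c(z) / (z + a)^{p+1}`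
(used for `-1 < z < 1`). -/
def Q (a p A₁ A₂ z : ℝ) : ℝ :=
  P.pc z / (z + a) ^ (p - 1) * (2 * P.curvSum z)
    - (A₁ * z + A₂) * P.pc z / (z + a) ^ (p + 1)

/-- `G(z) = 2 p_c(-1) (a - 1)^{1-p} (z + 1) + ∫_{-1}^z Q(t) (z - t) dt`. -/
def G (a p A₁ A₂ z : ℝ) : ℝ :=
  2 * P.pc (-1) / (a - 1) ^ (p - 1) * (z + 1)
    + ∫ t in (-1 : ℝ)..z, P.Q a p A₁ A₂ t * (z - t)

/-- `F(z) = (z + a)^{p-1} G(z)`. -/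
def F (a p A₁ A₂ z : ℝ) : ℝ :=
  (z + a) ^ (p - 1) * P.G a p A₁ A₂ z

/-- The coordinate space of the base, split according to its factors. -/
abbrev Base : Type _ := (a : ι) → EuclideanSpace ℂ (Fin (P.d a))

/-- The model fibre of `E₀`. -/
abbrev Fib₀ : Type := EuclideanSpace ℂ (Fin (P.d₀ + 1))

/-- The model fibre of `E_∞`. -/
abbrev Fib₁ : Type := EuclideanSpace ℂ (Fin (P.d₁ + 1))

/-- The coordinate space of `P(E₀ ⊕ E_∞)`. -/
abbrev Tot : Type := EuclideanSpace ℂ (Fin ((∑ a, P.d a) + P.d₀ + P.d₁ + 1))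

end AdmissibleParams

/-- `Θ` is a smooth function on `[-1, 1]`, positive inside, with `Θ(±1) = 0`, `Θ'(±1) = ∓2`. -/
structure IsMomentumProfile (Θ : ℝ → ℝ) : Prop where
  smooth : ContDiffOn ℝ ∞ Θ (Icc (-1) 1)
  pos : ∀ z ∈ Ioo (-1 : ℝ) 1, 0 < Θ z
  left : Θ (-1) = 0
  right : Θ 1 = 0
  deriv_left : derivWithin Θ (Icc (-1) 1) (-1) = 2
  deriv_right : derivWithin Θ (Icc (-1) 1) 1 = -2

/-! ## Admissible manifolds -/

section Frames

variable {B : Type*} [NormedAddCommGroup B] [NormedSpace ℂ B]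
  {S : Type*} [TopologicalSpace S] [ChartedSpace B S]
  {r : ℕ} {E : S → Type*} [∀ s, AddCommGroup (E s)] [∀ s, Module ℂ (E s)]
  [∀ s, TopologicalSpace (E s)]
  [TopologicalSpace (TotalSpace (EuclideanSpace ℂ (Fin r)) E)]
  [FiberBundle (EuclideanSpace ℂ (Fin r)) E]

/-- `e` is a holomorphic frame over `U` of the bundle `E` of rank `r`, in which the hermitian
metric with squared norm `h` is `e^{2φ}` times the standard one, with `φ` smooth on `U`.
The curvature of the Chern connection over `U` is then the scalar form `-2 ∂∂̄ φ ⊗ Id`, that is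
`-i Ω ⊗ Id` with the real form `Ω = -dd^c φ`. -/
structure IsConformalFrame (h : ∀ s, E s → ℝ) (U : Set S) (e : Fin r → ∀ s, E s) (φ : S → ℝ) :
    Prop where
  holo : ∀ i, ContMDiffOn 𝓘(ℂ, B) (𝓘(ℂ, B).prod 𝓘(ℂ, EuclideanSpace ℂ (Fin r))) ω
    (fun s => TotalSpace.mk' (EuclideanSpace ℂ (Fin r)) s (e i s)) U
  smooth : ContMDiffOn 𝓘(ℝ, B) 𝓘(ℝ) ∞ φ U
  norm_sq : ∀ s ∈ U, ∀ c : Fin r → ℂ,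
    h s (∑ i, c i • e i s) = Real.exp (2 * φ s) * ∑ i, ‖c i‖ ^ 2

/-- `E` with the hermitian metric of squared norm `h` is a projectively flat hermitian holomorphic
bundle: `P(E)` with its fibrewise Fubini-Study metrics is flat, i.e. near each point there is a
holomorphic frame in which the hermitian metric is conformal to a constant one. -/
def IsProjectivelyFlat (h : ∀ s, E s → ℝ) : Prop :=
  ∀ s : S, ∃ (U : Set S) (e : Fin r → ∀ s, E s) (φ : S → ℝ),
    IsOpen U ∧ s ∈ U ∧ IsConformalFrame (B := B) h U e φ

end Frames

section Admissible

variable {ι : Type*} [Fintype ι] (P : AdmissibleParams ι)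
  {S : Type*} [TopologicalSpace S] [ChartedSpace P.Base S]
  (E₀ E₁ : S → Type*)
  [∀ s, AddCommGroup (E₀ s)] [∀ s, Module ℂ (E₀ s)] [∀ s, TopologicalSpace (E₀ s)]
  [TopologicalSpace (TotalSpace P.Fib₀ E₀)] [FiberBundle P.Fib₀ E₀]
  [∀ s, AddCommGroup (E₁ s)] [∀ s, Module ℂ (E₁ s)] [∀ s, TopologicalSpace (E₁ s)]
  [TopologicalSpace (TotalSpace P.Fib₁ E₁)] [FiberBundle P.Fib₁ E₁]
  (M : Type*) [TopologicalSpace M] [ChartedSpace P.Tot M]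

open ManifoldGeometry LocalGeometry

/-- The fields `g a` of bilinear forms on the complex manifold `S` make it locally a product:
near each point there is a holomorphic chart in which each `g a` is the pull-back of a (positive or
negative definite) Kähler metric `γ` on an open set of `ℂ^{d a}` of scalar curvature
`2 (d a) (s a)`, with `x a • γ` positive. -/
def IsLocalKahlerProduct (g : ι → Tensor2 P.Base S) : Prop :=
  ∀ s : S, ∃ ψ ∈ IsManifold.maximalAtlas 𝓘(ℂ, P.Base) ω S, s ∈ ψ.source ∧ ∀ a,
    ∃ γ : EuclideanSpace ℂ (Fin (P.d a)) →
        EuclideanSpace ℂ (Fin (P.d a)) →L[ℝ] EuclideanSpace ℂ (Fin (P.d a)) →L[ℝ] ℝ,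
      ∀ y ∈ ψ.target,
        (∀ X Y, pullback (g a) ψ.symm y X Y = γ (y a) (X a) (Y a)) ∧
        ContDiffAt ℝ ∞ γ (y a) ∧
        (∀ v w, γ (y a) v w = γ (y a) w v) ∧
        (∀ v, v ≠ 0 → 0 < P.x a * γ (y a) v v) ∧
        (∀ v w, γ (y a) (Complex.I • v) (Complex.I • w) = γ (y a) v w) ∧
        (∀ v w k, fderiv ℝ γ (y a) v (Complex.I • w) k + fderiv ℝ γ (y a) w (Complex.I • k) v
          + fderiv ℝ γ (y a) k (Complex.I • v) w = 0) ∧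
        scal γ (y a) = 2 * P.d a * P.s a

variable {M} in
/-- `q` exhibits the complex manifold `M` as the projectivization `P(E₀ ⊕ E_∞)`: on nonzero vectors
it is a surjective holomorphic submersion whose fibres are the `ℂ^*`-orbits. (The value of `q` on
the zero section is irrelevant. These properties determine `M` up to a unique biholomorphism.) -/
structure IsProjectivization
    (q : TotalSpace (P.Fib₀ × P.Fib₁) (E₀ ×ᵇ E₁) → M) : Prop where
  holo : ContMDiffOn (𝓘(ℂ, P.Base).prod 𝓘(ℂ, P.Fib₀ × P.Fib₁)) 𝓘(ℂ, P.Tot) ω q {v | v.2 ≠ 0}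
  surj : ∀ x : M, ∃ v, v.2 ≠ 0 ∧ q v = x
  fibre : ∀ v w, v.2 ≠ 0 → w.2 ≠ 0 →
    (q v = q w ↔ ∃ c : ℂ, c ≠ 0 ∧ w = ⟨v.1, c • v.2⟩)
  submersion : ∀ v, v.2 ≠ 0 → Function.Surjective
    (mfderiv (𝓘(ℂ, P.Base).prod 𝓘(ℂ, P.Fib₀ × P.Fib₁)) 𝓘(ℂ, P.Tot) q v)

/-- A local description of a pair of hermitian bundles: a holomorphic chart of the base and
holomorphic frames in which the hermitian metrics are `e^{2φ₀}`, `e^{2φ₁}` times the standard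
ones. -/
structure Gauge (h₀ : ∀ s, E₀ s → ℝ) (h₁ : ∀ s, E₁ s → ℝ) where
  ψ : OpenPartialHomeomorph S P.Base
  e₀ : Fin (P.d₀ + 1) → ∀ s, E₀ s
  e₁ : Fin (P.d₁ + 1) → ∀ s, E₁ s
  φ₀ : S → ℝ
  φ₁ : S → ℝ
  mem_atlas : ψ ∈ IsManifold.maximalAtlas 𝓘(ℂ, P.Base) ω S
  frame₀ : IsConformalFrame (B := P.Base) (r := P.d₀ + 1) h₀ ψ.source e₀ φ₀
  frame₁ : IsConformalFrame (B := P.Base) (r := P.d₁ + 1) h₁ ψ.source e₁ φ₁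

/-- An admissible manifold `M = P(E₀ ⊕ E_∞) → S` over a (local product) CSCK base, with the choices
entering the definition of its admissible metrics: the tensors `g a` on the base, and the hermitian
metrics (given by their squared norms `h₀`, `h₁`) of the projectively flat bundles `E₀`, `E_∞`,
with curvatures related by `Ω_∞ - Ω_0 = ∑ ω_a`, where `ω_a = g_a(i ·, ·)`. The class is given by
the parameters `x a`, `|x a| < 1`. -/
structure AdmissibleData where
  g : ι → Tensor2 P.Base S
  h₀ : ∀ s, E₀ s → ℝ
  h₁ : ∀ s, E₁ s → ℝ
  q : TotalSpace (P.Fib₀ × P.Fib₁) (E₀ ×ᵇ E₁) → M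
  abs_x_lt : ∀ a, |P.x a| < 1
  base : IsLocalKahlerProduct P g
  flat₀ : IsProjectivelyFlat (B := P.Base) (r := P.d₀ + 1) h₀
  flat₁ : IsProjectivelyFlat (B := P.Base) (r := P.d₁ + 1) h₁
  proj : IsProjectivization P E₀ E₁ q
  curvature : ∀ τ : Gauge P E₀ E₁ h₀ h₁, ∀ y ∈ τ.ψ.target, ∀ X Y : P.Base,
    ddc (fun y' => τ.φ₀ (τ.ψ.symm y') - τ.φ₁ (τ.ψ.symm y')) y X Y
      = ∑ a, pullback (g a) τ.ψ.symm y (Complex.I • X) Y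

namespace AdmissibleData

variable {P E₀ E₁ M}
variable (D : AdmissibleData P E₀ E₁ M)

/-- The momentum map `z : M → [-1, 1]`, `z [v₀ + v_∞] = (|v₀|² - |v_∞|²) / (|v₀|² + |v_∞|²)`. -/
def z (x : M) : ℝ :=
  let v := Classical.choose (D.proj.surj x)
  (D.h₀ v.1 v.2.1 - D.h₁ v.1 v.2.2) / (D.h₀ v.1 v.2.1 + D.h₁ v.1 v.2.2)

/-- The coordinate space `B × ℂ^{d₀+1} × ℂ^{d_∞+1}` of (the total space of) `E₀ ⊕ E_∞`. -/
abbrev Coord (_ : AdmissibleData P E₀ E₁ M) : Type _ := P.Base × P.Fib₀ × P.Fib₁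

variable (τ : Gauge P E₀ E₁ D.h₀ D.h₁)

/-- The homogeneous coordinates of `P(E₀ ⊕ E_∞)` given by a gauge:
`(y, v, w) ↦ [∑ vᵢ e₀ᵢ(y) + ∑ wⱼ e₁ⱼ(y)]`. -/
def toM (p : D.Coord) : M :=
  D.q ⟨τ.ψ.symm p.1, (∑ i, p.2.1 i • τ.e₀ i (τ.ψ.symm p.1), ∑ i, p.2.2 i • τ.e₁ i (τ.ψ.symm p.1))⟩

/-- The coordinates of the open dense part `M₀` of `M` (where `v₀ ≠ 0` and `v_∞ ≠ 0`). -/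
def dom : Set D.Coord := {p | p.1 ∈ τ.ψ.target ∧ p.2.1 ≠ 0 ∧ p.2.2 ≠ 0}

/-- `log (r₀ / r_∞)`, with `r₀ = |v₀|` and `r_∞ = |v_∞|` the fibrewise norms. -/
def logRatio (p : D.Coord) : ℝ :=
  τ.φ₀ (τ.ψ.symm p.1) - τ.φ₁ (τ.ψ.symm p.1) + Real.log ‖p.2.1‖ - Real.log ‖p.2.2‖

/-- The connection form `θ = θ̂₀ - θ̂_∞`, where `θ̂₀ = d^c log r₀` and `θ̂_∞ = d^c log r_∞` are the
connection forms of the tautological line bundles (equal to `1` on the generators of the circle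
actions). Thus `dθ = ∑ ω_a` over the extended index set. -/
def theta (p X : D.Coord) : ℝ := -fderiv ℝ (D.logRatio τ) p (Complex.I • X)

/-- `dz`. -/
def dz (p X : D.Coord) : ℝ := fderiv ℝ (fun p' => D.z (D.toM τ p')) p X

/-- The horizontal part `∑ (1 + x_a z) / x_a g_a` over the extended index set, where `x_0 = 1`,
`x_∞ = -1`, and `g_0`, `-g_∞` are Fubini-Study metrics. -/
def horizontal (p X Y : D.Coord) : ℝ :=
  (∑ a, (1 + P.x a * D.z (D.toM τ p)) / P.x a * pullback (D.g a) τ.ψ.symm p.1 X.1 Y.1)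
    + (1 + D.z (D.toM τ p)) * fubiniStudy p.2.1 X.2.1 Y.2.1
    + (1 - D.z (D.toM τ p)) * fubiniStudy p.2.2 X.2.2 Y.2.2

/-- On `M₀` (in homogeneous coordinates),
`g = ∑ (1 + x_a z) / x_a g_a + dz² / Θ(z) + Θ(z) θ²`. -/
def IsAdmissibleMetric (Θ : ℝ → ℝ) (g : Tensor2 P.Tot M) : Prop :=
  ∀ τ : Gauge P E₀ E₁ D.h₀ D.h₁, ∀ p ∈ D.dom τ, ∀ X Y : D.Coord,
    pullback g (D.toM τ) p X Y = D.horizontal τ p X Y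
      + D.dz τ p X * D.dz τ p Y / Θ (D.z (D.toM τ p))
      + Θ (D.z (D.toM τ p)) * (D.theta τ p X * D.theta τ p Y)

/-- On `M₀` (in homogeneous coordinates), `om = ∑ (1 + x_a z) / x_a ω_a + dz ∧ θ`. A smooth form
`om` on `M` with this property is the admissible symplectic form with parameters `x a`, and the
admissible Kähler class is its de Rham class. -/
def IsAdmissibleForm (om : Tensor2 P.Tot M) : Prop :=
  ∀ τ : Gauge P E₀ E₁ D.h₀ D.h₁, ∀ p ∈ D.dom τ, ∀ X Y : D.Coord,
    pullback om (D.toM τ) p X Y = D.horizontal τ p (Complex.I • X) Y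
      + (D.dz τ p X * D.theta τ p Y - D.dz τ p Y * D.theta τ p X)

end AdmissibleData

end Admissible

end

open Set Bundle
open scoped Manifold ContDiff Topology

noncomputable section

set_option maxSynthPendingDepth 3
set_option linter.unusedSectionVars false

/-! ## Division of smooth functions of one variable -/

section Division

open MeasureTheory intervalIntegral

/-- The weighted mean `∫₀¹ s ^ k q(c + s (z - c)) ds`. -/
def radialMean (q : ℝ → ℝ) (c : ℝ) (k : ℕ) (z : ℝ) : ℝ :=
  ∫ s in (0 : ℝ)..1, s ^ k * q (c + s * (z - c))

theorem hasDerivAt_radialMean {q : ℝ → ℝ} (hq : ContDiff ℝ 1 q) (c : ℝ) (k : ℕ) (z : ℝ) :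
    HasDerivAt (radialMean q c k) (radialMean (deriv q) c (k + 1) z) z := by
  have hc := hq.continuous
  have hdc : Continuous (deriv q) := hq.continuous_deriv le_rfl
  have hd : Differentiable ℝ q := hq.differentiable one_ne_zero
  have hK : IsCompact (Metric.closedBall z 1 ×ˢ Icc (0 : ℝ) 1) :=
    (isCompact_closedBall z 1).prod isCompact_Icc
  have hcont : Continuous fun y : ℝ × ℝ => y.2 ^ (k + 1) * deriv q (c + y.2 * (y.1 - c)) := by
    fun_prop
  obtain ⟨C, hC⟩ := hK.exists_bound_of_continuousOn hcont.continuousOn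
  refine (intervalIntegral.hasDerivAt_integral_of_dominated_loc_of_deriv_le
    (F := fun x s => s ^ k * q (c + s * (x - c)))
    (F' := fun x s => s ^ (k + 1) * deriv q (c + s * (x - c))) (bound := fun _ => C)
    (Metric.closedBall_mem_nhds z one_pos) ?_ ?_ ?_ ?_ ?_ ?_).2
  · exact Filter.Eventually.of_forall fun x =>
      (Continuous.aestronglyMeasurable (by fun_prop))
  · exact Continuous.intervalIntegrable (by fun_prop) _ _
  · exact (Continuous.aestronglyMeasurable (by fun_prop))
  · refine Filter.Eventually.of_forall fun t ht x hx => hC (x, t) ⟨hx, ?_⟩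
    rw [uIoc_of_le zero_le_one] at ht
    exact ⟨ht.1.le, ht.2⟩
  · exact intervalIntegrable_const
  · refine Filter.Eventually.of_forall fun t _ x _ => ?_
    have h1 : HasDerivAt (fun x => c + t * (x - c)) t x := by
      simpa using (((hasDerivAt_id x).sub_const c).const_mul t).const_add c
    have h2 := ((hd (c + t * (x - c))).hasDerivAt.comp x h1).const_mul (t ^ k)
    exact h2.congr_deriv (by ring)

theorem contDiff_radialMean {q : ℝ → ℝ} (hq : ContDiff ℝ ∞ q) (c : ℝ) (k : ℕ) :
    ContDiff ℝ ∞ (radialMean q c k) := by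
  rw [contDiff_infty]
  intro n
  induction n generalizing q k with
  | zero =>
    refine contDiff_zero.2 (continuous_iff_continuousAt.2 fun z => ?_)
    exact (hasDerivAt_radialMean (hq.of_le (by norm_cast)) c k z).continuousAt
  | succ n ih =>
    have h1 : ∀ z, HasDerivAt (radialMean q c k) (radialMean (deriv q) c (k + 1) z) z :=
      hasDerivAt_radialMean (hq.of_le (by norm_cast)) c k
    have h2 : deriv (radialMean q c k) = radialMean (deriv q) c (k + 1) :=
      funext fun z => (h1 z).deriv
    push_cast
    rw [contDiff_succ_iff_deriv]
    refine ⟨fun z => (h1 z).differentiableAt, fun h => absurd h (by simp), ?_⟩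
    rw [h2]
    exact ih (contDiff_infty_iff_deriv.1 hq).2 (k + 1)

theorem radialMean_self (q : ℝ → ℝ) (c : ℝ) (k : ℕ) : radialMean q c k c = q c / (k + 1) := by
  simp [radialMean, intervalIntegral.integral_mul_const, integral_pow, div_eq_inv_mul]

theorem radialMean_identity {q : ℝ → ℝ} (hq : ContDiff ℝ 1 q) (c : ℝ) (k : ℕ) (z : ℝ) :
    (k + 1) * radialMean q c k z + (z - c) * radialMean (deriv q) c (k + 1) z = q z := by
  have hc := hq.continuous
  have hdc : Continuous (deriv q) := hq.continuous_deriv le_rfl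
  have hd : Differentiable ℝ q := hq.differentiable one_ne_zero
  have key : ∀ s ∈ uIcc (0 : ℝ) 1, HasDerivAt (fun s => s ^ (k + 1) * q (c + s * (z - c)))
      ((k + 1) * (s ^ k * q (c + s * (z - c)))
        + (z - c) * (s ^ (k + 1) * deriv q (c + s * (z - c)))) s := by
    intro s _
    have h1 : HasDerivAt (fun s => c + s * (z - c)) (z - c) s := by
      simpa using ((hasDerivAt_id s).mul_const (z - c)).const_add c
    have h2 := (hasDerivAt_pow (k + 1) s).mul ((hd (c + s * (z - c))).hasDerivAt.comp s h1)
    refine h2.congr_deriv ?_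
    push_cast
    simp only [Function.comp_apply]
    ring
  have h := integral_eq_sub_of_hasDerivAt key (Continuous.intervalIntegrable (by fun_prop) _ _)
  rw [integral_add (Continuous.intervalIntegrable (by fun_prop) _ _)
    (Continuous.intervalIntegrable (by fun_prop) _ _), intervalIntegral.integral_const_mul,
    intervalIntegral.integral_const_mul] at h
  simpa [radialMean] using h

/-- A function whose derivative is divisible by `(z - c) ^ k` and which vanishes at `c` is
divisible by `(z - c) ^ (k + 1)`. -/
theorem exists_eq_pow_succ_mul {f q : ℝ → ℝ} {c : ℝ} (k : ℕ) (hq : ContDiff ℝ ∞ q)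
    (hf : ∀ z, HasDerivAt f ((z - c) ^ k * q z) z) (h0 : f c = 0) :
    ∃ g : ℝ → ℝ, ContDiff ℝ ∞ g ∧ (∀ z, f z = (z - c) ^ (k + 1) * g z) ∧
      g c = q c / (k + 1) := by
  refine ⟨radialMean q c k, contDiff_radialMean hq c k, ?_, radialMean_self q c k⟩
  have hq1 : ContDiff ℝ 1 q := hq.of_le (by norm_cast)
  have h1 : ∀ z, HasDerivAt (fun z => f z - (z - c) ^ (k + 1) * radialMean q c k z) 0 z := by
    intro z
    have h2 : HasDerivAt (fun z => (z - c) ^ (k + 1)) ((k + 1) * (z - c) ^ k) z := by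
      exact (((hasDerivAt_id z).sub_const c).pow (k + 1)).congr_deriv (by simp)
    refine ((hf z).sub (h2.mul (hasDerivAt_radialMean hq1 c k z))).congr_deriv ?_
    rw [← radialMean_identity hq1 c k z]
    ring
  intro z
  have := is_const_of_deriv_eq_zero (fun z => (h1 z).differentiableAt) (fun z => (h1 z).deriv) z c
  simp [h0] at this
  linarith

/-- A smooth function which is divisible by a power of `1 + z` and by a power of `1 - z` is
divisible by their product. -/
theorem exists_eq_mul_mul {f g₁ g₂ : ℝ → ℝ} {m n : ℕ} (h₁ : ContDiff ℝ ∞ g₁)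
    (h₂ : ContDiff ℝ ∞ g₂) (hf₁ : ∀ z, f z = (1 + z) ^ m * g₁ z)
    (hf₂ : ∀ z, f z = (1 - z) ^ n * g₂ z) :
    ∃ h : ℝ → ℝ, ContDiff ℝ ∞ h ∧ (∀ z, f z = (1 + z) ^ m * (1 - z) ^ n * h z) ∧
      h (-1) = g₁ (-1) / 2 ^ n ∧ h 1 = g₂ 1 / 2 ^ m := by
  let h : ℝ → ℝ := fun z => if z < 0 then g₁ z / (1 - z) ^ n else g₂ z / (1 + z) ^ m
  have hl : ∀ z, z < 1 → h z = g₁ z / (1 - z) ^ n := by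
    intro z hz
    by_cases h0 : z < 0
    · simp [h, h0]
    · have e1 : (1 - z) ^ n ≠ 0 := pow_ne_zero _ (by linarith)
      have e2 : (1 + z) ^ m ≠ 0 := pow_ne_zero _ (by linarith)
      simp only [h, h0, if_false]
      rw [div_eq_div_iff e2 e1]
      linarith [hf₁ z, hf₂ z]
  have hr : ∀ z, -1 < z → h z = g₂ z / (1 + z) ^ m := by
    intro z hz
    by_cases h0 : z < 0
    · have e1 : (1 - z) ^ n ≠ 0 := pow_ne_zero _ (by linarith)
      have e2 : (1 + z) ^ m ≠ 0 := pow_ne_zero _ (by linarith)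
      simp only [h, h0, if_true]
      rw [div_eq_div_iff e1 e2]
      linarith [hf₁ z, hf₂ z]
    · simp [h, h0]
  refine ⟨h, contDiff_iff_contDiffAt.2 fun z => ?_, fun z => ?_, ?_, ?_⟩
  · by_cases hz : z < 1
    · have : h =ᶠ[𝓝 z] fun z => g₁ z / (1 - z) ^ n := by
        filter_upwards [eventually_lt_nhds hz] with y hy using hl y hy
      refine ContDiffAt.congr_of_eventuallyEq ?_ this
      exact h₁.contDiffAt.div (by fun_prop) (pow_ne_zero _ (by linarith))
    · have hz' : -1 < z := by linarith
      have : h =ᶠ[𝓝 z] fun z => g₂ z / (1 + z) ^ m := by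
        filter_upwards [eventually_gt_nhds hz'] with y hy using hr y hy
      refine ContDiffAt.congr_of_eventuallyEq ?_ this
      exact h₂.contDiffAt.div (by fun_prop) (pow_ne_zero _ (by linarith))
  · by_cases hz : z < 1
    · rw [hl z hz, hf₁ z]
      have e1 : (1 - z) ^ n ≠ 0 := pow_ne_zero _ (by linarith)
      field_simp
    · rw [hr z (by linarith), hf₂ z]
      have e2 : (1 + z) ^ m ≠ 0 := pow_ne_zero _ (by linarith)
      field_simp
  · rw [hl _ (by norm_num)]; norm_num
  · rw [hr _ (by norm_num)]; norm_num

theorem exists_eq_one_add_pow_mul {G G₁ ρ σ : ℝ → ℝ} {m n : ℕ} (hρ : ContDiff ℝ ∞ ρ)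
    (hσ : ContDiff ℝ ∞ σ) (hG : ∀ z, HasDerivAt G (G₁ z) z)
    (hG₁ : ∀ z, HasDerivAt G₁ ((1 + z) ^ m * (1 - z) ^ n * ρ z
      + (m * (m + 1) * ((1 + z) ^ (m - 1) * (1 - z) ^ n)
        + n * (n + 1) * ((1 + z) ^ m * (1 - z) ^ (n - 1))) * σ z) z)
    (h0 : G (-1) = 0) (h1 : G₁ (-1) = 0 ^ m * 2 ^ n * σ (-1)) :
    ∃ g : ℝ → ℝ, ContDiff ℝ ∞ g ∧ (∀ z, G z = (1 + z) ^ (m + 1) * g z) ∧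
      g (-1) = 2 ^ n * σ (-1) := by
  rcases m with _ | m
  · have hG₁s : ContDiff ℝ ∞ G₁ := by
      refine contDiff_infty_iff_deriv.2 ⟨fun z => (hG₁ z).differentiableAt, ?_⟩
      rw [funext fun z => (hG₁ z).deriv]
      fun_prop
    obtain ⟨g, hg, hg1, hg2⟩ := exists_eq_pow_succ_mul (f := G) (c := -1) 0 hG₁s
      (fun z => by simpa using hG z) h0
    refine ⟨g, hg, fun z => ?_, ?_⟩
    · rw [hg1]; ring
    · rw [hg2, h1]; simp
  · have hs : ContDiff ℝ ∞ fun z => (1 + z) * (1 - z) ^ n * ρ z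
      + ((m + 1) * (m + 2) * (1 - z) ^ n
        + n * (n + 1) * ((1 + z) * (1 - z) ^ (n - 1))) * σ z := by fun_prop
    obtain ⟨g, hg, hg1, hg2⟩ := exists_eq_pow_succ_mul (f := G₁) (c := -1) m hs
      (fun z => by
        refine (hG₁ z).congr_deriv ?_
        push_cast
        ring) (by rw [h1]; simp)
    obtain ⟨g', hg', hg1', hg2'⟩ := exists_eq_pow_succ_mul (f := G) (c := -1) (m + 1) hg
      (fun z => (hG z).congr_deriv (hg1 z)) h0
    refine ⟨g', hg', fun z => ?_, ?_⟩
    · rw [hg1']; ring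
    · rw [hg2', hg2]
      have : (m : ℝ) + 1 ≠ 0 := by positivity
      have : (m : ℝ) + 1 + 1 ≠ 0 := by positivity
      push_cast
      field_simp
      ring

theorem exists_eq_pow_mul_pow_mul {G G₁ ρ σ : ℝ → ℝ} {m n : ℕ} (hρ : ContDiff ℝ ∞ ρ)
    (hσ : ContDiff ℝ ∞ σ) (hG : ∀ z, HasDerivAt G (G₁ z) z)
    (hG₁ : ∀ z, HasDerivAt G₁ ((1 + z) ^ m * (1 - z) ^ n * ρ z
      + (m * (m + 1) * ((1 + z) ^ (m - 1) * (1 - z) ^ n)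
        + n * (n + 1) * ((1 + z) ^ m * (1 - z) ^ (n - 1))) * σ z) z)
    (h0 : G (-1) = 0) (h1 : G₁ (-1) = 0 ^ m * 2 ^ n * σ (-1))
    (h0' : G 1 = 0) (h1' : G₁ 1 = - (0 ^ n * 2 ^ m * σ 1)) :
    ∃ h : ℝ → ℝ, ContDiff ℝ ∞ h ∧ (∀ z, G z = (1 + z) ^ (m + 1) * (1 - z) ^ (n + 1) * h z) ∧
      h (-1) = σ (-1) / 2 ∧ h 1 = σ 1 / 2 := by
  obtain ⟨g, hg, hg1, hg2⟩ := exists_eq_one_add_pow_mul hρ hσ hG hG₁ h0 h1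
  have hn : ∀ z : ℝ, HasDerivAt (fun z : ℝ => -z) (-1) z := fun z => hasDerivAt_neg z
  obtain ⟨g', hg', hg1', hg2'⟩ := exists_eq_one_add_pow_mul (m := n) (n := m)
    (G := fun z => G (-z)) (G₁ := fun z => - G₁ (-z)) (ρ := fun z => ρ (-z))
    (σ := fun z => σ (-z)) (by fun_prop) (by fun_prop)
    (fun z => ((hG (-z)).comp z (hn z)).congr_deriv (by ring))
    (fun z => by
      refine (((hG₁ (-z)).comp z (hn z)).neg).congr_deriv ?_
      rw [show (1 + -z) = 1 - z by ring, show (1 - -z) = 1 + z by ring]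
      ring) (by simpa using h0') (by simp [h1'])
  obtain ⟨h, hh, hh1, hh2, hh3⟩ := exists_eq_mul_mul (f := G) (g₁ := g) (g₂ := fun z => g' (-z))
    (m := m + 1) (n := n + 1) hg (by fun_prop) hg1
    (fun z => by simpa [← sub_eq_add_neg] using hg1' (-z))
  refine ⟨h, hh, hh1, ?_, ?_⟩
  · rw [hh2, hg2]
    field_simp
    ring
  · rw [hh3, hg2']
    simp only [neg_neg]
    field_simp
    ring

/-- A function which is smooth near `[-1, 1]` agrees near `[-1, 1]` with a smooth function. -/
theorem exists_contDiff_extension {f : ℝ → ℝ} {δ : ℝ} (hδ : 0 < δ)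
    (hf : ContDiffOn ℝ ∞ f (Ioo (-1 - δ) (1 + δ))) :
    ∃ g : ℝ → ℝ, ContDiff ℝ ∞ g ∧ ∃ ε > 0, ∀ z ∈ Ioo (-1 - ε) (1 + ε), g z = f z := by
  let χ : ContDiffBump (0 : ℝ) := ⟨1 + δ / 3, 1 + 2 * δ / 3, by linarith, by linarith⟩
  refine ⟨fun z => χ z * f z, contDiff_iff_contDiffAt.2 fun z => ?_, δ / 3, by linarith, ?_⟩
  · by_cases hz : z ∈ Ioo (-1 - δ) (1 + δ)
    · exact χ.contDiffAt.mul (hf.contDiffAt (isOpen_Ioo.mem_nhds hz))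
    · have hz' : z ∈ (Metric.closedBall (0 : ℝ) (1 + 2 * δ / 3))ᶜ := by
        intro h
        rw [Metric.mem_closedBall, Real.dist_eq, sub_zero, abs_le] at h
        exact hz ⟨by linarith [h.1], by linarith [h.2]⟩
      have : (fun z => χ z * f z) =ᶠ[𝓝 z] fun _ => 0 := by
        filter_upwards [Metric.isClosed_closedBall.isOpen_compl.mem_nhds hz'] with y hy
        have : χ y = 0 := χ.zero_of_le_dist (by
          simp only [mem_compl_iff, Metric.mem_closedBall, not_le] at hy
          exact hy.le)
        simp [this]
      exact contDiffAt_const.congr_of_eventuallyEq this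
  · intro z hz
    have : χ z = 1 := χ.one_of_mem_closedBall (by
      rw [Metric.mem_closedBall, Real.dist_eq, sub_zero, abs_le]
      change -(1 + δ / 3) ≤ z ∧ z ≤ 1 + δ / 3
      exact ⟨by linarith [hz.1], by linarith [hz.2]⟩)
    simp [this]

end Division

/-! ## The functions `p_c`, `Q`, `G`, `F` -/

namespace AdmissibleParams

open MeasureTheory

variable {ι : Type*} [Fintype ι] (P : AdmissibleParams ι)

/-- The factor of `p_c` coming from the base. -/
def basePoly (z : ℝ) : ℝ := ∏ a, (1 + P.x a * z) ^ P.d a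

open Classical in
/-- The polynomial `p_c ∑ x_a d_a s_a / (1 + x_a z)`. -/
def curvPoly (z : ℝ) : ℝ :=
  (1 + z) ^ P.d₀ * (1 - z) ^ P.d₁ * (∑ a, P.x a * P.d a * P.s a *
      ((1 + P.x a * z) ^ (P.d a - 1) * ∏ b ∈ Finset.univ.erase a, (1 + P.x b * z) ^ P.d b))
    + (P.d₀ * (P.d₀ + 1) * ((1 + z) ^ (P.d₀ - 1) * (1 - z) ^ P.d₁)
      + P.d₁ * (P.d₁ + 1) * ((1 + z) ^ P.d₀ * (1 - z) ^ (P.d₁ - 1))) * P.basePoly z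

theorem contDiff_basePoly : ContDiff ℝ ∞ P.basePoly := by
  unfold basePoly
  fun_prop

theorem contDiff_pc : ContDiff ℝ ∞ P.pc := by
  unfold pc
  fun_prop

theorem contDiff_curvPoly : ContDiff ℝ ∞ P.curvPoly := by
  have := P.contDiff_basePoly
  unfold curvPoly
  fun_prop

variable {P}

theorem one_add_mul_pos (hx : ∀ a, |P.x a| < 1) (a : ι) {z : ℝ} (hz : z ∈ Icc (-1 : ℝ) 1) :
    0 < 1 + P.x a * z := by
  have h1 := abs_lt.1 (hx a)
  have h2 : |P.x a * z| < 1 := by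
    rw [abs_mul]
    have : |z| ≤ 1 := abs_le.2 hz
    nlinarith [abs_nonneg (P.x a), abs_nonneg z, hx a]
  linarith [(abs_lt.1 h2).1]

theorem basePoly_pos (hx : ∀ a, |P.x a| < 1) {z : ℝ} (hz : z ∈ Icc (-1 : ℝ) 1) :
    0 < P.basePoly z :=
  Finset.prod_pos fun a _ => pow_pos (one_add_mul_pos hx a hz) _

theorem pc_pos (hx : ∀ a, |P.x a| < 1) {z : ℝ} (hz : z ∈ Ioo (-1 : ℝ) 1) : 0 < P.pc z :=
  mul_pos (mul_pos (basePoly_pos hx (Ioo_subset_Icc_self hz)) (pow_pos (by linarith [hz.1]) _))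
    (pow_pos (by linarith [hz.2]) _)

theorem pow_pred_mul (d : ℕ) (x c : ℝ) (hx : x ≠ 0) : d * c / x * x ^ d = d * c * x ^ (d - 1) := by
  rcases d with _ | d
  · simp
  · rw [Nat.add_sub_cancel, pow_succ]
    field_simp

theorem pc_mul_curvSum (hx : ∀ a, |P.x a| < 1) {z : ℝ} (hz : z ∈ Ioo (-1 : ℝ) 1) :
    P.pc z * P.curvSum z = P.curvPoly z := by
  classical
  have e1 : 1 + z ≠ 0 := by linarith [hz.1]
  have e2 : 1 - z ≠ 0 := by linarith [hz.2]
  have hsum : P.basePoly z * ∑ a, P.x a * P.d a * P.s a / (1 + P.x a * z)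
      = ∑ a, P.x a * P.d a * P.s a * ((1 + P.x a * z) ^ (P.d a - 1)
        * ∏ b ∈ Finset.univ.erase a, (1 + P.x b * z) ^ P.d b) := by
    rw [Finset.mul_sum]
    refine Finset.sum_congr rfl fun a _ => ?_
    have h1 := (one_add_mul_pos hx a (Ioo_subset_Icc_self hz)).ne'
    have h2 := pow_pred_mul (P.d a) (1 + P.x a * z) (P.x a * P.s a) h1
    rw [basePoly, ← Finset.mul_prod_erase _ _ (Finset.mem_univ a)]
    calc _ = (P.d a * (P.x a * P.s a) / (1 + P.x a * z) * (1 + P.x a * z) ^ P.d a)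
          * ∏ b ∈ Finset.univ.erase a, (1 + P.x b * z) ^ P.d b := by ring
      _ = _ := by rw [h2]; ring
  have h0 := pow_pred_mul P.d₀ (1 + z) (P.d₀ + 1) e1
  have h1 := pow_pred_mul P.d₁ (1 - z) (P.d₁ + 1) e2
  rw [curvPoly, ← hsum]
  have : P.pc z * P.curvSum z
      = (1 + z) ^ P.d₀ * (1 - z) ^ P.d₁ *
          (P.basePoly z * ∑ a, P.x a * P.d a * P.s a / (1 + P.x a * z))
        + (P.d₀ * (P.d₀ + 1) / (1 + z) * (1 + z) ^ P.d₀ * (1 - z) ^ P.d₁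
          + P.d₁ * (P.d₁ + 1) / (1 - z) * (1 - z) ^ P.d₁ * (1 + z) ^ P.d₀) * P.basePoly z := by
    simp only [pc, curvSum, basePoly]
    ring
  rw [this, h0, h1]
  ring

/-- Real powers of `z + a` agree near `[-1, 1]` with smooth functions. -/
theorem exists_contDiff_rpow {a : ℝ} (ha : 1 < a) (q : ℝ) :
    ∃ w : ℝ → ℝ, ContDiff ℝ ∞ w ∧ ∃ ε > 0, ∀ z ∈ Ioo (-1 - ε) (1 + ε), w z = (z + a) ^ q := by
  refine exists_contDiff_extension (f := fun z => (z + a) ^ q) (δ := (a - 1) / 2) (by linarith) ?_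
  intro z hz
  refine ContDiffAt.contDiffWithinAt ?_
  refine ContDiffAt.rpow_const_of_ne (by fun_prop) ?_
  have := hz.1
  intro h
  linarith

theorem integral_congr_Ioo {f g : ℝ → ℝ} {x y : ℝ} (hxy : x ≤ y) (h : ∀ t ∈ Ioo x y, f t = g t) :
    ∫ t in x..y, f t = ∫ t in x..y, g t := by
  rw [intervalIntegral.integral_of_le hxy, intervalIntegral.integral_of_le hxy,
    integral_Ioc_eq_integral_Ioo, integral_Ioc_eq_integral_Ioo]
  exact setIntegral_congr_fun measurableSet_Ioo h

theorem alpha_sq_lt (hx : ∀ a, |P.x a| < 1) {a : ℝ} (ha : 1 < a) (q : ℝ) :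
    0 < P.alpha a 0 q ∧ P.alpha a 1 q ^ 2 < P.alpha a 0 q * P.alpha a 2 q := by
  obtain ⟨w, hw, ε, hε, hwq⟩ := exists_contDiff_rpow ha q
  have hwz : ∀ z ∈ Icc (-1 : ℝ) 1, w z = (z + a) ^ q := fun z hz =>
    hwq z ⟨by linarith [hz.1], by linarith [hz.2]⟩
  have hα : ∀ r, P.alpha a r q = ∫ t in (-1 : ℝ)..1, w t * t ^ r * P.pc t := fun r =>
    integral_congr_Ioo (by norm_num) fun t ht => by rw [hwz t (Ioo_subset_Icc_self ht)]
  have hwc := hw.continuous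
  have hpc := P.contDiff_pc.continuous
  have hpos : ∀ u v : ℝ, (u ≠ 0 ∨ v ≠ 0) →
      0 < u ^ 2 * P.alpha a 0 q + 2 * u * v * P.alpha a 1 q + v ^ 2 * P.alpha a 2 q := by
    intro u v huv
    have : u ^ 2 * P.alpha a 0 q + 2 * u * v * P.alpha a 1 q + v ^ 2 * P.alpha a 2 q
        = ∫ t in (-1 : ℝ)..1, w t * (u + v * t) ^ 2 * P.pc t := by
      rw [hα, hα, hα, ← intervalIntegral.integral_const_mul, ← intervalIntegral.integral_const_mul,
        ← intervalIntegral.integral_const_mul, ← intervalIntegral.integral_add,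
        ← intervalIntegral.integral_add]
      · congr 1; ext t; ring
      all_goals exact Continuous.intervalIntegrable (by fun_prop) _ _
    rw [this]
    have hwpos : ∀ t ∈ Icc (-1 : ℝ) 1, 0 < w t := fun t ht => by
      rw [hwz t ht]; exact Real.rpow_pos_of_pos (by linarith [ht.1]) _
    have hpc0 : ∀ t ∈ Icc (-1 : ℝ) 1, 0 ≤ P.pc t := fun t ht =>
      mul_nonneg (mul_nonneg (basePoly_pos hx ht).le (pow_nonneg (by linarith [ht.1]) _))
        (pow_nonneg (by linarith [ht.2]) _)
    obtain ⟨c, hc, hcne⟩ : ∃ c ∈ Ioo (-1 : ℝ) 1, u + v * c ≠ 0 := by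
      by_contra! h
      have h1 := h 0 (by norm_num)
      have h2 := h (1 / 2) (by norm_num)
      rcases huv with h3 | h3
      · exact h3 (by linarith)
      · exact h3 (by linarith)
    refine intervalIntegral.integral_pos (by norm_num) (Continuous.continuousOn (by fun_prop))
      (fun t ht => ?_) ⟨c, Ioo_subset_Icc_self hc, ?_⟩
    · have ht' := Ioc_subset_Icc_self ht
      exact mul_nonneg (mul_nonneg (hwpos t ht').le (sq_nonneg _)) (hpc0 t ht')
    · exact mul_pos (mul_pos (hwpos c (Ioo_subset_Icc_self hc)) (by positivity)) (pc_pos hx hc)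
  have h0 : 0 < P.alpha a 0 q := by simpa using hpos 1 0 (by simp)
  refine ⟨h0, ?_⟩
  have h1 := hpos (- P.alpha a 1 q) (P.alpha a 0 q) (Or.inr h0.ne')
  nlinarith

theorem existsUnique_solvesSystem (hx : ∀ a, |P.x a| < 1) {a : ℝ} (ha : 1 < a) (p : ℝ) :
    ∃! A : ℝ × ℝ, P.SolvesSystem a p A.1 A.2 := by
  have h := (alpha_sq_lt hx ha (-(1 + p))).2
  unfold SolvesSystem
  set α₀ := P.alpha a 0 (-(1 + p))
  set α₁ := P.alpha a 1 (-(1 + p))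
  set α₂ := P.alpha a 2 (-(1 + p))
  set b₀ := 2 * P.beta a 0 (1 - p)
  set b₁ := 2 * P.beta a 1 (1 - p)
  have hD : α₀ * α₂ - α₁ ^ 2 ≠ 0 := by linarith
  refine ⟨((α₀ * b₁ - α₁ * b₀) / (α₀ * α₂ - α₁ ^ 2), (α₂ * b₀ - α₁ * b₁) / (α₀ * α₂ - α₁ ^ 2)),
    ⟨?_, ?_⟩, ?_⟩
  · simp only [← mul_div_assoc, ← add_div]
    rw [div_eq_iff hD]
    ring
  · simp only [← mul_div_assoc, ← add_div]
    rw [div_eq_iff hD]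
    ring
  · rintro ⟨A₁, A₂⟩ ⟨h1, h2⟩
    simp only at h1 h2
    rw [Prod.mk.injEq, eq_div_iff hD, eq_div_iff hD, ← h1, ← h2]
    constructor <;> ring

/-- The smooth models of `G` and its derivatives. -/
theorem exists_smooth_G (hx : ∀ a, |P.x a| < 1) {a : ℝ} (ha : 1 < a) {p A₁ A₂ : ℝ}
    (hA : P.SolvesSystem a p A₁ A₂) :
    ∃ G₀ G₁ Q₀ h : ℝ → ℝ, ContDiff ℝ ∞ Q₀ ∧ ContDiff ℝ ∞ h ∧
      (∀ z, HasDerivAt G₀ (G₁ z) z) ∧ (∀ z, HasDerivAt G₁ (Q₀ z) z) ∧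
      (∀ z ∈ Icc (-1 : ℝ) 1, P.G a p A₁ A₂ z = G₀ z) ∧
      (∀ z ∈ Ioo (-1 : ℝ) 1, P.Q a p A₁ A₂ z = Q₀ z) ∧
      G₀ (-1) = 0 ∧ G₀ 1 = 0 ∧ G₁ (-1) = 2 * P.pc (-1) * (a - 1) ^ (1 - p) ∧
      G₁ 1 = -2 * P.pc 1 * (1 + a) ^ (1 - p) ∧
      (∀ z, G₀ z = (1 + z) ^ (P.d₀ + 1) * (1 - z) ^ (P.d₁ + 1) * h z) ∧
      h (-1) = (a - 1) ^ (1 - p) * P.basePoly (-1) ∧ h 1 = (1 + a) ^ (1 - p) * P.basePoly 1 := by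
  classical
  obtain ⟨w₁, hw₁, ε₁, hε₁, hwq₁⟩ := exists_contDiff_rpow ha (1 - p)
  obtain ⟨w₂, hw₂, ε₂, hε₂, hwq₂⟩ := exists_contDiff_rpow ha (-(1 + p))
  replace hwq₁ : ∀ z ∈ Icc (-1 : ℝ) 1, w₁ z = (z + a) ^ (1 - p) := fun z hz =>
    hwq₁ z ⟨by linarith [hz.1], by linarith [hz.2]⟩
  replace hwq₂ : ∀ z ∈ Icc (-1 : ℝ) 1, w₂ z = (z + a) ^ (-(1 + p)) := fun z hz =>
    hwq₂ z ⟨by linarith [hz.1], by linarith [hz.2]⟩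
  have hpc := P.contDiff_pc
  have hcp := P.contDiff_curvPoly
  have hbp := P.contDiff_basePoly
  let Q₀ : ℝ → ℝ := fun z => 2 * w₁ z * P.curvPoly z - (A₁ * z + A₂) * P.pc z * w₂ z
  have hQ₀ : ContDiff ℝ ∞ Q₀ := by fun_prop
  have hQc := hQ₀.continuous
  let c := 2 * P.pc (-1) * (a - 1) ^ (1 - p)
  let G₁ : ℝ → ℝ := fun z => c + ∫ t in (-1 : ℝ)..z, Q₀ t
  let G₀ : ℝ → ℝ := fun z => c * (z + 1)
    + (z * (∫ t in (-1 : ℝ)..z, Q₀ t) - ∫ t in (-1 : ℝ)..z, Q₀ t * t)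
  have hI : ∀ z, HasDerivAt (fun z => ∫ t in (-1 : ℝ)..z, Q₀ t) (Q₀ z) z := fun z =>
    intervalIntegral.integral_hasDerivAt_right (hQc.intervalIntegrable _ _)
      (hQc.stronglyMeasurableAtFilter _ _) hQc.continuousAt
  have hJc : Continuous fun t => Q₀ t * t := by fun_prop
  have hJ : ∀ z, HasDerivAt (fun z => ∫ t in (-1 : ℝ)..z, Q₀ t * t) (Q₀ z * z) z := fun z =>
    intervalIntegral.integral_hasDerivAt_right (hJc.intervalIntegrable _ _)
      (hJc.stronglyMeasurableAtFilter _ _) hJc.continuousAt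
  have hG₁ : ∀ z, HasDerivAt G₁ (Q₀ z) z := fun z => (hI z).const_add c
  have hG₀ : ∀ z, HasDerivAt G₀ (G₁ z) z := fun z =>
    ((((hasDerivAt_id z).add_const 1).const_mul c).add
      (((hasDerivAt_id z).mul (hI z)).sub (hJ z))).congr_deriv (by
        simp only [G₁, id]; ring)
  have hQ : ∀ z ∈ Ioo (-1 : ℝ) 1, P.Q a p A₁ A₂ z = Q₀ z := by
    intro z hz
    have hz' := Ioo_subset_Icc_self hz
    have hza : 0 < z + a := by linarith [hz.1]
    simp only [Q, Q₀, ← pc_mul_curvSum hx hz, hwq₁ z hz', hwq₂ z hz']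
    rw [show 1 - p = -(p - 1) by ring, Real.rpow_neg hza.le, Real.rpow_neg hza.le,
      show 1 + p = p + 1 by ring]
    ring
  have hG : ∀ z ∈ Icc (-1 : ℝ) 1, P.G a p A₁ A₂ z = G₀ z := by
    intro z hz
    have h1 : ∫ t in (-1 : ℝ)..z, P.Q a p A₁ A₂ t * (z - t)
        = z * (∫ t in (-1 : ℝ)..z, Q₀ t) - ∫ t in (-1 : ℝ)..z, Q₀ t * t := by
      rw [← intervalIntegral.integral_const_mul, ← intervalIntegral.integral_sub]
      · refine integral_congr_Ioo hz.1 fun t ht => ?_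
        rw [hQ t ⟨ht.1, ht.2.trans_le hz.2⟩]
        ring
      all_goals exact Continuous.intervalIntegrable (by fun_prop) _ _
    have h2 : (a - 1) ^ (1 - p) = ((a - 1) ^ (p - 1))⁻¹ := by
      rw [← Real.rpow_neg (by linarith)]; congr 1; ring
    simp only [G, G₀, c, h1, h2]
    ring
  have hβ : ∀ r, (∫ t in (-1 : ℝ)..1, Q₀ t * t ^ r) = 2 * P.beta a r (1 - p)
      - 2 * ((-1) ^ r * (a - 1) ^ (1 - p) * P.pc (-1) + (1 + a) ^ (1 - p) * P.pc 1)
      - (A₁ * P.alpha a (r + 1) (-(1 + p)) + A₂ * P.alpha a r (-(1 + p))) := by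
    intro r
    have e1 : P.beta a r (1 - p) = (∫ t in (-1 : ℝ)..1, w₁ t * P.curvPoly t * t ^ r)
        + ((-1) ^ r * (a - 1) ^ (1 - p) * P.pc (-1) + (1 + a) ^ (1 - p) * P.pc 1) := by
      unfold beta
      congr 1
      refine integral_congr_Ioo (by norm_num) fun t ht => ?_
      rw [← pc_mul_curvSum hx ht, hwq₁ t (Ioo_subset_Icc_self ht)]
      ring
    have e2 : ∀ r, P.alpha a r (-(1 + p)) = ∫ t in (-1 : ℝ)..1, w₂ t * t ^ r * P.pc t := fun r =>
      integral_congr_Ioo (by norm_num) fun t ht => by rw [hwq₂ t (Ioo_subset_Icc_self ht)]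
    rw [e1, e2, e2, ← intervalIntegral.integral_const_mul A₁,
      ← intervalIntegral.integral_const_mul A₂, mul_add, add_sub_cancel_right,
      ← intervalIntegral.integral_const_mul, ← intervalIntegral.integral_add,
      ← intervalIntegral.integral_sub]
    · congr 1; ext t; simp only [Q₀]; ring
    all_goals
      refine Continuous.intervalIntegrable ?_ _ _
      have := hw₁.continuous
      have := hw₂.continuous
      have := hpc.continuous
      have := hcp.continuous
      fun_prop
  have hβ0 := hβ 0
  have hβ1 := hβ 1
  simp only [pow_zero, mul_one, pow_one, one_mul, zero_add, Nat.reduceAdd] at hβ0 hβ1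
  have hm0 : G₀ (-1) = 0 := by simp [G₀]
  have hm1 : G₁ (-1) = c := by simp [G₁]
  have h11 : G₁ 1 = -2 * P.pc 1 * (1 + a) ^ (1 - p) := by
    simp only [G₁, c]
    rw [hβ0]
    linarith [hA.1]
  have h10 : G₀ 1 = 0 := by
    simp only [G₀, c]
    rw [hβ0, hβ1]
    linarith [hA.1, hA.2]
  let ρ : ℝ → ℝ := fun z => 2 * w₁ z * (∑ a, P.x a * P.d a * P.s a *
      ((1 + P.x a * z) ^ (P.d a - 1) * ∏ b ∈ Finset.univ.erase a, (1 + P.x b * z) ^ P.d b))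
      - (A₁ * z + A₂) * P.basePoly z * w₂ z
  have hwl : w₁ (-1) = (a - 1) ^ (1 - p) := by
    rw [hwq₁ _ (by norm_num)]; congr 1; ring
  have hwr : w₁ 1 = (1 + a) ^ (1 - p) := by
    rw [hwq₁ _ (by norm_num)]
  obtain ⟨h, hh, hh1, hh2, hh3⟩ := exists_eq_pow_mul_pow_mul (m := P.d₀) (n := P.d₁) (ρ := ρ)
    (σ := fun z => 2 * w₁ z * P.basePoly z) (by fun_prop) (by fun_prop) hG₀
    (fun z => (hG₁ z).congr_deriv (by simp only [Q₀, ρ, curvPoly, pc, basePoly]; ring)) hm0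
    (by rw [hm1, hwl]; simp only [c, pc, basePoly]; norm_num; ring) h10
    (by rw [h11, hwr]; simp only [pc, basePoly]; norm_num; ring)
  refine ⟨G₀, G₁, Q₀, h, hQ₀, hh, hG₀, hG₁, hG, hQ, hm0, h10, hm1, h11, hh1, ?_, ?_⟩
  · rw [hh2, hwl]; ring
  · rw [hh3, hwr]; ring

/-- The regularity and the boundary behaviour of `F`, and its differential equation. -/
theorem F_properties (hx : ∀ a, |P.x a| < 1) {a : ℝ} (ha : 1 < a) {p A₁ A₂ : ℝ}
    (hA : P.SolvesSystem a p A₁ A₂) :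
    ContDiffOn ℝ ∞ (P.F a p A₁ A₂) (Icc (-1) 1) ∧
      (∀ z ∈ Ioo (-1 : ℝ) 1,
        deriv (deriv fun w => P.F a p A₁ A₂ w / (w + a) ^ (p - 1)) z = P.Q a p A₁ A₂ z) ∧
      P.F a p A₁ A₂ (-1) = 0 ∧ P.F a p A₁ A₂ 1 = 0 ∧
      derivWithin (P.F a p A₁ A₂) (Icc (-1) 1) (-1) = 2 * P.pc (-1) ∧
      derivWithin (P.F a p A₁ A₂) (Icc (-1) 1) 1 = -2 * P.pc 1 := by
  obtain ⟨G₀, G₁, Q₀, h, hQ₀, hh, hG₀, hG₁, hG, hQ, hm0, h10, hm1, h11, -, -, -⟩ :=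
    exists_smooth_G hx ha hA
  obtain ⟨w, hw, ε, hε, hwq⟩ := exists_contDiff_rpow ha (p - 1)
  replace hwq : ∀ z ∈ Icc (-1 : ℝ) 1, w z = (z + a) ^ (p - 1) := fun z hz =>
    hwq z ⟨by linarith [hz.1], by linarith [hz.2]⟩
  have hG₁s : ContDiff ℝ ∞ G₁ := by
    refine contDiff_infty_iff_deriv.2 ⟨fun z => (hG₁ z).differentiableAt, ?_⟩
    rwa [funext fun z => (hG₁ z).deriv]
  have hG₀s : ContDiff ℝ ∞ G₀ := by
    refine contDiff_infty_iff_deriv.2 ⟨fun z => (hG₀ z).differentiableAt, ?_⟩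
    rwa [funext fun z => (hG₀ z).deriv]
  have hF : EqOn (P.F a p A₁ A₂) (fun z => w z * G₀ z) (Icc (-1) 1) := fun z hz => by
    simp only [F, hG z hz, hwq z hz]
  have hd : ∀ z ∈ Icc (-1 : ℝ) 1, G₀ z = 0 →
      derivWithin (P.F a p A₁ A₂) (Icc (-1) 1) z = w z * G₁ z := by
    intro z hz h0
    rw [derivWithin_congr hF (hF hz)]
    have h1 := ((hw.differentiable (by simp) z).hasDerivAt.mul (hG₀ z)).hasDerivWithinAt
      (s := Icc (-1) 1)
    refine (HasDerivWithinAt.derivWithin h1 (uniqueDiffOn_Icc (by norm_num) z hz)).trans ?_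
    rw [h0]
    ring
  have hml : (-1 : ℝ) ∈ Icc (-1 : ℝ) 1 := by norm_num
  have hmr : (1 : ℝ) ∈ Icc (-1 : ℝ) 1 := by norm_num
  have hpow : ∀ y : ℝ, 0 < y → y ^ (p - 1) * y ^ (1 - p) = 1 := fun y hy => by
    rw [← Real.rpow_add hy]; simp
  refine ⟨(hw.mul hG₀s).contDiffOn.congr hF, fun z hz => ?_, ?_, ?_, ?_, ?_⟩
  · have h1 : ∀ y ∈ Ioo (-1 : ℝ) 1,
        (fun w => P.F a p A₁ A₂ w / (w + a) ^ (p - 1)) =ᶠ[𝓝 y] G₀ := by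
      intro y hy
      filter_upwards [isOpen_Ioo.mem_nhds hy] with t ht
      have : (t + a) ^ (p - 1) ≠ 0 := (Real.rpow_pos_of_pos (by linarith [ht.1]) _).ne'
      simp only [F, hG t (Ioo_subset_Icc_self ht)]
      field_simp
    have h2 : (deriv fun w => P.F a p A₁ A₂ w / (w + a) ^ (p - 1)) =ᶠ[𝓝 z] G₁ := by
      filter_upwards [isOpen_Ioo.mem_nhds hz] with t ht
      rw [(h1 t ht).deriv_eq, (hG₀ t).deriv]
    rw [h2.deriv_eq, (hG₁ z).deriv, hQ z hz]
  · rw [hF hml]; simp [hm0]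
  · rw [hF hmr]; simp [h10]
  · rw [hd _ hml hm0, hm1, hwq _ hml, show -1 + a = a - 1 by ring]
    linear_combination 2 * P.pc (-1) * hpow (a - 1) (by linarith)
  · rw [hd _ hmr h10, h11, hwq _ hmr]
    linear_combination (-2 * P.pc 1) * hpow (1 + a) (by linarith)

/-- If `F` is positive, then `F / p_c = (1 - z²) κ` with `κ = 1 + (1 - z²) τ` smooth and
positive. -/
theorem exists_profile (hx : ∀ a, |P.x a| < 1) {a : ℝ} (ha : 1 < a) {p A₁ A₂ : ℝ}
    (hA : P.SolvesSystem a p A₁ A₂) (hpos : ∀ z ∈ Ioo (-1 : ℝ) 1, 0 < P.F a p A₁ A₂ z) :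
    ∃ τ : ℝ → ℝ, ContDiff ℝ ∞ τ ∧ (∀ z ∈ Icc (-1 : ℝ) 1, 0 < 1 + (1 - z ^ 2) * τ z) ∧
      ∀ z ∈ Icc (-1 : ℝ) 1,
        P.F a p A₁ A₂ z = P.pc z * ((1 - z ^ 2) * (1 + (1 - z ^ 2) * τ z)) := by
  obtain ⟨G₀, G₁, Q₀, h, hQ₀, hh, hG₀, hG₁, hG, hQ, hm0, h10, hm1, h11, hGh, hhl, hhr⟩ :=
    exists_smooth_G hx ha hA
  obtain ⟨w, hw, ε, hε, hwq⟩ := exists_contDiff_rpow ha (p - 1)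
  replace hwq : ∀ z ∈ Icc (-1 : ℝ) 1, w z = (z + a) ^ (p - 1) := fun z hz =>
    hwq z ⟨by linarith [hz.1], by linarith [hz.2]⟩
  obtain ⟨δ, hδ, hbp⟩ : ∃ δ > 0, ∀ z ∈ Ioo (-1 - δ) (1 + δ), P.basePoly z ≠ 0 := by
    have hU : IsOpen {z | P.basePoly z ≠ 0} :=
      isOpen_ne_fun P.contDiff_basePoly.continuous continuous_const
    obtain ⟨δ, hδ, hsub⟩ := (isCompact_Icc (a := (-1 : ℝ)) (b := 1)).exists_thickening_subset_open
      hU (fun z hz => (basePoly_pos hx hz).ne')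
    refine ⟨δ, hδ, fun z hz => hsub ?_⟩
    rw [Metric.mem_thickening_iff]
    rcases lt_or_ge z (-1) with h1 | h1
    · exact ⟨-1, by norm_num, by rw [Real.dist_eq, abs_lt]; constructor <;> linarith [hz.1]⟩
    rcases lt_or_ge 1 z with h2 | h2
    · exact ⟨1, by norm_num, by rw [Real.dist_eq, abs_lt]; constructor <;> linarith [hz.2]⟩
    · exact ⟨z, ⟨h1, h2⟩, by simpa using hδ⟩
  obtain ⟨κ, hκ, ε', hε', hκeq⟩ := exists_contDiff_extension (f := fun z => w z * h z / P.basePoly z)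
    hδ (fun z hz => ((hw.mul hh).contDiffAt.div P.contDiff_basePoly.contDiffAt
      (hbp z hz)).contDiffWithinAt)
  replace hκeq : ∀ z ∈ Icc (-1 : ℝ) 1, κ z = w z * h z / P.basePoly z := fun z hz =>
    hκeq z ⟨by linarith [hz.1], by linarith [hz.2]⟩
  have hml : (-1 : ℝ) ∈ Icc (-1 : ℝ) 1 := by norm_num
  have hmr : (1 : ℝ) ∈ Icc (-1 : ℝ) 1 := by norm_num
  have hpow : ∀ y : ℝ, 0 < y → y ^ (p - 1) * y ^ (1 - p) = 1 := fun y hy => by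
    rw [← Real.rpow_add hy]; simp
  have hκl : κ (-1) = 1 := by
    rw [hκeq _ hml, hwq _ hml, hhl, show -1 + a = a - 1 by ring, ← mul_assoc,
      hpow _ (by linarith), one_mul, div_self (basePoly_pos hx hml).ne']
  have hκr : κ 1 = 1 := by
    rw [hκeq _ hmr, hwq _ hmr, hhr, ← mul_assoc, hpow _ (by linarith), one_mul,
      div_self (basePoly_pos hx hmr).ne']
  have hκ1 : ∀ z, HasDerivAt (fun z => κ z - 1) (deriv κ z) z := fun z =>
    (hκ.differentiable (by simp) z).hasDerivAt.sub_const 1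
  have hκd : ContDiff ℝ ∞ (deriv κ) := (contDiff_infty_iff_deriv.1 hκ).2
  obtain ⟨g₁, hg₁, hg₁e, -⟩ := exists_eq_pow_succ_mul (f := fun z => κ z - 1) (c := -1) 0 hκd
    (fun z => (hκ1 z).congr_deriv (by simp)) (by simp [hκl])
  obtain ⟨g₂, hg₂, hg₂e, -⟩ := exists_eq_pow_succ_mul (f := fun z => κ z - 1) (c := 1) 0 hκd
    (fun z => (hκ1 z).congr_deriv (by simp)) (by simp [hκr])
  obtain ⟨τ, hτ, hτe, -, -⟩ := exists_eq_mul_mul (f := fun z => κ z - 1) (m := 1) (n := 1) hg₁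
    hg₂.neg (fun z => by rw [hg₁e z]; ring) (fun z => by rw [hg₂e z]; ring)
  have hκτ : ∀ z, 1 + (1 - z ^ 2) * τ z = κ z := fun z => by linear_combination -hτe z
  have hF : ∀ z ∈ Icc (-1 : ℝ) 1, P.F a p A₁ A₂ z = P.pc z * ((1 - z ^ 2) * κ z) := by
    intro z hz
    have hb := (basePoly_pos hx hz).ne'
    rw [hκeq z hz, F, hG z hz, hGh, hwq z hz]
    have : P.pc z = P.basePoly z * (1 + z) ^ P.d₀ * (1 - z) ^ P.d₁ := rfl
    rw [this]
    field_simp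
    ring
  refine ⟨τ, hτ, fun z hz => ?_, fun z hz => by rw [hκτ, hF z hz]⟩
  rw [hκτ]
  rcases eq_or_lt_of_le hz.1 with h1 | h1
  · rw [← h1, hκl]; exact one_pos
  rcases eq_or_lt_of_le hz.2 with h2 | h2
  · rw [h2, hκr]; exact one_pos
  have h3 := hpos z ⟨h1, h2⟩
  rw [hF z hz, ← mul_assoc] at h3
  exact pos_of_mul_pos_right h3 (mul_pos (pc_pos hx ⟨h1, h2⟩) (by nlinarith)).le

end AdmissibleParams

theorem isMomentumProfile_of_smooth {τ : ℝ → ℝ} (hτ : ContDiff ℝ ∞ τ)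
    (hpos : ∀ z ∈ Icc (-1 : ℝ) 1, 0 < 1 + (1 - z ^ 2) * τ z) :
    IsMomentumProfile fun z => (1 - z ^ 2) * (1 + (1 - z ^ 2) * τ z) := by
  have hd : ∀ z ∈ Icc (-1 : ℝ) 1, 1 - z ^ 2 = 0 →
      derivWithin (fun z => (1 - z ^ 2) * (1 + (1 - z ^ 2) * τ z)) (Icc (-1) 1) z = -2 * z := by
    intro z hz h0
    have h1 : HasDerivAt (fun z : ℝ => 1 - z ^ 2) (-(2 * z)) z := by
      simpa using (hasDerivAt_pow 2 z).const_sub 1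
    have h2 := h1.mul ((h1.mul (hτ.differentiable (by simp) z).hasDerivAt).const_add 1)
    refine (HasDerivWithinAt.derivWithin h2.hasDerivWithinAt
      (uniqueDiffOn_Icc (by norm_num) z hz)).trans ?_
    simp only [Pi.mul_apply, h0]
    ring
  refine ⟨ContDiff.contDiffOn (by fun_prop), fun z hz => ?_, by simp, by simp, ?_, ?_⟩
  · exact mul_pos (by nlinarith [hz.1, hz.2]) (hpos z (Ioo_subset_Icc_self hz))
  · rw [hd _ (by norm_num) (by norm_num)]; norm_num
  · rw [hd _ (by norm_num) (by norm_num)]; norm_num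

/-! ## Naturality of the local geometry -/

namespace LocalGeometry

section Derivatives

variable {V W E F : Type*} [NormedAddCommGroup V] [NormedSpace ℝ V]
  [NormedAddCommGroup W] [NormedSpace ℝ W] [NormedAddCommGroup E] [NormedSpace ℝ E]
  [NormedAddCommGroup F] [NormedSpace ℝ F]

theorem fderiv_apply_const {T : V → E →L[ℝ] F} {u : V} (hT : DifferentiableAt ℝ T u) (v : V)
    (w : E) : fderiv ℝ (fun u' => T u' w) u v = fderiv ℝ T u v w := by
  rw [(hT.hasFDerivAt.clm_apply (hasFDerivAt_const w u)).fderiv]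
  simp

theorem fderiv_apply_const₂ {T : V → E →L[ℝ] W →L[ℝ] F} {u : V} (hT : DifferentiableAt ℝ T u)
    (v : V) (w : E) (k : W) :
    fderiv ℝ (fun u' => T u' w k) u v = fderiv ℝ T u v w k := by
  rw [fderiv_apply_const (T := fun u' => T u' w) (hT.clm_apply (differentiableAt_const w)),
    fderiv_apply_const hT]

end Derivatives

section Christoffel

variable {V : Type*} [NormedAddCommGroup V] [NormedSpace ℝ V]

/-- The Christoffel symbols as a bilinear map. -/
def chr (G : V → V →L[ℝ] V →L[ℝ] ℝ) (u : V) : V →L[ℝ] V →L[ℝ] V :=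
  (ContinuousLinearMap.compL ℝ V (V →L[ℝ] ℝ) V (G u).inverse).comp
    ((1 / 2 : ℝ) • (fderiv ℝ G u + (fderiv ℝ G u).flip
      - ((ContinuousLinearMap.flipₗᵢ ℝ V V ℝ).toContinuousLinearEquiv.toContinuousLinearMap.comp (fderiv ℝ G u).flip)))

theorem chr_apply (G : V → V →L[ℝ] V →L[ℝ] ℝ) (u v w : V) :
    chr G u v w = christoffel G u v w := rfl

/-- The bilinear form `G u` is symmetric and nondegenerate. -/
structure IsNondegSymm (g : V →L[ℝ] V →L[ℝ] ℝ) : Prop where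
  symm : ∀ v w, g v w = g w v
  inv : g.IsInvertible

/-- `G` is smooth at `u` and a (pseudo-Riemannian) metric near `u`. -/
structure IsMetricAt (G : V → V →L[ℝ] V →L[ℝ] ℝ) (u : V) : Prop where
  smooth : ContDiffAt ℝ ∞ G u
  nondeg : ∀ᶠ u' in 𝓝 u, IsNondegSymm (G u')

theorem IsNondegSymm.apply_inverse {g : V →L[ℝ] V →L[ℝ] ℝ} (hg : IsNondegSymm g)
    (α : V →L[ℝ] ℝ) : g (g.inverse α) = α := by
  have := hg.inv.self_apply_inverse α
  exact this

theorem IsNondegSymm.inverse_apply {g : V →L[ℝ] V →L[ℝ] ℝ} (hg : IsNondegSymm g)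
    (v : V) : g.inverse (g v) = v :=
  hg.inv.inverse_apply_self v

theorem IsNondegSymm.ext {g : V →L[ℝ] V →L[ℝ] ℝ} (hg : IsNondegSymm g) {v w : V}
    (h : ∀ k, g v k = g w k) : v = w := by
  rw [← hg.inverse_apply v, ← hg.inverse_apply w]
  congr 1
  ext k
  exact h k

theorem IsNondegSymm.apply_christoffel {G : V → V →L[ℝ] V →L[ℝ] ℝ} {u : V}
    (hg : IsNondegSymm (G u)) (v w k : V) :
    G u (christoffel G u v w) k
      = (1 / 2) * (fderiv ℝ G u v w k + fderiv ℝ G u w v k - fderiv ℝ G u k v w) := by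
  rw [christoffel, sharp, hg.apply_inverse]
  simp

theorem IsMetricAt.eventually {G : V → V →L[ℝ] V →L[ℝ] ℝ} {u : V} (hG : IsMetricAt G u) :
    ∀ᶠ u' in 𝓝 u, IsNondegSymm (G u') ∧ ContDiffAt ℝ 2 G u' ∧
      (∀ v w k, fderiv ℝ G u' v w k = fderiv ℝ G u' v k w) := by
  have h2 : ∀ᶠ u' in 𝓝 u, ContDiffAt ℝ 2 G u' :=
    (hG.smooth.of_le (m := 2) (by norm_cast)).eventually
      (by simp)
  filter_upwards [hG.nondeg.eventually_nhds, h2] with y hy hy2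
  refine ⟨hy.self_of_nhds, hy2, fun v w k => ?_⟩
  have hd : DifferentiableAt ℝ G y := hy2.differentiableAt (by simp)
  rw [← fderiv_apply_const₂ hd, ← fderiv_apply_const₂ hd]
  have : (fun u' => G u' w k) =ᶠ[𝓝 y] fun u' => G u' k w := by
    filter_upwards [hy] with u' hu' using hu'.symm w k
  rw [this.fderiv_eq]

theorem IsMetricAt.christoffel_symm {G : V → V →L[ℝ] V →L[ℝ] ℝ} {u : V} (hG : IsMetricAt G u) :
    ∀ᶠ u' in 𝓝 u, ∀ v w, christoffel G u' v w = christoffel G u' w v := by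
  filter_upwards [hG.eventually] with y hy' v w
  obtain ⟨hy, -, hy3⟩ := hy'
  refine hy.ext fun k => ?_
  rw [hy.apply_christoffel, hy.apply_christoffel, hy3 k v w]
  ring

variable [CompleteSpace V]

theorem IsMetricAt.contDiffAt_inverse {G : V → V →L[ℝ] V →L[ℝ] ℝ} {u : V}
    (hG : IsMetricAt G u) : ContDiffAt ℝ ∞ (fun u' => (G u').inverse) u := by
  exact (hG.nondeg.self_of_nhds.inv.contDiffAt_map_inverse (n := ∞)).comp u hG.smooth

theorem IsMetricAt.contDiffAt_chr {G : V → V →L[ℝ] V →L[ℝ] ℝ} {u : V}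
    (hG : IsMetricAt G u) : ContDiffAt ℝ ∞ (chr G) u := by
  have h1 := hG.contDiffAt_inverse
  have h2 : ContDiffAt ℝ ∞ (fderiv ℝ G) u := hG.smooth.fderiv_right (m := ∞) (by simp)
  have h3 : ContDiffAt ℝ ∞ (fun u => (fderiv ℝ G u).flip) u :=
    (ContinuousLinearMap.flipₗᵢ ℝ V V (V →L[ℝ] ℝ)).contDiff.contDiffAt.comp u h2
  unfold chr
  refine ContDiffAt.clm_comp ?_ (ContDiffAt.const_smul _ ((h2.add h3).sub
    (ContDiffAt.clm_comp contDiffAt_const h3)))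
  exact (ContinuousLinearMap.contDiff _).contDiffAt.comp u h1

theorem IsMetricAt.riemann_eq {G : V → V →L[ℝ] V →L[ℝ] ℝ} {u : V}
    (hG : IsMetricAt G u) (v w k : V) :
    riemann G u v w k = fderiv ℝ (chr G) u v w k - fderiv ℝ (chr G) u w v k
      + chr G u v (chr G u w k) - chr G u w (chr G u v k) := by
  have hd : DifferentiableAt ℝ (chr G) u := hG.contDiffAt_chr.differentiableAt (by simp)
  rw [← fderiv_apply_const₂ hd, ← fderiv_apply_const₂ hd]
  rfl

end Christoffel

/-! ### Traces -/

section Trace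

variable {V : Type*} [NormedAddCommGroup V] [NormedSpace ℝ V] [FiniteDimensional ℝ V]

theorem sum_coord_eq_trace (T : V →ₗ[ℝ] V) :
    ∑ i, coord V i (T (Module.finBasis ℝ V i)) = LinearMap.trace ℝ V T := by
  rw [LinearMap.trace_eq_matrix_trace ℝ (Module.finBasis ℝ V), Matrix.trace]
  simp [LinearMap.toMatrix_apply, coord]

/-- The metric trace of a bilinear form. -/
def metricTrace (g : V →L[ℝ] V →L[ℝ] ℝ) (B : V →ₗ[ℝ] V →ₗ[ℝ] ℝ) : ℝ :=
  LinearMap.trace ℝ V (g.inverse.toLinearMap ∘ₗ LinearMap.toContinuousLinearMap.toLinearMap ∘ₗ B)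

theorem IsNondegSymm.inverse_symm {g : V →L[ℝ] V →L[ℝ] ℝ} (hg : IsNondegSymm g)
    (α β : V →L[ℝ] ℝ) : α (g.inverse β) = β (g.inverse α) := by
  conv_lhs => rw [← hg.apply_inverse α]
  conv_rhs => rw [← hg.apply_inverse β]
  rw [hg.symm]

theorem IsNondegSymm.sum_eq_metricTrace {g : V →L[ℝ] V →L[ℝ] ℝ} (hg : IsNondegSymm g)
    (B : V →ₗ[ℝ] V →ₗ[ℝ] ℝ) :
    ∑ i, B (Module.finBasis ℝ V i) (g.inverse (coord V i)) = metricTrace g B := by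
  rw [metricTrace, ← sum_coord_eq_trace]
  refine Finset.sum_congr rfl fun i _ => ?_
  rw [LinearMap.comp_apply, LinearMap.comp_apply]
  exact hg.inverse_symm (LinearMap.toContinuousLinearMap (B (Module.finBasis ℝ V i))) (coord V i)

theorem isInvertible_of_injective {W : Type*} [NormedAddCommGroup W] [NormedSpace ℝ W]
    [FiniteDimensional ℝ W] {f : V →L[ℝ] W} (hf : ∀ v, f v = 0 → v = 0)
    (hd : Module.finrank ℝ V = Module.finrank ℝ W) : f.IsInvertible := by
  have hinj : Function.Injective f.toLinearMap :=
    LinearMap.ker_eq_bot.1 (LinearMap.ker_eq_bot'.2 hf)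
  exact ⟨(LinearMap.linearEquivOfInjective f.toLinearMap hinj hd).toContinuousLinearEquiv,
    by ext; rfl⟩

theorem isNondegSymm_of_nondeg {g : V →L[ℝ] V →L[ℝ] ℝ} (hs : ∀ v w, g v w = g w v)
    (h : ∀ v, (∀ w, g v w = 0) → v = 0) : IsNondegSymm g := by
  refine ⟨hs, isInvertible_of_injective (fun v hv => h v fun w => by rw [hv]; rfl) ?_⟩
  rw [← LinearEquiv.finrank_eq (LinearMap.toContinuousLinearMap (𝕜 := ℝ) (E := V) (F' := ℝ))]
  exact (Subspace.dual_finrank_eq (K := ℝ) (V := V)).symm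

end Trace

/-! ### Local isometries -/

section Isometry

variable {V V' : Type*} [NormedAddCommGroup V] [NormedSpace ℝ V] [NormedAddCommGroup V']
  [NormedSpace ℝ V']

/-- `δ` is near `u` a local isometry between (pseudo-Riemannian) metrics `G'` and `G`. -/
structure IsLocalIsometryAt (δ : V' → V) (G' : V' → V' →L[ℝ] V' →L[ℝ] ℝ)
    (G : V → V →L[ℝ] V →L[ℝ] ℝ) (u : V') : Prop where
  smooth : ContDiffAt ℝ ∞ δ u
  inv : (fderiv ℝ δ u).IsInvertible
  source : IsMetricAt G' u
  target : IsMetricAt G (δ u)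
  pull : ∀ᶠ u' in 𝓝 u, ∀ v w, G' u' v w = G (δ u') (fderiv ℝ δ u' v) (fderiv ℝ δ u' w)

variable {δ : V' → V} {G' : V' → V' →L[ℝ] V' →L[ℝ] ℝ} {G : V → V →L[ℝ] V →L[ℝ] ℝ} {u : V'}

/-- The derivative of a pulled back bilinear form. -/
theorem fderiv_pullback {T' : V' → V' →L[ℝ] V' →L[ℝ] ℝ} {T : V → V →L[ℝ] V →L[ℝ] ℝ}
    (hδ : ContDiffAt ℝ 2 δ u) (hT : DifferentiableAt ℝ T (δ u)) (hT' : DifferentiableAt ℝ T' u)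
    (h : ∀ᶠ u' in 𝓝 u, ∀ v w, T' u' v w = T (δ u') (fderiv ℝ δ u' v) (fderiv ℝ δ u' w))
    (v w k : V') :
    fderiv ℝ T' u v w k = fderiv ℝ T (δ u) (fderiv ℝ δ u v) (fderiv ℝ δ u w) (fderiv ℝ δ u k)
      + T (δ u) (fderiv ℝ (fderiv ℝ δ) u v w) (fderiv ℝ δ u k)
      + T (δ u) (fderiv ℝ δ u w) (fderiv ℝ (fderiv ℝ δ) u v k) := by
  rw [← fderiv_apply_const₂ hT']
  have h1 : (fun u' => T' u' w k)
      =ᶠ[𝓝 u] fun u' => T (δ u') (fderiv ℝ δ u' w) (fderiv ℝ δ u' k) := by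
    filter_upwards [h] with u' hu' using hu' w k
  rw [h1.fderiv_eq]
  have hd1 : DifferentiableAt ℝ δ u := hδ.differentiableAt (by simp)
  have hd2 : DifferentiableAt ℝ (fderiv ℝ δ) u :=
    (hδ.fderiv_right (m := 1) (by norm_num)).differentiableAt (by simp)
  have e1 := hT.hasFDerivAt.comp u hd1.hasFDerivAt
  have e2 := hd2.hasFDerivAt.clm_apply (hasFDerivAt_const w u)
  have e3 := hd2.hasFDerivAt.clm_apply (hasFDerivAt_const k u)
  have e4 := ((e1.clm_apply e2).clm_apply e3).fderiv
  simp only [Function.comp_apply] at e4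
  rw [e4]
  simp
  ring

theorem snd_fderiv_symm {f : V' → V} (hf : ContDiffAt ℝ 2 f u) (v w : V') :
    fderiv ℝ (fderiv ℝ f) u v w = fderiv ℝ (fderiv ℝ f) u w v :=
  (hf.isSymmSndFDerivAt (by simp)).eq v w

theorem eventually_contDiffAt_two {f : V' → V} (hf : ContDiffAt ℝ ∞ f u) :
    ∀ᶠ u' in 𝓝 u, ContDiffAt ℝ 2 f u' :=
  (hf.of_le (m := 2) (by norm_cast)).eventually (by simp)

theorem isInvertible_eventually [CompleteSpace V'] {f : V' → V} (hf : ContDiffAt ℝ ∞ f u)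
    (hi : (fderiv ℝ f u).IsInvertible) : ∀ᶠ u' in 𝓝 u, (fderiv ℝ f u').IsInvertible := by
  obtain ⟨e, he⟩ := hi
  have hc : ContinuousAt (fderiv ℝ f) u := (hf.fderiv_right (m := ∞) (by simp)).continuousAt
  have := hc.preimage_mem_nhds (by rw [← he]; exact e.nhds)
  filter_upwards [this] with u' hu'
  obtain ⟨e', he'⟩ := hu'
  exact ⟨e', he'⟩

namespace IsLocalIsometryAt

theorem christoffel_eq [CompleteSpace V'] (h : IsLocalIsometryAt δ G' G u) :
    ∀ᶠ u' in 𝓝 u, ∀ v w, fderiv ℝ δ u' (christoffel G' u' v w)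
      = christoffel G (δ u') (fderiv ℝ δ u' v) (fderiv ℝ δ u' w)
        + fderiv ℝ (fderiv ℝ δ) u' v w := by
  filter_upwards [h.pull.eventually_nhds, h.source.eventually,
    h.smooth.continuousAt.eventually h.target.eventually, eventually_contDiffAt_two h.smooth,
    isInvertible_eventually h.smooth h.inv] with y hp hs ht hδ hi v w
  refine ht.1.ext fun k => ?_
  obtain ⟨k, rfl⟩ := hi.surjective k
  have hd := fderiv_pullback hδ (ht.2.1.differentiableAt (by simp))
    (hs.2.1.differentiableAt (by simp)) hp
  rw [← hp.self_of_nhds, map_add, add_apply, hs.1.apply_christoffel,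
    ht.1.apply_christoffel, hd, hd, hd, snd_fderiv_symm hδ w v, snd_fderiv_symm hδ k v,
    snd_fderiv_symm hδ k w, ht.1.symm _ (fderiv ℝ (fderiv ℝ δ) y w k),
    ht.1.symm (fderiv ℝ (fderiv ℝ δ) y v k)]
  ring

theorem riemann_eq [CompleteSpace V'] [CompleteSpace V] (h : IsLocalIsometryAt δ G' G u)
    (v w k : V') :
    fderiv ℝ δ u (riemann G' u v w k)
      = riemann G (δ u) (fderiv ℝ δ u v) (fderiv ℝ δ u w) (fderiv ℝ δ u k) := by
  have hδ2 : ContDiffAt ℝ 2 δ u := h.smooth.of_le (by norm_cast)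
  have hD : ContDiffAt ℝ ∞ (fderiv ℝ δ) u := h.smooth.fderiv_right (m := ∞) (by simp)
  have hD2 : ContDiffAt ℝ ∞ (fderiv ℝ (fderiv ℝ δ)) u := hD.fderiv_right (m := ∞) (by simp)
  have hc' := h.source.contDiffAt_chr.differentiableAt (by simp)
  have hc := h.target.contDiffAt_chr.differentiableAt (by simp)
  have dD := hD.differentiableAt (by simp)
  have dD2 := hD2.differentiableAt (by simp)
  have dδ := h.smooth.differentiableAt (by simp)
  have key : ∀ x v w, fderiv ℝ (fderiv ℝ δ) u x (chr G' u v w)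
      + fderiv ℝ δ u (fderiv ℝ (chr G') u x v w)
      = fderiv ℝ (chr G) (δ u) (fderiv ℝ δ u x) (fderiv ℝ δ u v) (fderiv ℝ δ u w)
        + chr G (δ u) (fderiv ℝ (fderiv ℝ δ) u x v) (fderiv ℝ δ u w)
        + chr G (δ u) (fderiv ℝ δ u v) (fderiv ℝ (fderiv ℝ δ) u x w)
        + fderiv ℝ (fderiv ℝ (fderiv ℝ δ)) u x v w := by
    intro x v w
    have e1 := (hc'.hasFDerivAt.clm_apply (hasFDerivAt_const v u)).clm_apply
      (hasFDerivAt_const w u)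
    have e2 := (dD.hasFDerivAt.clm_apply e1).fderiv
    have e3 := hc.hasFDerivAt.comp u dδ.hasFDerivAt
    have e4 := dD.hasFDerivAt.clm_apply (hasFDerivAt_const v u)
    have e5 := dD.hasFDerivAt.clm_apply (hasFDerivAt_const w u)
    have e6 := (dD2.hasFDerivAt.clm_apply (hasFDerivAt_const v u)).clm_apply
      (hasFDerivAt_const w u)
    have e7 := (((e3.clm_apply e4).clm_apply e5).add e6).fderiv
    have e8 : (fun u' => fderiv ℝ δ u' (chr G' u' v w)) =ᶠ[𝓝 u]
        fun u' => chr G (δ u') (fderiv ℝ δ u' v) (fderiv ℝ δ u' w)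
          + fderiv ℝ (fderiv ℝ δ) u' v w := by
      filter_upwards [h.christoffel_eq] with u' hu'
      exact hu' v w
    have e9 := e2.symm.trans (e8.fderiv_eq.trans e7)
    have e10 := DFunLike.congr_fun e9 x
    simp at e10
    rw [add_comm, e10]
    abel
  have hchr : ∀ v w, fderiv ℝ δ u (chr G' u v w)
      = chr G (δ u) (fderiv ℝ δ u v) (fderiv ℝ δ u w) + fderiv ℝ (fderiv ℝ δ) u v w :=
    h.christoffel_eq.self_of_nhds
  have h3 : ∀ v w k, fderiv ℝ (fderiv ℝ (fderiv ℝ δ)) u v w k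
      = fderiv ℝ (fderiv ℝ (fderiv ℝ δ)) u w v k := fun v w k => by
    rw [snd_fderiv_symm (f := fderiv ℝ δ) (hD.of_le (by norm_cast)) v w]
  have k1 := key v w k
  have k2 := key w v k
  rw [h.source.riemann_eq, h.target.riemann_eq, map_sub, map_add, map_sub, hchr, hchr, hchr, hchr,
    ← sub_eq_zero]
  rw [h3 v w k, snd_fderiv_symm hδ2 v w, add_comm] at k1
  rw [add_comm] at k2
  rw [eq_sub_of_add_eq k1, eq_sub_of_add_eq k2, map_add, map_add]
  abel

variable [FiniteDimensional ℝ V] [FiniteDimensional ℝ V']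

theorem trace_eq {A : V' →L[ℝ] V} (hA : A.IsInvertible) (T' : V' →ₗ[ℝ] V') (T : V →ₗ[ℝ] V)
    (hT : ∀ v, A (T' v) = T (A v)) : LinearMap.trace ℝ V' T' = LinearMap.trace ℝ V T := by
  obtain ⟨e, rfl⟩ := hA
  rw [← LinearMap.trace_conj' T' e.toLinearEquiv]
  congr 1
  ext v
  simp only [LinearEquiv.conj_apply, LinearMap.comp_apply]
  have := hT (e.symm v)
  simpa using this

theorem inverse_eq (h : IsLocalIsometryAt δ G' G u) (α : V →L[ℝ] ℝ) :
    fderiv ℝ δ u ((G' u).inverse (α.comp (fderiv ℝ δ u))) = (G (δ u)).inverse α := by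
  have hs := h.source.nondeg.self_of_nhds
  have ht := h.target.nondeg.self_of_nhds
  refine ht.ext fun k => ?_
  obtain ⟨k, rfl⟩ := h.inv.surjective k
  rw [← h.pull.self_of_nhds, hs.apply_inverse, ht.apply_inverse]
  rfl

theorem metricTrace_eq (h : IsLocalIsometryAt δ G' G u) (B' : V' →ₗ[ℝ] V' →ₗ[ℝ] ℝ)
    (B : V →ₗ[ℝ] V →ₗ[ℝ] ℝ) (hB : ∀ v w, B' v w = B (fderiv ℝ δ u v) (fderiv ℝ δ u w)) :
    metricTrace (G' u) B' = metricTrace (G (δ u)) B := by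
  refine trace_eq h.inv _ _ fun v => ?_
  simp only [LinearMap.comp_apply]
  have e := h.inverse_eq (LinearMap.toContinuousLinearMap (B (fderiv ℝ δ u v)))
  refine Eq.trans ?_ e
  refine congrArg (fun α => fderiv ℝ δ u ((G' u).inverse α)) ?_
  ext w
  exact hB v w

end IsLocalIsometryAt

end Isometry

end LocalGeometry

namespace LocalGeometry

/-! ### Traces of the curvature and the Hessian -/

section Curvature

variable {V : Type*} [NormedAddCommGroup V] [NormedSpace ℝ V] [FiniteDimensional ℝ V]

/-- The endomorphism `v ↦ R(v, w) k`. -/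
def riemannMap (G : V → V →L[ℝ] V →L[ℝ] ℝ) (u w k : V) : V →ₗ[ℝ] V where
  toFun v := fderiv ℝ (chr G) u v w k - fderiv ℝ (chr G) u w v k
      + chr G u v (chr G u w k) - chr G u w (chr G u v k)
  map_add' x y := by simp; abel
  map_smul' c x := by simp [smul_sub, smul_add]

/-- The Ricci tensor as a bilinear map. -/
def ricciMap (G : V → V →L[ℝ] V →L[ℝ] ℝ) (u : V) : V →ₗ[ℝ] V →ₗ[ℝ] ℝ :=
  LinearMap.mk₂ ℝ (fun w k => LinearMap.trace ℝ V (riemannMap G u w k))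
    (fun w w' k => by
      rw [← map_add]; congr 1; ext v; simp [riemannMap]; abel)
    (fun c w k => by
      rw [← map_smul]; congr 1; ext v; simp [riemannMap, smul_sub, smul_add])
    (fun w k k' => by
      rw [← map_add]; congr 1; ext v; simp [riemannMap]; abel)
    (fun c w k => by
      rw [← map_smul]; congr 1; ext v; simp [riemannMap, smul_sub, smul_add])

theorem ricciMap_apply (G : V → V →L[ℝ] V →L[ℝ] ℝ) (u w k : V) :
    ricciMap G u w k = LinearMap.trace ℝ V (riemannMap G u w k) := rfl

/-- The Hessian as a bilinear map. -/
def hessianMap (G : V → V →L[ℝ] V →L[ℝ] ℝ) (f : V → ℝ) (u : V) : V →ₗ[ℝ] V →ₗ[ℝ] ℝ :=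
  LinearMap.mk₂ ℝ (fun v w => fderiv ℝ (fderiv ℝ f) u v w - fderiv ℝ f u (chr G u v w))
    (fun w w' k => by simp; abel) (fun c w k => by simp [mul_sub])
    (fun w k k' => by simp; abel) (fun c w k => by simp [mul_sub])

theorem hessianMap_apply (G : V → V →L[ℝ] V →L[ℝ] ℝ) (f : V → ℝ) (u v w : V) :
    hessianMap G f u v w = hessian G f u v w := rfl

variable {G : V → V →L[ℝ] V →L[ℝ] ℝ} {u : V}

theorem IsMetricAt.riemannMap_apply (hG : IsMetricAt G u) (v w k : V) :
    riemannMap G u w k v = riemann G u v w k := (hG.riemann_eq v w k).symm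

theorem IsMetricAt.ricci_eq (hG : IsMetricAt G u) (w k : V) :
    ricci G u w k = ricciMap G u w k := by
  rw [ricciMap_apply, ← sum_coord_eq_trace, ricci]
  simp only [hG.riemannMap_apply]

theorem IsMetricAt.scal_eq (hG : IsMetricAt G u) :
    scal G u = metricTrace (G u) (ricciMap G u) := by
  rw [← hG.nondeg.self_of_nhds.sum_eq_metricTrace, scal]
  simp only [hG.ricci_eq]
  rfl

theorem IsMetricAt.laplacian_eq (hG : IsMetricAt G u) (f : V → ℝ) :
    laplacian G f u = - metricTrace (G u) (hessianMap G f u) := by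
  rw [← hG.nondeg.self_of_nhds.sum_eq_metricTrace, laplacian]
  rfl

end Curvature

section Continuity

variable {V : Type*} [NormedAddCommGroup V] [NormedSpace ℝ V] [FiniteDimensional ℝ V]
  {G : V → V →L[ℝ] V →L[ℝ] ℝ} {u : V}

theorem IsMetricAt.continuousAt_scal (hG : ∀ᶠ u' in 𝓝 u, IsMetricAt G u') :
    ContinuousAt (scal G) u := by
  have h0 := hG.self_of_nhds
  have hc := h0.contDiffAt_chr.continuousAt
  have hdc : ContinuousAt (fderiv ℝ (chr G)) u :=
    (h0.contDiffAt_chr.fderiv_right (m := ∞) (by simp)).continuousAt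
  have hi : ContinuousAt (fun u' => (G u').inverse) u := h0.contDiffAt_inverse.continuousAt
  have : scal G =ᶠ[𝓝 u] fun u' => ∑ i, ∑ j, coord V j
      (fderiv ℝ (chr G) u' (Module.finBasis ℝ V j) (Module.finBasis ℝ V i)
          ((G u').inverse (coord V i))
        - fderiv ℝ (chr G) u' (Module.finBasis ℝ V i) (Module.finBasis ℝ V j)
          ((G u').inverse (coord V i))
        + chr G u' (Module.finBasis ℝ V j) (chr G u' (Module.finBasis ℝ V i)
          ((G u').inverse (coord V i)))
        - chr G u' (Module.finBasis ℝ V i) (chr G u' (Module.finBasis ℝ V j)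
          ((G u').inverse (coord V i)))) := by
    filter_upwards [hG] with u' hu'
    simp only [scal, ricci, hu'.riemann_eq]
    rfl
  refine ContinuousAt.congr ?_ this.symm
  fun_prop

theorem IsMetricAt.continuousAt_laplacian (hG : IsMetricAt G u) {f : V → ℝ}
    (hf : ContDiffAt ℝ ∞ f u) : ContinuousAt (laplacian G f) u := by
  have hc := hG.contDiffAt_chr.continuousAt
  have hi : ContinuousAt (fun u' => (G u').inverse) u := hG.contDiffAt_inverse.continuousAt
  have h1 : ContDiffAt ℝ ∞ (fderiv ℝ f) u := hf.fderiv_right (m := ∞) (by simp)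
  have h2 : ContinuousAt (fderiv ℝ (fderiv ℝ f)) u :=
    (h1.fderiv_right (m := ∞) (by simp)).continuousAt
  have h3 := h1.continuousAt
  have : laplacian G f = fun u' => - ∑ i, (fderiv ℝ (fderiv ℝ f) u' (Module.finBasis ℝ V i)
      ((G u').inverse (coord V i)) - fderiv ℝ f u' (chr G u' (Module.finBasis ℝ V i)
      ((G u').inverse (coord V i)))) := rfl
  rw [this]
  fun_prop

theorem IsMetricAt.continuousAt_weightedScal (hG : ∀ᶠ u' in 𝓝 u, IsMetricAt G u') {f : V → ℝ}
    (hf : ContDiffAt ℝ ∞ f u) (p : ℝ) : ContinuousAt (weightedScal G f p) u := by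
  have h1 := IsMetricAt.continuousAt_scal hG
  have h2 := hG.self_of_nhds.continuousAt_laplacian hf
  have h3 := hf.continuousAt
  have h4 : ContinuousAt (fderiv ℝ f) u := (hf.fderiv_right (m := ∞) (by simp)).continuousAt
  have hi : ContinuousAt (fun u' => (G u').inverse) u :=
    hG.self_of_nhds.contDiffAt_inverse.continuousAt
  have h5 : ContinuousAt (normSqDiff G f) u := by
    have : normSqDiff G f = fun u' => fderiv ℝ f u' ((G u').inverse (fderiv ℝ f u')) := rfl
    rw [this]
    fun_prop
  unfold weightedScal
  fun_prop

end Continuity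

section Isometry

variable {V V' : Type*} [NormedAddCommGroup V] [NormedSpace ℝ V] [NormedAddCommGroup V']
  [NormedSpace ℝ V'] [FiniteDimensional ℝ V] [FiniteDimensional ℝ V']
  {δ : V' → V} {G' : V' → V' →L[ℝ] V' →L[ℝ] ℝ} {G : V → V →L[ℝ] V →L[ℝ] ℝ} {u : V'}

namespace IsLocalIsometryAt

theorem scal_eq (h : IsLocalIsometryAt δ G' G u) : scal G' u = scal G (δ u) := by
  rw [h.source.scal_eq, h.target.scal_eq]
  refine h.metricTrace_eq _ _ fun w k => trace_eq h.inv _ _ fun v => ?_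
  rw [h.source.riemannMap_apply, h.target.riemannMap_apply, h.riemann_eq]

theorem fderiv_comp {f : V → ℝ} (h : IsLocalIsometryAt δ G' G u) (hf : ContDiffAt ℝ ∞ f (δ u)) :
    ∀ᶠ u' in 𝓝 u, fderiv ℝ (f ∘ δ) u' = (fderiv ℝ f (δ u')).comp (fderiv ℝ δ u') := by
  filter_upwards [eventually_contDiffAt_two h.smooth,
    h.smooth.continuousAt.eventually (eventually_contDiffAt_two hf)] with y h1 h2
  exact _root_.fderiv_comp y (h2.differentiableAt (by simp)) (h1.differentiableAt (by simp))

theorem laplacian_eq {f : V → ℝ} (h : IsLocalIsometryAt δ G' G u)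
    (hf : ContDiffAt ℝ ∞ f (δ u)) : laplacian G' (f ∘ δ) u = laplacian G f (δ u) := by
  rw [h.source.laplacian_eq, h.target.laplacian_eq]
  congr 1
  refine h.metricTrace_eq _ _ fun v w => ?_
  rw [hessianMap_apply, hessianMap_apply, hessian, hessian]
  have d1 : DifferentiableAt ℝ (fderiv ℝ δ) u :=
    (h.smooth.fderiv_right (m := ∞) (by simp)).differentiableAt (by simp)
  have d2 : DifferentiableAt ℝ (fderiv ℝ f) (δ u) :=
    (hf.fderiv_right (m := ∞) (by simp)).differentiableAt (by simp)
  have d0 := h.smooth.differentiableAt (by simp)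
  have e1 := (d2.hasFDerivAt.comp u d0.hasFDerivAt).clm_comp d1.hasFDerivAt
  have e2 := (Filter.EventuallyEq.fderiv_eq (h.fderiv_comp hf)).trans e1.fderiv
  rw [e2, (h.fderiv_comp hf).self_of_nhds, ContinuousLinearMap.comp_apply,
    h.christoffel_eq.self_of_nhds]
  simp
  ring

theorem normSqDiff_eq {f : V → ℝ} (h : IsLocalIsometryAt δ G' G u)
    (hf : ContDiffAt ℝ ∞ f (δ u)) : normSqDiff G' (f ∘ δ) u = normSqDiff G f (δ u) := by
  rw [normSqDiff, normSqDiff, sharp, sharp, (h.fderiv_comp hf).self_of_nhds,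
    ContinuousLinearMap.comp_apply, h.inverse_eq]

theorem weightedScal_eq {f : V → ℝ} (h : IsLocalIsometryAt δ G' G u)
    (hf : ContDiffAt ℝ ∞ f (δ u)) (p : ℝ) :
    weightedScal G' (f ∘ δ) p u = weightedScal G f p (δ u) := by
  rw [weightedScal, weightedScal, h.scal_eq, h.laplacian_eq hf, h.normSqDiff_eq hf]
  rfl

end IsLocalIsometryAt

end Isometry

end LocalGeometry

namespace LocalGeometry

/-! ### Metrics which are Kähler for a constant complex structure -/

section Hermitian

variable {V : Type*} [NormedAddCommGroup V] [NormedSpace ℝ V] [NormedSpace ℂ V]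
  [IsScalarTower ℝ ℂ V]

variable (V) in
/-- Multiplication by the imaginary unit. -/
def mulI : V →L[ℝ] V := (Complex.I • ContinuousLinearMap.id ℂ V).restrictScalars ℝ

@[simp] theorem mulI_apply (v : V) : mulI V v = Complex.I • v := rfl

/-- `G` is smooth at `u`, near `u` it is a pseudo-Riemannian metric compatible with the constant
complex structure, and its Kähler form is closed near `u`. -/
structure IsHolKahlerAt (G : V → V →L[ℝ] V →L[ℝ] ℝ) (u : V) : Prop extends IsMetricAt G u where
  herm : ∀ᶠ u' in 𝓝 u, ∀ v w, G u' (Complex.I • v) (Complex.I • w) = G u' v w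
  closed : ∀ᶠ u' in 𝓝 u, ∀ v w k, fderiv ℝ G u' v (Complex.I • w) k
    + fderiv ℝ G u' w (Complex.I • k) v + fderiv ℝ G u' k (Complex.I • v) w = 0

variable {G : V → V →L[ℝ] V →L[ℝ] ℝ} {u : V}

theorem I_smul_I_smul (v : V) : Complex.I • Complex.I • v = -v := by
  rw [smul_smul, Complex.I_mul_I, neg_one_smul]

theorem IsHolKahlerAt.fderiv_herm (hG : IsHolKahlerAt G u) :
    ∀ᶠ u' in 𝓝 u, ∀ v w k,
      fderiv ℝ G u' v (Complex.I • w) (Complex.I • k) = fderiv ℝ G u' v w k := by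
  filter_upwards [hG.herm.eventually_nhds, hG.eventually] with y h1 h2 v w k
  have hd := h2.2.1.differentiableAt (by simp)
  rw [← fderiv_apply_const₂ hd, ← fderiv_apply_const₂ hd]
  have : (fun u' => G u' (Complex.I • w) (Complex.I • k)) =ᶠ[𝓝 y] fun u' => G u' w k := by
    filter_upwards [h1] with u' hu' using hu' w k
  rw [this.fderiv_eq]

theorem IsHolKahlerAt.christoffel_I (hG : IsHolKahlerAt G u) :
    ∀ᶠ u' in 𝓝 u, ∀ v w,
      christoffel G u' (Complex.I • v) w = Complex.I • christoffel G u' v w := by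
  filter_upwards [hG.herm, hG.fderiv_herm, hG.closed, hG.eventually] with y h1 h2 h3 h4 v w
  obtain ⟨h4, -, h5⟩ := h4
  refine h4.ext fun k => ?_
  have e0 : G y (Complex.I • christoffel G y v w) k
      = - G y (christoffel G y v w) (Complex.I • k) := by
    rw [← h1 (Complex.I • christoffel G y v w) k, I_smul_I_smul, map_neg]
    rfl
  rw [e0, h4.apply_christoffel, h4.apply_christoffel]
  have hI : ∀ x v w, fderiv ℝ G y x v (Complex.I • w) = - fderiv ℝ G y x (Complex.I • v) w := by
    intro x v w
    rw [← h2 x v (Complex.I • w), I_smul_I_smul, map_neg]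
  have c1 := h3 v w k
  have c2 := h3 (Complex.I • v) w (Complex.I • k)
  rw [I_smul_I_smul, I_smul_I_smul, h2 (Complex.I • v) w k, map_neg, map_neg, neg_apply,
    neg_apply] at c2
  rw [hI v w k, hI w v k]
  rw [h5 w (Complex.I • k) v, hI w v k] at c1
  rw [h5 w k (Complex.I • v)] at c2
  linarith

variable [FiniteDimensional ℝ V]

theorem trace_eq_zero_of_anticommute {T : V →ₗ[ℝ] V}
    (h : ∀ v, T (Complex.I • v) = - (Complex.I • T v)) : LinearMap.trace ℝ V T = 0 := by
  have h1 : LinearMap.trace ℝ V ((mulI V).toLinearMap ∘ₗ (T ∘ₗ (mulI V).toLinearMap))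
      = LinearMap.trace ℝ V ((T ∘ₗ (mulI V).toLinearMap) ∘ₗ (mulI V).toLinearMap) :=
    LinearMap.trace_comp_comm' _ _
  have h2 : (mulI V).toLinearMap ∘ₗ (T ∘ₗ (mulI V).toLinearMap) = T := by
    ext v
    change Complex.I • T (Complex.I • v) = T v
    rw [h, smul_neg, I_smul_I_smul, neg_neg]
  have h3 : (T ∘ₗ (mulI V).toLinearMap) ∘ₗ (mulI V).toLinearMap = -T := by
    ext v
    change T (Complex.I • Complex.I • v) = - T v
    rw [I_smul_I_smul, map_neg]
  rw [h2, h3, map_neg] at h1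
  linarith

theorem metricTrace_add (g : V →L[ℝ] V →L[ℝ] ℝ) (B C : V →ₗ[ℝ] V →ₗ[ℝ] ℝ) :
    metricTrace g (B + C) = metricTrace g B + metricTrace g C := by
  simp only [metricTrace]
  rw [← map_add]
  congr 1
  ext v
  simp

theorem metricTrace_smul (g : V →L[ℝ] V →L[ℝ] ℝ) (c : ℝ) (B : V →ₗ[ℝ] V →ₗ[ℝ] ℝ) :
    metricTrace g (c • B) = c * metricTrace g B := by
  simp only [metricTrace]
  rw [← smul_eq_mul, ← map_smul]
  congr 1
  ext v
  simp

theorem metricTrace_sum {κ : Type*} (s : Finset κ) (g : V →L[ℝ] V →L[ℝ] ℝ)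
    (B : κ → V →ₗ[ℝ] V →ₗ[ℝ] ℝ) :
    metricTrace g (∑ a ∈ s, B a) = ∑ a ∈ s, metricTrace g (B a) := by
  classical
  induction s using Finset.induction_on with
  | empty =>
    simp only [Finset.sum_empty]
    have := metricTrace_smul g 0 (0 : V →ₗ[ℝ] V →ₗ[ℝ] ℝ)
    simpa using this
  | insert a s ha ih => rw [Finset.sum_insert ha, Finset.sum_insert ha, metricTrace_add, ih]

/-- The metric trace of a form which changes sign under the complex structure vanishes. -/
theorem metricTrace_eq_zero_of_anti {g : V →L[ℝ] V →L[ℝ] ℝ} (hg : IsNondegSymm g)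
    (hI : ∀ v w, g (Complex.I • v) (Complex.I • w) = g v w) {B : V →ₗ[ℝ] V →ₗ[ℝ] ℝ}
    (hB : ∀ v w, B (Complex.I • v) (Complex.I • w) = - B v w) : metricTrace g B = 0 := by
  refine trace_eq_zero_of_anticommute fun v => ?_
  have key : ∀ v k, g (g.inverse (LinearMap.toContinuousLinearMap (B v))) k = B v k := by
    intro v k
    rw [hg.apply_inverse]
    rfl
  refine hg.ext fun k => ?_
  change g (g.inverse (LinearMap.toContinuousLinearMap (B (Complex.I • v)))) k
    = g (-(Complex.I • g.inverse (LinearMap.toContinuousLinearMap (B v)))) k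
  rw [key, map_neg, neg_apply, ← hI (Complex.I • _) k, I_smul_I_smul, map_neg, neg_apply, key,
    neg_neg, ← neg_neg (B v (Complex.I • k)), ← hB, I_smul_I_smul, map_neg, neg_neg]

/-- The metric trace of an alternating form vanishes. -/
theorem metricTrace_eq_zero_of_skew {g : V →L[ℝ] V →L[ℝ] ℝ} (hg : IsNondegSymm g)
    {B : V →ₗ[ℝ] V →ₗ[ℝ] ℝ} (hB : ∀ v w, B v w = - B w v) : metricTrace g B = 0 := by
  have key : ∀ C : V →ₗ[ℝ] V →ₗ[ℝ] ℝ, metricTrace g C = ∑ i, ∑ j,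
      coord V j (g.inverse (coord V i)) * C (Module.finBasis ℝ V i) (Module.finBasis ℝ V j) := by
    intro C
    rw [← hg.sum_eq_metricTrace]
    refine Finset.sum_congr rfl fun i _ => ?_
    have h := congrArg (C (Module.finBasis ℝ V i))
      ((Module.finBasis ℝ V).sum_repr (g.inverse (coord V i)))
    rw [← h, map_sum]
    refine Finset.sum_congr rfl fun j _ => ?_
    rw [map_smul, smul_eq_mul]
    rfl
  have h1 : metricTrace g B = - metricTrace g B := by
    conv_rhs => rw [key, Finset.sum_comm]
    rw [key, ← Finset.sum_neg_distrib]
    refine Finset.sum_congr rfl fun i _ => ?_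
    rw [← Finset.sum_neg_distrib]
    refine Finset.sum_congr rfl fun j _ => ?_
    rw [hg.inverse_symm (coord V i), hB]
    ring
  linarith

/-- The 1-form `X ↦ tr Γ(X, ·)`. -/
def chrTrace (G : V → V →L[ℝ] V →L[ℝ] ℝ) (u : V) : V →L[ℝ] ℝ :=
  (LinearMap.toContinuousLinearMap (LinearMap.trace ℝ V ∘ₗ ContinuousLinearMap.coeLM ℝ)).comp
    (chr G u)

theorem chrTrace_apply (G : V → V →L[ℝ] V →L[ℝ] ℝ) (u v : V) :
    chrTrace G u v = LinearMap.trace ℝ V (chr G u v).toLinearMap := rfl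

theorem IsMetricAt.fderiv_chrTrace (hG : IsMetricAt G u) (v w : V) :
    fderiv ℝ (chrTrace G) u v w = LinearMap.trace ℝ V (fderiv ℝ (chr G) u v w).toLinearMap := by
  have hd := hG.contDiffAt_chr.differentiableAt (by simp)
  have : HasFDerivAt (chrTrace G) _ u := (hasFDerivAt_const _ u).clm_comp hd.hasFDerivAt
  rw [this.fderiv]
  simp [LinearMap.toContinuousLinearMap]

/-- A bilinear map from a bounded bilinear map. -/
abbrev toBilin (B : V →L[ℝ] V →L[ℝ] ℝ) : V →ₗ[ℝ] V →ₗ[ℝ] ℝ :=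
  ContinuousLinearMap.coeLM ℝ ∘ₗ B.toLinearMap

theorem IsHolKahlerAt.fderiv_chr (hG : IsHolKahlerAt G u) (x v w : V) :
    fderiv ℝ (chr G) u x v w = fderiv ℝ (chr G) u x w v ∧
    fderiv ℝ (chr G) u x (Complex.I • v) w = Complex.I • fderiv ℝ (chr G) u x v w := by
  have hd := hG.contDiffAt_chr.differentiableAt (by simp)
  have hd2 : DifferentiableAt ℝ (fun u' => chr G u' v w) u :=
    (hd.clm_apply (differentiableAt_const v)).clm_apply (differentiableAt_const w)
  constructor
  · rw [← fderiv_apply_const₂ hd, ← fderiv_apply_const₂ hd]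
    have : (fun u' => chr G u' v w) =ᶠ[𝓝 u] fun u' => chr G u' w v := by
      filter_upwards [hG.christoffel_symm] with u' hu' using hu' v w
    rw [this.fderiv_eq]
  · rw [← fderiv_apply_const₂ hd, ← fderiv_apply_const₂ hd]
    have : (fun u' => chr G u' (Complex.I • v) w)
        =ᶠ[𝓝 u] fun u' => mulI V (chr G u' v w) := by
      filter_upwards [hG.christoffel_I] with u' hu' using hu' v w
    rw [this.fderiv_eq]
    have e := ((mulI V).hasFDerivAt.comp u hd2.hasFDerivAt).fderiv
    exact DFunLike.congr_fun e x

/-- The scalar curvature of a Kähler metric in holomorphic coordinates. -/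
theorem IsHolKahlerAt.scal_eq (hG : IsHolKahlerAt G u) :
    scal G u = - metricTrace (G u) (toBilin (fderiv ℝ (chrTrace G) u)) := by
  have hn := hG.nondeg.self_of_nhds
  rw [hG.toIsMetricAt.scal_eq, ← sub_eq_zero, sub_neg_eq_add, ← metricTrace_add]
  refine metricTrace_eq_zero_of_anti hn hG.herm.self_of_nhds fun w k => ?_
  have hs := hG.christoffel_symm.self_of_nhds
  have hI := hG.christoffel_I.self_of_nhds
  have hI' : ∀ v w, chr G u v (Complex.I • w) = Complex.I • chr G u v w := fun v w => by
    rw [chr_apply, hs, hI, hs]; rfl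
  have hI0 : ∀ v w, chr G u (Complex.I • v) w = Complex.I • chr G u v w := hI
  have hD := hG.fderiv_chr
  have hD' : ∀ x v w, fderiv ℝ (chr G) u x v (Complex.I • w)
      = Complex.I • fderiv ℝ (chr G) u x v w := fun x v w => by
    rw [(hD x v _).1, (hD x w v).2, (hD x v w).1]
  have key : ∀ w k, (ricciMap G u + toBilin (fderiv ℝ (chrTrace G) u)) w k
      = LinearMap.trace ℝ V (((fderiv ℝ (chr G) u).flip w).flip k).toLinearMap
        + LinearMap.trace ℝ V ((chr G u).flip (chr G u w k)).toLinearMap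
        - LinearMap.trace ℝ V ((chr G u w).comp ((chr G u).flip k)).toLinearMap := by
    intro w k
    change ricciMap G u w k + fderiv ℝ (chrTrace G) u w k = _
    rw [hG.fderiv_chrTrace, ricciMap_apply, ← map_add, ← map_add, ← map_sub]
    congr 1
    ext v
    simp [riemannMap]
    rw [(hD w k v).1]
    abel
  have e1 : ((fderiv ℝ (chr G) u).flip (Complex.I • w)).flip (Complex.I • k)
      = -((fderiv ℝ (chr G) u).flip w).flip k := by
    ext v
    simp [(hD v w _).2, hD', I_smul_I_smul]
  have e2 : chr G u (Complex.I • w) (Complex.I • k) = - chr G u w k := by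
    rw [hI', hI0, I_smul_I_smul]
  have e3 : (chr G u (Complex.I • w)).comp ((chr G u).flip (Complex.I • k))
      = - (chr G u w).comp ((chr G u).flip k) := by
    ext v
    simp [hI', hI0, I_smul_I_smul]
  rw [key, key, e1, e2, e3]
  simp only [map_neg, ContinuousLinearMap.toLinearMap_neg]
  ring

/-- The Christoffel symbols of a Kähler metric in holomorphic coordinates are trace free, so that
the Laplacian is computed from the second derivatives. -/
theorem IsHolKahlerAt.laplacian_eq (hG : IsHolKahlerAt G u) (f : V → ℝ) :
    laplacian G f u = - metricTrace (G u) (toBilin (fderiv ℝ (fderiv ℝ f) u)) := by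
  have hn := hG.nondeg.self_of_nhds
  rw [hG.toIsMetricAt.laplacian_eq, neg_inj, ← sub_eq_zero, sub_eq_add_neg]
  have : -metricTrace (G u) (toBilin (fderiv ℝ (fderiv ℝ f) u))
      = metricTrace (G u) ((-1 : ℝ) • toBilin (fderiv ℝ (fderiv ℝ f) u)) := by
    rw [metricTrace_smul, neg_one_mul]
  rw [this, ← metricTrace_add]
  refine metricTrace_eq_zero_of_anti hn hG.herm.self_of_nhds fun v w => ?_
  have hs := hG.christoffel_symm.self_of_nhds
  have hI := hG.christoffel_I.self_of_nhds
  have e2 : christoffel G u (Complex.I • v) (Complex.I • w) = - christoffel G u v w := by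
    rw [hI, hs, hI, hs, I_smul_I_smul]
  simp [hessianMap_apply, hessian, e2]

/-- The trace of the Christoffel symbols is half the logarithmic derivative of the volume. -/
theorem IsMetricAt.chrTrace_eq (hG : IsMetricAt G u) (v : V) :
    chrTrace G u v = (1 / 2) * metricTrace (G u) (toBilin (fderiv ℝ G u v)) := by
  have hn := hG.nondeg.self_of_nhds
  let C : V →ₗ[ℝ] V →ₗ[ℝ] ℝ := toBilin ((fderiv ℝ G u).flip v - ((fderiv ℝ G u).flip v).flip)
  have hC : metricTrace (G u) C = 0 := by
    refine metricTrace_eq_zero_of_skew hn fun w k => ?_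
    simp [C]
  have h1 : (1 / 2) * metricTrace (G u) (toBilin (fderiv ℝ G u v))
      = metricTrace (G u) ((1 / 2 : ℝ) • (toBilin (fderiv ℝ G u v) + C)) := by
    rw [metricTrace_smul, metricTrace_add, hC, add_zero]
  rw [h1, chrTrace_apply, metricTrace]
  congr 1
  ext w
  refine hn.ext fun k => ?_
  change G u (christoffel G u v w) k = G u ((G u).inverse _) k
  rw [hn.apply_inverse, hn.apply_christoffel]
  simp [C]
  ring

end Hermitian

/-! ### Local isometries from holomorphic Kähler metrics -/

section Transfer

variable {V V' : Type*} [NormedAddCommGroup V] [NormedSpace ℝ V] [NormedAddCommGroup V']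
  [NormedSpace ℝ V'] [NormedSpace ℂ V'] [IsScalarTower ℝ ℂ V'] [FiniteDimensional ℝ V]
  [FiniteDimensional ℝ V'] {δ : V' → V} {G' : V' → V' →L[ℝ] V' →L[ℝ] ℝ}
  {G W : V → V →L[ℝ] V →L[ℝ] ℝ} {u : V'}

namespace IsLocalIsometryAt

theorem complexStr_eq (h : IsLocalIsometryAt δ G' G u)
    (hW : ∀ᶠ u' in 𝓝 u, ∀ v w,
      W (δ u') (fderiv ℝ δ u' v) (fderiv ℝ δ u' w) = G' u' (Complex.I • v) w) :
    ∀ᶠ u' in 𝓝 u, ∀ v,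
      complexStr G W (δ u') (fderiv ℝ δ u' v) = fderiv ℝ δ u' (Complex.I • v) := by
  filter_upwards [hW, h.pull, h.smooth.continuousAt.eventually h.target.nondeg,
    isInvertible_eventually h.smooth h.inv] with y h1 h2 h3 h4 v
  refine h3.ext fun k => ?_
  obtain ⟨k, rfl⟩ := h4.surjective k
  rw [← h2, ← h1, complexStr, ContinuousLinearMap.comp_apply, h3.apply_inverse]

theorem isKahlerAt (h : IsLocalIsometryAt δ G' G u) (hK : IsHolKahlerAt G' u)
    (hpos : ∀ v, v ≠ 0 → 0 < G' u v v) (hWs : ContDiffAt ℝ ∞ W (δ u))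
    (hW : ∀ᶠ u' in 𝓝 u, ∀ v w,
      W (δ u') (fderiv ℝ δ u' v) (fderiv ℝ δ u' w) = G' u' (Complex.I • v) w) :
    IsKahlerAt G W (δ u) := by
  have hp := h.pull.self_of_nhds
  have hs := hK.nondeg.self_of_nhds.symm
  have hI := hK.herm.self_of_nhds
  have hJ := h.complexStr_eq hW
  have hδ2 : ContDiffAt ℝ 2 δ u := h.smooth.of_le (by norm_cast)
  have hskew : ∀ v w, W (δ u) (fderiv ℝ δ u v) (fderiv ℝ δ u w)
      = - W (δ u) (fderiv ℝ δ u w) (fderiv ℝ δ u v) := by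
    intro v w
    rw [hW.self_of_nhds, hW.self_of_nhds, ← hI (Complex.I • v), I_smul_I_smul, map_neg, neg_apply,
      hs]
  refine ⟨h.target.smooth, hWs, h.target.nondeg.self_of_nhds.symm, fun v hv => ?_, fun v => ?_,
    fun v w k => ?_, fun v => ?_, fun v w => ?_⟩
  · obtain ⟨v, rfl⟩ := h.inv.surjective v
    rw [← hp]
    exact hpos v fun h0 => hv (by rw [h0, map_zero])
  · obtain ⟨v, rfl⟩ := h.inv.surjective v
    linarith [hskew v v]
  · obtain ⟨v, rfl⟩ := h.inv.surjective v
    obtain ⟨w, rfl⟩ := h.inv.surjective w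
    obtain ⟨k, rfl⟩ := h.inv.surjective k
    have hd := h.source.smooth.differentiableAt (by simp)
    have e1 : HasFDerivAt (fun u' => (G' u').comp (mulI V')) _ u :=
      hd.hasFDerivAt.clm_comp (hasFDerivAt_const _ u)
    have e2 : ∀ v w k, fderiv ℝ (fun u' => (G' u').comp (mulI V')) u v w k
        = fderiv ℝ G' u v (Complex.I • w) k := by
      intro v w k
      rw [e1.fderiv]
      simp
    have e3 := fderiv_pullback (T' := fun u' => (G' u').comp (mulI V')) hδ2
      (hWs.differentiableAt (by simp)) e1.differentiableAt
      (by filter_upwards [hW] with u' hu' v w using (hu' v w).symm)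
    have e4 := hK.closed.self_of_nhds v w k
    obtain ⟨a, ha⟩ := h.inv.surjective (fderiv ℝ (fderiv ℝ δ) u v w)
    obtain ⟨b, hb⟩ := h.inv.surjective (fderiv ℝ (fderiv ℝ δ) u v k)
    obtain ⟨c, hc⟩ := h.inv.surjective (fderiv ℝ (fderiv ℝ δ) u w k)
    rw [← e2, ← e2, ← e2, e3, e3, e3, snd_fderiv_symm hδ2 w v, snd_fderiv_symm hδ2 k v,
      snd_fderiv_symm hδ2 k w, ← ha, ← hb, ← hc] at e4
    rw [hskew w b, hskew k a, hskew v c] at e4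
    linarith
  · obtain ⟨v, rfl⟩ := h.inv.surjective v
    rw [hJ.self_of_nhds, hJ.self_of_nhds, I_smul_I_smul, map_neg]
  · obtain ⟨v, rfl⟩ := h.inv.surjective v
    obtain ⟨w, rfl⟩ := h.inv.surjective w
    have dJ : DifferentiableAt ℝ (complexStr G W) (δ u) :=
      ((h.target.contDiffAt_inverse.clm_comp hWs).differentiableAt (by simp))
    have dD : DifferentiableAt ℝ (fderiv ℝ δ) u :=
      (h.smooth.fderiv_right (m := ∞) (by simp)).differentiableAt (by simp)
    have dδ := h.smooth.differentiableAt (by simp)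
    have key : ∀ x w, fderiv ℝ (complexStr G W) (δ u) (fderiv ℝ δ u x) (fderiv ℝ δ u w)
        = fderiv ℝ (fderiv ℝ δ) u x (Complex.I • w)
          - complexStr G W (δ u) (fderiv ℝ (fderiv ℝ δ) u x w) := by
      intro x w
      have e1 := (dJ.hasFDerivAt.comp u dδ.hasFDerivAt).clm_apply
        (dD.hasFDerivAt.clm_apply (hasFDerivAt_const w u))
      have e2 := dD.hasFDerivAt.clm_apply (hasFDerivAt_const (Complex.I • w) u)
      have e3 : (fun u' => complexStr G W (δ u') (fderiv ℝ δ u' w))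
          =ᶠ[𝓝 u] fun u' => fderiv ℝ δ u' (Complex.I • w) := by
        filter_upwards [hJ] with u' hu' using hu' w
      have e4 := e1.fderiv.symm.trans (e3.fderiv_eq.trans e2.fderiv)
      have e5 := DFunLike.congr_fun e4 x
      simp at e5
      rw [← e5]
      abel
    have hJ0 := hJ.self_of_nhds
    have hJJ : ∀ v, complexStr G W (δ u) (complexStr G W (δ u) v) = -v := by
      intro v
      obtain ⟨v, rfl⟩ := h.inv.surjective v
      rw [hJ0, hJ0, I_smul_I_smul, map_neg]
    rw [nijenhuis, hJ0, hJ0, key, key, key, key, snd_fderiv_symm hδ2 (Complex.I • w) (Complex.I • v),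
      map_sub, map_sub, hJJ, hJJ, snd_fderiv_symm hδ2 (Complex.I • v) w,
      snd_fderiv_symm hδ2 (Complex.I • w) v, snd_fderiv_symm hδ2 w v]
    abel

theorem isKillingPotentialAt (h : IsLocalIsometryAt δ G' G u)
    (hWs : ContDiffAt ℝ ∞ W (δ u))
    (hW : ∀ᶠ u' in 𝓝 u, ∀ v w,
      W (δ u') (fderiv ℝ δ u' v) (fderiv ℝ δ u' w) = G' u' (Complex.I • v) w)
    {f : V → ℝ} (hf : ContDiffAt ℝ ∞ f (δ u)) {e : V'}
    (hgrad : ∀ᶠ u' in 𝓝 u, ∀ k, fderiv ℝ (f ∘ δ) u' k = G' u' e k)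
    (hinv : fderiv ℝ G' u (Complex.I • e) = 0) : IsKillingPotentialAt G W f (δ u) := by
  have hδ2 : ContDiffAt ℝ 2 δ u := h.smooth.of_le (by norm_cast)
  have dD : DifferentiableAt ℝ (fderiv ℝ δ) u :=
    (h.smooth.fderiv_right (m := ∞) (by simp)).differentiableAt (by simp)
  have dδ := h.smooth.differentiableAt (by simp)
  unfold IsKillingPotentialAt
  intro X
  have hX : ∀ᶠ u' in 𝓝 u, X (δ u') = fderiv ℝ δ u' (Complex.I • e) := by
    filter_upwards [h.complexStr_eq hW, h.fderiv_comp hf, hgrad, h.pull,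
      h.smooth.continuousAt.eventually h.target.nondeg, isInvertible_eventually h.smooth h.inv]
      with y h1 h2 h3 h4 h5 h6
    rw [← h1]
    change complexStr G W (δ y) (sharp G (δ y) (fderiv ℝ f (δ y))) = _
    congr 1
    refine h5.ext fun k => ?_
    obtain ⟨k, rfl⟩ := h6.surjective k
    rw [← h4, ← h3, h2, sharp, h5.apply_inverse]
    rfl
  have dX : DifferentiableAt ℝ X (δ u) := by
    have h1 := h.target.contDiffAt_inverse
    have h2 : ContDiffAt ℝ ∞ (fderiv ℝ f) (δ u) := hf.fderiv_right (m := ∞) (by simp)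
    exact ((h1.clm_comp hWs).clm_apply (h1.clm_apply h2)).differentiableAt (by simp)
  have hdX : ∀ v, fderiv ℝ X (δ u) (fderiv ℝ δ u v)
      = fderiv ℝ (fderiv ℝ δ) u v (Complex.I • e) := by
    intro v
    have e1 := (dX.hasFDerivAt.comp u dδ.hasFDerivAt).fderiv
    have e2 := (dD.hasFDerivAt.clm_apply (hasFDerivAt_const (Complex.I • e) u)).fderiv
    have e3 := e1.symm.trans ((Filter.EventuallyEq.fderiv_eq hX).trans e2)
    have e5 := DFunLike.congr_fun e3 v
    simpa using e5
  intro v w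
  obtain ⟨v, rfl⟩ := h.inv.surjective v
  obtain ⟨w, rfl⟩ := h.inv.surjective w
  have e3 := fderiv_pullback hδ2 (h.target.smooth.differentiableAt (by simp))
    (h.source.smooth.differentiableAt (by simp)) h.pull (Complex.I • e) v w
  rw [hinv] at e3
  rw [hX.self_of_nhds, hdX, hdX, snd_fderiv_symm hδ2 v, snd_fderiv_symm hδ2 w]
  exact e3.symm

end IsLocalIsometryAt

end Transfer

/-! ### Metric traces and orthogonal projections -/

section Projection

variable {V U : Type*} [NormedAddCommGroup V] [NormedSpace ℝ V] [FiniteDimensional ℝ V]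
  [NormedAddCommGroup U] [NormedSpace ℝ U] [FiniteDimensional ℝ U]

/-- The metric trace of a form pulled back by an orthogonal projection. -/
theorem metricTrace_pullback {g : V →L[ℝ] V →L[ℝ] ℝ} (hg : IsNondegSymm g)
    {γ : U →L[ℝ] U →L[ℝ] ℝ} (hγ : IsNondegSymm γ) {c : ℝ} (hc : c ≠ 0)
    (pr : V →ₗ[ℝ] U) (σ : U →ₗ[ℝ] V) (hσ : ∀ y, pr (σ y) = y)
    (hG : ∀ y w, g (σ y) w = c * γ y (pr w)) (B : V →ₗ[ℝ] V →ₗ[ℝ] ℝ) (b : U →ₗ[ℝ] U →ₗ[ℝ] ℝ)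
    (hB : ∀ v w, B v w = b (pr v) (pr w)) :
    metricTrace g B = c⁻¹ * metricTrace γ b := by
  let T : U →ₗ[ℝ] U :=
    γ.inverse.toLinearMap ∘ₗ LinearMap.toContinuousLinearMap.toLinearMap ∘ₗ b
  have h1 : g.inverse.toLinearMap ∘ₗ LinearMap.toContinuousLinearMap.toLinearMap ∘ₗ B
      = c⁻¹ • (σ ∘ₗ (T ∘ₗ pr)) := by
    ext v
    refine hg.ext fun k => ?_
    change g (g.inverse (LinearMap.toContinuousLinearMap (B v))) k
      = g (c⁻¹ • σ (γ.inverse (LinearMap.toContinuousLinearMap (b (pr v))))) k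
    rw [hg.apply_inverse, map_smul, smul_apply, hG, hγ.apply_inverse, smul_eq_mul,
      inv_mul_cancel_left₀ hc]
    exact hB v k
  rw [metricTrace, h1, map_smul, LinearMap.trace_comp_comm', smul_eq_mul]
  congr 1
  rw [metricTrace]
  congr 1
  ext y
  change T (pr (σ y)) = T y
  rw [hσ]

/-- The metric trace of a product of two covectors. -/
theorem metricTrace_smulRight (g : V →L[ℝ] V →L[ℝ] ℝ) (α β : V →L[ℝ] ℝ)
    (B : V →ₗ[ℝ] V →ₗ[ℝ] ℝ) (hB : ∀ v w, B v w = α v * β w) :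
    metricTrace g B = α (g.inverse β) := by
  have : g.inverse.toLinearMap ∘ₗ LinearMap.toContinuousLinearMap.toLinearMap ∘ₗ B
      = α.toLinearMap.smulRight (g.inverse β) := by
    ext v
    change g.inverse (LinearMap.toContinuousLinearMap (B v)) = α v • g.inverse β
    rw [← map_smul]
    congr 1
    ext w
    exact hB v w
  rw [metricTrace, this, LinearMap.trace_smulRight]
  rfl

end Projection

end LocalGeometry

namespace LocalGeometry

section Apply

variable {D E F H : Type*} [NormedAddCommGroup D] [NormedSpace ℝ D]
  [NormedAddCommGroup E] [NormedSpace ℝ E] [FiniteDimensional ℝ E]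
  [NormedAddCommGroup F] [NormedSpace ℝ F] [FiniteDimensional ℝ F]
  [NormedAddCommGroup H] [NormedSpace ℝ H]

theorem contDiffAt_clm_apply_iff {n : ℕ∞ω} {f : D → E →L[ℝ] H} {x : D} :
    ContDiffAt ℝ n f x ↔ ∀ y, ContDiffAt ℝ n (fun x => f x y) x := by
  refine ⟨fun h y => h.clm_apply contDiffAt_const, fun h => ?_⟩
  let d := Module.finrank ℝ E
  have hd : d = Module.finrank ℝ (Fin d → ℝ) := (Module.finrank_fin_fun ℝ).symm
  let e₁ := ContinuousLinearEquiv.ofFinrankEq hd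
  let e₂ := (e₁.arrowCongr (1 : H ≃L[ℝ] H)).trans (ContinuousLinearEquiv.piRing (Fin d))
  rw [← Function.id_comp f, ← e₂.symm_comp_self]
  exact e₂.symm.contDiff.contDiffAt.comp x (contDiffAt_pi.mpr fun i => h _)

theorem contDiffAt_clm_apply₂_iff {n : ℕ∞ω} {f : D → E →L[ℝ] F →L[ℝ] H} {x : D} :
    ContDiffAt ℝ n f x ↔ ∀ y z, ContDiffAt ℝ n (fun x => f x y z) x := by
  rw [contDiffAt_clm_apply_iff]
  exact forall_congr' fun y => contDiffAt_clm_apply_iff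

end Apply

/-! ### The momentum construction over a product of Kähler metrics -/

/-- The data of the momentum construction on `(Π a, B a) × ℂ`. -/
structure Calabi {κ : Type*} [Fintype κ] (B : κ → Type*) [∀ a, NormedAddCommGroup (B a)]
    [∀ a, NormedSpace ℝ (B a)] where
  γ : ∀ a, B a → B a →L[ℝ] B a →L[ℝ] ℝ
  k : κ → ℝ
  h : (∀ a, B a) → ℝ
  Z : ℝ → ℝ
  Θ : ℝ → ℝ

namespace Calabi

variable {κ : Type*} [Fintype κ] {B : κ → Type*} [∀ a, NormedAddCommGroup (B a)]
  [∀ a, NormedSpace ℝ (B a)] [∀ a, NormedSpace ℂ (B a)] [∀ a, IsScalarTower ℝ ℂ (B a)]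
  [∀ a, FiniteDimensional ℝ (B a)] (C : Calabi B)

/-- The logarithm of the norm in the fibre. -/
def u (n : (∀ a, B a) × ℂ) : ℝ := C.h n.1 + n.2.re

/-- The momentum. -/
def z (n : (∀ a, B a) × ℂ) : ℝ := C.Z (C.u n)

variable (B) in
/-- The projection to a factor. -/
def pr (a : κ) : ((∀ a, B a) × ℂ) →L[ℝ] B a :=
  (ContinuousLinearMap.proj a).comp (ContinuousLinearMap.fst ℝ _ _)

@[simp] theorem pr_apply (a : κ) (n : (∀ a, B a) × ℂ) : pr B a n = n.1 a := rfl

/-- The differential of `u`. -/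
def du (n : (∀ a, B a) × ℂ) : ((∀ a, B a) × ℂ) →L[ℝ] ℝ :=
  (fderiv ℝ C.h n.1).comp (ContinuousLinearMap.fst ℝ _ _)
    + Complex.reCLM.comp (ContinuousLinearMap.snd ℝ _ _)

theorem du_apply (n v : (∀ a, B a) × ℂ) : C.du n v = fderiv ℝ C.h n.1 v.1 + v.2.re := rfl

/-- The metric. -/
def G (n : (∀ a, B a) × ℂ) : ((∀ a, B a) × ℂ) →L[ℝ] ((∀ a, B a) × ℂ) →L[ℝ] ℝ :=
  (∑ a, (C.z n + C.k a) • (C.γ a (n.1 a)).bilinearComp (pr B a) (pr B a))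
    + C.Θ (C.z n) • ((C.du n).smulRight (C.du n)
      + ((C.du n).comp (mulI _)).smulRight ((C.du n).comp (mulI _)))

theorem G_apply (n v w : (∀ a, B a) × ℂ) :
    C.G n v w = (∑ a, (C.z n + C.k a) * C.γ a (n.1 a) (v.1 a) (w.1 a))
      + C.Θ (C.z n) * (C.du n v * C.du n w
        + C.du n (Complex.I • v) * C.du n (Complex.I • w)) := by
  simp [G, mul_add]

/-- The conditions at a point under which the metric is Kähler. -/
structure Good (n : (∀ a, B a) × ℂ) : Prop where
  diff : ∀ a, DifferentiableAt ℝ (C.γ a) (n.1 a)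
  nondeg : ∀ a, IsNondegSymm (C.γ a (n.1 a))
  herm : ∀ a v w, C.γ a (n.1 a) (Complex.I • v) (Complex.I • w) = C.γ a (n.1 a) v w
  closed : ∀ a v w k, fderiv ℝ (C.γ a) (n.1 a) v (Complex.I • w) k
    + fderiv ℝ (C.γ a) (n.1 a) w (Complex.I • k) v
    + fderiv ℝ (C.γ a) (n.1 a) k (Complex.I • v) w = 0
  h_smooth : ContDiffAt ℝ 2 C.h n.1
  h_ddc : ∀ Y Y' : ∀ a, B a, fderiv ℝ (fderiv ℝ C.h) n.1 Y' (Complex.I • Y)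
    - fderiv ℝ (fderiv ℝ C.h) n.1 Y (Complex.I • Y')
    = ∑ a, C.γ a (n.1 a) (Complex.I • Y a) (Y' a)
  Z_deriv : HasDerivAt C.Z (C.Θ (C.z n)) (C.u n)
  Θ_diff : DifferentiableAt ℝ C.Θ (C.z n)
  Θ_pos : 0 < C.Θ (C.z n)
  k_ne : ∀ a, C.z n + C.k a ≠ 0

/-- The conditions on the data near a point. -/
structure Regular (n : (∀ a, B a) × ℂ) : Prop where
  kahler : ∀ a, IsHolKahlerAt (C.γ a) (n.1 a)
  h_smooth : ContDiffAt ℝ ∞ C.h n.1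
  h_ddc : ∀ᶠ y in 𝓝 n.1, ∀ Y Y' : ∀ a, B a, fderiv ℝ (fderiv ℝ C.h) y Y' (Complex.I • Y)
    - fderiv ℝ (fderiv ℝ C.h) y Y (Complex.I • Y') = ∑ a, C.γ a (y a) (Complex.I • Y a) (Y' a)
  Z_smooth : ContDiffAt ℝ ∞ C.Z (C.u n)
  Z_deriv : ∀ᶠ t in 𝓝 (C.u n), HasDerivAt C.Z (C.Θ (C.Z t)) t
  Θ_smooth : ContDiffAt ℝ ∞ C.Θ (C.z n)
  Θ_pos : 0 < C.Θ (C.z n)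
  k_ne : ∀ a, C.z n + C.k a ≠ 0

variable {C} {n : (∀ a, B a) × ℂ}

theorem Regular.contDiffAt_u (hC : C.Regular n) : ContDiffAt ℝ ∞ C.u n :=
  (hC.h_smooth.comp n contDiffAt_fst).add (Complex.reCLM.contDiff.contDiffAt.comp n contDiffAt_snd)

theorem Regular.contDiffAt_z (hC : C.Regular n) : ContDiffAt ℝ ∞ C.z n :=
  hC.Z_smooth.comp n hC.contDiffAt_u

theorem Regular.contDiffAt_du (hC : C.Regular n) : ContDiffAt ℝ ∞ C.du n := by
  have h1 : ContDiffAt ℝ ∞ (fderiv ℝ C.h) n.1 := hC.h_smooth.fderiv_right (m := ∞) (by simp)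
  exact ((h1.comp n contDiffAt_fst).clm_comp contDiffAt_const).add contDiffAt_const

theorem Regular.contDiffAt_G (hC : C.Regular n) : ContDiffAt ℝ ∞ C.G n := by
  rw [contDiffAt_clm_apply₂_iff]
  intro v w
  simp only [G_apply]
  have h1 := hC.contDiffAt_du
  have h2 := hC.contDiffAt_z
  have h3 : ContDiffAt ℝ ∞ (fun n => C.Θ (C.z n)) n := hC.Θ_smooth.comp n h2
  have h4 : ∀ a, ContDiffAt ℝ ∞ (fun n : (∀ a, B a) × ℂ => C.γ a (n.1 a)) n := fun a =>
    (hC.kahler a).smooth.comp n (pr B a).contDiff.contDiffAt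
  have h5 : ∀ v, ContDiffAt ℝ ∞ (fun n => C.du n v) n := fun v => h1.clm_apply contDiffAt_const
  refine (ContDiffAt.sum fun a _ => (h2.add contDiffAt_const).mul
    (((h4 a).clm_apply contDiffAt_const).clm_apply contDiffAt_const)).add
    (h3.mul (((h5 v).mul (h5 w)).add ((h5 _).mul (h5 _))))

theorem Regular.eventually_good (hC : C.Regular n) : ∀ᶠ n' in 𝓝 n, C.Good n' := by
  have hu := hC.contDiffAt_u.continuousAt
  have hz := hC.contDiffAt_z.continuousAt
  have hp : ∀ a, ContinuousAt (fun n : (∀ a, B a) × ℂ => n.1 a) n := fun a =>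
    (pr B a).continuous.continuousAt
  have e1 : ∀ᶠ n' in 𝓝 n, ∀ a, DifferentiableAt ℝ (C.γ a) (n'.1 a)
      ∧ IsNondegSymm (C.γ a (n'.1 a)) :=
    Filter.eventually_all.2 fun a => by
      have h1 := (hC.kahler a).eventually.mono fun y hy =>
        And.intro (hy.2.1.differentiableAt (by simp)) hy.1
      exact (hp a).eventually h1
  have e2 := Filter.eventually_all.2 fun a => (hp a).eventually (hC.kahler a).herm
  have e3 := Filter.eventually_all.2 fun a => (hp a).eventually (hC.kahler a).closed
  have hf : ContinuousAt (fun n : (∀ a, B a) × ℂ => n.1) n := continuous_fst.continuousAt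
  have e4 := hf.eventually (eventually_contDiffAt_two hC.h_smooth)
  have e5 := hf.eventually hC.h_ddc
  have e6 := hu.eventually hC.Z_deriv
  have e7 := hz.eventually (eventually_contDiffAt_two hC.Θ_smooth)
  have e8 := (hC.Θ_smooth.continuousAt.comp hz).eventually (lt_mem_nhds hC.Θ_pos)
  have e9 : ∀ᶠ n' in 𝓝 n, ∀ a, C.z n' + C.k a ≠ 0 := Filter.eventually_all.2 fun a =>
    (hz.add continuousAt_const).eventually (isOpen_ne.mem_nhds (hC.k_ne a))
  filter_upwards [e1, e2, e3, e4, e5, e6, e7, e8, e9] with n' h1 h2 h3 h4 h5 h6 h7 h8 h9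
  exact ⟨fun a => (h1 a).1, fun a => (h1 a).2, h2, h3, h4, h5, h6,
    h7.differentiableAt (by simp), h8, h9⟩

namespace Good

theorem hasFDerivAt_u (hn : C.Good n) : HasFDerivAt C.u (C.du n) n :=
  ((hn.h_smooth.differentiableAt (by simp)).hasFDerivAt.comp n hasFDerivAt_fst).add
    (Complex.reCLM.hasFDerivAt.comp n hasFDerivAt_snd)

theorem hasFDerivAt_z (hn : C.Good n) : HasFDerivAt C.z (C.Θ (C.z n) • C.du n) n :=
  hn.Z_deriv.comp_hasFDerivAt n hn.hasFDerivAt_u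

theorem fderiv_z (hn : C.Good n) : fderiv ℝ C.z n = C.Θ (C.z n) • C.du n :=
  hn.hasFDerivAt_z.fderiv

theorem hasFDerivAt_du (hn : C.Good n) (v : (∀ a, B a) × ℂ) :
    HasFDerivAt (fun n => C.du n v)
      (((fderiv ℝ (fderiv ℝ C.h) n.1).flip v.1).comp (ContinuousLinearMap.fst ℝ _ _)) n := by
  have h1 : DifferentiableAt ℝ (fderiv ℝ C.h) n.1 :=
    (hn.h_smooth.fderiv_right (m := 1) (by norm_num)).differentiableAt (by simp)
  have h2 := ((h1.hasFDerivAt.comp n hasFDerivAt_fst).clm_apply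
    (hasFDerivAt_const v.1 n)).add_const v.2.re
  refine h2.congr_fderiv ?_
  ext x <;> simp

theorem fderiv_G (hn : C.Good n) (hG : DifferentiableAt ℝ C.G n) (x v w : (∀ a, B a) × ℂ) :
    fderiv ℝ C.G n x v w
      = (∑ a, (C.Θ (C.z n) * C.du n x * C.γ a (n.1 a) (v.1 a) (w.1 a)
          + (C.z n + C.k a) * fderiv ℝ (C.γ a) (n.1 a) (x.1 a) (v.1 a) (w.1 a)))
        + (deriv C.Θ (C.z n) * (C.Θ (C.z n) * C.du n x)
            * (C.du n v * C.du n w + C.du n (Complex.I • v) * C.du n (Complex.I • w))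
          + C.Θ (C.z n) * (fderiv ℝ (fderiv ℝ C.h) n.1 x.1 v.1 * C.du n w
            + C.du n v * fderiv ℝ (fderiv ℝ C.h) n.1 x.1 w.1
            + fderiv ℝ (fderiv ℝ C.h) n.1 x.1 (Complex.I • v.1) * C.du n (Complex.I • w)
            + C.du n (Complex.I • v) * fderiv ℝ (fderiv ℝ C.h) n.1 x.1 (Complex.I • w.1))) := by
  rw [← fderiv_apply_const₂ hG]
  simp only [G_apply]
  have hz := hn.hasFDerivAt_z
  have hΘ := hn.Θ_diff.hasDerivAt.comp_hasFDerivAt n hz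
  have h1 : ∀ a, HasFDerivAt (fun n : (∀ a, B a) × ℂ => C.γ a (n.1 a) (v.1 a) (w.1 a)) _ n :=
    fun a => (((hn.diff a).hasFDerivAt.comp n (pr B a).hasFDerivAt).clm_apply
      (hasFDerivAt_const (v.1 a) n)).clm_apply (hasFDerivAt_const (w.1 a) n)
  have hd := hn.hasFDerivAt_du
  have h2 := (HasFDerivAt.fun_sum fun a (_ : a ∈ Finset.univ) =>
    ((hz.add_const (C.k a)).mul (h1 a))).add
    (hΘ.mul (((hd v).mul (hd w)).add ((hd (Complex.I • v)).mul (hd (Complex.I • w)))))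
  refine (DFunLike.congr_fun h2.fderiv x).trans ?_
  simp
  congr 1
  · refine Finset.sum_congr rfl fun a _ => ?_
    ring
  · ring

theorem du_I_I (v : (∀ a, B a) × ℂ) :
    C.du n (Complex.I • Complex.I • v) = - C.du n v := by
  rw [I_smul_I_smul, map_neg]

theorem symm (hn : C.Good n) (v w : (∀ a, B a) × ℂ) : C.G n v w = C.G n w v := by
  rw [G_apply, G_apply]
  congr 1
  · exact Finset.sum_congr rfl fun a _ => by rw [(hn.nondeg a).symm]
  · ring

theorem G_I_I (hn : C.Good n) (v w : (∀ a, B a) × ℂ) :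
    C.G n (Complex.I • v) (Complex.I • w) = C.G n v w := by
  rw [G_apply, G_apply, du_I_I, du_I_I]
  congr 1
  · exact Finset.sum_congr rfl fun a _ => by
      rw [Prod.smul_fst, Prod.smul_fst, Pi.smul_apply, Pi.smul_apply, hn.herm]
  · ring

theorem du_vert (ζ : ℂ) : C.du n (0, ζ) = ζ.re := by simp [du_apply]

theorem du_I_vert (ζ : ℂ) : C.du n (Complex.I • ((0, ζ) : (∀ a, B a) × ℂ)) = - ζ.im := by
  simp [du_apply]

theorem G_vert (v : (∀ a, B a) × ℂ) (ζ : ℂ) : C.G n (0, ζ) v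
    = C.Θ (C.z n) * (ζ.re * C.du n v - ζ.im * C.du n (Complex.I • v)) := by
  rw [G_apply, du_vert, du_I_vert]
  simp
  left
  ring

theorem eq_zero_of_horizontal {v : (∀ a, B a) × ℂ} (h0 : v.1 = 0)
    (h1 : C.du n v = 0) (h2 : C.du n (Complex.I • v) = 0) : v = 0 := by
  obtain ⟨y, ζ⟩ := v
  simp only at h0
  subst h0
  rw [du_vert] at h1
  rw [du_I_vert, neg_eq_zero] at h2
  rw [Complex.ext (z := ζ) (w := 0) h1 h2]
  rfl

open Classical in
/-- The horizontal lift of a vector of a factor. -/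
def lift (C : Calabi B) (n : (∀ a, B a) × ℂ) (a : κ) : B a →ₗ[ℝ] (∀ a, B a) × ℂ where
  toFun y := (Pi.single a y, ⟨- fderiv ℝ C.h n.1 (Pi.single a y),
    fderiv ℝ C.h n.1 (Complex.I • Pi.single a y)⟩)
  map_add' x y := by
    ext1
    · simp [Pi.single_add]
    · apply Complex.ext
      · simp [Pi.single_add]; ring
      · simp [Pi.single_add]
  map_smul' c x := by
    ext1
    · simp [Pi.single_smul]
    · apply Complex.ext
      · simp [Pi.single_smul]
      · simp only [Pi.single_smul, smul_comm Complex.I c, map_smul]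
        simp

theorem pr_lift (a : κ) (y : B a) : pr B a (lift C n a y) = y := by
  simp [lift]

theorem du_lift (a : κ) (y : B a) : C.du n (lift C n a y) = 0 := by
  simp [du_apply, lift]

theorem du_I_lift (a : κ) (y : B a) : C.du n (Complex.I • lift C n a y) = 0 := by
  simp [du_apply, lift]

theorem G_lift (a : κ) (y : B a) (w : (∀ a, B a) × ℂ) :
    C.G n (lift C n a y) w = (C.z n + C.k a) * C.γ a (n.1 a) y (pr B a w) := by
  classical
  rw [G_apply, du_lift, du_I_lift, Finset.sum_eq_single a]
  · simp [lift]
  · intro b _ hb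
    simp [lift, Pi.single_eq_of_ne hb]
  · simp

theorem isNondegSymm (hn : C.Good n) : IsNondegSymm (C.G n) := by
  refine isNondegSymm_of_nondeg hn.symm fun v hv => ?_
  have h1 : C.du n v = 0 := by
    have := hv (0, 1)
    rw [hn.symm, G_vert] at this
    simpa [hn.Θ_pos.ne'] using this
  have h2 : C.du n (Complex.I • v) = 0 := by
    have := hv (0, Complex.I)
    rw [hn.symm, G_vert] at this
    simpa [hn.Θ_pos.ne'] using this
  refine eq_zero_of_horizontal ?_ h1 h2
  funext a
  refine (hn.nondeg a).ext fun k => ?_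
  have := hv (lift C n a k)
  rw [hn.symm, G_lift, (hn.nondeg a).symm] at this
  simpa [hn.k_ne a] using this

theorem closed_G (hn : C.Good n) (hG : DifferentiableAt ℝ C.G n) (v w k : (∀ a, B a) × ℂ) :
    fderiv ℝ C.G n v (Complex.I • w) k + fderiv ℝ C.G n w (Complex.I • k) v
      + fderiv ℝ C.G n k (Complex.I • v) w = 0 := by
  have hs : ∀ x y, fderiv ℝ (fderiv ℝ C.h) n.1 x y = fderiv ℝ (fderiv ℝ C.h) n.1 y x :=
    snd_fderiv_symm hn.h_smooth
  have hγ : ∀ v w : (∀ a, B a) × ℂ, ∑ a, C.γ a (n.1 a) (Complex.I • v.1 a) (w.1 a)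
      = fderiv ℝ (fderiv ℝ C.h) n.1 w.1 (Complex.I • v.1)
        - fderiv ℝ (fderiv ℝ C.h) n.1 v.1 (Complex.I • w.1) :=
    fun v w => (hn.h_ddc v.1 w.1).symm
  have hc : (∑ a, (C.z n + C.k a) * fderiv ℝ (C.γ a) (n.1 a) (v.1 a) (Complex.I • w.1 a) (k.1 a))
      + (∑ a, (C.z n + C.k a) * fderiv ℝ (C.γ a) (n.1 a) (w.1 a) (Complex.I • k.1 a) (v.1 a))
      + (∑ a, (C.z n + C.k a) * fderiv ℝ (C.γ a) (n.1 a) (k.1 a) (Complex.I • v.1 a) (w.1 a))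
      = 0 := by
    rw [← Finset.sum_add_distrib, ← Finset.sum_add_distrib]
    refine Finset.sum_eq_zero fun a _ => ?_
    rw [← mul_add, ← mul_add, hn.closed, mul_zero]
  rw [hn.fderiv_G hG, hn.fderiv_G hG, hn.fderiv_G hG]
  simp only [Finset.sum_add_distrib, mul_assoc, ← Finset.mul_sum, Prod.smul_fst, Pi.smul_apply,
    hγ, I_smul_I_smul, map_neg]
  linear_combination hc + C.Θ (C.z n) * C.du n (Complex.I • w) * hs v.1 k.1
    - C.Θ (C.z n) * C.du n (Complex.I • k) * hs v.1 w.1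
    - C.Θ (C.z n) * C.du n (Complex.I • v) * hs w.1 k.1

end Good

theorem Regular.isHolKahlerAt (hC : C.Regular n) : IsHolKahlerAt C.G n := by
  have hd : ∀ᶠ n' in 𝓝 n, DifferentiableAt ℝ C.G n' :=
    (eventually_contDiffAt_two hC.contDiffAt_G).mono fun y hy => hy.differentiableAt (by simp)
  refine ⟨⟨hC.contDiffAt_G, hC.eventually_good.mono fun _ h => h.isNondegSymm⟩,
    hC.eventually_good.mono fun _ h => h.G_I_I, ?_⟩
  filter_upwards [hC.eventually_good, hd] with n' h1 h2 using h1.closed_G h2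

namespace Good

/-- Traces of forms pulled back from a factor. -/
theorem metricTrace_pr (hn : C.Good n) (a : κ) (b : B a →ₗ[ℝ] B a →ₗ[ℝ] ℝ)
    (b' : (∀ a, B a) × ℂ →ₗ[ℝ] (∀ a, B a) × ℂ →ₗ[ℝ] ℝ)
    (hb : ∀ v w, b' v w = b (v.1 a) (w.1 a)) :
    metricTrace (C.G n) b' = (C.z n + C.k a)⁻¹ * metricTrace (C.γ a (n.1 a)) b :=
  metricTrace_pullback hn.isNondegSymm (hn.nondeg a) (hn.k_ne a) (pr B a).toLinearMap
    (lift C n a) (pr_lift a) (G_lift a) b' b hb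

theorem inverse_du (hn : C.Good n) : (C.G n).inverse (C.du n) = (C.Θ (C.z n))⁻¹ • (0, 1) := by
  refine hn.isNondegSymm.ext fun k => ?_
  rw [hn.isNondegSymm.apply_inverse, map_smul, smul_apply, G_vert]
  have := hn.Θ_pos.ne'
  simp
  field_simp

theorem inverse_du_I (hn : C.Good n) :
    (C.G n).inverse ((C.du n).comp (mulI _)) = (C.Θ (C.z n))⁻¹ • (0, -Complex.I) := by
  refine hn.isNondegSymm.ext fun k => ?_
  rw [hn.isNondegSymm.apply_inverse, map_smul, smul_apply, G_vert]
  have := hn.Θ_pos.ne'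
  simp
  field_simp

/-- Traces of products with `du`. -/
theorem metricTrace_du (hn : C.Good n) (α : (∀ a, B a) × ℂ →L[ℝ] ℝ)
    (b : (∀ a, B a) × ℂ →ₗ[ℝ] (∀ a, B a) × ℂ →ₗ[ℝ] ℝ) (hb : ∀ v w, b v w = α v * C.du n w) :
    metricTrace (C.G n) b = (C.Θ (C.z n))⁻¹ * α (0, 1) := by
  rw [metricTrace_smulRight _ α (C.du n) b hb, hn.inverse_du, map_smul, smul_eq_mul]

theorem metricTrace_du_I (hn : C.Good n) (α : (∀ a, B a) × ℂ →L[ℝ] ℝ)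
    (b : (∀ a, B a) × ℂ →ₗ[ℝ] (∀ a, B a) × ℂ →ₗ[ℝ] ℝ)
    (hb : ∀ v w, b v w = α v * C.du n (Complex.I • w)) :
    metricTrace (C.G n) b = (C.Θ (C.z n))⁻¹ * α (0, -Complex.I) := by
  rw [metricTrace_smulRight _ α ((C.du n).comp (mulI _)) b hb, hn.inverse_du_I, map_smul,
    smul_eq_mul]

theorem metricTrace_flip {V : Type*} [NormedAddCommGroup V] [NormedSpace ℝ V] [NormedSpace ℂ V]
    [IsScalarTower ℝ ℂ V]
    [FiniteDimensional ℝ V] {g : V →L[ℝ] V →L[ℝ] ℝ} (hg : IsNondegSymm g)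
    (b : V →ₗ[ℝ] V →ₗ[ℝ] ℝ) : metricTrace g b.flip = metricTrace g b := by
  have h1 : metricTrace g (b.flip + (-1 : ℝ) • b) = 0 :=
    metricTrace_eq_zero_of_skew hg fun v w => by simp
  rw [metricTrace_add, metricTrace_smul] at h1
  linarith

theorem metricTrace_self {V : Type*} [NormedAddCommGroup V] [NormedSpace ℝ V] [NormedSpace ℂ V]
    [IsScalarTower ℝ ℂ V]
    [FiniteDimensional ℝ V] {g : V →L[ℝ] V →L[ℝ] ℝ} (hg : IsNondegSymm g) :
    metricTrace g (toBilin g) = Module.finrank ℝ V := by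
  rw [← LinearMap.trace_id, metricTrace]
  congr 1
  ext v
  exact hg.inverse_apply v

end Good

/-- Half the sum of the real dimensions, weighted with the logarithmic derivatives of the
coefficients. -/
def S (C : Calabi B) (z : ℝ) : ℝ := ∑ a, (Module.finrank ℝ (B a) / 2 : ℝ) / (z + C.k a)

/-- The derivative of the logarithm of the volume. -/
def L (C : Calabi B) (z : ℝ) : ℝ := C.Θ z * C.S z + deriv C.Θ z

namespace Good

/-- The Hessian of `h` pulled back to the total space. -/
def hess (C : Calabi B) (n : (∀ a, B a) × ℂ) :
    ((∀ a, B a) × ℂ) →L[ℝ] ((∀ a, B a) × ℂ) →L[ℝ] ℝ :=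
  (fderiv ℝ (fderiv ℝ C.h) n.1).bilinearComp (ContinuousLinearMap.fst ℝ _ _)
    (ContinuousLinearMap.fst ℝ _ _)

theorem metricTrace_hess (hn : C.Good n) : metricTrace (C.G n) (toBilin (hess C n)) = C.S (C.z n) := by
  let b : κ → ((∀ a, B a) × ℂ →ₗ[ℝ] (∀ a, B a) × ℂ →ₗ[ℝ] ℝ) := fun a =>
    toBilin ((C.γ a (n.1 a)).bilinearComp (pr B a) (pr B a))
  have h1 : metricTrace (C.G n) (toBilin (hess C n) + (-(1 / 2) : ℝ) • ∑ a, b a) = 0 := by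
    refine metricTrace_eq_zero_of_anti hn.isNondegSymm hn.G_I_I fun v w => ?_
    have h2 := hn.h_ddc v.1 (Complex.I • w.1)
    rw [I_smul_I_smul, map_neg, snd_fderiv_symm hn.h_smooth (Complex.I • w.1)] at h2
    have h3 : ∑ a, C.γ a (n.1 a) (Complex.I • v.1 a) ((Complex.I • w.1) a)
        = ∑ a, C.γ a (n.1 a) (v.1 a) (w.1 a) :=
      Finset.sum_congr rfl fun a _ => hn.herm a _ _
    rw [h3] at h2
    simp [b, hess, LinearMap.sum_apply, hn.herm]
    linarith
  have h4 : ∀ a, metricTrace (C.G n) (b a)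
      = (C.z n + C.k a)⁻¹ * Module.finrank ℝ (B a) := fun a => by
    rw [hn.metricTrace_pr a (toBilin (C.γ a (n.1 a))) (b a) fun v w => rfl,
      metricTrace_self (hn.nondeg a)]
  rw [metricTrace_add, metricTrace_smul, metricTrace_sum] at h1
  simp only [h4] at h1
  rw [eq_neg_of_add_eq_zero_left h1, S, Finset.mul_sum, ← Finset.sum_neg_distrib]
  refine Finset.sum_congr rfl fun a _ => ?_
  ring

theorem chrTrace_eq (hn : C.Good n) (hG : IsMetricAt C.G n)
    (hγ : ∀ a, IsMetricAt (C.γ a) (n.1 a)) (x : (∀ a, B a) × ℂ) :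
    chrTrace C.G n x
      = C.L (C.z n) * C.du n x + ∑ a, chrTrace (C.γ a) (n.1 a) (x.1 a) := by
  have hg := hn.isNondegSymm
  have hd := hG.smooth.differentiableAt (by simp)
  have hΘ := hn.Θ_pos.ne'
  let H : ((∀ a, B a) × ℂ) →L[ℝ] ℝ := hess C n x
  let HI : ((∀ a, B a) × ℂ) →L[ℝ] ℝ := H.comp (mulI _)
  let α := C.du n
  let αI := α.comp (mulI _)
  let b₁ : κ → ((∀ a, B a) × ℂ →ₗ[ℝ] (∀ a, B a) × ℂ →ₗ[ℝ] ℝ) := fun a =>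
    toBilin ((C.γ a (n.1 a)).bilinearComp (pr B a) (pr B a))
  let b₂ : κ → ((∀ a, B a) × ℂ →ₗ[ℝ] (∀ a, B a) × ℂ →ₗ[ℝ] ℝ) := fun a =>
    toBilin ((fderiv ℝ (C.γ a) (n.1 a) (x.1 a)).bilinearComp (pr B a) (pr B a))
  have key : toBilin (fderiv ℝ C.G n x)
      = ((C.Θ (C.z n) * C.du n x) • ∑ a, b₁ a) + (∑ a, (C.z n + C.k a) • b₂ a)
        + ((deriv C.Θ (C.z n) * (C.Θ (C.z n) * C.du n x))
            • (toBilin (α.smulRight α) + toBilin (αI.smulRight αI))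
          + C.Θ (C.z n) • (toBilin (H.smulRight α) + (toBilin (H.smulRight α)).flip
            + (toBilin (HI.smulRight αI) + (toBilin (HI.smulRight αI)).flip))) := by
    refine LinearMap.ext fun v => LinearMap.ext fun w => ?_
    change fderiv ℝ C.G n x v w = _
    rw [hn.fderiv_G hd]
    simp only [LinearMap.add_apply, LinearMap.smul_apply, LinearMap.sum_apply, smul_eq_mul,
      LinearMap.flip_apply]
    simp [b₁, b₂, α, αI, H, HI, hess, Finset.sum_add_distrib, Finset.mul_sum, mul_assoc]
    left
    ring
  have t1 : ∀ a, metricTrace (C.G n) (b₁ a)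
      = (C.z n + C.k a)⁻¹ * Module.finrank ℝ (B a) := fun a => by
    rw [hn.metricTrace_pr a (toBilin (C.γ a (n.1 a))) (b₁ a) fun v w => rfl,
      metricTrace_self (hn.nondeg a)]
  have t2 : ∀ a, metricTrace (C.G n) (b₂ a)
      = (C.z n + C.k a)⁻¹ * (2 * chrTrace (C.γ a) (n.1 a) (x.1 a)) := fun a => by
    rw [hn.metricTrace_pr a (toBilin (fderiv ℝ (C.γ a) (n.1 a) (x.1 a))) (b₂ a) fun v w => rfl,
      (hγ a).chrTrace_eq]
    ring
  have t3 : metricTrace (C.G n) (toBilin (α.smulRight α)) = (C.Θ (C.z n))⁻¹ := by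
    rw [hn.metricTrace_du α _ fun v w => rfl, du_vert]
    simp
  have t4 : metricTrace (C.G n) (toBilin (αI.smulRight αI)) = (C.Θ (C.z n))⁻¹ := by
    rw [hn.metricTrace_du_I αI _ fun v w => rfl]
    change _ * C.du n (Complex.I • (0, -Complex.I)) = _
    rw [du_I_vert]
    simp
  have t5 : metricTrace (C.G n) (toBilin (H.smulRight α)) = 0 := by
    rw [hn.metricTrace_du H _ fun v w => rfl]
    simp [H, hess]
  have t6 : metricTrace (C.G n) (toBilin (HI.smulRight αI)) = 0 := by
    rw [hn.metricTrace_du_I HI _ fun v w => rfl]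
    simp [HI, H, hess]
  rw [hG.chrTrace_eq, key]
  simp only [metricTrace_add, metricTrace_smul, metricTrace_sum, metricTrace_flip hg, t1, t2, t3,
    t4, t5, t6]
  have s2 : ∑ a, (C.z n + C.k a) * ((C.z n + C.k a)⁻¹ * (2 * chrTrace (C.γ a) (n.1 a) (x.1 a)))
      = 2 * ∑ a, chrTrace (C.γ a) (n.1 a) (x.1 a) := by
    rw [Finset.mul_sum]
    exact Finset.sum_congr rfl fun a _ => mul_inv_cancel_left₀ (hn.k_ne a) _
  have s1 : ∑ a, (C.z n + C.k a)⁻¹ * (Module.finrank ℝ (B a) : ℝ) = 2 * C.S (C.z n) := by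
    rw [S, Finset.mul_sum]
    exact Finset.sum_congr rfl fun a _ => by ring
  rw [s1, s2, L]
  field_simp
  ring

end Good

theorem Regular.contDiffAt_S (hC : C.Regular n) : ContDiffAt ℝ ∞ C.S (C.z n) :=
  ContDiffAt.sum fun a _ => contDiffAt_const.div (contDiffAt_id.add contDiffAt_const) (hC.k_ne a)

theorem contDiffAt_deriv {f : ℝ → ℝ} {t : ℝ} (hf : ContDiffAt ℝ ∞ f t) :
    ContDiffAt ℝ ∞ (deriv f) t := by
  have h : deriv f = fun t => fderiv ℝ f t 1 := by
    funext t
    exact fderiv_apply_one_eq_deriv.symm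
  rw [h]
  exact (hf.fderiv_right (m := ∞) (by simp)).clm_apply contDiffAt_const

theorem Regular.contDiffAt_L (hC : C.Regular n) : ContDiffAt ℝ ∞ C.L (C.z n) :=
  (hC.Θ_smooth.mul hC.contDiffAt_S).add (contDiffAt_deriv hC.Θ_smooth)

theorem Regular.scal_eq (hC : ∀ᶠ n' in 𝓝 n, C.Regular n') :
    scal C.G n = (∑ a, scal (C.γ a) (n.1 a) / (C.z n + C.k a))
      - deriv C.L (C.z n) - C.L (C.z n) * C.S (C.z n) := by
  have h0 := hC.self_of_nhds
  have hn := h0.eventually_good.self_of_nhds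
  let ℓ : (∀ a, B a) × ℂ → ((∀ a, B a) × ℂ) →L[ℝ] ℝ := fun n =>
    C.L (C.z n) • C.du n + ∑ a, (chrTrace (C.γ a) (n.1 a)).comp (pr B a)
  have he : chrTrace C.G =ᶠ[𝓝 n] ℓ := by
    filter_upwards [hC] with n' h
    refine ContinuousLinearMap.ext fun x => ?_
    rw [h.eventually_good.self_of_nhds.chrTrace_eq h.isHolKahlerAt.toIsMetricAt
      fun a => (h.kahler a).toIsMetricAt]
    simp [ℓ]
  have hL := (h0.contDiffAt_L.differentiableAt (by simp)).hasDerivAt.comp_hasFDerivAt n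
    hn.hasFDerivAt_z
  have hdu : DifferentiableAt ℝ C.du n := h0.contDiffAt_du.differentiableAt (by simp)
  have hcd : ∀ a, DifferentiableAt ℝ (chrTrace (C.γ a)) (n.1 a) := fun a =>
    (differentiableAt_const _).clm_comp
      ((h0.kahler a).toIsMetricAt.contDiffAt_chr.differentiableAt (by simp))
  have hc : ∀ a, HasFDerivAt (fun n : (∀ a, B a) × ℂ => (chrTrace (C.γ a) (n.1 a)).comp (pr B a))
      _ n := fun a => ((hcd a).hasFDerivAt.comp n (pr B a).hasFDerivAt).clm_comp
        (hasFDerivAt_const (pr B a) n)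
  have hℓ := (hL.smul hdu.hasFDerivAt).add (HasFDerivAt.fun_sum fun a (_ : a ∈ Finset.univ) => hc a)
  have hdu' : ∀ v w, fderiv ℝ C.du n v w = Good.hess C n v w := fun v w => by
    rw [← fderiv_apply_const hdu, (hn.hasFDerivAt_du w).fderiv]
    rfl
  let b : κ → ((∀ a, B a) × ℂ →ₗ[ℝ] (∀ a, B a) × ℂ →ₗ[ℝ] ℝ) := fun a =>
    toBilin ((fderiv ℝ (chrTrace (C.γ a)) (n.1 a)).bilinearComp (pr B a) (pr B a))
  have key : toBilin (fderiv ℝ (chrTrace C.G) n)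
      = (deriv C.L (C.z n) * C.Θ (C.z n)) • toBilin ((C.du n).smulRight (C.du n))
        + C.L (C.z n) • toBilin (Good.hess C n) + ∑ a, b a := by
    refine LinearMap.ext fun v => LinearMap.ext fun w => ?_
    change fderiv ℝ (chrTrace C.G) n v w = _
    rw [he.fderiv_eq]
    refine (congrArg (fun T => T v w) hℓ.fderiv).trans ?_
    simp only [LinearMap.add_apply, LinearMap.smul_apply, LinearMap.sum_apply, smul_eq_mul]
    simp [b, hdu', mul_assoc]
    ring
  have t1 : metricTrace (C.G n) (toBilin ((C.du n).smulRight (C.du n))) = (C.Θ (C.z n))⁻¹ := by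
    rw [hn.metricTrace_du (C.du n) _ fun v w => rfl, Good.du_vert]
    simp
  have t2 : ∀ a, metricTrace (C.G n) (b a)
      = (C.z n + C.k a)⁻¹ * (- scal (C.γ a) (n.1 a)) := fun a => by
    rw [hn.metricTrace_pr a (toBilin (fderiv ℝ (chrTrace (C.γ a)) (n.1 a))) (b a) fun v w => rfl,
      (h0.kahler a).scal_eq, neg_neg]
  rw [h0.isHolKahlerAt.scal_eq, key, metricTrace_add, metricTrace_add, metricTrace_smul,
    metricTrace_smul, metricTrace_sum, t1, hn.metricTrace_hess]
  simp only [t2]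
  have := hn.Θ_pos.ne'
  have e : ∑ a, (C.z n + C.k a)⁻¹ * (- scal (C.γ a) (n.1 a))
      = - ∑ a, scal (C.γ a) (n.1 a) / (C.z n + C.k a) := by
    rw [← Finset.sum_neg_distrib]
    exact Finset.sum_congr rfl fun a _ => by ring
  rw [e]
  field_simp
  ring

theorem Good.pos (hn : C.Good n) (hpos : ∀ a v, v ≠ 0 → 0 < (C.z n + C.k a) * C.γ a (n.1 a) v v)
    (v : (∀ a, B a) × ℂ) (hv : v ≠ 0) : 0 < C.G n v v := by
  have hnn : ∀ a, 0 ≤ (C.z n + C.k a) * C.γ a (n.1 a) (v.1 a) (v.1 a) := fun a => by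
    rcases eq_or_ne (v.1 a) 0 with h | h
    · simp [h]
    · exact (hpos a _ h).le
  have h1 := Finset.sum_nonneg fun a (_ : a ∈ Finset.univ) => hnn a
  rw [G_apply, ← sq, ← sq]
  by_contra hneg
  have hsq : 0 ≤ C.Θ (C.z n) * (C.du n v ^ 2 + C.du n (Complex.I • v) ^ 2) := by
    have := hn.Θ_pos
    positivity
  have h2 : ∑ a, (C.z n + C.k a) * C.γ a (n.1 a) (v.1 a) (v.1 a) = 0 := by linarith
  have h3 : C.Θ (C.z n) * (C.du n v ^ 2 + C.du n (Complex.I • v) ^ 2) = 0 := by linarith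
  have h4 := (mul_eq_zero.1 h3).resolve_left hn.Θ_pos.ne'
  rw [Finset.sum_eq_zero_iff_of_nonneg fun a _ => hnn a] at h2
  refine hv (Good.eq_zero_of_horizontal (C := C) (n := n) ?_ ?_ ?_)
  · funext a
    by_contra h
    exact (hpos a _ h).ne' (h2 a (Finset.mem_univ a))
  · nlinarith [sq_nonneg (C.du n v), sq_nonneg (C.du n (Complex.I • v))]
  · nlinarith [sq_nonneg (C.du n v), sq_nonneg (C.du n (Complex.I • v))]

theorem Regular.laplacian_z (hC : C.Regular n) (c : ℝ) :
    laplacian C.G (fun n => C.z n + c) n = - C.L (C.z n) := by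
  have hn := hC.eventually_good.self_of_nhds
  have he : fderiv ℝ (fun n => C.z n + c) =ᶠ[𝓝 n] fun n => C.Θ (C.z n) • C.du n := by
    filter_upwards [hC.eventually_good] with n' h
    rw [fderiv_add_const, h.fderiv_z]
  have hΘ := hn.Θ_diff.hasDerivAt.comp_hasFDerivAt n hn.hasFDerivAt_z
  have hdu : DifferentiableAt ℝ C.du n := hC.contDiffAt_du.differentiableAt (by simp)
  have hdu' : ∀ v w, fderiv ℝ C.du n v w = Good.hess C n v w := fun v w => by
    rw [← fderiv_apply_const hdu, (hn.hasFDerivAt_du w).fderiv]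
    rfl
  have hℓ := hΘ.smul hdu.hasFDerivAt
  have key : toBilin (fderiv ℝ (fderiv ℝ fun n => C.z n + c) n)
      = (deriv C.Θ (C.z n) * C.Θ (C.z n)) • toBilin ((C.du n).smulRight (C.du n))
        + C.Θ (C.z n) • toBilin (Good.hess C n) := by
    refine LinearMap.ext fun v => LinearMap.ext fun w => ?_
    change fderiv ℝ (fderiv ℝ fun n => C.z n + c) n v w = _
    rw [he.fderiv_eq]
    refine (congrArg (fun T => T v w) hℓ.fderiv).trans ?_
    simp [hdu', mul_assoc]
    ring
  have t1 : metricTrace (C.G n) (toBilin ((C.du n).smulRight (C.du n))) = (C.Θ (C.z n))⁻¹ := by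
    rw [hn.metricTrace_du (C.du n) _ fun v w => rfl, Good.du_vert]
    simp
  rw [hC.isHolKahlerAt.laplacian_eq, key, metricTrace_add, metricTrace_smul, metricTrace_smul, t1,
    hn.metricTrace_hess, L]
  have := hn.Θ_pos.ne'
  field_simp
  ring

theorem Good.normSqDiff_z (hn : C.Good n) (c : ℝ) :
    normSqDiff C.G (fun n => C.z n + c) n = C.Θ (C.z n) := by
  have := hn.Θ_pos.ne'
  rw [normSqDiff, sharp, fderiv_add_const, hn.fderiv_z, map_smul, hn.inverse_du, smul_smul,
    mul_inv_cancel₀ this, one_smul, smul_apply, Good.du_vert]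
  simp

theorem Regular.weightedScal_eq (hC : ∀ᶠ n' in 𝓝 n, C.Regular n') (c p : ℝ) :
    weightedScal C.G (fun n => C.z n + c) p n
      = (C.z n + c) ^ 2 * ((∑ a, scal (C.γ a) (n.1 a) / (C.z n + C.k a))
          - deriv C.L (C.z n) - C.L (C.z n) * C.S (C.z n))
        + 2 * (p - 1) * (C.z n + c) * C.L (C.z n) - p * (p - 1) * C.Θ (C.z n) := by
  have h0 := hC.self_of_nhds
  rw [weightedScal, Regular.scal_eq hC, h0.laplacian_z,
    h0.eventually_good.self_of_nhds.normSqDiff_z]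
  ring

/-- The gradient of an affine function of the momentum is a constant field. -/
theorem Good.fderiv_affine (hn : C.Good n) (c₁ c₂ : ℝ) (k : (∀ a, B a) × ℂ) :
    fderiv ℝ (fun n => c₁ * C.z n + c₂) n k = C.G n (c₁ • (0, 1)) k := by
  rw [fderiv_add_const, (hn.hasFDerivAt_z.const_mul c₁).fderiv]
  simp only [map_smul, smul_apply]
  rw [Good.G_vert]
  simp

theorem Good.fderiv_G_vert (hn : C.Good n) (hG : DifferentiableAt ℝ C.G n) (c : ℝ) :
    fderiv ℝ C.G n (Complex.I • c • (0, 1)) = 0 := by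
  refine ContinuousLinearMap.ext fun v => ContinuousLinearMap.ext fun w => ?_
  have h : C.du n (Complex.I • c • ((0, 1) : (∀ a, B a) × ℂ)) = 0 := by
    rw [smul_comm Complex.I c, map_smul, Good.du_I_vert]
    simp
  have h' : (Complex.I • c • ((0, 1) : (∀ a, B a) × ℂ)).1 = 0 := by simp
  rw [hn.fderiv_G hG, h]
  simp only [h']
  simp

end Calabi

end LocalGeometry

namespace LocalGeometry

/-! ### Fubini-Study metrics in affine coordinates -/

/-- A real inner product for which the multiplication by the imaginary unit is an isometry. -/
structure IsHermitianInner {V : Type*} [NormedAddCommGroup V] [NormedSpace ℝ V] [NormedSpace ℂ V]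
    (B : V →L[ℝ] V →L[ℝ] ℝ) : Prop where
  symm : ∀ v w, B v w = B w v
  herm : ∀ v w, B (Complex.I • v) (Complex.I • w) = B v w
  pos : ∀ v, v ≠ 0 → 0 < B v v

section FubiniStudy

variable {V : Type*} [NormedAddCommGroup V] [NormedSpace ℝ V] [NormedSpace ℂ V]
  [IsScalarTower ℝ ℂ V] {B : V →L[ℝ] V →L[ℝ] ℝ}

theorem IsHermitianInner.I_left (hB : IsHermitianInner B) (v w : V) :
    B (Complex.I • v) w = - B v (Complex.I • w) := by
  rw [← hB.herm v (Complex.I • w), I_smul_I_smul, map_neg, neg_neg]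

theorem IsHermitianInner.self_I (hB : IsHermitianInner B) (v : V) : B v (Complex.I • v) = 0 := by
  have h1 := hB.I_left v v
  rw [hB.symm] at h1
  linarith

theorem IsHermitianInner.nonneg (hB : IsHermitianInner B) (v : V) : 0 ≤ B v v := by
  rcases eq_or_ne v 0 with h | h
  · simp [h]
  · exact (hB.pos v h).le

variable (B) in
/-- The Kähler potential of the Fubini-Study metric. -/
def fsPot (r : ℝ) (m : V) : ℝ := (1 / 2) * Real.log (r + B m m)

variable (B) in
/-- The Fubini-Study metric in affine coordinates, for the Kähler potential `log (r + |m|²) / 2`. -/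
def fsMetric (r : ℝ) (m : V) : V →L[ℝ] V →L[ℝ] ℝ :=
  (2 / (r + B m m)) • B - (2 / (r + B m m) ^ 2) • ((B m).smulRight (B m)
    + ((B m).comp (mulI V)).smulRight ((B m).comp (mulI V)))

theorem fsMetric_apply (r : ℝ) (m v w : V) : fsMetric B r m v w
    = 2 / (r + B m m) * B v w - 2 / (r + B m m) ^ 2 * (B m v * B m w
      + B m (Complex.I • v) * B m (Complex.I • w)) := by
  simp [fsMetric, mul_add]

theorem IsHermitianInner.hasFDerivAt_self (hB : IsHermitianInner B) (r : ℝ) (m : V) :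
    HasFDerivAt (fun m => r + B m m) ((2 : ℝ) • B m) m := by
  refine ((B.hasFDerivAt.clm_apply (hasFDerivAt_id m)).const_add r).congr_fderiv ?_
  refine ContinuousLinearMap.ext fun v => ?_
  simp [hB.symm v m]
  ring

theorem IsHermitianInner.hasFDerivAt_inv (hB : IsHermitianInner B) {r : ℝ} {m : V}
    (hm : r + B m m ≠ 0) :
    HasFDerivAt (fun m => (r + B m m)⁻¹) ((-((r + B m m) ^ 2)⁻¹) • (2 : ℝ) • B m) m :=
  (hasDerivAt_inv hm).comp_hasFDerivAt m (hB.hasFDerivAt_self r m)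

theorem IsHermitianInner.hasFDerivAt_fsPot (hB : IsHermitianInner B) {r : ℝ} {m : V}
    (hm : r + B m m ≠ 0) : HasFDerivAt (fsPot B r) ((r + B m m)⁻¹ • B m) m := by
  refine (((hB.hasFDerivAt_self r m).log hm).const_mul (1 / 2)).congr_fderiv ?_
  refine ContinuousLinearMap.ext fun v => ?_
  simp
  ring

theorem eventually_ne_fsPot {r : ℝ} {m : V} (hm : r + B m m ≠ 0) :
    ∀ᶠ m' in 𝓝 m, r + B m' m' ≠ 0 := by
  have h : ContinuousAt (fun m => r + B m m) m := by fun_prop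
  exact h.eventually (isOpen_ne.mem_nhds hm)

theorem contDiff_fsPot_aux (r : ℝ) : ContDiff ℝ ∞ fun m => r + B m m := by fun_prop

theorem contDiffAt_fsPot {r : ℝ} {m : V} (hm : r + B m m ≠ 0) :
    ContDiffAt ℝ ∞ (fsPot B r) m :=
  contDiffAt_const.mul ((contDiff_fsPot_aux r).contDiffAt.log hm)

theorem IsHermitianInner.fderiv_fderiv_fsPot (hB : IsHermitianInner B) {r : ℝ} {m : V}
    (hm : r + B m m ≠ 0) (v w : V) : fderiv ℝ (fderiv ℝ (fsPot B r)) m v w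
      = B v w / (r + B m m) - 2 * B m v * B m w / (r + B m m) ^ 2 := by
  have he : fderiv ℝ (fsPot B r) =ᶠ[𝓝 m] fun m => (r + B m m)⁻¹ • B m := by
    filter_upwards [eventually_ne_fsPot hm] with m' h using (hB.hasFDerivAt_fsPot h).fderiv
  have h2 := ((hB.hasFDerivAt_inv hm).smul B.hasFDerivAt).fderiv
  rw [he.fderiv_eq]
  refine (congrArg (fun T => T v w) h2).trans ?_
  simp
  field_simp
  ring

theorem IsHermitianInner.ddc_fsPot (hB : IsHermitianInner B) {r : ℝ} {m : V}
    (hm : r + B m m ≠ 0) (v w : V) :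
    fderiv ℝ (fderiv ℝ (fsPot B r)) m w (Complex.I • v)
      - fderiv ℝ (fderiv ℝ (fsPot B r)) m v (Complex.I • w)
        = fsMetric B r m (Complex.I • v) w := by
  rw [hB.fderiv_fderiv_fsPot hm, hB.fderiv_fderiv_fsPot hm, fsMetric_apply, I_smul_I_smul,
    map_neg, hB.I_left v w, hB.symm w, hB.I_left v w]
  field_simp
  ring

theorem contDiffAt_fsMetric {r : ℝ} {m : V} (hm : r + B m m ≠ 0) :
    ContDiffAt ℝ ∞ (fsMetric B r) m := by
  have h1 : ContDiffAt ℝ ∞ (fun m => r + B m m) m := (contDiff_fsPot_aux r).contDiffAt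
  have h2 : ContDiffAt ℝ ∞ (fun m => B m) m := B.contDiff.contDiffAt
  have h3 : ContDiffAt ℝ ∞ (fun m => (B m).comp (mulI V)) m := h2.clm_comp contDiffAt_const
  exact ((contDiffAt_const.div h1 hm).smul contDiffAt_const).sub
    ((contDiffAt_const.div (h1.pow 2) (pow_ne_zero 2 hm)).smul
      ((h2.smulRight h2).add (h3.smulRight h3)))

theorem IsHermitianInner.fderiv_fsMetric (hB : IsHermitianInner B) {r : ℝ} {m : V}
    (hm : r + B m m ≠ 0) (z v w : V) : fderiv ℝ (fsMetric B r) m z v w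
      = - 4 * B m z / (r + B m m) ^ 2 * B v w
        - 2 / (r + B m m) ^ 2 * (B z v * B m w + B m v * B z w
          + B z (Complex.I • v) * B m (Complex.I • w) + B m (Complex.I • v) * B z (Complex.I • w))
        + 8 * B m z / (r + B m m) ^ 3 * (B m v * B m w
          + B m (Complex.I • v) * B m (Complex.I • w)) := by
  rw [← fderiv_apply_const₂ ((contDiffAt_fsMetric hm).differentiableAt (by simp))]
  simp only [fsMetric_apply]
  have h1 := hB.hasFDerivAt_inv hm
  have h0 := (hasFDerivAt_pow 2 (𝕜 := ℝ)).comp m h1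
  have hd : ∀ v, HasFDerivAt (fun m => B m v) (B.flip v) m := fun v => (B.flip v).hasFDerivAt
  have h2 := ((h1.const_mul 2).mul_const (B v w)).sub ((h0.const_mul 2).mul
    (((hd v).mul (hd w)).add ((hd (Complex.I • v)).mul (hd (Complex.I • w)))))
  have h3 := h2.congr_of_eventuallyEq (f₁ := fun m => 2 / (r + B m m) * B v w
    - 2 / (r + B m m) ^ 2 * (B m v * B m w + B m (Complex.I • v) * B m (Complex.I • w)))
    (.of_forall fun m => by simp [div_eq_mul_inv])
  refine (congrArg (fun T => T z) h3.fderiv).trans ?_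
  simp
  field_simp
  ring

theorem IsHermitianInner.fsMetric_pos (hB : IsHermitianInner B) {r : ℝ} (hr : 0 < r) (m : V)
    {v : V} (hv : v ≠ 0) : 0 < fsMetric B r m v v := by
  have hN : 0 < r + B m m := add_pos_of_pos_of_nonneg hr (hB.nonneg m)
  have hv' := hB.pos v hv
  have key : B m v * B m v + B m (Complex.I • v) * B m (Complex.I • v) ≤ B m m * B v v := by
    have h := hB.nonneg (B v v • m - (B m v) • v - (B m (Complex.I • v)) • Complex.I • v)
    have e1 := hB.symm v m
    have e2 := hB.symm (Complex.I • v) m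
    have e3 := hB.self_I v
    have e4 := hB.symm (Complex.I • v) v
    simp only [map_sub, map_smul, sub_apply, smul_apply, smul_eq_mul, hB.herm, e1, e2, e3, e4] at h
    have h' : 0 ≤ B v v * (B m m * B v v
        - (B m v * B m v + B m (Complex.I • v) * B m (Complex.I • v))) := by
      nlinarith
    have := nonneg_of_mul_nonneg_right h' hv'
    linarith
  rw [fsMetric_apply]
  have : 2 / (r + B m m) * B v v - 2 / (r + B m m) ^ 2 * (B m v * B m v
      + B m (Complex.I • v) * B m (Complex.I • v)) = 2 / (r + B m m) ^ 2 * (r * B v v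
        + (B m m * B v v - (B m v * B m v + B m (Complex.I • v) * B m (Complex.I • v)))) := by
    field_simp
    ring
  rw [this]
  have h2 : 0 < r * B v v := mul_pos hr hv'
  have h3 : 0 < 2 / (r + B m m) ^ 2 := by positivity
  exact mul_pos h3 (by linarith)

variable [FiniteDimensional ℝ V]

theorem IsHermitianInner.isHolKahlerAt (hB : IsHermitianInner B) {r : ℝ} (hr : 0 < r) (m : V)
    {c : ℝ} (hc : c ≠ 0) : IsHolKahlerAt (fun m => c • fsMetric B r m) m := by
  have hN : ∀ m, r + B m m ≠ 0 := fun m =>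
    (add_pos_of_pos_of_nonneg hr (hB.nonneg m)).ne'
  have hf : ∀ m, fderiv ℝ (fun m => c • fsMetric B r m) m = c • fderiv ℝ (fsMetric B r) m :=
    fun m => fderiv_const_smul ((contDiffAt_fsMetric (hN m)).differentiableAt (by simp)) c
  refine ⟨⟨contDiffAt_const.smul (f := fun _ => c) (contDiffAt_fsMetric (hN m)), .of_forall fun m => ?_⟩,
    .of_forall fun m v w => ?_, .of_forall fun m v w k => ?_⟩
  · refine isNondegSymm_of_nondeg (fun v w => ?_) fun v hv => ?_
    · simp only [smul_apply, fsMetric_apply, hB.symm w v]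
      ring
    · by_contra h
      have := hB.fsMetric_pos hr m h
      have h2 := hv v
      simp only [smul_apply, smul_eq_mul] at h2
      exact this.ne' ((mul_eq_zero.1 h2).resolve_left hc)
  · simp only [smul_apply, fsMetric_apply, hB.herm, I_smul_I_smul, map_neg]
    ring
  · simp only [hf, smul_apply, hB.fderiv_fsMetric (hN m), I_smul_I_smul, map_neg, smul_eq_mul,
      hB.I_left]
    rw [hB.symm w v, hB.symm k v, hB.symm k w]
    have e1 : B w (Complex.I • v) = - B v (Complex.I • w) := by rw [hB.symm, hB.I_left]
    have e2 : B k (Complex.I • v) = - B v (Complex.I • k) := by rw [hB.symm, hB.I_left]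
    have e3 : B k (Complex.I • w) = - B w (Complex.I • k) := by rw [hB.symm, hB.I_left]
    rw [e1, e2, e3]
    ring

/-- The Christoffel symbols of the Fubini-Study metric. -/
theorem IsHermitianInner.christoffel_eq (hB : IsHermitianInner B) {r : ℝ} (hr : 0 < r) (m : V)
    {c : ℝ} (hc : c ≠ 0) (v w : V) : christoffel (fun m => c • fsMetric B r m) m v w
      = (-(r + B m m)⁻¹) • (B m v • w - B m (Complex.I • v) • Complex.I • w
        + B m w • v - B m (Complex.I • w) • Complex.I • v) := by
  have hN : ∀ m, r + B m m ≠ 0 := fun m =>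
    (add_pos_of_pos_of_nonneg hr (hB.nonneg m)).ne'
  have hf : ∀ m, fderiv ℝ (fun m => c • fsMetric B r m) m = c • fderiv ℝ (fsMetric B r) m :=
    fun m => fderiv_const_smul ((contDiffAt_fsMetric (hN m)).differentiableAt (by simp)) c
  have hn := (hB.isHolKahlerAt hr m hc).nondeg.self_of_nhds
  refine hn.ext fun k => ?_
  refine (hn.apply_christoffel (G := fun m => c • fsMetric B r m) v w k).trans ?_
  simp only [hf, smul_apply, hB.fderiv_fsMetric (hN m), smul_eq_mul, fsMetric_apply, map_smul,
    map_add, map_sub, add_apply, sub_apply, hB.I_left, I_smul_I_smul, map_neg,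
    smul_add, smul_sub]
  rw [hB.symm w v, hB.symm k v, hB.symm k w]
  have e1 : B w (Complex.I • v) = - B v (Complex.I • w) := by rw [hB.symm, hB.I_left]
  have e2 : B k (Complex.I • v) = - B v (Complex.I • k) := by rw [hB.symm, hB.I_left]
  have e3 : B k (Complex.I • w) = - B w (Complex.I • k) := by rw [hB.symm, hB.I_left]
  rw [e1, e2, e3]
  have := hN m
  field_simp
  ring

theorem IsHermitianInner.isNondegSymm (hB : IsHermitianInner B) : IsNondegSymm B :=
  isNondegSymm_of_nondeg hB.symm fun v hv => by
    by_contra h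
    exact (hB.pos v h).ne' (hv v)

theorem IsHermitianInner.trace_mulI (hB : IsHermitianInner B) :
    LinearMap.trace ℝ V (mulI V).toLinearMap = 0 := by
  have h := metricTrace_eq_zero_of_skew hB.isNondegSymm (B := toBilin (B.comp (mulI V)))
    fun v w => by
      change B (Complex.I • v) w = - B (Complex.I • w) v
      rw [hB.I_left, hB.symm]
  rw [← h, metricTrace]
  congr 1
  ext v
  exact (hB.isNondegSymm.inverse_apply _).symm

theorem IsHermitianInner.chrTrace_eq (hB : IsHermitianInner B) {r : ℝ} (hr : 0 < r) (m : V)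
    {c : ℝ} (hc : c ≠ 0) : chrTrace (fun m => c • fsMetric B r m) m
      = (-((Module.finrank ℝ V + 2) * (r + B m m)⁻¹)) • B m := by
  refine ContinuousLinearMap.ext fun v => ?_
  rw [chrTrace_apply]
  have : (chr (fun m => c • fsMetric B r m) m v).toLinearMap
      = (-(r + B m m)⁻¹) • (B m v • LinearMap.id - B m (Complex.I • v) • (mulI V).toLinearMap
        + (B m).toLinearMap.smulRight v
        - ((B m).comp (mulI V)).toLinearMap.smulRight (Complex.I • v)) := by
    ext w
    change chr (fun m => c • fsMetric B r m) m v w = _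
    rw [chr_apply, hB.christoffel_eq hr m hc]
    simp
  rw [this]
  simp only [map_smul, map_sub, map_add, LinearMap.trace_id, hB.trace_mulI,
    LinearMap.trace_smulRight]
  simp [I_smul_I_smul]
  ring

theorem IsHermitianInner.scal_eq (hB : IsHermitianInner B) {r : ℝ} (hr : 0 < r)
    {c : ℝ} (hc : c ≠ 0) : scal (fun m => c • fsMetric B r m) 0
      = Module.finrank ℝ V * (Module.finrank ℝ V + 2) / 2 / c := by
  have hK := hB.isHolKahlerAt hr 0 hc
  have hn := hK.nondeg.self_of_nhds
  have hr' : r + B 0 0 ≠ 0 := by simpa using hr.ne'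
  have h1 : fderiv ℝ (chrTrace fun m => c • fsMetric B r m) 0
      = (-((Module.finrank ℝ V + 2) / (2 * c))) • (c • fsMetric B r 0) := by
    have : chrTrace (fun m => c • fsMetric B r m)
        = fun m => (-((Module.finrank ℝ V + 2) * (r + B m m)⁻¹)) • B m :=
      funext fun m => hB.chrTrace_eq hr m hc
    rw [this]
    have h2 := ((hB.hasFDerivAt_inv hr').const_mul
      (Module.finrank ℝ V + 2 : ℝ)).neg.smul B.hasFDerivAt
    refine h2.fderiv.trans ?_
    refine ContinuousLinearMap.ext fun v => ContinuousLinearMap.ext fun w => ?_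
    simp [fsMetric]
    field_simp
  have h3 : toBilin ((-((Module.finrank ℝ V + 2) / (2 * c))) • (c • fsMetric B r 0))
      = (-((Module.finrank ℝ V + 2 : ℝ) / (2 * c))) • toBilin (c • fsMetric B r 0) := rfl
  rw [hK.scal_eq, h1, h3, metricTrace_smul, Calabi.Good.metricTrace_self hn]
  field_simp

end FubiniStudy

end LocalGeometry

namespace AdmissibleParams

variable {ι : Type*} [Fintype ι] (P : AdmissibleParams ι)

/-- The logarithmic derivative of `p_c`. -/
def logDerivPc (z : ℝ) : ℝ :=
  (∑ a, P.d a * P.x a / (1 + P.x a * z)) + P.d₀ / (1 + z) - P.d₁ / (1 - z)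

variable {P}

theorem hasDerivAt_pc (hx : ∀ a, |P.x a| < 1) {z : ℝ} (hz : z ∈ Ioo (-1 : ℝ) 1) :
    HasDerivAt P.pc (P.pc z * P.logDerivPc z) z := by
  have h1 : ∀ a, 1 + P.x a * z ≠ 0 := fun a => (one_add_mul_pos hx a (Ioo_subset_Icc_self hz)).ne'
  have h2 : (1 : ℝ) + z ≠ 0 := by linarith [hz.1]
  have h3 : (1 : ℝ) - z ≠ 0 := by linarith [hz.2]
  have hd : DifferentiableAt ℝ P.pc z := P.contDiff_pc.differentiable (by simp) z
  have hl : ∀ a, HasDerivAt (fun z => 1 + P.x a * z) (P.x a) z := fun a => by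
    simpa using ((hasDerivAt_id z).const_mul (P.x a)).const_add 1
  have hp : HasDerivAt (fun z : ℝ => 1 + z) 1 z := (hasDerivAt_id z).const_add 1
  have hm : HasDerivAt (fun z : ℝ => 1 - z) (-1) z := (hasDerivAt_id z).const_sub 1
  have hlog : logDeriv P.pc z = P.logDerivPc z := by
    have e : P.pc = fun z => (∏ a, (1 + P.x a * z) ^ P.d a) * (1 + z) ^ P.d₀ * (1 - z) ^ P.d₁ := rfl
    have n1 : ∏ a, (1 + P.x a * z) ^ P.d a ≠ 0 :=
      Finset.prod_ne_zero_iff.2 fun a _ => pow_ne_zero _ (h1 a)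
    have d1 : DifferentiableAt ℝ (fun z => ∏ a, (1 + P.x a * z) ^ P.d a) z := by fun_prop
    have d2 : DifferentiableAt ℝ (fun z : ℝ => (1 + z) ^ P.d₀) z := by fun_prop
    have d3 : DifferentiableAt ℝ (fun z : ℝ => (1 - z) ^ P.d₁) z := by fun_prop
    rw [e, logDeriv_mul (f := fun z => (∏ a, (1 + P.x a * z) ^ P.d a) * (1 + z) ^ P.d₀)
      (g := fun z => (1 - z) ^ P.d₁) z (mul_ne_zero n1 (pow_ne_zero _ h2)) (pow_ne_zero _ h3)
      (d1.mul d2) d3, logDeriv_mul (f := fun z => ∏ a, (1 + P.x a * z) ^ P.d a)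
      (g := fun z => (1 + z) ^ P.d₀) z n1 (pow_ne_zero _ h2) d1 d2,
      logDeriv_prod (f := fun a z => (1 + P.x a * z) ^ P.d a) (fun a _ => pow_ne_zero _ (h1 a))
        (fun a _ => by fun_prop),
      logDeriv_fun_pow hp.differentiableAt, logDeriv_fun_pow hm.differentiableAt, logDerivPc,
      logDeriv_apply, logDeriv_apply, hp.deriv, hm.deriv]
    have : ∀ a, logDeriv (fun z => (1 + P.x a * z) ^ P.d a) z
        = P.d a * P.x a / (1 + P.x a * z) := fun a => by
      rw [logDeriv_fun_pow (hl a).differentiableAt, logDeriv_apply, (hl a).deriv]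
      ring
    simp only [this]
    ring
  refine hd.hasDerivAt.congr_deriv ?_
  rw [← hlog, logDeriv_apply, mul_div_cancel₀ _ (pc_pos hx hz).ne']

/-- The equation satisfied by the momentum profile. -/
theorem profile_ode (hx : ∀ a, |P.x a| < 1) {a : ℝ} (ha : 1 < a) {p A₁ A₂ : ℝ}
    (hA : P.SolvesSystem a p A₁ A₂) {Θ L : ℝ → ℝ} (hΘ : ContDiff ℝ ∞ Θ)
    (hF : ∀ z ∈ Ioo (-1 : ℝ) 1, P.F a p A₁ A₂ z = P.pc z * Θ z)
    (hL : ∀ z ∈ Ioo (-1 : ℝ) 1, L z = Θ z * P.logDerivPc z + deriv Θ z)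
    {z : ℝ} (hz : z ∈ Ioo (-1 : ℝ) 1) :
    (z + a) ^ 2 * (2 * P.curvSum z - deriv L z - L z * P.logDerivPc z)
      + 2 * (p - 1) * (z + a) * L z - p * (p - 1) * Θ z = A₁ * z + A₂ := by
  have hode := (F_properties hx ha hA).2.1 z hz
  have hpos : ∀ y ∈ Ioo (-1 : ℝ) 1, 0 < y + a := fun y hy => by linarith [hy.1]
  have hpc : ∀ y ∈ Ioo (-1 : ℝ) 1, P.pc y ≠ 0 := fun y hy => (pc_pos hx hy).ne'
  have hr : ∀ y ∈ Ioo (-1 : ℝ) 1, ∀ q : ℝ,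
      HasDerivAt (fun y => (y + a) ^ q) (q * (y + a) ^ (q - 1)) y := fun y hy q => by
    have h1 : HasDerivAt (fun y : ℝ => y + a) 1 y := (hasDerivAt_id y).add_const a
    simpa using h1.rpow_const (p := q) (Or.inl (hpos y hy).ne')
  have hΘ' : ∀ y, HasDerivAt Θ (deriv Θ y) y := fun y =>
    (hΘ.differentiable (by simp) y).hasDerivAt
  have hpcΘ : ∀ y ∈ Ioo (-1 : ℝ) 1,
      HasDerivAt (fun y => P.pc y * Θ y) (P.pc y * L y) y := fun y hy =>
    ((hasDerivAt_pc hx hy).mul (hΘ' y)).congr_deriv (by rw [hL y hy]; ring)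
  have hLd : DifferentiableAt ℝ L z := by
    have h1 : DifferentiableAt ℝ (fun y => deriv (fun y => P.pc y * Θ y) y / P.pc y) z :=
      (((contDiff_infty_iff_deriv.1 (P.contDiff_pc.mul hΘ)).2).differentiable (by simp) z).div
        (P.contDiff_pc.differentiable (by simp) z) (hpc z hz)
    refine h1.congr_of_eventuallyEq ?_
    filter_upwards [isOpen_Ioo.mem_nhds hz] with y hy
    rw [(hpcΘ y hy).deriv, mul_div_cancel_left₀ _ (hpc y hy)]
  have h1 : (deriv fun w => P.F a p A₁ A₂ w / (w + a) ^ (p - 1))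
      =ᶠ[𝓝 z] fun y => P.pc y * L y * (y + a) ^ (1 - p)
        + P.pc y * Θ y * ((1 - p) * (y + a) ^ (-p)) := by
    filter_upwards [isOpen_Ioo.mem_nhds hz] with y hy
    have h2 := (hpcΘ y hy).mul (hr y hy (1 - p))
    have h3 : (fun w => P.F a p A₁ A₂ w / (w + a) ^ (p - 1))
        =ᶠ[𝓝 y] fun y => P.pc y * Θ y * (y + a) ^ (1 - p) := by
      filter_upwards [isOpen_Ioo.mem_nhds hy] with t ht
      rw [hF t ht, div_eq_mul_inv, ← Real.rpow_neg (hpos t ht).le, neg_sub]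
    rw [h3.deriv_eq]
    refine h2.deriv.trans ?_
    rw [show 1 - p - 1 = -p by ring]
  have h4 := (((hasDerivAt_pc hx hz).mul hLd.hasDerivAt).mul (hr z hz (1 - p))).add
    ((hpcΘ z hz).mul ((hr z hz (-p)).const_mul (1 - p)))
  rw [h1.deriv_eq] at hode
  have h5 := h4.deriv.symm.trans hode
  have hy := hpos z hz
  have e0 : ∀ q : ℝ, (z + a) ^ (q + 1) = (z + a) * (z + a) ^ q := fun q => by
    rw [Real.rpow_add hy, Real.rpow_one, mul_comm]
  have e2 : (z + a) ^ (-p) = (z + a) * (z + a) ^ (-p - 1) := by rw [← e0]; ring_nf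
  have e1 : (z + a) ^ (1 - p) = (z + a) ^ 2 * (z + a) ^ (-p - 1) := by
    rw [sq, mul_assoc, ← e2, ← e0]; ring_nf
  have e3 : ((z + a) ^ (p - 1))⁻¹ = (z + a) ^ 2 * (z + a) ^ (-p - 1) := by
    rw [← Real.rpow_neg hy.le, neg_sub, e1]
  have e4 : ((z + a) ^ (p + 1))⁻¹ = (z + a) ^ (-p - 1) := by
    rw [← Real.rpow_neg hy.le, neg_add, ← sub_eq_add_neg]
  simp only [Pi.mul_apply] at h5
  rw [Q, div_eq_mul_inv, div_eq_mul_inv, e3, e4, show 1 - p - 1 = -p by ring, e1, e2] at h5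
  have h6 : P.pc z * (z + a) ^ (-p - 1) ≠ 0 :=
    mul_ne_zero (hpc z hz) (Real.rpow_pos_of_pos hy _).ne'
  refine mul_left_cancel₀ h6 ?_
  linear_combination -h5

end AdmissibleParams

/-! ### Conformal frames -/

section Frames

variable {B : Type*} [NormedAddCommGroup B] [NormedSpace ℂ B]
  {S : Type*} [TopologicalSpace S] [ChartedSpace B S]
  {r : ℕ} {E : S → Type*} [∀ s, AddCommGroup (E s)] [∀ s, Module ℂ (E s)]

/-- The map from the standard fibre given by a frame. -/
def frameMap (e : Fin r → ∀ s, E s) (s : S) : EuclideanSpace ℂ (Fin r) →ₗ[ℂ] E s where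
  toFun c := ∑ i, c i • e i s
  map_add' c d := by simp [add_smul, Finset.sum_add_distrib]
  map_smul' c d := by simp [Finset.smul_sum, smul_smul]

theorem frameMap_apply (e : Fin r → ∀ s, E s) (s : S) (c : EuclideanSpace ℂ (Fin r)) :
    frameMap e s c = ∑ i, c i • e i s := rfl

/-- The coordinates of a vector in a frame. -/
def frameCoord (e : Fin r → ∀ s, E s) (s : S) (v : E s) : EuclideanSpace ℂ (Fin r) :=
  Function.invFun (frameMap e s) v

variable [∀ s, TopologicalSpace (E s)]
  [TopologicalSpace (TotalSpace (EuclideanSpace ℂ (Fin r)) E)]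
  [FiberBundle (EuclideanSpace ℂ (Fin r)) E]
  {h : ∀ s, E s → ℝ} {U : Set S} {e : Fin r → ∀ s, E s} {φ : S → ℝ}

theorem IsConformalFrame.norm_frameMap (he : IsConformalFrame (B := B) h U e φ) {s : S}
    (hs : s ∈ U) (c : EuclideanSpace ℂ (Fin r)) :
    h s (frameMap e s c) = Real.exp (2 * φ s) * ‖c‖ ^ 2 := by
  rw [EuclideanSpace.norm_sq_eq]
  exact he.norm_sq s hs c

theorem IsConformalFrame.mono (he : IsConformalFrame (B := B) h U e φ) {U' : Set S}
    (hU : U' ⊆ U) : IsConformalFrame (B := B) h U' e φ :=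
  ⟨fun i => (he.holo i).mono hU, he.smooth.mono hU, fun s hs => he.norm_sq s (hU hs)⟩

theorem IsConformalFrame.injective (he : IsConformalFrame (B := B) h U e φ) {s : S}
    (hs : s ∈ U) : Function.Injective (frameMap e s) := by
  refine (injective_iff_map_eq_zero _).2 fun c hc => ?_
  have h1 := he.norm_frameMap hs c
  have h0 := he.norm_frameMap hs 0
  rw [hc] at h1
  rw [map_zero, h1] at h0
  have := (Real.exp_pos (2 * φ s)).ne'
  simpa [this] using h0

variable [VectorBundle ℂ (EuclideanSpace ℂ (Fin r)) E]

theorem IsConformalFrame.bijective (he : IsConformalFrame (B := B) h U e φ) {s : S}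
    (hs : s ∈ U) : Function.Bijective (frameMap e s) := by
  let t := (trivializationAt (EuclideanSpace ℂ (Fin r)) E s).continuousLinearEquivAt ℂ s
    (mem_baseSet_trivializationAt _ _ s)
  have h1 : Function.Injective (t.toLinearEquiv.toLinearMap ∘ₗ frameMap e s) :=
    t.injective.comp (he.injective hs)
  have h2 := LinearMap.injective_iff_surjective.1 h1
  refine ⟨he.injective hs, fun v => ?_⟩
  obtain ⟨c, hc⟩ := h2 (t v)
  exact ⟨c, t.injective hc⟩

theorem IsConformalFrame.frameCoord_frameMap (he : IsConformalFrame (B := B) h U e φ) {s : S}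
    (hs : s ∈ U) (c : EuclideanSpace ℂ (Fin r)) : frameCoord e s (frameMap e s c) = c :=
  Function.leftInverse_invFun (he.injective hs) c

theorem IsConformalFrame.frameMap_frameCoord (he : IsConformalFrame (B := B) h U e φ) {s : S}
    (hs : s ∈ U) (v : E s) : frameMap e s (frameCoord e s v) = v :=
  Function.rightInverse_invFun (he.bijective hs).2 v

theorem IsConformalFrame.norm_smul (he : IsConformalFrame (B := B) h U e φ) {s : S}
    (hs : s ∈ U) (c : ℂ) (v : E s) : h s (c • v) = ‖c‖ ^ 2 * h s v := by
  rw [← he.frameMap_frameCoord hs v, ← map_smul, he.norm_frameMap hs, he.norm_frameMap hs,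
    _root_.norm_smul]
  ring

/-- The matrix of a frame in a trivialization. -/
def frameMatrix (e : Fin r → ∀ s, E s)
    (t : Trivialization (EuclideanSpace ℂ (Fin r))
      (TotalSpace.proj : TotalSpace (EuclideanSpace ℂ (Fin r)) E → S)) (s : S) :
    EuclideanSpace ℂ (Fin r) →L[ℂ] EuclideanSpace ℂ (Fin r) :=
  ∑ i, (EuclideanSpace.proj (𝕜 := ℂ) i).smulRight (t ⟨s, e i s⟩).2

theorem frameMatrix_apply (t : Trivialization (EuclideanSpace ℂ (Fin r))
      (TotalSpace.proj : TotalSpace (EuclideanSpace ℂ (Fin r)) E → S)) [t.IsLinear ℂ] {s : S}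
    (hs : s ∈ t.baseSet) (c : EuclideanSpace ℂ (Fin r)) :
    frameMatrix e t s c = (t ⟨s, frameMap e s c⟩).2 := by
  have hl := t.linear ℂ hs
  have h1 : (t ⟨s, frameMap e s c⟩).2
      = IsLinearMap.mk' (fun y : E s => (t ⟨s, y⟩).2) hl (frameMap e s c) := rfl
  rw [h1, frameMap_apply, map_sum]
  simp [frameMatrix, sum_apply]

theorem IsConformalFrame.contMDiffAt_frameMatrix (he : IsConformalFrame (B := B) h U e φ)
    (hU : IsOpen U) {s : S} (hs : s ∈ U) :
    ContMDiffAt 𝓘(ℂ, B) 𝓘(ℂ, EuclideanSpace ℂ (Fin r) →L[ℂ] EuclideanSpace ℂ (Fin r)) ω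
      (frameMatrix e (trivializationAt (EuclideanSpace ℂ (Fin r)) E s)) s := by
  have h1 : ∀ i, ContMDiffAt 𝓘(ℂ, B) 𝓘(ℂ, EuclideanSpace ℂ (Fin r)) ω
      (fun s' => (trivializationAt (EuclideanSpace ℂ (Fin r)) E s ⟨s', e i s'⟩).2) s := fun i =>
    (contMDiffAt_section s).1 ((he.holo i).contMDiffAt (hU.mem_nhds hs))
  unfold frameMatrix
  refine contMDiffAt_finsetSum fun i _ => ?_
  have h2 : ContDiff ℂ ω fun x : EuclideanSpace ℂ (Fin r) =>
      ((EuclideanSpace.proj (𝕜 := ℂ) i : EuclideanSpace ℂ (Fin r) →L[ℂ] ℂ)).smulRight x :=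
    contDiff_const.smulRight contDiff_id
  exact h2.contMDiff.contMDiffAt.comp s (h1 i)

variable {EN : Type*} [NormedAddCommGroup EN] [NormedSpace ℂ EN] {HN : Type*} [TopologicalSpace HN]
  {IN : ModelWithCorners ℂ EN HN} {N : Type*} [TopologicalSpace N] [ChartedSpace HN N]

theorem IsConformalFrame.contMDiffAt_frameMap (he : IsConformalFrame (B := B) h U e φ)
    (hU : IsOpen U) {f : N → S} {c : N → EuclideanSpace ℂ (Fin r)} {n : N} (hn : f n ∈ U)
    (hf : ContMDiffAt IN 𝓘(ℂ, B) ω f n)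
    (hc : ContMDiffAt IN 𝓘(ℂ, EuclideanSpace ℂ (Fin r)) ω c n) :
    ContMDiffAt IN (𝓘(ℂ, B).prod 𝓘(ℂ, EuclideanSpace ℂ (Fin r))) ω
      (fun n => TotalSpace.mk' (EuclideanSpace ℂ (Fin r)) (f n) (frameMap e (f n) (c n))) n := by
  rw [contMDiffAt_totalSpace]
  refine ⟨hf, ?_⟩
  have h1 := ((he.contMDiffAt_frameMatrix hU hn).comp n hf).clm_apply hc
  refine h1.congr_of_eventuallyEq ?_
  filter_upwards [hf.continuousAt.preimage_mem_nhds
    ((trivializationAt (EuclideanSpace ℂ (Fin r)) E (f n)).open_baseSet.mem_nhds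
      (mem_baseSet_trivializationAt _ _ _))] with n' hn'
  exact (frameMatrix_apply _ hn' _).symm

theorem IsConformalFrame.contMDiffAt_frameCoord (he : IsConformalFrame (B := B) h U e φ)
    (hU : IsOpen U) {σ : N → TotalSpace (EuclideanSpace ℂ (Fin r)) E} {n : N}
    (hn : (σ n).1 ∈ U) (hσ : ContMDiffAt IN (𝓘(ℂ, B).prod 𝓘(ℂ, EuclideanSpace ℂ (Fin r))) ω σ n) :
    ContMDiffAt IN 𝓘(ℂ, EuclideanSpace ℂ (Fin r)) ω
      (fun n => frameCoord e (σ n).1 (σ n).2) n := by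
  rw [contMDiffAt_totalSpace] at hσ
  obtain ⟨h1, h2⟩ := hσ
  set t := trivializationAt (EuclideanSpace ℂ (Fin r)) E (σ n).1 with ht
  have hb : (σ n).1 ∈ t.baseSet := mem_baseSet_trivializationAt _ _ _
  have hM := (he.contMDiffAt_frameMatrix hU hn).comp n h1
  have hinj : ∀ s ∈ U, s ∈ t.baseSet → Function.Injective (frameMatrix e t s) := by
    intro s hs hst
    refine (injective_iff_map_eq_zero _).2 fun c hc => ?_
    rw [frameMatrix_apply t hst] at hc
    refine he.injective hs ?_
    rw [map_zero]
    refine (t.continuousLinearEquivAt ℂ s hst).injective ?_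
    rw [map_zero]
    exact hc
  have hinv : ∀ s ∈ U, s ∈ t.baseSet → (frameMatrix e t s).IsInvertible := fun s hs hst =>
    ⟨(LinearEquiv.ofInjectiveEndo _ (hinj s hs hst)).toContinuousLinearEquiv, by ext; rfl⟩
  have h3 : ContMDiffAt IN 𝓘(ℂ, EuclideanSpace ℂ (Fin r) →L[ℂ] EuclideanSpace ℂ (Fin r)) ω
      (fun n => (frameMatrix e t (σ n).1).inverse) n := by
    have := ((hinv _ hn hb).contDiffAt_map_inverse (n := ω)).contMDiffAt
    exact this.comp n hM
  refine (h3.clm_apply h2).congr_of_eventuallyEq ?_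
  filter_upwards [h1.continuousAt.preimage_mem_nhds (t.open_baseSet.mem_nhds hb),
    h1.continuousAt.preimage_mem_nhds (hU.mem_nhds hn)] with n' hn1 hn2
  have h4 := frameMatrix_apply (e := e) t hn1 (frameCoord e (σ n').1 (σ n').2)
  rw [he.frameMap_frameCoord hn2] at h4
  exact ((hinv _ hn2 hn1).inverse_apply_self _).symm.trans (congrArg _ h4)

end Frames

section ProdBundle

variable {𝕜 : Type*} [NontriviallyNormedField 𝕜] {B : Type*} [NormedAddCommGroup B]
  [NormedSpace 𝕜 B] {S : Type*} [TopologicalSpace S] [ChartedSpace B S]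
  {F₁ F₂ : Type*} [NormedAddCommGroup F₁] [NormedSpace 𝕜 F₁] [NormedAddCommGroup F₂]
  [NormedSpace 𝕜 F₂] {E₁ E₂ : S → Type*}
  [∀ s, AddCommGroup (E₁ s)] [∀ s, Module 𝕜 (E₁ s)] [∀ s, TopologicalSpace (E₁ s)]
  [TopologicalSpace (TotalSpace F₁ E₁)] [FiberBundle F₁ E₁]
  [∀ s, AddCommGroup (E₂ s)] [∀ s, Module 𝕜 (E₂ s)] [∀ s, TopologicalSpace (E₂ s)]
  [TopologicalSpace (TotalSpace F₂ E₂)] [FiberBundle F₂ E₂]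
  {EN : Type*} [NormedAddCommGroup EN] [NormedSpace 𝕜 EN] {HN : Type*} [TopologicalSpace HN]
  {IN : ModelWithCorners 𝕜 EN HN} {N : Type*} [TopologicalSpace N] [ChartedSpace HN N]

theorem contMDiffAt_prodBundle_iff {k : ℕ∞ω} {f : N → TotalSpace (F₁ × F₂) (E₁ ×ᵇ E₂)} {n : N} :
    ContMDiffAt IN (𝓘(𝕜, B).prod 𝓘(𝕜, F₁ × F₂)) k f n ↔
      ContMDiffAt IN (𝓘(𝕜, B).prod 𝓘(𝕜, F₁)) k
        (fun x => TotalSpace.mk' F₁ (f x).1 (f x).2.1) n ∧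
      ContMDiffAt IN (𝓘(𝕜, B).prod 𝓘(𝕜, F₂)) k
        (fun x => TotalSpace.mk' F₂ (f x).1 (f x).2.2) n := by
  rw [contMDiffAt_totalSpace, contMDiffAt_totalSpace, contMDiffAt_totalSpace]
  constructor
  · rintro ⟨h1, h2⟩
    exact ⟨⟨h1, ((ContinuousLinearMap.fst 𝕜 F₁ F₂).contMDiff.contMDiffAt).comp n h2⟩,
      ⟨h1, ((ContinuousLinearMap.snd 𝕜 F₁ F₂).contMDiff.contMDiffAt).comp n h2⟩⟩
  · rintro ⟨⟨h1, h2⟩, -, h3⟩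
    exact ⟨h1, h2.prodMk_space h3⟩

end ProdBundle

namespace LocalGeometry

/-! ### The operator `dd^c` and holomorphic maps -/

section Ddc

variable {V : Type*} [NormedAddCommGroup V] [NormedSpace ℝ V] [NormedSpace ℂ V]
  [IsScalarTower ℝ ℂ V] {W : Type*} [NormedAddCommGroup W] [NormedSpace ℝ W] [NormedSpace ℂ W]
  [IsScalarTower ℝ ℂ W]

/-- `dd^c f` as a bounded bilinear map. -/
def ddcMap (f : V → ℝ) (u : V) : V →L[ℝ] V →L[ℝ] ℝ :=
  (fderiv ℝ (fderiv ℝ f) u).flip.bilinearComp (mulI V) (ContinuousLinearMap.id ℝ V)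
    - (fderiv ℝ (fderiv ℝ f) u).bilinearComp (ContinuousLinearMap.id ℝ V) (mulI V)

theorem ddcMap_apply (f : V → ℝ) (u v w : V) :
    ddcMap f u v w = fderiv ℝ (fderiv ℝ f) u w (Complex.I • v)
      - fderiv ℝ (fderiv ℝ f) u v (Complex.I • w) := rfl

theorem ddcMap_skew (f : V → ℝ) (u v w : V) : ddcMap f u v w = - ddcMap f u w v := by
  rw [ddcMap_apply, ddcMap_apply, neg_sub]

theorem ContDiffAt.ddcMap {f : V → ℝ} {u : V} (hf : ContDiffAt ℝ ∞ f u) :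
    ContDiffAt ℝ ∞ (ddcMap f) u := by
  have h1 : ContDiffAt ℝ ∞ (fderiv ℝ (fderiv ℝ f)) u :=
    (hf.fderiv_right (m := ∞) (by simp)).fderiv_right (m := ∞) (by simp)
  have h2 : ContDiff ℝ ∞ fun b : V →L[ℝ] V →L[ℝ] ℝ =>
      b.flip.bilinearComp (mulI V) (ContinuousLinearMap.id ℝ V)
        - b.bilinearComp (ContinuousLinearMap.id ℝ V) (mulI V) := by
    have h3 : ContDiff ℝ ∞ fun b : V →L[ℝ] V →L[ℝ] ℝ => b.flip :=
      (ContinuousLinearMap.flipₗᵢ ℝ V V ℝ).contDiff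
    have h4 : ∀ A C : V →L[ℝ] V, ContDiff ℝ ∞ fun b : V →L[ℝ] V →L[ℝ] ℝ => b.bilinearComp A C := by
      intro A C
      have h5 : ContDiff ℝ ∞ fun b : V →L[ℝ] V →L[ℝ] ℝ => b.comp A := contDiff_id.clm_comp contDiff_const
      have h6 : ContDiff ℝ ∞ fun b : V →L[ℝ] V →L[ℝ] ℝ => b.flip.comp C :=
        h3.clm_comp contDiff_const
      exact h3.comp (h6.comp h5)
    exact ((h4 _ _).comp h3).sub (h4 _ _)
  exact h2.contDiffAt.comp u h1

theorem ddcMap_congr {f g : V → ℝ} {u : V} (h : f =ᶠ[𝓝 u] g) : ddcMap f u = ddcMap g u := by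
  have : fderiv ℝ (fderiv ℝ f) u = fderiv ℝ (fderiv ℝ g) u := h.fderiv.fderiv_eq
  rw [ddcMap, ddcMap, this]

theorem fderiv_fderiv_add {f g : V → ℝ} {u : V} (hf : ContDiffAt ℝ 2 f u)
    (hg : ContDiffAt ℝ 2 g u) : fderiv ℝ (fderiv ℝ fun x => f x + g x) u
      = fderiv ℝ (fderiv ℝ f) u + fderiv ℝ (fderiv ℝ g) u := by
  have h1 : fderiv ℝ (fun x => f x + g x) =ᶠ[𝓝 u] fun x => fderiv ℝ f x + fderiv ℝ g x := by
    filter_upwards [hf.eventually (by simp), hg.eventually (by simp)] with x h2 h3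
    exact fderiv_fun_add (h2.differentiableAt (by simp)) (h3.differentiableAt (by simp))
  rw [h1.fderiv_eq]
  exact fderiv_fun_add ((hf.fderiv_right (m := 1) (by norm_num)).differentiableAt (by simp))
    ((hg.fderiv_right (m := 1) (by norm_num)).differentiableAt (by simp))

theorem fderiv_fderiv_const_mul {f : V → ℝ} {u : V} (hf : ContDiffAt ℝ 2 f u) (c : ℝ) :
    fderiv ℝ (fderiv ℝ fun x => c * f x) u = c • fderiv ℝ (fderiv ℝ f) u := by
  have h1 : fderiv ℝ (fun x => c * f x) =ᶠ[𝓝 u] fun x => c • fderiv ℝ f x := by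
    filter_upwards [hf.eventually (by simp)] with x h2
    exact fderiv_const_mul (h2.differentiableAt (by simp)) c
  rw [h1.fderiv_eq]
  exact fderiv_fun_const_smul
    ((hf.fderiv_right (m := 1) (by norm_num)).differentiableAt (by simp)) c

theorem ddcMap_add {f g : V → ℝ} {u : V} (hf : ContDiffAt ℝ 2 f u) (hg : ContDiffAt ℝ 2 g u) :
    ddcMap (fun x => f x + g x) u = ddcMap f u + ddcMap g u := by
  ext v w
  simp only [ddcMap_apply, fderiv_fderiv_add hf hg, add_apply]
  ring

theorem ddcMap_const_mul {f : V → ℝ} {u : V} (hf : ContDiffAt ℝ 2 f u) (c : ℝ) :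
    ddcMap (fun x => c * f x) u = c • ddcMap f u := by
  ext v w
  simp only [ddcMap_apply, fderiv_fderiv_const_mul hf, smul_apply, smul_eq_mul]
  ring

theorem ddcMap_const (c : ℝ) (u : V) : ddcMap (fun _ : V => c) u = 0 := by
  ext v w
  have h : fderiv ℝ (fun _ : V => c) = fun _ => 0 := by
    funext x
    exact fderiv_const_apply c
  simp [ddcMap_apply, h]

/-- The derivative of a holomorphic map. -/
theorem fderiv_real_eq {f : V → W} {u : V} (hf : DifferentiableAt ℂ f u) :
    fderiv ℝ f u = (fderiv ℂ f u).restrictScalars ℝ :=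
  (hf.hasFDerivAt.restrictScalars ℝ).fderiv

theorem fderiv_fderiv_comp {V W : Type*} [NormedAddCommGroup V] [NormedSpace ℝ V]
    [NormedAddCommGroup W] [NormedSpace ℝ W] {T : V → W} {K : W → ℝ} {u : V} (hT : ContDiffAt ℝ 2 T u)
    (hK : ContDiffAt ℝ 2 K (T u)) (x y : V) :
    fderiv ℝ (fderiv ℝ fun v => K (T v)) u x y
      = fderiv ℝ (fderiv ℝ K) (T u) (fderiv ℝ T u x) (fderiv ℝ T u y)
        + fderiv ℝ K (T u) (fderiv ℝ (fderiv ℝ T) u x y) := by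
  have h1 : (fderiv ℝ fun v => K (T v)) =ᶠ[𝓝 u] fun v => (fderiv ℝ K (T v)).comp (fderiv ℝ T v) := by
    filter_upwards [hT.eventually (by simp), hT.continuousAt.eventually (hK.eventually (by simp))]
      with v h2 h3
    exact fderiv_comp v (h3.differentiableAt (by simp)) (h2.differentiableAt (by simp))
  have h2 : DifferentiableAt ℝ (fderiv ℝ K) (T u) :=
    (hK.fderiv_right (m := 1) (by norm_num)).differentiableAt (by simp)
  have h3 : DifferentiableAt ℝ (fderiv ℝ T) u :=
    (hT.fderiv_right (m := 1) (by norm_num)).differentiableAt (by simp)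
  have h4 := (h2.hasFDerivAt.comp u (hT.differentiableAt (by simp)).hasFDerivAt).clm_comp
    h3.hasFDerivAt
  rw [h1.fderiv_eq]
  refine (congrArg (fun L => L x y) h4.fderiv).trans ?_
  simp
  ring

/-- `dd^c` commutes with pull-backs by holomorphic maps. -/
theorem ddcMap_comp {T : V → W} {K : W → ℝ} {u : V} (hT : ContDiffAt ℂ ω T u)
    (hK : ContDiffAt ℝ 2 K (T u)) (x y : V) :
    ddcMap (fun v => K (T v)) u x y = ddcMap K (T u) (fderiv ℝ T u x) (fderiv ℝ T u y) := by
  have hT2 : ContDiffAt ℝ 2 T u := (hT.restrict_scalars ℝ).of_le (by simp)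
  have hd : ∀ᶠ v in 𝓝 u, ∀ y, fderiv ℝ T v (Complex.I • y) = Complex.I • fderiv ℝ T v y := by
    filter_upwards [hT.eventually (by simp)] with v hv y
    rw [fderiv_real_eq (hv.differentiableAt (by simp))]
    simp
  have h3 : DifferentiableAt ℝ (fderiv ℝ T) u :=
    (hT2.fderiv_right (m := 1) (by norm_num)).differentiableAt (by simp)
  have h4 : ∀ x y, fderiv ℝ (fderiv ℝ T) u x (Complex.I • y)
      = Complex.I • fderiv ℝ (fderiv ℝ T) u x y := fun x y => by
    rw [← fderiv_apply_const h3, ← fderiv_apply_const h3]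
    have h5 : (fun v => fderiv ℝ T v (Complex.I • y)) =ᶠ[𝓝 u]
        fun v => Complex.I • fderiv ℝ T v y := hd.mono fun v hv => hv y
    rw [h5.fderiv_eq]
    have h6 : DifferentiableAt ℝ (fun v => fderiv ℝ T v y) u := h3.clm_apply (by fun_prop)
    have h7 := ((mulI W).hasFDerivAt.comp u h6.hasFDerivAt).fderiv
    exact congrArg (fun L => L x) h7
  have hs : ∀ x y, fderiv ℝ (fderiv ℝ T) u x y = fderiv ℝ (fderiv ℝ T) u y x :=
    snd_fderiv_symm hT2
  rw [ddcMap_apply, ddcMap_apply, fderiv_fderiv_comp hT2 hK, fderiv_fderiv_comp hT2 hK,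
    hd.self_of_nhds, hd.self_of_nhds, h4, h4, hs y x]
  ring

end Ddc

/-- The real inner product of a complex Euclidean space. -/
def reInner (n : ℕ) :
    EuclideanSpace ℂ (Fin n) →L[ℝ] EuclideanSpace ℂ (Fin n) →L[ℝ] ℝ :=
  LinearMap.toContinuousLinearMap
    { toFun := fun v => Complex.reCLM.comp ((innerSL ℂ v).restrictScalars ℝ)
      map_add' := fun v w => by ext; simp
      map_smul' := fun c v => by
        ext w
        have h : c • v = (c : ℂ) • v := by ext; simp
        change (inner ℂ (c • v) w).re = c * (inner ℂ v w).re
        rw [h, inner_smul_left]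
        simp }

theorem reInner_apply {n : ℕ} (v w : EuclideanSpace ℂ (Fin n)) :
    reInner n v w = (inner ℂ v w).re := rfl

theorem reInner_self {n : ℕ} (v : EuclideanSpace ℂ (Fin n)) : reInner n v v = ‖v‖ ^ 2 := by
  rw [reInner_apply, inner_self_eq_norm_sq_to_K]
  norm_cast

theorem reInner_I {n : ℕ} (v w : EuclideanSpace ℂ (Fin n)) :
    reInner n v (Complex.I • w) = - (inner ℂ v w).im := by
  rw [reInner_apply, inner_smul_right]
  simp

theorem isHermitianInner_reInner (n : ℕ) : IsHermitianInner (reInner n) where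
  symm v w := by
    rw [reInner_apply, reInner_apply, ← inner_conj_symm v w, Complex.conj_re]
  herm v w := by
    rw [reInner_apply, reInner_apply, inner_smul_left, inner_smul_right]
    simp [← mul_assoc]
  pos v hv := by
    rw [reInner_self]
    have := norm_pos_iff.2 hv
    positivity

theorem fsPot_reInner {n : ℕ} (v : EuclideanSpace ℂ (Fin n)) :
    fsPot (reInner n) 0 v = Real.log ‖v‖ := by
  rw [fsPot, reInner_self, zero_add, Real.log_pow]
  push_cast
  ring

theorem fsMetric_reInner {n : ℕ} (v X Y : EuclideanSpace ℂ (Fin n)) :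
    fsMetric (reInner n) 0 v X Y = fubiniStudy v X Y := by
  rcases eq_or_ne v 0 with rfl | hv
  · simp [fsMetric_apply, fubiniStudy]
  have hn : ‖v‖ ≠ 0 := norm_ne_zero_iff.2 hv
  rw [fsMetric_apply, fubiniStudy, reInner_self, reInner_I, reInner_I, reInner_apply, reInner_apply,
    reInner_apply, ← inner_conj_symm X v]
  generalize inner ℂ X Y = a
  generalize inner ℂ v X = b
  generalize inner ℂ v Y = c
  have : ((‖v‖ : ℂ) ^ 2) = ((‖v‖ ^ 2 : ℝ) : ℂ) := by norm_cast
  rw [this, Complex.sub_re, Complex.re_mul_ofReal, Complex.mul_re, Complex.conj_re,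
    Complex.conj_im]
  field_simp
  ring

theorem contDiffAt_log_norm {n : ℕ} {v : EuclideanSpace ℂ (Fin n)} (hv : v ≠ 0) :
    ContDiffAt ℝ ∞ (fun v : EuclideanSpace ℂ (Fin n) => Real.log ‖v‖) v := by
  have h := contDiffAt_fsPot (B := reInner n) (r := 0) (m := v) (by
    rw [reInner_self]
    simpa using hv)
  exact h.congr_of_eventuallyEq (.of_forall fun v => (fsPot_reInner v).symm)

theorem ddcMap_log_norm {n : ℕ} {v : EuclideanSpace ℂ (Fin n)} (hv : v ≠ 0)
    (X Y : EuclideanSpace ℂ (Fin n)) :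
    ddcMap (fun v : EuclideanSpace ℂ (Fin n) => Real.log ‖v‖) v X Y
      = fubiniStudy v (Complex.I • X) Y := by
  have h := (isHermitianInner_reInner n).ddc_fsPot (r := 0) (m := v) (by
    rw [reInner_self]
    simpa using hv) X Y
  rw [fsMetric_reInner] at h
  rw [← h, ddcMap_congr (.of_forall fun v => (fsPot_reInner v).symm)]
  rfl

/-- The logarithm of the absolute value of a holomorphic function is pluriharmonic. -/
theorem ddcMap_log_norm_holomorphic {V : Type*} [NormedAddCommGroup V] [NormedSpace ℝ V]
    [NormedSpace ℂ V] [IsScalarTower ℝ ℂ V] {f : V → ℂ} {u : V} (hf : ContDiffAt ℂ ω f u)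
    (h0 : f u ≠ 0) : ddcMap (fun v => Real.log ‖f v‖) u = 0 := by
  let L : ℂ →L[ℂ] EuclideanSpace ℂ (Fin 1) :=
    (ContinuousLinearMap.id ℂ ℂ).smulRight (EuclideanSpace.single 0 1)
  have hL : ∀ c, L c = c • EuclideanSpace.single (0 : Fin 1) (1 : ℂ) := fun c => rfl
  have hLn : ∀ c, ‖L c‖ = ‖c‖ := fun c => by rw [hL, norm_smul]; simp
  have hT : ContDiffAt ℂ ω (fun v => L (f v)) u := L.contDiff.contDiffAt.comp u hf
  have h1 : L (f u) ≠ 0 := by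
    rw [← norm_ne_zero_iff, hLn]
    exact norm_ne_zero_iff.2 h0
  have h2 : (fun v => Real.log ‖f v‖) = fun v => Real.log ‖L (f v)‖ := by
    funext v
    rw [hLn]
  ext X Y
  rw [h2, ddcMap_comp hT ((contDiffAt_log_norm h1).of_le (by norm_cast)), ddcMap_log_norm h1]
  have h3 : ∀ v : EuclideanSpace ℂ (Fin 1), v = v 0 • EuclideanSpace.single (0 : Fin 1) (1 : ℂ) := by
    intro v
    ext i
    fin_cases i
    simp
  generalize fderiv ℝ (fun v => L (f v)) u X = X'
  generalize fderiv ℝ (fun v => L (f v)) u Y = Y'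
  generalize L (f u) = m
  rw [fubiniStudy, h3 m, h3 X', h3 Y']
  simp only [inner_smul_left, inner_smul_right, norm_smul]
  simp
  left
  have e : ((‖m.ofLp 0‖ : ℂ) ^ 2)
      = (((m.ofLp 0).re * (m.ofLp 0).re + (m.ofLp 0).im * (m.ofLp 0).im : ℝ) : ℂ) := by
    rw [← Complex.normSq_apply, Complex.normSq_eq_norm_sq]
    push_cast
    rfl
  rw [e, Complex.ofReal_im, Complex.ofReal_re]
  ring

theorem contDiffAt_log_norm_holomorphic {V : Type*} [NormedAddCommGroup V] [NormedSpace ℝ V]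
    [NormedSpace ℂ V] [IsScalarTower ℝ ℂ V] {f : V → ℂ} {u : V} (hf : ContDiffAt ℂ ω f u)
    (h0 : f u ≠ 0) : ContDiffAt ℝ ∞ (fun v => Real.log ‖f v‖) u :=
  (((hf.restrict_scalars ℝ).of_le (by simp)).norm ℝ h0).log (norm_ne_zero_iff.2 h0)

end LocalGeometry

/-! ### Homogeneous coordinates on an admissible manifold -/

section Admissible

variable {ι : Type*} [Fintype ι] {P : AdmissibleParams ι}
  {S : Type*} [TopologicalSpace S] [ChartedSpace P.Base S]
  {E₀ E₁ : S → Type*}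
  [∀ s, AddCommGroup (E₀ s)] [∀ s, Module ℂ (E₀ s)] [∀ s, TopologicalSpace (E₀ s)]
  [TopologicalSpace (TotalSpace P.Fib₀ E₀)] [FiberBundle P.Fib₀ E₀]
  [∀ s, AddCommGroup (E₁ s)] [∀ s, Module ℂ (E₁ s)] [∀ s, TopologicalSpace (E₁ s)]
  [TopologicalSpace (TotalSpace P.Fib₁ E₁)] [FiberBundle P.Fib₁ E₁]
  {M : Type*} [TopologicalSpace M] [ChartedSpace P.Tot M]
  [VectorBundle ℂ P.Fib₀ E₀] [VectorBundle ℂ P.Fib₁ E₁]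

open ManifoldGeometry LocalGeometry

namespace AdmissibleData

variable {D : AdmissibleData P E₀ E₁ M} (τ τ' : Gauge P E₀ E₁ D.h₀ D.h₁)

/-- The part of the coordinate space on which `toM` is a submersion. -/
def punctured : Set D.Coord := {p | p.1 ∈ τ.ψ.target ∧ p.2 ≠ 0}

/-- The point of the vector bundle with given coordinates. -/
def lift (p : D.Coord) : TotalSpace (P.Fib₀ × P.Fib₁) (E₀ ×ᵇ E₁) :=
  ⟨τ.ψ.symm p.1, (frameMap τ.e₀ (τ.ψ.symm p.1) p.2.1, frameMap τ.e₁ (τ.ψ.symm p.1) p.2.2)⟩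

/-- The coordinates of a point of the vector bundle. -/
def cod (v : TotalSpace (P.Fib₀ × P.Fib₁) (E₀ ×ᵇ E₁)) : D.Coord :=
  (τ.ψ v.1, frameCoord τ.e₀ v.1 v.2.1, frameCoord τ.e₁ v.1 v.2.2)

theorem toM_eq (p : D.Coord) : D.toM τ p = D.q (lift τ p) := rfl

variable {τ τ'}

theorem isOpen_punctured : IsOpen (punctured τ) :=
  (τ.ψ.open_target.preimage continuous_fst).inter
    (isOpen_ne.preimage continuous_snd)

theorem dom_subset_punctured : D.dom τ ⊆ punctured τ := fun p hp =>
  ⟨hp.1, fun h => hp.2.1 (by rw [h]; rfl)⟩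

theorem isOpen_dom : IsOpen (D.dom τ) :=
  (τ.ψ.open_target.preimage continuous_fst).inter
    ((isOpen_ne.preimage (continuous_fst.comp continuous_snd)).inter
      (isOpen_ne.preimage (continuous_snd.comp continuous_snd)))

theorem symm_mem_source {y : P.Base} (hy : y ∈ τ.ψ.target) : τ.ψ.symm y ∈ τ.ψ.source :=
  τ.ψ.map_target hy

theorem cod_lift {p : D.Coord} (hp : p.1 ∈ τ.ψ.target) : cod τ (lift τ p) = p := by
  have hs := symm_mem_source hp
  refine Prod.ext (τ.ψ.right_inv hp) (Prod.ext ?_ ?_)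
  · exact τ.frame₀.frameCoord_frameMap hs _
  · exact τ.frame₁.frameCoord_frameMap hs _

theorem lift_cod {v : TotalSpace (P.Fib₀ × P.Fib₁) (E₀ ×ᵇ E₁)} (hv : v.1 ∈ τ.ψ.source) :
    lift τ (cod τ v) = v := by
  obtain ⟨s, v⟩ := v
  have h1 : τ.ψ.symm (τ.ψ s) = s := τ.ψ.left_inv hv
  have h2 : ∀ s', s' = s → (⟨s', (frameMap τ.e₀ s' (frameCoord τ.e₀ s v.1),
      frameMap τ.e₁ s' (frameCoord τ.e₁ s v.2))⟩ : TotalSpace (P.Fib₀ × P.Fib₁) (E₀ ×ᵇ E₁))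
      = ⟨s, v⟩ := by
    rintro _ rfl
    rw [τ.frame₀.frameMap_frameCoord hv, τ.frame₁.frameMap_frameCoord hv]
  exact h2 _ h1

theorem lift_ne_zero {p : D.Coord} (hp : p ∈ punctured τ) : (lift τ p).2 ≠ 0 := by
  have hs := symm_mem_source hp.1
  intro h
  refine hp.2 (Prod.ext ?_ ?_)
  · refine τ.frame₀.injective hs ?_
    rw [Prod.fst_zero, map_zero]
    exact congrArg Prod.fst h
  · refine τ.frame₁.injective hs ?_
    rw [Prod.snd_zero, map_zero]
    exact congrArg Prod.snd h

theorem lift_smul (p : D.Coord) (c : ℂ) :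
    lift τ (p.1, c • p.2) = ⟨(lift τ p).1, c • (lift τ p).2⟩ := by
  simp only [lift, Prod.smul_fst, Prod.smul_snd, map_smul]
  rfl

theorem toM_smul {p : D.Coord} (hp : p ∈ punctured τ) {c : ℂ} (hc : c ≠ 0) :
    D.toM τ (p.1, c • p.2) = D.toM τ p := by
  have hp' : ((p.1, c • p.2) : D.Coord) ∈ punctured τ := ⟨hp.1, smul_ne_zero hc hp.2⟩
  rw [toM_eq, toM_eq, eq_comm, D.proj.fibre _ _ (lift_ne_zero hp) (lift_ne_zero hp')]
  exact ⟨c, hc, lift_smul p c⟩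

variable [IsManifold 𝓘(ℂ, P.Base) ω S]

theorem contMDiffAt_lift {p : D.Coord} (hp : p.1 ∈ τ.ψ.target) :
    ContMDiffAt 𝓘(ℂ, D.Coord) (𝓘(ℂ, P.Base).prod 𝓘(ℂ, P.Fib₀ × P.Fib₁)) ω (lift τ) p := by
  have hs := symm_mem_source hp
  have h1 : ContMDiffAt 𝓘(ℂ, D.Coord) 𝓘(ℂ, P.Base) ω (fun p : D.Coord => τ.ψ.symm p.1) p := by
    have h2 := (contMDiffOn_symm_of_mem_maximalAtlas τ.mem_atlas).contMDiffAt
      (τ.ψ.open_target.mem_nhds hp)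
    have h3 : ContMDiffAt 𝓘(ℂ, D.Coord) 𝓘(ℂ, P.Base) ω (Prod.fst : D.Coord → P.Base) p :=
      contDiff_fst.contMDiff.contMDiffAt
    exact h2.comp p h3
  rw [contMDiffAt_prodBundle_iff]
  constructor
  · exact τ.frame₀.contMDiffAt_frameMap τ.ψ.open_source hs h1
      (contDiff_fst.comp contDiff_snd).contMDiff.contMDiffAt
  · exact τ.frame₁.contMDiffAt_frameMap τ.ψ.open_source hs h1
      (contDiff_snd.comp contDiff_snd).contMDiff.contMDiffAt

theorem contMDiffAt_cod {EN : Type*} [NormedAddCommGroup EN] [NormedSpace ℂ EN] {HN : Type*}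
    [TopologicalSpace HN] {IN : ModelWithCorners ℂ EN HN} {N : Type*} [TopologicalSpace N]
    [ChartedSpace HN N] {f : N → TotalSpace (P.Fib₀ × P.Fib₁) (E₀ ×ᵇ E₁)} {n : N}
    (hf : ContMDiffAt IN (𝓘(ℂ, P.Base).prod 𝓘(ℂ, P.Fib₀ × P.Fib₁)) ω f n)
    (hn : (f n).1 ∈ τ.ψ.source) :
    ContMDiffAt IN 𝓘(ℂ, D.Coord) ω (fun n => cod τ (f n)) n := by
  have h1 : ContMDiffAt IN 𝓘(ℂ, P.Base) ω (fun n => τ.ψ (f n).1) n :=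
    ((contMDiffOn_of_mem_maximalAtlas τ.mem_atlas).contMDiffAt
      (τ.ψ.open_source.mem_nhds hn)).comp n (contMDiffAt_totalSpace.1 hf).1
  rw [contMDiffAt_prodBundle_iff] at hf
  exact h1.prodMk_space ((τ.frame₀.contMDiffAt_frameCoord τ.ψ.open_source hn hf.1).prodMk_space
    (τ.frame₁.contMDiffAt_frameCoord τ.ψ.open_source hn hf.2))

theorem contMDiffAt_toM {p : D.Coord} (hp : p ∈ punctured τ) :
    ContMDiffAt 𝓘(ℂ, D.Coord) 𝓘(ℂ, P.Tot) ω (D.toM τ) p := by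
  have h1 := (D.proj.holo (lift τ p) (lift_ne_zero hp)).comp p
    (contMDiffAt_lift hp.1).contMDiffWithinAt (s := punctured τ) fun p' hp' => lift_ne_zero hp'
  exact h1.contMDiffAt (isOpen_punctured.mem_nhds hp)

theorem surjective_mfderiv_toM {p : D.Coord} (hp : p ∈ punctured τ) :
    Function.Surjective (mfderiv 𝓘(ℂ, D.Coord) 𝓘(ℂ, P.Tot) (D.toM τ) p) := by
  have hs := symm_mem_source hp.1
  have h1 : ContMDiffAt (𝓘(ℂ, P.Base).prod 𝓘(ℂ, P.Fib₀ × P.Fib₁)) 𝓘(ℂ, D.Coord) ω (cod τ)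
      (lift τ p) := contMDiffAt_cod contMDiffAt_id hs
  have h2 : D.q =ᶠ[𝓝 (lift τ p)] fun v => D.toM τ (cod τ v) := by
    have h3 : ∀ᶠ v in 𝓝 (lift τ p), v.1 ∈ τ.ψ.source :=
      (contMDiffAt_totalSpace.1 (contMDiffAt_id (n := ω) (I := 𝓘(ℂ, P.Base).prod
        𝓘(ℂ, P.Fib₀ × P.Fib₁)) (x := lift τ p))).1.continuousAt.preimage_mem_nhds
          (τ.ψ.open_source.mem_nhds hs)
    filter_upwards [h3] with v hv
    rw [toM_eq, lift_cod hv]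
  have h4 := D.proj.submersion (lift τ p) (lift_ne_zero hp)
  have hp' : D.toM τ (cod τ (lift τ p)) = D.toM τ p := by rw [cod_lift hp.1]
  have hm : MDifferentiableAt 𝓘(ℂ, D.Coord) 𝓘(ℂ, P.Tot) (D.toM τ) (cod τ (lift τ p)) := by
    rw [cod_lift hp.1]
    exact (contMDiffAt_toM hp).mdifferentiableAt (by simp)
  have h5 := mfderiv_comp (lift τ p) hm (h1.mdifferentiableAt (by simp))
  have h6 := h2.mfderiv_eq (I := 𝓘(ℂ, P.Base).prod 𝓘(ℂ, P.Fib₀ × P.Fib₁)) (I' := 𝓘(ℂ, P.Tot))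
  rw [h6] at h4
  intro w
  obtain ⟨X, hX⟩ := h4 w
  have h7 : ∀ p', p' = p → ∀ Y : D.Coord, (mfderiv 𝓘(ℂ, D.Coord) 𝓘(ℂ, P.Tot) (D.toM τ) p' Y : P.Tot)
      = (mfderiv 𝓘(ℂ, D.Coord) 𝓘(ℂ, P.Tot) (D.toM τ) p Y : P.Tot) := by
    rintro _ rfl Y
    rfl
  refine ⟨mfderiv (𝓘(ℂ, P.Base).prod 𝓘(ℂ, P.Fib₀ × P.Fib₁)) 𝓘(ℂ, D.Coord) (cod τ) (lift τ p) X, ?_⟩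
  refine (h7 _ (cod_lift hp.1) _).symm.trans (Eq.trans ?_ hX)
  exact (congrArg (fun L => L X) h5).symm

end AdmissibleData

end Admissible

section RealStructure

variable {E : Type*} [NormedAddCommGroup E] [NormedSpace ℝ E] [NormedSpace ℂ E]
  [IsScalarTower ℝ ℂ E] {H : Type*} [NormedAddCommGroup H] [NormedSpace ℝ H] [NormedSpace ℂ H]
  [IsScalarTower ℝ ℂ H] {N : Type*} [TopologicalSpace N] [ChartedSpace E N]
  {M : Type*} [TopologicalSpace M] [ChartedSpace H M]

/-- A holomorphic map between complex manifolds is smooth. -/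
theorem ContMDiffAt.real_of_complex {f : N → M} {x : N}
    (hf : ContMDiffAt 𝓘(ℂ, E) 𝓘(ℂ, H) ω f x) : ContMDiffAt 𝓘(ℝ, E) 𝓘(ℝ, H) ∞ f x := by
  rw [contMDiffAt_iff] at hf ⊢
  exact ⟨hf.1, (hf.2.restrict_scalars ℝ).of_le (by simp)⟩

end RealStructure

namespace ManifoldGeometry

section Pullback

variable {V : Type*} [NormedAddCommGroup V] [NormedSpace ℝ V]
  {M : Type*} [TopologicalSpace M] [ChartedSpace V M]
  {X : Type*} [NormedAddCommGroup X] [NormedSpace ℝ X]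
  {Y : Type*} [NormedAddCommGroup Y] [NormedSpace ℝ Y]

theorem pullback_apply (T : Tensor2 V M) (Φ : X → M) (u v w : X) :
    pullback T Φ u v w = T (Φ u) (mfderiv 𝓘(ℝ, X) 𝓘(ℝ, V) Φ u v)
      (mfderiv 𝓘(ℝ, X) 𝓘(ℝ, V) Φ u w) := rfl

theorem pullback_congr (T : Tensor2 V M) {Φ Ψ : X → M} {u : X} (h : Φ =ᶠ[𝓝 u] Ψ) :
    pullback T Φ u = pullback T Ψ u := by
  have h1 : (mfderiv 𝓘(ℝ, X) 𝓘(ℝ, V) Φ u : X →L[ℝ] V) = mfderiv 𝓘(ℝ, X) 𝓘(ℝ, V) Ψ u :=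
    h.mfderiv_eq
  have h2 : ∀ (x y : M) (A B : X →L[ℝ] V), x = y → A = B →
      ContinuousLinearMap.bilinearComp (E := V) (F := V) (G := ℝ) (T x) A A
        = ContinuousLinearMap.bilinearComp (E := V) (F := V) (G := ℝ) (T y) B B := by
    rintro x _ A _ rfl rfl
    rfl
  exact h2 _ _ _ _ h.eq_of_nhds h1

theorem pullback_comp (T : Tensor2 V M) {Φ : Y → M} {f : X → Y} {u : X}
    (hΦ : MDifferentiableAt 𝓘(ℝ, Y) 𝓘(ℝ, V) Φ (f u)) (hf : DifferentiableAt ℝ f u) (v w : X) :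
    pullback T (fun x => Φ (f x)) u v w
      = pullback T Φ (f u) (fderiv ℝ f u v) (fderiv ℝ f u w) := by
  have h1 := mfderiv_comp u hΦ hf.mdifferentiableAt
  rw [mfderiv_eq_fderiv] at h1
  rw [pullback_apply, pullback_apply]
  have h2 : ∀ v : X, (mfderiv 𝓘(ℝ, X) 𝓘(ℝ, V) (fun x => Φ (f x)) u v : V)
      = mfderiv 𝓘(ℝ, Y) 𝓘(ℝ, V) Φ (f u) (fderiv ℝ f u v) := fun v => congrArg (fun L => L v) h1
  exact congrArg₂ (fun a b : V => (T (Φ (f u)) : V →L[ℝ] V →L[ℝ] ℝ) a b) (h2 v) (h2 w)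

end Pullback

section Chart

variable {V : Type*} [NormedAddCommGroup V] [NormedSpace ℝ V] [NormedSpace ℂ V]
  [IsScalarTower ℝ ℂ V] {M : Type*} [TopologicalSpace M] [ChartedSpace V M]
  [IsManifold 𝓘(ℂ, V) ω M]

theorem mdifferentiableAt_chart_symm (x : M) {u : V} (hu : u ∈ (chartAt V x).target) :
    MDifferentiableAt 𝓘(ℝ, V) 𝓘(ℝ, V) (chartAt V x).symm u :=
  ((contMDiffOn_chart_symm (I := 𝓘(ℂ, V)) (n := ω) (x := x)).contMDiffAt
    ((chartAt V x).open_target.mem_nhds hu)).real_of_complex.mdifferentiableAt (by simp)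

theorem mdifferentiableAt_symm_of_mem_maximalAtlas {ψ : OpenPartialHomeomorph M V}
    (hψ : ψ ∈ IsManifold.maximalAtlas 𝓘(ℂ, V) ω M) {u : V} (hu : u ∈ ψ.target) :
    MDifferentiableAt 𝓘(ℝ, V) 𝓘(ℝ, V) ψ.symm u :=
  ((contMDiffOn_symm_of_mem_maximalAtlas hψ).contMDiffAt
    (ψ.open_target.mem_nhds hu)).real_of_complex.mdifferentiableAt (by simp)

end Chart

end ManifoldGeometry

section Admissible

variable {ι : Type*} [Fintype ι] {P : AdmissibleParams ι}
  {S : Type*} [TopologicalSpace S] [ChartedSpace P.Base S]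
  {E₀ E₁ : S → Type*}
  [∀ s, AddCommGroup (E₀ s)] [∀ s, Module ℂ (E₀ s)] [∀ s, TopologicalSpace (E₀ s)]
  [TopologicalSpace (TotalSpace P.Fib₀ E₀)] [FiberBundle P.Fib₀ E₀]
  [∀ s, AddCommGroup (E₁ s)] [∀ s, Module ℂ (E₁ s)] [∀ s, TopologicalSpace (E₁ s)]
  [TopologicalSpace (TotalSpace P.Fib₁ E₁)] [FiberBundle P.Fib₁ E₁]
  {M : Type*} [TopologicalSpace M] [ChartedSpace P.Tot M]
  [VectorBundle ℂ P.Fib₀ E₀] [VectorBundle ℂ P.Fib₁ E₁] [IsManifold 𝓘(ℂ, P.Base) ω S]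
  [IsManifold 𝓘(ℂ, P.Tot) ω M]

open ManifoldGeometry LocalGeometry

namespace AdmissibleData

variable {D : AdmissibleData P E₀ E₁ M} (τ τ' : Gauge P E₀ E₁ D.h₀ D.h₁)

/-- The map to a chart of `M` in homogeneous coordinates. -/
def toChart (x : M) (p : D.Coord) : P.Tot := chartAt P.Tot x (D.toM τ p)

/-- The part of the coordinate space lying over a chart. -/
def overChart (x : M) : Set D.Coord := {p | p ∈ punctured τ ∧ D.toM τ p ∈ (chartAt P.Tot x).source}

variable {τ τ'}

theorem continuousOn_toM : ContinuousOn (D.toM τ) (punctured τ) := fun _ hp =>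
  (contMDiffAt_toM hp).continuousAt.continuousWithinAt

theorem isOpen_overChart (x : M) : IsOpen (overChart τ x) :=
  continuousOn_toM.isOpen_inter_preimage isOpen_punctured (chartAt P.Tot x).open_source

theorem contDiffAt_toChart {x : M} {p : D.Coord} (hp : p ∈ overChart τ x) :
    ContDiffAt ℂ ω (toChart τ x) p := by
  rw [← contMDiffAt_iff_contDiffAt]
  exact ((contMDiffOn_chart (I := 𝓘(ℂ, P.Tot)) (n := ω) (x := x)).contMDiffAt
    ((chartAt P.Tot x).open_source.mem_nhds hp.2)).comp p (contMDiffAt_toM hp.1)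

theorem contDiffAt_real_toChart {x : M} {p : D.Coord} (hp : p ∈ overChart τ x) :
    ContDiffAt ℝ ∞ (toChart τ x) p :=
  ((contDiffAt_toChart hp).restrict_scalars ℝ).of_le (by simp)

theorem surjective_fderiv_toChart {x : M} {p : D.Coord} (hp : p ∈ overChart τ x) :
    Function.Surjective (fderiv ℂ (toChart τ x) p) := by
  have h1 := (mdifferentiable_chart (I := 𝓘(ℂ, P.Tot)) x).mfderiv_surjective hp.2
  have hc : MDifferentiableAt 𝓘(ℂ, P.Tot) 𝓘(ℂ, P.Tot) (chartAt P.Tot x) (D.toM τ p) :=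
    ((contMDiffOn_chart (I := 𝓘(ℂ, P.Tot)) (n := ω) (x := x)).contMDiffAt
      ((chartAt P.Tot x).open_source.mem_nhds hp.2)).mdifferentiableAt (by simp)
  have h2 := mfderiv_comp p hc ((contMDiffAt_toM hp.1).mdifferentiableAt (by simp))
  have h3 : mfderiv 𝓘(ℂ, D.Coord) 𝓘(ℂ, P.Tot) (toChart τ x) p = fderiv ℂ (toChart τ x) p :=
    mfderiv_eq_fderiv
  have h4 := h1.comp (surjective_mfderiv_toM hp.1)
  intro w
  obtain ⟨X, hX⟩ := h4 w
  refine ⟨X, Eq.trans ?_ hX⟩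
  exact (congrArg (fun L => L X) h3).symm.trans (congrArg (fun L => L X) h2)

theorem fderiv_toChart_vertical {x : M} {p : D.Coord} (hp : p ∈ overChart τ x) :
    fderiv ℂ (toChart τ x) p (0, p.2) = 0 := by
  have h1 : HasDerivAt (fun t : ℂ => p + (t - 1) • ((0, p.2) : D.Coord)) (0, p.2) 1 := by
    simpa using ((((hasDerivAt_id (1 : ℂ)).sub_const 1).smul_const
      ((0, p.2) : D.Coord)).const_add p)
  have h2 : HasFDerivAt (toChart τ x) (fderiv ℂ (toChart τ x) p)
      (p + ((1 : ℂ) - 1) • ((0, p.2) : D.Coord)) := by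
    rw [sub_self, zero_smul, add_zero]
    exact ((contDiffAt_toChart hp).differentiableAt (by simp)).hasFDerivAt
  have h3 := h2.comp_hasDerivAt 1 h1
  have h4 : (toChart τ x ∘ fun t : ℂ => p + (t - 1) • ((0, p.2) : D.Coord))
      =ᶠ[𝓝 1] fun _ => toChart τ x p := by
    filter_upwards [isOpen_ne.mem_nhds (one_ne_zero (α := ℂ))] with t ht
    have : p + (t - 1) • ((0, p.2) : D.Coord) = (p.1, t • p.2) := by
      refine Prod.ext (by simp) ?_
      simp [sub_smul]
    rw [Function.comp_apply, this, toChart, toM_smul hp.1 ht, toChart]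
  have h5 := h4.deriv_eq
  rw [h3.deriv, deriv_const] at h5
  exact h5

theorem fderiv_toChart_eq_zero {x : M} {p : D.Coord} (hp : p ∈ overChart τ x) {X : D.Coord}
    (hX : fderiv ℂ (toChart τ x) p X = 0) : ∃ c : ℂ, X = c • (0, p.2) := by
  have h1 := LinearMap.finrank_range_add_finrank_ker (fderiv ℂ (toChart τ x) p).toLinearMap
  rw [LinearMap.range_eq_top.2 (surjective_fderiv_toChart hp), finrank_top] at h1
  have h2 : Module.finrank ℂ D.Coord = (∑ a, P.d a) + ((P.d₀ + 1) + (P.d₁ + 1)) := by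
    rw [Module.finrank_prod, Module.finrank_prod, Module.finrank_pi_fintype]
    simp
  have h3 : Module.finrank ℂ P.Tot = (∑ a, P.d a) + P.d₀ + P.d₁ + 1 := by simp
  have h4 : Module.finrank ℂ (LinearMap.ker (fderiv ℂ (toChart τ x) p).toLinearMap) = 1 := by
    omega
  have hE : ((0, p.2) : D.Coord) ≠ 0 := fun h => hp.1.2 (congrArg Prod.snd h)
  let e : LinearMap.ker (fderiv ℂ (toChart τ x) p).toLinearMap :=
    ⟨(0, p.2), fderiv_toChart_vertical hp⟩
  obtain ⟨c, hc⟩ := (finrank_eq_one_iff_of_nonzero' e (fun h => hE (congrArg Subtype.val h))).1 h4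
    ⟨X, hX⟩
  exact ⟨c, (congrArg Subtype.val hc).symm⟩

theorem fderiv_real_toChart {x : M} {p : D.Coord} (hp : p ∈ overChart τ x) :
    fderiv ℝ (toChart τ x) p = (fderiv ℂ (toChart τ x) p).restrictScalars ℝ :=
  fderiv_real_eq ((contDiffAt_toChart hp).differentiableAt (by simp))

theorem fderiv_toChart_I {x : M} {p : D.Coord} (hp : p ∈ overChart τ x) (X : D.Coord) :
    fderiv ℝ (toChart τ x) p (Complex.I • X) = Complex.I • fderiv ℝ (toChart τ x) p X := by
  rw [fderiv_real_toChart hp]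
  simp

theorem toChart_mem_target {x : M} {p : D.Coord} (hp : p ∈ overChart τ x) :
    toChart τ x p ∈ (chartAt P.Tot x).target := (chartAt P.Tot x).map_source hp.2

theorem symm_toChart {x : M} {p : D.Coord} (hp : p ∈ overChart τ x) :
    (chartAt P.Tot x).symm (toChart τ x p) = D.toM τ p := (chartAt P.Tot x).left_inv hp.2

theorem pullback_toM (T : Tensor2 P.Tot M) {x : M} {p : D.Coord} (hp : p ∈ overChart τ x)
    (X Y : D.Coord) : pullback T (D.toM τ) p X Y
      = inChart T x (toChart τ x p) (fderiv ℝ (toChart τ x) p X)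
          (fderiv ℝ (toChart τ x) p Y) := by
  have h1 : D.toM τ =ᶠ[𝓝 p] fun p => (chartAt P.Tot x).symm (toChart τ x p) := by
    filter_upwards [(isOpen_overChart x).mem_nhds hp] with p' hp'
    exact (symm_toChart hp').symm
  rw [pullback_congr T h1]
  exact pullback_comp T (mdifferentiableAt_chart_symm x (toChart_mem_target hp))
    ((contDiffAt_real_toChart hp).differentiableAt (by simp)) X Y

/-- The map to a chart has local sections. -/
theorem exists_section {x : M} {p : D.Coord} (hp : p ∈ overChart τ x) :
    ∃ σ : P.Tot → D.Coord, σ (toChart τ x p) = p ∧ ContDiffAt ℝ ∞ σ (toChart τ x p) ∧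
      ∀ᶠ u in 𝓝 (toChart τ x p), toChart τ x (σ u) = u := by
  obtain ⟨R, hR⟩ := LinearMap.exists_rightInverse_of_surjective
    (fderiv ℝ (toChart τ x) p).toLinearMap (LinearMap.range_eq_top.2 (by
      rw [fderiv_real_toChart hp]
      exact surjective_fderiv_toChart hp))
  let R' : P.Tot →L[ℝ] D.Coord := LinearMap.toContinuousLinearMap R
  have hR' : ∀ w, fderiv ℝ (toChart τ x) p (R' w) = w := fun w => DFunLike.congr_fun hR w
  let f : P.Tot → P.Tot := fun t => toChart τ x (p + R' t)
  have h0 : p + R' 0 = p := by simp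
  have hf : ContDiffAt ℝ ∞ f 0 := by
    refine ContDiffAt.comp (g := toChart τ x) 0 ?_ (contDiffAt_const.add R'.contDiff.contDiffAt)
    rw [h0]
    exact contDiffAt_real_toChart hp
  have hf' : HasFDerivAt f ((ContinuousLinearEquiv.refl ℝ P.Tot : P.Tot ≃L[ℝ] P.Tot) :
      P.Tot →L[ℝ] P.Tot) 0 := by
    have h1 : HasFDerivAt (toChart τ x) (fderiv ℝ (toChart τ x) p) (p + R' 0) := by
      rw [h0]
      exact ((contDiffAt_real_toChart hp).differentiableAt (by simp)).hasFDerivAt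
    refine (h1.comp 0 (R'.hasFDerivAt.const_add p)).congr_fderiv ?_
    exact ContinuousLinearMap.ext hR'
  have hf0 : f 0 = toChart τ x p := by simp only [f, h0]
  have hstr := hf.hasStrictFDerivAt' hf' (by simp)
  refine ⟨fun u => p + R' (hf.localInverse hf' (by simp) u), ?_, ?_, ?_⟩
  · have h2 := hf.localInverse_apply_image hf' (by simp)
    rw [← hf0]
    beta_reduce
    rw [h2, h0]
  · rw [← hf0]
    exact contDiffAt_const.add
      (R'.contDiff.contDiffAt.comp _ (hf.to_localInverse hf' (by simp)))
  · rw [← hf0]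
    exact hstr.eventually_right_inverse

end AdmissibleData

end Admissible

section FrameDet

variable {B : Type*} [NormedAddCommGroup B] [NormedSpace ℂ B]
  {S : Type*} [TopologicalSpace S] [ChartedSpace B S]
  {r : ℕ} {E : S → Type*} [∀ s, AddCommGroup (E s)] [∀ s, Module ℂ (E s)]
  [∀ s, TopologicalSpace (E s)]
  [TopologicalSpace (TotalSpace (EuclideanSpace ℂ (Fin r)) E)]
  [FiberBundle (EuclideanSpace ℂ (Fin r)) E]
  {h : ∀ s, E s → ℝ} {U U' : Set S} {e e' : Fin r → ∀ s, E s} {φ φ' : S → ℝ}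

/-- The determinant of a change of frames. -/
def frameDet (e e' : Fin r → ∀ s, E s) (s : S) : ℂ :=
  Matrix.det (Matrix.of fun i j => frameCoord e' s (frameMap e s (EuclideanSpace.single j 1)) i)

variable [VectorBundle ℂ (EuclideanSpace ℂ (Fin r)) E]

theorem IsConformalFrame.norm_frameDet (he : IsConformalFrame (B := B) h U e φ)
    (he' : IsConformalFrame (B := B) h U' e' φ') {s : S} (hs : s ∈ U) (hs' : s ∈ U') :
    ‖frameDet e e' s‖ = Real.exp (φ s - φ' s) ^ r := by
  set t : ℝ := Real.exp (φ s - φ' s) with ht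
  have ht0 : 0 < t := Real.exp_pos _
  let A : EuclideanSpace ℂ (Fin r) →ₗ[ℂ] EuclideanSpace ℂ (Fin r) :=
    (LinearEquiv.ofBijective _ (he'.bijective hs')).symm.toLinearMap ∘ₗ frameMap e s
  have hA : ∀ v, A v = frameCoord e' s (frameMap e s v) := fun v => by
    refine he'.injective hs' ?_
    rw [he'.frameMap_frameCoord hs']
    exact LinearEquiv.apply_symm_apply (LinearEquiv.ofBijective _ (he'.bijective hs')) _
  have hn : ∀ v, ‖A v‖ = t * ‖v‖ := fun v => by
    have h1 := he'.norm_frameMap hs' (A v)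
    rw [hA, he'.frameMap_frameCoord hs', he.norm_frameMap hs] at h1
    rw [← hA] at h1
    have h2 : (t * ‖v‖) ^ 2 = ‖A v‖ ^ 2 := by
      have h3 : Real.exp (2 * φ s) = Real.exp (2 * φ' s) * t ^ 2 := by
        rw [ht, ← Real.exp_nat_mul, ← Real.exp_add]
        congr 1
        push_cast
        ring
      have h4 := (Real.exp_pos (2 * φ' s)).ne'
      rw [h3] at h1
      refine mul_left_cancel₀ h4 ?_
      rw [← h1]
      ring
    exact ((pow_left_inj₀ (by positivity) (norm_nonneg _) two_ne_zero).1 h2).symm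
  let L : EuclideanSpace ℂ (Fin r) →ₗᵢ[ℂ] EuclideanSpace ℂ (Fin r) :=
    ⟨((t : ℂ)⁻¹) • A, fun v => by
      rw [LinearMap.smul_apply, _root_.norm_smul, hn, norm_inv, Complex.norm_real, Real.norm_eq_abs,
        abs_of_pos ht0, inv_mul_cancel_left₀ ht0.ne']⟩
  have hLA : ∀ v, A v = (t : ℂ) • L v := fun v => by
    have : (t : ℂ) ≠ 0 := by exact_mod_cast ht0.ne'
    change A v = (t : ℂ) • (t : ℂ)⁻¹ • A v
    rw [smul_inv_smul₀ this]
  have hinner : ∀ v w, inner ℂ (A v) (A w) = (t : ℂ) ^ 2 * inner ℂ v w := fun v w => by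
    rw [hLA, hLA, inner_smul_left, inner_smul_right, L.inner_map_map, Complex.conj_ofReal]
    ring
  set X : Matrix (Fin r) (Fin r) ℂ :=
    Matrix.of fun i j => frameCoord e' s (frameMap e s (EuclideanSpace.single j 1)) i with hX
  have hXA : ∀ i j, X i j = A (EuclideanSpace.single j 1) i := fun i j => by rw [hA]; rfl
  have hXX : X.conjTranspose * X = ((t : ℂ) ^ 2) • (1 : Matrix (Fin r) (Fin r) ℂ) := by
    ext j k
    have h1 := hinner (EuclideanSpace.single j 1) (EuclideanSpace.single k 1)
    rw [PiLp.inner_apply] at h1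
    simp only [Matrix.mul_apply, Matrix.conjTranspose_apply, hXA, Matrix.smul_apply,
      Matrix.one_apply, smul_eq_mul]
    simp only [RCLike.inner_apply, EuclideanSpace.inner_single_left] at h1
    refine (Finset.sum_congr rfl fun i _ => mul_comm _ _).trans (h1.trans ?_)
    simp
  have h2 := congrArg (fun Y => ‖Matrix.det Y‖) hXX
  simp only [Matrix.det_mul, Matrix.det_conjTranspose, Matrix.det_smul, Matrix.det_one,
    norm_mul, norm_star, norm_pow, Complex.norm_real, Real.norm_eq_abs, abs_of_pos ht0,
    Fintype.card_fin, mul_one] at h2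
  refine (pow_left_inj₀ (norm_nonneg _) (by positivity) two_ne_zero).1 ?_
  change ‖X.det‖ ^ 2 = _
  rw [sq, h2]
  ring

theorem IsConformalFrame.frameDet_ne_zero (he : IsConformalFrame (B := B) h U e φ)
    (he' : IsConformalFrame (B := B) h U' e' φ') {s : S} (hs : s ∈ U) (hs' : s ∈ U') :
    frameDet e e' s ≠ 0 := by
  rw [← norm_ne_zero_iff, he.norm_frameDet he' hs hs']
  exact pow_ne_zero _ (Real.exp_pos _).ne'

theorem IsConformalFrame.log_norm_frameDet (he : IsConformalFrame (B := B) h U e φ)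
    (he' : IsConformalFrame (B := B) h U' e' φ') {s : S} (hs : s ∈ U) (hs' : s ∈ U') :
    Real.log ‖frameDet e e' s‖ = r * (φ s - φ' s) := by
  rw [he.norm_frameDet he' hs hs', Real.log_pow, Real.log_exp]

theorem IsConformalFrame.contDiffAt_frameDet {N : Type*} [NormedAddCommGroup N] [NormedSpace ℂ N]
    (he : IsConformalFrame (B := B) h U e φ) (hU : IsOpen U)
    (he' : IsConformalFrame (B := B) h U' e' φ') (hU' : IsOpen U') {f : N → S} {n : N}
    (hf : ContMDiffAt 𝓘(ℂ, N) 𝓘(ℂ, B) ω f n) (hn : f n ∈ U) (hn' : f n ∈ U') :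
    ContDiffAt ℂ ω (fun n => frameDet e e' (f n)) n := by
  have h1 : ∀ i j, ContDiffAt ℂ ω (fun n => frameCoord e' (f n) (frameMap e (f n)
      (EuclideanSpace.single j 1)) i) n := fun i j => by
    have h2 : ContMDiffAt 𝓘(ℂ, N) 𝓘(ℂ, EuclideanSpace ℂ (Fin r)) ω (fun n =>
        frameCoord e' (f n) (frameMap e (f n) (EuclideanSpace.single j 1))) n :=
      he'.contMDiffAt_frameCoord hU'
        (σ := fun n => ⟨f n, frameMap e (f n) (EuclideanSpace.single j 1)⟩) hn'
        (he.contMDiffAt_frameMap hU hn hf contMDiffAt_const)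
    exact (EuclideanSpace.proj (𝕜 := ℂ) i).contDiff.contDiffAt.comp n h2.contDiffAt
  unfold frameDet
  simp only [Matrix.det_apply', Matrix.of_apply]
  exact ContDiffAt.sum fun σ _ => contDiffAt_const.mul (contDiffAt_prod fun i _ => h1 _ _)

end FrameDet

section Admissible

variable {ι : Type*} [Fintype ι] {P : AdmissibleParams ι}
  {S : Type*} [TopologicalSpace S] [ChartedSpace P.Base S]
  {E₀ E₁ : S → Type*}
  [∀ s, AddCommGroup (E₀ s)] [∀ s, Module ℂ (E₀ s)] [∀ s, TopologicalSpace (E₀ s)]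
  [TopologicalSpace (TotalSpace P.Fib₀ E₀)] [FiberBundle P.Fib₀ E₀]
  [∀ s, AddCommGroup (E₁ s)] [∀ s, Module ℂ (E₁ s)] [∀ s, TopologicalSpace (E₁ s)]
  [TopologicalSpace (TotalSpace P.Fib₁ E₁)] [FiberBundle P.Fib₁ E₁]
  {M : Type*} [TopologicalSpace M] [ChartedSpace P.Tot M]
  [VectorBundle ℂ P.Fib₀ E₀] [VectorBundle ℂ P.Fib₁ E₁] [IsManifold 𝓘(ℂ, P.Base) ω S]
  [IsManifold 𝓘(ℂ, P.Tot) ω M]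

open ManifoldGeometry LocalGeometry

namespace AdmissibleData

variable {D : AdmissibleData P E₀ E₁ M} (τ τ' : Gauge P E₀ E₁ D.h₀ D.h₁)

/-- The squared norm of the component in `E₀`. -/
def sq₀ (p : D.Coord) : ℝ := Real.exp (2 * τ.φ₀ (τ.ψ.symm p.1)) * ‖p.2.1‖ ^ 2

/-- The squared norm of the component in `E_∞`. -/
def sq₁ (p : D.Coord) : ℝ := Real.exp (2 * τ.φ₁ (τ.ψ.symm p.1)) * ‖p.2.2‖ ^ 2

/-- The potential of the part of an admissible form which does not come from the base. -/
def pot (p : D.Coord) : ℝ :=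
  Real.log (sq₀ τ p + sq₁ τ p) - τ.φ₀ (τ.ψ.symm p.1) - τ.φ₁ (τ.ψ.symm p.1)

variable {τ τ'}

theorem h₀_lift {p : D.Coord} (hp : p.1 ∈ τ.ψ.target) :
    D.h₀ (lift τ p).1 (lift τ p).2.1 = sq₀ τ p :=
  τ.frame₀.norm_frameMap (symm_mem_source hp) _

theorem h₁_lift {p : D.Coord} (hp : p.1 ∈ τ.ψ.target) :
    D.h₁ (lift τ p).1 (lift τ p).2.2 = sq₁ τ p :=
  τ.frame₁.norm_frameMap (symm_mem_source hp) _

theorem sq_pos {p : D.Coord} (hp : p.2 ≠ 0) : 0 < sq₀ τ p + sq₁ τ p := by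
  have h0 := Real.exp_pos (2 * τ.φ₀ (τ.ψ.symm p.1))
  have h1 := Real.exp_pos (2 * τ.φ₁ (τ.ψ.symm p.1))
  unfold sq₀ sq₁
  by_cases h : p.2.1 = 0
  · have h' : p.2.2 ≠ 0 := fun h' => hp (Prod.ext h h')
    have := norm_pos_iff.2 h'
    positivity
  · have := norm_pos_iff.2 h
    positivity

theorem z_toM {p : D.Coord} (hp : p ∈ punctured τ) :
    D.z (D.toM τ p) = (sq₀ τ p - sq₁ τ p) / (sq₀ τ p + sq₁ τ p) := by
  obtain ⟨hv0, hv⟩ := Classical.choose_spec (D.proj.surj (D.toM τ p))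
  set v := Classical.choose (D.proj.surj (D.toM τ p)) with hvdef
  rw [toM_eq] at hv
  obtain ⟨c, hc, hcv⟩ := (D.proj.fibre _ _ hv0 (lift_ne_zero hp)).1 hv
  have hs : v.1 ∈ τ.ψ.source := by
    have : (lift τ p).1 = v.1 := by rw [hcv]
    rw [← this]
    exact symm_mem_source hp.1
  have e0 : sq₀ τ p = ‖c‖ ^ 2 * D.h₀ v.1 v.2.1 := by
    rw [← h₀_lift hp.1, hcv]
    exact τ.frame₀.norm_smul hs c v.2.1
  have e1 : sq₁ τ p = ‖c‖ ^ 2 * D.h₁ v.1 v.2.2 := by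
    rw [← h₁_lift hp.1, hcv]
    exact τ.frame₁.norm_smul hs c v.2.2
  have hz : D.z (D.toM τ p) = (D.h₀ v.1 v.2.1 - D.h₁ v.1 v.2.2)
    / (D.h₀ v.1 v.2.1 + D.h₁ v.1 v.2.2) := rfl
  have hc2 : ‖c‖ ^ 2 ≠ 0 := pow_ne_zero 2 (norm_ne_zero_iff.2 hc)
  rw [hz, e0, e1, ← mul_sub, ← mul_add, mul_div_mul_left _ _ hc2]

theorem contDiffAt_φ₀ {y : P.Base} (hy : y ∈ τ.ψ.target) :
    ContDiffAt ℝ ∞ (fun y => τ.φ₀ (τ.ψ.symm y)) y := by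
  have h1 := (τ.frame₀.smooth.contMDiffAt (τ.ψ.open_source.mem_nhds (symm_mem_source hy)))
  have h2 := ((contMDiffOn_symm_of_mem_maximalAtlas τ.mem_atlas).contMDiffAt
    (τ.ψ.open_target.mem_nhds hy)).real_of_complex
  exact (h1.comp y h2).contDiffAt

theorem contDiffAt_φ₁ {y : P.Base} (hy : y ∈ τ.ψ.target) :
    ContDiffAt ℝ ∞ (fun y => τ.φ₁ (τ.ψ.symm y)) y := by
  have h1 := (τ.frame₁.smooth.contMDiffAt (τ.ψ.open_source.mem_nhds (symm_mem_source hy)))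
  have h2 := ((contMDiffOn_symm_of_mem_maximalAtlas τ.mem_atlas).contMDiffAt
    (τ.ψ.open_target.mem_nhds hy)).real_of_complex
  exact (h1.comp y h2).contDiffAt

theorem contDiff_norm_sq (n : ℕ) : ContDiff ℝ ∞ fun v : EuclideanSpace ℂ (Fin n) => ‖v‖ ^ 2 := by
  have : (fun v : EuclideanSpace ℂ (Fin n) => ‖v‖ ^ 2) = fun v => reInner n v v :=
    funext fun v => (reInner_self v).symm
  rw [this]
  fun_prop

theorem contDiffAt_sq₀ {p : D.Coord} (hp : p.1 ∈ τ.ψ.target) : ContDiffAt ℝ ∞ (sq₀ τ) p :=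
  ((contDiffAt_const.mul ((contDiffAt_φ₀ hp).comp p contDiffAt_fst)).exp).mul
    ((contDiff_norm_sq _).contDiffAt.comp p (contDiff_fst.comp contDiff_snd).contDiffAt)

theorem contDiffAt_sq₁ {p : D.Coord} (hp : p.1 ∈ τ.ψ.target) : ContDiffAt ℝ ∞ (sq₁ τ) p :=
  ((contDiffAt_const.mul ((contDiffAt_φ₁ hp).comp p contDiffAt_fst)).exp).mul
    ((contDiff_norm_sq _).contDiffAt.comp p (contDiff_snd.comp contDiff_snd).contDiffAt)

theorem contDiffAt_pot {p : D.Coord} (hp : p ∈ punctured τ) : ContDiffAt ℝ ∞ (pot τ) p :=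
  ((((contDiffAt_sq₀ hp.1).add (contDiffAt_sq₁ hp.1)).log (sq_pos hp.2).ne').sub
    ((contDiffAt_φ₀ hp.1).comp p contDiffAt_fst)).sub ((contDiffAt_φ₁ hp.1).comp p contDiffAt_fst)

/-- Two homogeneous coordinate systems are related by holomorphic maps. -/
theorem exists_transition {p p' : D.Coord} (hp : p ∈ punctured τ) (hp' : p' ∈ punctured τ')
    (h : D.toM τ p = D.toM τ' p') :
    ∃ T : D.Coord → D.Coord, ContDiffAt ℂ ω T p ∧ T p = p' ∧
      (∀ᶠ r in 𝓝 p, D.toM τ' (T r) = D.toM τ r) ∧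
      (∀ᶠ r in 𝓝 p, τ'.ψ.symm (T r).1 = τ.ψ.symm r.1) ∧
      ddcMap (fun r => pot τ' (T r)) p = ddcMap (pot τ) p := by
  rw [toM_eq, toM_eq] at h
  obtain ⟨c, hc, hcp⟩ := (D.proj.fibre _ _ (lift_ne_zero hp) (lift_ne_zero hp')).1 h
  have hs' : (lift τ p).1 ∈ τ'.ψ.source := by
    have : (lift τ' p').1 = (lift τ p).1 := by rw [hcp]
    rw [← this]
    exact symm_mem_source hp'.1
  let L : D.Coord →L[ℂ] D.Coord := (ContinuousLinearMap.fst ℂ _ _).prod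
    (c • ContinuousLinearMap.snd ℂ _ _)
  let T : D.Coord → D.Coord := fun r => L (cod τ' (lift τ r))
  have hL : ∀ r, L r = (r.1, c • r.2) := fun r => rfl
  have hT : ContDiffAt ℂ ω T p :=
    L.contDiff.contDiffAt.comp p (contMDiffAt_cod (contMDiffAt_lift hp.1) hs').contDiffAt
  have hsrc : ∀ᶠ r in 𝓝 p, r ∈ punctured τ ∧ (lift τ r).1 ∈ τ'.ψ.source := by
    have h1 : ContinuousAt (fun r : D.Coord => τ.ψ.symm r.1) p :=
      (τ.ψ.symm.continuousAt hp.1).comp continuousAt_fst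
    filter_upwards [isOpen_punctured.mem_nhds hp,
      h1.preimage_mem_nhds (τ'.ψ.open_source.mem_nhds hs')] with r h1 h2 using ⟨h1, h2⟩
  have hlift : ∀ r, (lift τ r).1 ∈ τ'.ψ.source →
      lift τ' (T r) = ⟨(lift τ r).1, c • (lift τ r).2⟩ := fun r hr => by
    have h1 := lift_smul (τ := τ') (cod τ' (lift τ r)) c
    rw [lift_cod hr] at h1
    exact h1
  have hTt : ∀ r, (lift τ r).1 ∈ τ'.ψ.source → (T r).1 ∈ τ'.ψ.target := fun r hr =>
    τ'.ψ.map_source hr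
  have hTp : T p = p' := by
    rw [← cod_lift (τ := τ') (hTt p hs'), hlift p hs', ← hcp, cod_lift hp'.1]
  refine ⟨T, hT, hTp, ?_, ?_, ?_⟩
  · filter_upwards [hsrc] with r hr
    have hne : (lift τ' (T r)).2 ≠ 0 := by
      rw [hlift r hr.2]
      exact smul_ne_zero hc (lift_ne_zero hr.1)
    rw [toM_eq, toM_eq, eq_comm, D.proj.fibre _ _ (lift_ne_zero hr.1) hne]
    exact ⟨c, hc, hlift r hr.2⟩
  · filter_upwards [hsrc] with r hr
    exact congrArg TotalSpace.proj (hlift r hr.2)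
  · let f : D.Coord → S := fun r => τ.ψ.symm r.1
    have hf : ContMDiffAt 𝓘(ℂ, D.Coord) 𝓘(ℂ, P.Base) ω f p :=
      (contMDiffAt_totalSpace.1 (contMDiffAt_lift hp.1)).1
    have hs : f p ∈ τ.ψ.source := symm_mem_source hp.1
    have hd0 := τ.frame₀.contDiffAt_frameDet τ.ψ.open_source τ'.frame₀ τ'.ψ.open_source hf hs hs'
    have hd1 := τ.frame₁.contDiffAt_frameDet τ.ψ.open_source τ'.frame₁ τ'.ψ.open_source hf hs hs'
    have hn0 := τ.frame₀.frameDet_ne_zero τ'.frame₀ hs hs'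
    have hn1 := τ.frame₁.frameDet_ne_zero τ'.frame₁ hs hs'
    have hl0 := (contDiffAt_log_norm_holomorphic hd0 hn0).of_le (m := 2) (by norm_cast)
    have hl1 := (contDiffAt_log_norm_holomorphic hd1 hn1).of_le (m := 2) (by norm_cast)
    have hpot := (contDiffAt_pot hp).of_le (m := 2) (by norm_cast)
    have heq : (fun r => pot τ' (T r)) =ᶠ[𝓝 p] fun r => (pot τ r + Real.log (‖c‖ ^ 2))
        + ((P.d₀ + 1 : ℝ)⁻¹ * Real.log ‖frameDet τ.e₀ τ'.e₀ (f r)‖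
          + (P.d₁ + 1 : ℝ)⁻¹ * Real.log ‖frameDet τ.e₁ τ'.e₁ (f r)‖) := by
      filter_upwards [hsrc] with r hr
      have hr1 : f r ∈ τ.ψ.source := symm_mem_source hr.1.1
      have e0 : sq₀ τ' (T r) = ‖c‖ ^ 2 * sq₀ τ r := by
        rw [← h₀_lift (hTt r hr.2), hlift r hr.2, ← h₀_lift hr.1.1]
        exact τ.frame₀.norm_smul hr1 c _
      have e1 : sq₁ τ' (T r) = ‖c‖ ^ 2 * sq₁ τ r := by
        rw [← h₁_lift (hTt r hr.2), hlift r hr.2, ← h₁_lift hr.1.1]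
        exact τ.frame₁.norm_smul hr1 c _
      have e2 : τ'.ψ.symm (T r).1 = f r := congrArg TotalSpace.proj (hlift r hr.2)
      have hc2 : ‖c‖ ^ 2 ≠ 0 := pow_ne_zero 2 (norm_ne_zero_iff.2 hc)
      have hd₀ : (P.d₀ + 1 : ℝ) ≠ 0 := by positivity
      have hd₁ : (P.d₁ + 1 : ℝ) ≠ 0 := by positivity
      rw [τ.frame₀.log_norm_frameDet τ'.frame₀ hr1 hr.2,
        τ.frame₁.log_norm_frameDet τ'.frame₁ hr1 hr.2]
      push_cast
      rw [inv_mul_cancel_left₀ hd₀, inv_mul_cancel_left₀ hd₁]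
      simp only [pot]
      rw [e0, e1, e2, ← mul_add, Real.log_mul hc2 (sq_pos hr.1.2).ne']
      simp only [f]
      ring
    rw [ddcMap_congr heq, ddcMap_add (hpot.add contDiffAt_const)
      ((contDiffAt_const.mul hl0).add (contDiffAt_const.mul hl1)), ddcMap_add hpot contDiffAt_const,
      ddcMap_add (contDiffAt_const.mul hl0) (contDiffAt_const.mul hl1), ddcMap_const_mul hl0,
      ddcMap_const_mul hl1, ddcMap_log_norm_holomorphic hd0 hn0,
      ddcMap_log_norm_holomorphic hd1 hn1, ddcMap_const]
    simp

end AdmissibleData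

namespace AdmissibleData

variable {D : AdmissibleData P E₀ E₁ M} (τ τ' : Gauge P E₀ E₁ D.h₀ D.h₁)

/-- The projection to the base in homogeneous coordinates. -/
def toBase (p : D.Coord) : S := τ.ψ.symm p.1

/-- The closed form representing the admissible class in homogeneous coordinates. -/
def formMap (p : D.Coord) : D.Coord →L[ℝ] D.Coord →L[ℝ] ℝ :=
  ddcMap (pot τ) p + ∑ a, (P.x a)⁻¹ •
    (pullback (D.g a) τ.ψ.symm p.1).bilinearComp
      ((mulI P.Base).comp (ContinuousLinearMap.fst ℝ _ _)) (ContinuousLinearMap.fst ℝ _ _)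

variable {τ τ'}

theorem formMap_apply (p X Y : D.Coord) : formMap τ p X Y = ddcMap (pot τ) p X Y
    + ∑ a, (P.x a)⁻¹ * pullback (D.g a) τ.ψ.symm p.1 (Complex.I • X.1) Y.1 := by
  simp only [formMap, add_apply, sum_apply, smul_apply, smul_eq_mul]
  rfl

theorem mdifferentiableAt_symm {y : P.Base} (hy : y ∈ τ.ψ.target) :
    MDifferentiableAt 𝓘(ℝ, P.Base) 𝓘(ℝ, P.Base) τ.ψ.symm y :=
  mdifferentiableAt_symm_of_mem_maximalAtlas τ.mem_atlas hy

theorem pullback_toBase (T : Tensor2 P.Base S) {p : D.Coord} (hp : p.1 ∈ τ.ψ.target)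
    (X Y : D.Coord) :
    pullback T (toBase τ) p X Y = pullback T τ.ψ.symm p.1 X.1 Y.1 := by
  have h := pullback_comp T (f := (Prod.fst : D.Coord → P.Base)) (Φ := τ.ψ.symm) (u := p)
    (mdifferentiableAt_symm hp) differentiableAt_fst X Y
  rw [fderiv_fst] at h
  exact h

theorem pot_smul {p : D.Coord} (hp : p.2 ≠ 0) {c : ℂ} (hc : c ≠ 0) :
    pot τ (p.1, c • p.2) = pot τ p + 2 * Real.log ‖c‖ := by
  have e0 : sq₀ τ (p.1, c • p.2) = ‖c‖ ^ 2 * sq₀ τ p := by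
    simp only [sq₀, Prod.smul_fst, norm_smul]
    ring
  have e1 : sq₁ τ (p.1, c • p.2) = ‖c‖ ^ 2 * sq₁ τ p := by
    simp only [sq₁, Prod.smul_snd, norm_smul]
    ring
  have hc2 : ‖c‖ ^ 2 ≠ 0 := pow_ne_zero 2 (norm_ne_zero_iff.2 hc)
  simp only [pot]
  rw [e0, e1, ← mul_add, Real.log_mul hc2 (sq_pos hp).ne', Real.log_pow]
  push_cast
  ring

theorem fderiv_pot_vertical {p : D.Coord} (hp : p ∈ punctured τ) (c : ℂ) :
    fderiv ℝ (pot τ) p (0, c • p.2) = 2 * c.re := by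
  have h1 : HasDerivAt (fun t : ℝ => Complex.exp (t * c)) c 0 := by
    have h := ((Complex.ofRealCLM.hasDerivAt (x := (0 : ℝ))).mul_const c).cexp
    simpa using h
  have h2 : HasDerivAt (fun t : ℝ => ((p.1, Complex.exp (t * c) • p.2) : D.Coord))
      (0, c • p.2) 0 := (hasDerivAt_const (0 : ℝ) p.1).prodMk (h1.smul_const p.2)
  have h0 : ((p.1, Complex.exp ((0 : ℝ) * c) • p.2) : D.Coord) = p := by simp
  have h3 : HasFDerivAt (pot τ) (fderiv ℝ (pot τ) p)
      ((p.1, Complex.exp ((0 : ℝ) * c) • p.2) : D.Coord) := by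
    rw [h0]
    exact ((contDiffAt_pot hp).differentiableAt (by simp)).hasFDerivAt
  have h4 := h3.comp_hasDerivAt (0 : ℝ) h2
  have h5 : (pot τ ∘ fun t : ℝ => ((p.1, Complex.exp (t * c) • p.2) : D.Coord))
      = fun t => pot τ p + 2 * (t * c.re) := by
    funext t
    rw [Function.comp_apply, pot_smul hp.2 (Complex.exp_ne_zero _), Complex.norm_exp, Real.log_exp,
      Complex.re_ofReal_mul]
  rw [h5] at h4
  refine h4.unique ?_
  have h6 := (((hasDerivAt_id (0 : ℝ)).mul_const c.re).const_mul 2).const_add (pot τ p)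
  simpa using h6

theorem fderiv_fderiv_pot_vertical {p : D.Coord} (hp : p ∈ punctured τ) (c : ℂ) (Y : D.Coord) :
    fderiv ℝ (fderiv ℝ (pot τ)) p Y (0, c • p.2) = - fderiv ℝ (pot τ) p (0, c • Y.2) := by
  let L : D.Coord →L[ℝ] D.Coord := (0 : D.Coord →L[ℝ] P.Base).prod
    ((c • ContinuousLinearMap.snd ℂ P.Base (P.Fib₀ × P.Fib₁)).restrictScalars ℝ)
  have hL : ∀ r, L r = (0, c • r.2) := fun r => rfl
  have h1 : HasFDerivAt (fun r => fderiv ℝ (pot τ) r (L r)) _ p :=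
    (((contDiffAt_pot hp).fderiv_right (m := ∞) (by simp)).differentiableAt
      (by simp)).hasFDerivAt.clm_apply L.hasFDerivAt
  have h2 : (fun r => fderiv ℝ (pot τ) r (L r)) =ᶠ[𝓝 p] fun _ => 2 * c.re := by
    filter_upwards [isOpen_punctured.mem_nhds hp] with r hr
    exact fderiv_pot_vertical hr c
  have h3 := h2.fderiv_eq (𝕜 := ℝ)
  rw [h1.fderiv, (hasFDerivAt_const (2 * c.re) p).fderiv] at h3
  have h4 := congrArg (fun A => A Y) h3
  simp only [add_apply, ContinuousLinearMap.comp_apply, ContinuousLinearMap.flip_apply,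
    zero_apply] at h4
  rw [hL, hL] at h4
  linarith

theorem ddcMap_pot_vertical {p : D.Coord} (hp : p ∈ punctured τ) (c : ℂ) (Y : D.Coord) :
    ddcMap (pot τ) p (c • (0, p.2)) Y = 0 := by
  have hs := snd_fderiv_symm ((contDiffAt_pot hp).of_le (m := 2) (by norm_cast))
  have e1 : (c • (0, p.2) : D.Coord) = (0, c • p.2) := Prod.ext (smul_zero c) rfl
  have e2 : (Complex.I • (0, c • p.2) : D.Coord) = (0, (Complex.I * c) • p.2) :=
    Prod.ext (smul_zero _) (smul_smul _ _ _)
  rw [e1, ddcMap_apply, e2, hs (0, c • p.2), fderiv_fderiv_pot_vertical hp,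
    fderiv_fderiv_pot_vertical hp, Prod.smul_snd, smul_smul, mul_comm c, sub_self]

theorem formMap_vertical_left {p : D.Coord} (hp : p ∈ punctured τ) (c : ℂ) (Y : D.Coord) :
    formMap τ p (c • (0, p.2)) Y = 0 := by
  rw [formMap_apply, ddcMap_pot_vertical hp, zero_add]
  refine Finset.sum_eq_zero fun a _ => ?_
  have : (Complex.I • (c • ((0, p.2) : D.Coord)).1 : P.Base) = 0 := by simp
  rw [this, map_zero]
  simp

theorem formMap_vertical_right {p : D.Coord} (hp : p ∈ punctured τ) (c : ℂ) (X : D.Coord) :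
    formMap τ p X (c • (0, p.2)) = 0 := by
  rw [formMap_apply, ddcMap_skew, ddcMap_pot_vertical hp, neg_zero, zero_add]
  refine Finset.sum_eq_zero fun a _ => ?_
  have : ((c • ((0, p.2) : D.Coord)).1 : P.Base) = 0 := by simp
  rw [this, map_zero]
  simp

/-- The form in homogeneous coordinates descends to `M`. -/
theorem formMap_eq_of_toChart_eq {x : M} {p p' : D.Coord} (hp : p ∈ overChart τ x)
    (hp' : p' ∈ overChart τ' x) (h : D.toM τ p = D.toM τ' p') {X Y X' Y' : D.Coord}
    (hX : fderiv ℝ (toChart τ x) p X = fderiv ℝ (toChart τ' x) p' X')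
    (hY : fderiv ℝ (toChart τ x) p Y = fderiv ℝ (toChart τ' x) p' Y') :
    formMap τ p X Y = formMap τ' p' X' Y' := by
  obtain ⟨T, hT, rfl, hM, hB, hpot⟩ := exists_transition hp.1 hp'.1 h
  have hTd : DifferentiableAt ℝ T p := (hT.differentiableAt (by simp)).restrictScalars ℝ
  have hker : ∀ {X X' : D.Coord}, fderiv ℝ (toChart τ x) p X = fderiv ℝ (toChart τ' x) (T p) X' →
      ∃ c : ℂ, X' = fderiv ℝ T p X + c • (0, (T p).2) := by
    intro X X' hX
    have h1 : (fun r => toChart τ' x (T r)) =ᶠ[𝓝 p] toChart τ x := by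
      filter_upwards [hM] with r hr
      exact congrArg _ hr
    have h2 := h1.fderiv_eq (𝕜 := ℝ)
    have h3 : fderiv ℝ (fun r => toChart τ' x (T r)) p
        = (fderiv ℝ (toChart τ' x) (T p)).comp (fderiv ℝ T p) :=
      fderiv_comp (g := toChart τ' x) p
        ((contDiffAt_real_toChart hp').differentiableAt (by simp)) hTd
    rw [h3] at h2
    rw [← h2] at hX
    have h4 : fderiv ℂ (toChart τ' x) (T p) (X' - fderiv ℝ T p X) = 0 := by
      rw [map_sub, sub_eq_zero]
      rw [fderiv_real_toChart hp'] at hX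
      exact hX.symm
    obtain ⟨c, hc⟩ := fderiv_toChart_eq_zero hp' h4
    exact ⟨c, by rw [← hc]; abel⟩
  obtain ⟨c, rfl⟩ := hker hX
  obtain ⟨c', rfl⟩ := hker hY
  have hlin : ∀ A B : D.Coord, formMap τ' (T p) (A + c • (0, (T p).2)) (B + c' • (0, (T p).2))
      = formMap τ' (T p) A B := fun A B => by
    rw [map_add, map_add, add_apply, add_apply, formMap_vertical_left hp'.1,
      formMap_vertical_right hp'.1, formMap_vertical_left hp'.1]
    ring
  have hI : Complex.I • fderiv ℝ T p X = fderiv ℝ T p (Complex.I • X) := by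
    rw [fderiv_real_eq (hT.differentiableAt (by simp))]
    simp
  rw [hlin, formMap_apply, formMap_apply, ← hpot,
    ddcMap_comp hT ((contDiffAt_pot hp'.1).of_le (by norm_cast))]
  congr 1
  refine Finset.sum_congr rfl fun a _ => ?_
  congr 1
  have hb : (fun r => toBase τ' (T r)) =ᶠ[𝓝 p] toBase τ := hB
  have h1 := pullback_comp (D.g a) (Φ := toBase τ') (f := T) (u := p)
    ((mdifferentiableAt_symm (τ := τ') hp'.1.1).comp (T p)
      (differentiableAt_fst (𝕜 := ℝ)).mdifferentiableAt) hTd (Complex.I • X) Y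
  rw [pullback_congr (D.g a) hb, pullback_toBase (D.g a) hp.1.1, pullback_toBase (D.g a) hp'.1.1,
    ← hI] at h1
  exact h1

end AdmissibleData

namespace AdmissibleData

variable {D : AdmissibleData P E₀ E₁ M} {τ τ' : Gauge P E₀ E₁ D.h₀ D.h₁}

/-- The chart of the gauge splits the base as a product of Kähler manifolds with metrics `γ`. -/
structure IsAdapted (τ : Gauge P E₀ E₁ D.h₀ D.h₁)
    (γ : ∀ a, EuclideanSpace ℂ (Fin (P.d a)) →
      EuclideanSpace ℂ (Fin (P.d a)) →L[ℝ] EuclideanSpace ℂ (Fin (P.d a)) →L[ℝ] ℝ) : Prop where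
  pull : ∀ a, ∀ y ∈ τ.ψ.target, ∀ X Y,
    pullback (D.g a) τ.ψ.symm y X Y = γ a (y a) (X a) (Y a)
  smooth : ∀ a, ∀ y ∈ τ.ψ.target, ContDiffAt ℝ ∞ (γ a) (y a)
  symm : ∀ a, ∀ y ∈ τ.ψ.target, ∀ v w, γ a (y a) v w = γ a (y a) w v
  pos : ∀ a, ∀ y ∈ τ.ψ.target, ∀ v, v ≠ 0 → 0 < P.x a * γ a (y a) v v
  herm : ∀ a, ∀ y ∈ τ.ψ.target, ∀ v w,
    γ a (y a) (Complex.I • v) (Complex.I • w) = γ a (y a) v w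
  closed : ∀ a, ∀ y ∈ τ.ψ.target, ∀ v w k, fderiv ℝ (γ a) (y a) v (Complex.I • w) k
    + fderiv ℝ (γ a) (y a) w (Complex.I • k) v + fderiv ℝ (γ a) (y a) k (Complex.I • v) w = 0
  scal_eq : ∀ a, ∀ y ∈ τ.ψ.target, scal (γ a) (y a) = 2 * P.d a * P.s a

variable (D) in
theorem exists_isAdapted (s : S) : ∃ (τ : Gauge P E₀ E₁ D.h₀ D.h₁) (γ : _),
    s ∈ τ.ψ.source ∧ IsAdapted τ γ := by
  obtain ⟨ψ, hψ, hs, hγ⟩ := D.base s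
  choose γ hγ using hγ
  obtain ⟨U₀, e₀, φ₀, hU₀, hs₀, h₀⟩ := D.flat₀ s
  obtain ⟨U₁, e₁, φ₁, hU₁, hs₁, h₁⟩ := D.flat₁ s
  have hU := hU₀.inter hU₁
  have hsrc : (ψ.restr (U₀ ∩ U₁)).source = ψ.source ∩ (U₀ ∩ U₁) := by
    rw [ψ.restr_source, hU.interior_eq]
  let τ : Gauge P E₀ E₁ D.h₀ D.h₁ :=
    { ψ := ψ.restr (U₀ ∩ U₁)
      e₀ := e₀
      e₁ := e₁
      φ₀ := φ₀
      φ₁ := φ₁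
      mem_atlas := restr_mem_maximalAtlas _ hψ hU
      frame₀ := h₀.mono (by rw [hsrc]; exact fun _ h => h.2.1)
      frame₁ := h₁.mono (by rw [hsrc]; exact fun _ h => h.2.2) }
  have ht : ∀ y ∈ τ.ψ.target, y ∈ ψ.target := fun y hy => by
    have := (ψ.restr_target (U₀ ∩ U₁)) ▸ hy
    exact this.1
  refine ⟨τ, γ, ?_, ?_⟩
  · change s ∈ (ψ.restr (U₀ ∩ U₁)).source
    rw [hsrc]
    exact ⟨hs, hs₀, hs₁⟩
  · exact
      { pull := fun a y hy => (hγ a y (ht y hy)).1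
        smooth := fun a y hy => (hγ a y (ht y hy)).2.1
        symm := fun a y hy => (hγ a y (ht y hy)).2.2.1
        pos := fun a y hy => (hγ a y (ht y hy)).2.2.2.1
        herm := fun a y hy => (hγ a y (ht y hy)).2.2.2.2.1
        closed := fun a y hy => (hγ a y (ht y hy)).2.2.2.2.2.1
        scal_eq := fun a y hy => (hγ a y (ht y hy)).2.2.2.2.2.2 }

variable (D) in
theorem exists_coord (x : M) : ∃ (τ : Gauge P E₀ E₁ D.h₀ D.h₁) (γ : _) (p : D.Coord),
    IsAdapted τ γ ∧ p ∈ punctured τ ∧ D.toM τ p = x := by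
  obtain ⟨v, hv, hx⟩ := D.proj.surj x
  obtain ⟨τ, γ, hs, hτ⟩ := D.exists_isAdapted v.1
  have h1 : lift τ (cod τ v) = v := lift_cod hs
  refine ⟨τ, γ, cod τ v, hτ, ⟨τ.ψ.map_source hs, fun h => hv ?_⟩, by rw [toM_eq, h1, hx]⟩
  have h2 : cod τ v = ((cod τ v).1, (0 : ℂ) • (cod τ v).2) := by
    refine Prod.ext rfl ?_
    rw [h]
    exact (smul_zero _).symm
  have h3 := lift_smul (τ := τ) (cod τ v) 0
  rw [← h2, h1] at h3
  rw [h3]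
  exact zero_smul ℂ _

variable (D) in
/-- A family of tensors in homogeneous coordinates which descends to `M`. -/
def IsCompatible (F : Gauge P E₀ E₁ D.h₀ D.h₁ → D.Coord → D.Coord →L[ℝ] D.Coord →L[ℝ] ℝ) : Prop :=
  ∀ (τ τ' : Gauge P E₀ E₁ D.h₀ D.h₁) (x : M) (p p' : D.Coord), p ∈ overChart τ x →
    p' ∈ overChart τ' x → D.toM τ p = D.toM τ' p' → ∀ X Y X' Y' : D.Coord,
    fderiv ℝ (toChart τ x) p X = fderiv ℝ (toChart τ' x) p' X' →
    fderiv ℝ (toChart τ x) p Y = fderiv ℝ (toChart τ' x) p' Y' → F τ p X Y = F τ' p' X' Y'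

theorem surjective_fderiv_real_toChart {x : M} {p : D.Coord} (hp : p ∈ overChart τ x) :
    Function.Surjective (fderiv ℝ (toChart τ x) p) := by
  rw [fderiv_real_toChart hp]
  exact surjective_fderiv_toChart hp

theorem mem_overChart {p : D.Coord} (hp : p ∈ punctured τ) : p ∈ overChart τ (D.toM τ p) :=
  ⟨hp, mem_chart_source _ _⟩

theorem mfderiv_toM {p : D.Coord} (hp : p ∈ punctured τ) (X : D.Coord) :
    (mfderiv 𝓘(ℝ, D.Coord) 𝓘(ℝ, P.Tot) (D.toM τ) p X : P.Tot)
      = fderiv ℝ (toChart τ (D.toM τ p)) p X := by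
  have h : MDifferentiableAt 𝓘(ℝ, D.Coord) 𝓘(ℝ, P.Tot) (D.toM τ) p :=
    (contMDiffAt_toM hp).real_of_complex.mdifferentiableAt (by simp)
  have h1 : fderivWithin ℝ (writtenInExtChartAt 𝓘(ℝ, D.Coord) 𝓘(ℝ, P.Tot) p (D.toM τ))
      (range 𝓘(ℝ, D.Coord)) (extChartAt 𝓘(ℝ, D.Coord) p p)
      = fderiv ℝ (toChart τ (D.toM τ p)) p := by
    simp only [writtenInExtChartAt, mfld_simps, fderivWithin_univ]
    rfl
  exact (congrArg (fun A => A X) h.mfderiv).trans (congrArg (fun A => A X) h1)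

/-- The tensor on `M` with given expressions in homogeneous coordinates. -/
theorem IsCompatible.exists_tensor
    {F : Gauge P E₀ E₁ D.h₀ D.h₁ → D.Coord → D.Coord →L[ℝ] D.Coord →L[ℝ] ℝ}
    (hF : D.IsCompatible F) : ∃ T : Tensor2 P.Tot M, ∀ (τ : Gauge P E₀ E₁ D.h₀ D.h₁),
      ∀ p ∈ punctured τ, ∀ X Y, pullback T (D.toM τ) p X Y = F τ p X Y := by
  have h1 : ∀ x : M, ∃ (B : P.Tot →L[ℝ] P.Tot →L[ℝ] ℝ), ∀ (τ : Gauge P E₀ E₁ D.h₀ D.h₁),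
      ∀ p ∈ punctured τ, D.toM τ p = x → ∀ X Y,
        B (fderiv ℝ (toChart τ x) p X) (fderiv ℝ (toChart τ x) p Y) = F τ p X Y := by
    intro x
    obtain ⟨τ, γ, p, -, hp, rfl⟩ := D.exists_coord x
    have hp' := mem_overChart hp
    obtain ⟨R, hR⟩ := LinearMap.exists_rightInverse_of_surjective
      (fderiv ℝ (toChart τ (D.toM τ p)) p).toLinearMap (LinearMap.range_eq_top.2
        (surjective_fderiv_real_toChart hp'))
    let R' : P.Tot →L[ℝ] D.Coord := LinearMap.toContinuousLinearMap R
    have hR' : ∀ w, fderiv ℝ (toChart τ (D.toM τ p)) p (R' w) = w := fun w => DFunLike.congr_fun hR w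
    refine ⟨(F τ p).bilinearComp R' R', fun τ' p' hp1 hx X Y => ?_⟩
    refine hF τ τ' (D.toM τ p) p p' hp' ⟨hp1, ?_⟩ hx.symm _ _ _ _ (hR' _) (hR' _)
    rw [hx]
    exact mem_chart_source _ _
  choose B hB using h1
  refine ⟨B, fun τ p hp X Y => ?_⟩
  refine Eq.trans ?_ (hB (D.toM τ p) τ p hp rfl X Y)
  exact congrArg₂ (fun a b => B (D.toM τ p) a b) (mfderiv_toM hp X) (mfderiv_toM hp Y)

variable (D) in
theorem isCompatible_formMap : D.IsCompatible formMap :=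
  fun _ _ _ _ _ hp hp' h _ _ _ _ hX hY => formMap_eq_of_toChart_eq hp hp' h hX hY

/-- The momentum map in homogeneous coordinates. -/
def mom (τ : Gauge P E₀ E₁ D.h₀ D.h₁) (p : D.Coord) : ℝ :=
  (sq₀ τ p - sq₁ τ p) / (sq₀ τ p + sq₁ τ p)

theorem contDiffAt_mom {p : D.Coord} (hp : p ∈ punctured τ) : ContDiffAt ℝ ∞ (mom τ) p :=
  ((contDiffAt_sq₀ hp.1).sub (contDiffAt_sq₁ hp.1)).div
    ((contDiffAt_sq₀ hp.1).add (contDiffAt_sq₁ hp.1)) (sq_pos hp.2).ne'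

theorem eventually_z_toM {p : D.Coord} (hp : p ∈ punctured τ) :
    (fun p => D.z (D.toM τ p)) =ᶠ[𝓝 p] mom τ := by
  filter_upwards [isOpen_punctured.mem_nhds hp] with r hr using z_toM hr

variable (D) in
/-- The momentum map in a chart. -/
def zChart (x : M) (u : P.Tot) : ℝ := D.z ((chartAt P.Tot x).symm u)

theorem zChart_toChart {x : M} {p : D.Coord} (hp : p ∈ overChart τ x) :
    D.zChart x (toChart τ x p) = mom τ p := by
  rw [zChart, symm_toChart hp, z_toM hp.1]
  rfl

variable (D) in
theorem exists_overChart {x : M} {u : P.Tot} (hu : u ∈ (chartAt P.Tot x).target) :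
    ∃ (τ : Gauge P E₀ E₁ D.h₀ D.h₁) (γ : _) (p : D.Coord), IsAdapted τ γ ∧ p ∈ overChart τ x ∧
      toChart τ x p = u := by
  obtain ⟨τ, γ, p, hτ, hp, h⟩ := D.exists_coord ((chartAt P.Tot x).symm u)
  refine ⟨τ, γ, p, hτ, ⟨hp, ?_⟩, ?_⟩
  · rw [h]
    exact (chartAt P.Tot x).map_target hu
  · rw [toChart, h, (chartAt P.Tot x).right_inv hu]

theorem contDiffAt_zChart {x : M} {u : P.Tot} (hu : u ∈ (chartAt P.Tot x).target) :
    ContDiffAt ℝ ∞ (D.zChart x) u := by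
  obtain ⟨τ, γ, p, hτ, hp, rfl⟩ := D.exists_overChart hu
  obtain ⟨σ, hσ0, hσ, hσ'⟩ := exists_section hp
  have h1 : ContDiffAt ℝ ∞ (fun u => mom τ (σ u)) (toChart τ x p) := by
    refine ContDiffAt.comp (g := mom τ) _ ?_ hσ
    rw [hσ0]
    exact contDiffAt_mom hp.1
  refine h1.congr_of_eventuallyEq ?_
  have h2 : ∀ᶠ u in 𝓝 (toChart τ x p), σ u ∈ overChart τ x :=
    hσ.continuousAt.preimage_mem_nhds (by
      rw [hσ0]
      exact (isOpen_overChart x).mem_nhds hp)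
  filter_upwards [h2, hσ'] with u h3 h4
  rw [← zChart_toChart h3, h4]

theorem fderiv_mom {x : M} {p : D.Coord} (hp : p ∈ overChart τ x) (X : D.Coord) :
    fderiv ℝ (mom τ) p X = fderiv ℝ (D.zChart x) (toChart τ x p) (fderiv ℝ (toChart τ x) p X) := by
  have h1 : mom τ =ᶠ[𝓝 p] fun p => D.zChart x (toChart τ x p) := by
    filter_upwards [(isOpen_overChart x).mem_nhds hp] with r hr
    exact (zChart_toChart hr).symm
  rw [h1.fderiv_eq]
  have h2 := fderiv_comp (g := D.zChart x) p
    ((contDiffAt_zChart (toChart_mem_target hp)).differentiableAt (by simp))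
    ((contDiffAt_real_toChart hp).differentiableAt (by simp))
  exact congrArg (fun A => A X) h2

/-- The metric with momentum profile `(1 - z²) (1 + (1 - z²) t(z))` in homogeneous coordinates. -/
def metricMap (t : ℝ → ℝ) (τ : Gauge P E₀ E₁ D.h₀ D.h₁) (p : D.Coord) :
    D.Coord →L[ℝ] D.Coord →L[ℝ] ℝ :=
  (formMap τ p).bilinearComp (ContinuousLinearMap.id ℝ _) (mulI D.Coord)
    + t (mom τ p) • ((fderiv ℝ (mom τ) p).comp (mulI D.Coord)).smulRight
      ((fderiv ℝ (mom τ) p).comp (mulI D.Coord))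
    - (t (mom τ p) / (1 + (1 - mom τ p ^ 2) * t (mom τ p))) •
      (fderiv ℝ (mom τ) p).smulRight (fderiv ℝ (mom τ) p)

theorem metricMap_apply (t : ℝ → ℝ) (p X Y : D.Coord) : metricMap t τ p X Y
    = formMap τ p X (Complex.I • Y)
      + t (mom τ p) * (fderiv ℝ (mom τ) p (Complex.I • X) * fderiv ℝ (mom τ) p (Complex.I • Y))
      - t (mom τ p) / (1 + (1 - mom τ p ^ 2) * t (mom τ p))
        * (fderiv ℝ (mom τ) p X * fderiv ℝ (mom τ) p Y) := rfl

variable (D) in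
theorem isCompatible_metricMap (t : ℝ → ℝ) : D.IsCompatible (metricMap t) := by
  intro τ τ' x p p' hp hp' h X Y X' Y' hX hY
  have hu : toChart τ x p = toChart τ' x p' := congrArg _ h
  have hI : ∀ {X X' : D.Coord}, fderiv ℝ (toChart τ x) p X = fderiv ℝ (toChart τ' x) p' X' →
      fderiv ℝ (toChart τ x) p (Complex.I • X) = fderiv ℝ (toChart τ' x) p' (Complex.I • X') := by
    intro X X' hX
    rw [fderiv_toChart_I hp, fderiv_toChart_I hp', hX]
  have hm : mom τ p = mom τ' p' := by rw [← zChart_toChart hp, ← zChart_toChart hp', hu]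
  have hd : ∀ {X X' : D.Coord}, fderiv ℝ (toChart τ x) p X = fderiv ℝ (toChart τ' x) p' X' →
      fderiv ℝ (mom τ) p X = fderiv ℝ (mom τ') p' X' := by
    intro X X' hX
    rw [fderiv_mom hp, fderiv_mom hp', hX, hu]
  rw [metricMap_apply, metricMap_apply, formMap_eq_of_toChart_eq hp hp' h hX (hI hY), hm, hd hX,
    hd hY, hd (hI hX), hd (hI hY)]

variable (D) in
/-- The admissible form. -/
def form : Tensor2 P.Tot M := Classical.choose D.isCompatible_formMap.exists_tensor

variable (D) in
/-- The metric with momentum profile `(1 - z²) (1 + (1 - z²) t(z))`. -/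
def metric (t : ℝ → ℝ) : Tensor2 P.Tot M :=
  Classical.choose (D.isCompatible_metricMap t).exists_tensor

theorem pullback_form {p : D.Coord} (hp : p ∈ punctured τ) (X Y : D.Coord) :
    pullback D.form (D.toM τ) p X Y = formMap τ p X Y :=
  Classical.choose_spec D.isCompatible_formMap.exists_tensor τ p hp X Y

theorem pullback_metric (t : ℝ → ℝ) {p : D.Coord} (hp : p ∈ punctured τ) (X Y : D.Coord) :
    pullback (D.metric t) (D.toM τ) p X Y = metricMap t τ p X Y :=
  Classical.choose_spec (D.isCompatible_metricMap t).exists_tensor τ p hp X Y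

theorem inChart_form {x : M} {p : D.Coord} (hp : p ∈ overChart τ x) (X Y : D.Coord) :
    inChart D.form x (toChart τ x p) (fderiv ℝ (toChart τ x) p X) (fderiv ℝ (toChart τ x) p Y)
      = formMap τ p X Y := by
  rw [← pullback_toM _ hp, pullback_form hp.1]

theorem inChart_metric (t : ℝ → ℝ) {x : M} {p : D.Coord} (hp : p ∈ overChart τ x) (X Y : D.Coord) :
    inChart (D.metric t) x (toChart τ x p) (fderiv ℝ (toChart τ x) p X)
      (fderiv ℝ (toChart τ x) p Y) = metricMap t τ p X Y := by
  rw [← pullback_toM _ hp, pullback_metric t hp.1]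

/-- A tensor is smooth in a chart if it is smooth in homogeneous coordinates. -/
theorem contDiffAt_inChart {T : Tensor2 P.Tot M} {x : M} {p : D.Coord} (hp : p ∈ overChart τ x)
    {F : D.Coord → D.Coord →L[ℝ] D.Coord →L[ℝ] ℝ} (hF : ContDiffAt ℝ ∞ F p)
    (hT : ∀ p ∈ overChart τ x, ∀ X Y, pullback T (D.toM τ) p X Y = F p X Y) :
    ContDiffAt ℝ ∞ (inChart T x) (toChart τ x p) := by
  obtain ⟨σ, hσ0, hσ, hσ'⟩ := exists_section hp
  have h1 : ContDiffAt ℝ ∞ (fun u => F (σ u)) (toChart τ x p) := by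
    refine ContDiffAt.comp (g := F) _ ?_ hσ
    rw [hσ0]
    exact hF
  have hd : ContDiffAt ℝ ∞ (fderiv ℝ σ) (toChart τ x p) := hσ.fderiv_right (m := ∞) (by simp)
  have h2 : ContDiffAt ℝ ∞ (fun u => (F (σ u)).bilinearComp (fderiv ℝ σ u) (fderiv ℝ σ u))
      (toChart τ x p) := by
    have h4 : ContDiffAt ℝ ∞ (fun u => ((F (σ u)).comp (fderiv ℝ σ u)).flip) (toChart τ x p) :=
      (ContinuousLinearMap.flipₗᵢ ℝ P.Tot D.Coord ℝ).contDiff.contDiffAt.comp _ (h1.clm_comp hd)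
    exact (ContinuousLinearMap.flipₗᵢ ℝ P.Tot P.Tot ℝ).contDiff.contDiffAt.comp _ (h4.clm_comp hd)
  refine h2.congr_of_eventuallyEq ?_
  have h5 : ∀ᶠ u in 𝓝 (toChart τ x p), σ u ∈ overChart τ x :=
    hσ.continuousAt.preimage_mem_nhds (by
      rw [hσ0]
      exact (isOpen_overChart x).mem_nhds hp)
  have h6 : ∀ᶠ u in 𝓝 (toChart τ x p), DifferentiableAt ℝ σ u := by
    filter_upwards [eventually_contDiffAt_two hσ] with u h using h.differentiableAt (by simp)
  filter_upwards [h5, h6, hσ'.eventually_nhds] with u h5 h6 h7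
  have h8 : ∀ X, fderiv ℝ (toChart τ x) (σ u) (fderiv ℝ σ u X) = X := fun X => by
    have h9 : HasFDerivAt (fun u => toChart τ x (σ u)) _ u :=
      ((contDiffAt_real_toChart h5).differentiableAt (by simp)).hasFDerivAt.comp u h6.hasFDerivAt
    have h10 : (fun u => toChart τ x (σ u)) =ᶠ[𝓝 u] id := h7
    have h11 := h10.fderiv_eq (𝕜 := ℝ)
    rw [h9.fderiv, fderiv_id] at h11
    exact congrArg (fun A => A X) h11
  refine ContinuousLinearMap.ext fun X => ContinuousLinearMap.ext fun Y => ?_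
  have h12 := pullback_toM T h5 (fderiv ℝ σ u X) (fderiv ℝ σ u Y)
  rw [hT _ h5, h8, h8, h7.self_of_nhds] at h12
  exact h12.symm

end AdmissibleData

end Admissible

namespace LocalGeometry

section

variable {V : Type*} [NormedAddCommGroup V] [NormedSpace ℝ V] {W : Type*} [NormedAddCommGroup W]
  [NormedSpace ℝ W]

theorem contDiff_bilinearComp (A B : V →L[ℝ] W) :
    ContDiff ℝ ∞ fun b : W →L[ℝ] W →L[ℝ] ℝ => b.bilinearComp A B := by
  have h1 : ContDiff ℝ ∞ fun b : W →L[ℝ] W →L[ℝ] ℝ => (b.comp A).flip :=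
    (ContinuousLinearMap.flipₗᵢ ℝ V W ℝ).contDiff.comp (contDiff_id.clm_comp contDiff_const)
  exact (ContinuousLinearMap.flipₗᵢ ℝ V V ℝ).contDiff.comp (h1.clm_comp contDiff_const)

theorem fderiv_fderiv_real {k : ℝ → ℝ} {t : ℝ} (hk : ContDiffAt ℝ 2 k t) (a b : ℝ) :
    fderiv ℝ (fderiv ℝ k) t a b = deriv (deriv k) t * (a * b) := by
  have h1 : DifferentiableAt ℝ (fderiv ℝ k) t :=
    (hk.fderiv_right (m := 1) (by norm_num)).differentiableAt (by simp)
  have h3 : HasFDerivAt (fun s => fderiv ℝ k s b) _ t :=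
    h1.hasFDerivAt.clm_apply (hasFDerivAt_const b t)
  have h4 : HasFDerivAt (fun s => fderiv ℝ k s 1) _ t :=
    h1.hasFDerivAt.clm_apply (hasFDerivAt_const 1 t)
  have h5 : deriv (deriv k) t = fderiv ℝ (fderiv ℝ k) t 1 1 := by
    have h6 : deriv k = fun s => fderiv ℝ k s 1 := funext fun s => rfl
    rw [h6, ← fderiv_apply_one_eq_deriv, h4.fderiv]
    simp
  have ha : a = a • (1 : ℝ) := by simp
  have hb : b = b • (1 : ℝ) := by simp
  rw [h5, ha, hb, map_smul, map_smul, smul_apply]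
  simp only [smul_eq_mul, mul_one]
  ring

variable [NormedSpace ℂ V] [IsScalarTower ℝ ℂ V]

theorem ddcMap_scalar_comp {k : ℝ → ℝ} {f : V → ℝ} {u : V} (hf : ContDiffAt ℝ 2 f u)
    (hk : ContDiffAt ℝ 2 k (f u)) (X Y : V) :
    ddcMap (fun v => k (f v)) u X Y = deriv k (f u) * ddcMap f u X Y
      + deriv (deriv k) (f u) * (fderiv ℝ f u Y * fderiv ℝ f u (Complex.I • X)
        - fderiv ℝ f u X * fderiv ℝ f u (Complex.I • Y)) := by
  rw [ddcMap_apply, ddcMap_apply, fderiv_fderiv_comp hf hk, fderiv_fderiv_comp hf hk,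
    fderiv_fderiv_real hk, fderiv_fderiv_real hk, fderiv_eq_smul_deriv, fderiv_eq_smul_deriv]
  simp only [smul_eq_mul]
  ring

/-- The second derivative of a function vanishing to second order along the kernel of a linear
map. -/
theorem fderiv_fderiv_log_one_add {n : ℕ} (L : V →L[ℝ] EuclideanSpace ℂ (Fin n)) {e : V → ℝ}
    {u : V} (he : ContDiffAt ℝ ∞ e u) (hu : L u = 0) (h0 : ∀ᶠ v in 𝓝 u, 0 ≤ e v) (X Y : V) :
    fderiv ℝ (fderiv ℝ fun v => Real.log (1 + e v * ‖L v‖ ^ 2)) u X Y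
      = 2 * e u * reInner n (L X) (L Y) := by
  set N : V → ℝ := fun v => ‖L v‖ ^ 2 with hNdef
  have hN : ∀ v, HasFDerivAt N ((2 : ℝ) • (reInner n (L v)).comp L) v := fun v => by
    have h1 : HasFDerivAt (fun v => reInner n (L v) (L v)) _ v :=
      ((reInner n).hasFDerivAt.comp v L.hasFDerivAt).clm_apply L.hasFDerivAt
    have h2 : N = fun v => reInner n (L v) (L v) := funext fun v => (reInner_self _).symm
    rw [h2]
    refine h1.congr_fderiv (ContinuousLinearMap.ext fun Y => ?_)
    simp only [add_apply, smul_apply, ContinuousLinearMap.comp_apply,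
      ContinuousLinearMap.flip_apply, smul_eq_mul]
    rw [(isHermitianInner_reInner n).symm (L Y) (L v), Function.comp_apply]
    ring
  have hNu : N u = 0 := by simp [hNdef, hu]
  have hpos : ∀ᶠ v in 𝓝 u, 0 < 1 + e v * N v := h0.mono fun v hv => by
    have : 0 ≤ N v := by positivity
    positivity
  set a : V → ℝ := fun v => e v / (1 + e v * N v) with ha
  set b : V → V →L[ℝ] ℝ := fun v => (1 + e v * N v)⁻¹ • fderiv ℝ e v with hb
  have heN : DifferentiableAt ℝ (fun v => 1 + e v * N v) u :=
    (differentiableAt_const _).add ((he.differentiableAt (by simp)).mul (hN u).differentiableAt)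
  set a : V → ℝ := fun v => e v * (1 + e v * N v)⁻¹ with ha
  set b : V → ℝ := fun v => (1 + e v * N v)⁻¹ * fderiv ℝ e v Y with hb
  have hde : DifferentiableAt ℝ (fderiv ℝ e) u :=
    (he.fderiv_right (m := ∞) (by simp)).differentiableAt (by simp)
  have heN : DifferentiableAt ℝ (fun v => (1 + e v * N v)⁻¹) u :=
    ((differentiableAt_const _).add
      ((he.differentiableAt (by simp)).mul (hN u).differentiableAt)).inv hpos.self_of_nhds.ne'
  have hda : DifferentiableAt ℝ a u := (he.differentiableAt (by simp)).mul heN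
  have hdb : DifferentiableAt ℝ b u := heN.mul (hde.clm_apply (differentiableAt_const Y))
  have h1 : (fun v => fderiv ℝ (fun v => Real.log (1 + e v * N v)) v Y)
      =ᶠ[𝓝 u] fun v => a v * (2 * reInner n (L v) (L Y)) + N v * b v := by
    filter_upwards [hpos, eventually_contDiffAt_two he] with v hv hev
    have h2 : HasFDerivAt (fun v => Real.log (1 + e v * N v)) _ v :=
      ((((hev.differentiableAt (by simp)).hasFDerivAt.mul (hN v)).const_add 1).log hv.ne')
    rw [h2.fderiv]
    simp only [add_apply, smul_apply, smul_eq_mul, ha, hb, Pi.mul_apply,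
      ContinuousLinearMap.comp_apply]
    ring
  have h3 : HasFDerivAt (fun v => 2 * reInner n (L v) (L Y))
      ((2 : ℝ) • ((reInner n).flip (L Y)).comp L) u :=
    (((reInner n).flip (L Y)).hasFDerivAt.comp u L.hasFDerivAt).const_mul 2
  have h4 := (hda.hasFDerivAt.mul h3).add ((hN u).mul hdb.hasFDerivAt)
  have h5 : DifferentiableAt ℝ (fderiv ℝ fun v => Real.log (1 + e v * N v)) u := by
    have h6 : ContDiffAt ℝ ∞ (fun v => Real.log (1 + e v * N v)) u := by
      refine ContDiffAt.log (contDiffAt_const.add (he.mul ?_)) hpos.self_of_nhds.ne'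
      have : N = fun v => reInner n (L v) (L v) := funext fun v => (reInner_self _).symm
      rw [this]
      fun_prop
    exact (h6.fderiv_right (m := ∞) (by simp)).differentiableAt (by simp)
  have h7 : HasFDerivAt (fun v => fderiv ℝ (fun v => Real.log (1 + e v * N v)) v Y) _ u :=
    h5.hasFDerivAt.clm_apply (hasFDerivAt_const Y u)
  have h8 := h7.fderiv.symm.trans (h1.fderiv_eq.trans h4.fderiv)
  have h9 := congrArg (fun T => T X) h8
  simp only [add_apply, smul_apply, smul_eq_mul, ContinuousLinearMap.comp_apply,
    ContinuousLinearMap.flip_apply, zero_apply, map_zero, hu, hNu, zero_mul, mul_zero, add_zero,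
    zero_add] at h9
  rw [h9]
  simp only [ha, hNu, mul_zero, add_zero, inv_one, mul_one]
  ring

theorem ddcMap_log_one_add {n : ℕ} (L : V →L[ℝ] EuclideanSpace ℂ (Fin n))
    (hL : ∀ v, L (Complex.I • v) = Complex.I • L v) {e : V → ℝ}
    {u : V} (he : ContDiffAt ℝ ∞ e u) (hu : L u = 0) (h0 : ∀ᶠ v in 𝓝 u, 0 ≤ e v) (X : V) :
    ddcMap (fun v => Real.log (1 + e v * ‖L v‖ ^ 2)) u X (Complex.I • X)
      = 4 * e u * ‖L X‖ ^ 2 := by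
  rw [ddcMap_apply, fderiv_fderiv_log_one_add L he hu h0, fderiv_fderiv_log_one_add L he hu h0,
    hL, hL, hL, (isHermitianInner_reInner n).herm, ← reInner_self]
  have : Complex.I • Complex.I • L X = -L X := by
    rw [smul_smul, Complex.I_mul_I, neg_one_smul]
  rw [this, map_neg]
  ring

end

theorem fubiniStudy_self {n : ℕ} (v X : EuclideanSpace ℂ (Fin n)) :
    fubiniStudy v X X = 2 * (‖X‖ ^ 2 * ‖v‖ ^ 2 - ‖inner ℂ v X‖ ^ 2) / ‖v‖ ^ 4 := by
  rw [fubiniStudy, inner_self_eq_norm_sq_to_K]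
  congr 2
  have h1 : inner ℂ X v * inner ℂ v X = ((‖(inner ℂ v X : ℂ)‖ ^ 2 : ℝ) : ℂ) := by
    rw [← inner_conj_symm X v, Complex.ofReal_pow]
    exact Complex.conj_mul' _
  rw [h1, Complex.sub_re, Complex.ofReal_re]
  congr 1
  simp only [Complex.coe_algebraMap, ← Complex.ofReal_pow, ← Complex.ofReal_mul, Complex.ofReal_re]

theorem fubiniStudy_nonneg {n : ℕ} (v X : EuclideanSpace ℂ (Fin n)) : 0 ≤ fubiniStudy v X X := by
  rw [fubiniStudy_self]
  have h1 : ‖(inner ℂ v X : ℂ)‖ ^ 2 ≤ (‖v‖ * ‖X‖) ^ 2 :=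
    pow_le_pow_left₀ (norm_nonneg _) (norm_inner_le_norm v X) 2
  have : 0 ≤ ‖X‖ ^ 2 * ‖v‖ ^ 2 - ‖(inner ℂ v X : ℂ)‖ ^ 2 := by nlinarith
  positivity

theorem exists_smul_of_fubiniStudy_eq_zero {n : ℕ} {v X : EuclideanSpace ℂ (Fin n)} (hv : v ≠ 0)
    (h : fubiniStudy v X X = 0) : ∃ c : ℂ, X = c • v := by
  have hv' : ‖v‖ ≠ 0 := norm_ne_zero_iff.2 hv
  rcases eq_or_ne X 0 with rfl | hX
  · exact ⟨0, by simp⟩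
  rw [fubiniStudy_self, div_eq_zero_iff, or_iff_left (pow_ne_zero 4 hv')] at h
  have h1 : ‖(inner ℂ v X : ℂ)‖ ^ 2 = (‖v‖ * ‖X‖) ^ 2 := by linarith
  have h2 := (pow_left_inj₀ (norm_nonneg _) (by positivity) two_ne_zero).1 h1
  obtain ⟨c, -, hc⟩ := (norm_inner_eq_norm_iff hv hX).1 h2
  exact ⟨c, hc⟩

end LocalGeometry

section Admissible

variable {ι : Type*} [Fintype ι] {P : AdmissibleParams ι}
  {S : Type*} [TopologicalSpace S] [ChartedSpace P.Base S]
  {E₀ E₁ : S → Type*}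
  [∀ s, AddCommGroup (E₀ s)] [∀ s, Module ℂ (E₀ s)] [∀ s, TopologicalSpace (E₀ s)]
  [TopologicalSpace (TotalSpace P.Fib₀ E₀)] [FiberBundle P.Fib₀ E₀]
  [∀ s, AddCommGroup (E₁ s)] [∀ s, Module ℂ (E₁ s)] [∀ s, TopologicalSpace (E₁ s)]
  [TopologicalSpace (TotalSpace P.Fib₁ E₁)] [FiberBundle P.Fib₁ E₁]
  {M : Type*} [TopologicalSpace M] [ChartedSpace P.Tot M]
  [VectorBundle ℂ P.Fib₀ E₀] [VectorBundle ℂ P.Fib₁ E₁] [IsManifold 𝓘(ℂ, P.Base) ω S]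
  [IsManifold 𝓘(ℂ, P.Tot) ω M]

open ManifoldGeometry LocalGeometry

namespace AdmissibleData

variable {D : AdmissibleData P E₀ E₁ M} {τ τ' : Gauge P E₀ E₁ D.h₀ D.h₁}
  {γ : ∀ a, EuclideanSpace ℂ (Fin (P.d a)) →
      EuclideanSpace ℂ (Fin (P.d a)) →L[ℝ] EuclideanSpace ℂ (Fin (P.d a)) →L[ℝ] ℝ}

/-- A factor with parameter zero is trivial. -/
theorem IsAdapted.eq_zero (hτ : IsAdapted τ γ) {y : P.Base} (hy : y ∈ τ.ψ.target) {a : ι}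
    (ha : P.x a = 0) (v : EuclideanSpace ℂ (Fin (P.d a))) : v = 0 := by
  by_contra hv
  have := hτ.pos a y hy v hv
  rw [ha, zero_mul] at this
  exact lt_irrefl _ this

theorem pullback_eq_zero {y : P.Base} (hy : y ∈ τ.ψ.target) {a : ι} (ha : P.x a = 0)
    (X Y : P.Base) : pullback (D.g a) τ.ψ.symm y X Y = 0 := by
  obtain ⟨τ', γ, hs, hτ⟩ := D.exists_isAdapted (τ.ψ.symm y)
  let f : P.Base → P.Base := fun y => τ'.ψ (τ.ψ.symm y)
  have h1 : ContMDiffAt 𝓘(ℂ, P.Base) 𝓘(ℂ, P.Base) ω f y :=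
    ((contMDiffOn_of_mem_maximalAtlas τ'.mem_atlas).contMDiffAt
      (τ'.ψ.open_source.mem_nhds hs)).comp y
      ((contMDiffOn_symm_of_mem_maximalAtlas τ.mem_atlas).contMDiffAt
        (τ.ψ.open_target.mem_nhds hy))
  have h2 : DifferentiableAt ℝ f y :=
    (h1.contDiffAt.differentiableAt (by simp)).restrictScalars ℝ
  have hf : f y ∈ τ'.ψ.target := τ'.ψ.map_source hs
  have h3 : (τ.ψ.symm : P.Base → S) =ᶠ[𝓝 y] fun y => τ'.ψ.symm (f y) := by
    filter_upwards [(τ.ψ.symm.continuousAt hy).preimage_mem_nhds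
      (τ'.ψ.open_source.mem_nhds hs)] with r hr
    exact (τ'.ψ.left_inv hr).symm
  rw [pullback_congr _ h3]
  refine (pullback_comp (D.g a) (mdifferentiableAt_symm hf) h2 X Y).trans ?_
  rw [hτ.pull a _ hf, hτ.eq_zero hf ha (fderiv ℝ f y X a), map_zero]
  rfl

theorem dz_eq {p : D.Coord} (hp : p ∈ punctured τ) (X : D.Coord) :
    D.dz τ p X = fderiv ℝ (mom τ) p X := by
  rw [dz, (eventually_z_toM hp).fderiv_eq]

/-- The logarithms of the norms of the components. -/
theorem sq₀_eq_exp {p : D.Coord} (hp : p.2.1 ≠ 0) :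
    sq₀ τ p = Real.exp (τ.φ₀ (τ.ψ.symm p.1) + Real.log ‖p.2.1‖) ^ 2 := by
  rw [sq₀, Real.exp_add, Real.exp_log (norm_pos_iff.2 hp), mul_pow, ← Real.exp_nat_mul]
  norm_num

theorem sq₁_eq_exp {p : D.Coord} (hp : p.2.2 ≠ 0) :
    sq₁ τ p = Real.exp (τ.φ₁ (τ.ψ.symm p.1) + Real.log ‖p.2.2‖) ^ 2 := by
  rw [sq₁, Real.exp_add, Real.exp_log (norm_pos_iff.2 hp), mul_pow, ← Real.exp_nat_mul]
  norm_num

theorem exp_sq_add (A B : ℝ) :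
    Real.exp A ^ 2 + Real.exp B ^ 2 = Real.exp (A + B) * (2 * Real.cosh (A - B)) := by
  rw [Real.cosh_eq, Real.exp_add, Real.exp_neg, Real.exp_sub]
  have hA := (Real.exp_pos A).ne'
  have hB := (Real.exp_pos B).ne'
  field_simp

theorem exp_sq_sub (A B : ℝ) :
    Real.exp A ^ 2 - Real.exp B ^ 2 = Real.exp (A + B) * (2 * Real.sinh (A - B)) := by
  rw [Real.sinh_eq, Real.exp_add, Real.exp_neg, Real.exp_sub]
  have hA := (Real.exp_pos A).ne'
  have hB := (Real.exp_pos B).ne'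
  field_simp

theorem mom_eq_tanh {p : D.Coord} (hp : p ∈ D.dom τ) : mom τ p = Real.tanh (D.logRatio τ p) := by
  rw [mom, sq₀_eq_exp hp.2.1, sq₁_eq_exp hp.2.2, exp_sq_add, exp_sq_sub,
    mul_div_mul_left _ _ (Real.exp_pos _).ne', mul_div_mul_left _ _ two_ne_zero,
    ← Real.tanh_eq_sinh_div_cosh, logRatio]
  congr 1
  ring

theorem pot_eq {p : D.Coord} (hp : p ∈ D.dom τ) : pot τ p
    = Real.log ‖p.2.1‖ + Real.log ‖p.2.2‖ + Real.log (2 * Real.cosh (D.logRatio τ p)) := by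
  have h : τ.φ₀ (τ.ψ.symm p.1) + Real.log ‖p.2.1‖ - (τ.φ₁ (τ.ψ.symm p.1) + Real.log ‖p.2.2‖)
      = D.logRatio τ p := by
    rw [logRatio]
    ring
  have hc := Real.cosh_pos (D.logRatio τ p)
  rw [pot, sq₀_eq_exp hp.2.1, sq₁_eq_exp hp.2.2, exp_sq_add, h,
    Real.log_mul (Real.exp_pos _).ne' (by positivity), Real.log_exp]
  ring

theorem contDiffAt_log_norm_fst {p : D.Coord} (hp : p.2.1 ≠ 0) :
    ContDiffAt ℝ ∞ (fun p : D.Coord => Real.log ‖p.2.1‖) p :=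
  (contDiffAt_log_norm hp).comp p (contDiff_fst.comp contDiff_snd).contDiffAt

theorem contDiffAt_log_norm_snd {p : D.Coord} (hp : p.2.2 ≠ 0) :
    ContDiffAt ℝ ∞ (fun p : D.Coord => Real.log ‖p.2.2‖) p :=
  (contDiffAt_log_norm hp).comp p (contDiff_snd.comp contDiff_snd).contDiffAt

theorem contDiffAt_logRatio {p : D.Coord} (hp : p ∈ D.dom τ) : ContDiffAt ℝ ∞ (D.logRatio τ) p :=
  ((((contDiffAt_φ₀ hp.1).comp p contDiffAt_fst).sub
    ((contDiffAt_φ₁ hp.1).comp p contDiffAt_fst)).add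
    (contDiffAt_log_norm_fst hp.2.1)).sub (contDiffAt_log_norm_snd hp.2.2)

theorem ddcMap_log_norm_fst {p : D.Coord} (hp : p.2.1 ≠ 0) (X Y : D.Coord) :
    ddcMap (fun p : D.Coord => Real.log ‖p.2.1‖) p X Y
      = fubiniStudy p.2.1 (Complex.I • X.2.1) Y.2.1 := by
  let L : D.Coord →L[ℂ] P.Fib₀ := (ContinuousLinearMap.fst ℂ _ _).comp
    (ContinuousLinearMap.snd ℂ _ _)
  have h := ddcMap_comp (T := L) (u := p) L.contDiff.contDiffAt
    ((contDiffAt_log_norm (v := L p) hp).of_le (by norm_cast)) X Y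
  have hL : fderiv ℝ L p = L.restrictScalars ℝ := (L.restrictScalars ℝ).fderiv
  rw [hL, ddcMap_log_norm (v := L p) hp] at h
  exact h

theorem ddcMap_log_norm_snd {p : D.Coord} (hp : p.2.2 ≠ 0) (X Y : D.Coord) :
    ddcMap (fun p : D.Coord => Real.log ‖p.2.2‖) p X Y
      = fubiniStudy p.2.2 (Complex.I • X.2.2) Y.2.2 := by
  let L : D.Coord →L[ℂ] P.Fib₁ := (ContinuousLinearMap.snd ℂ _ _).comp
    (ContinuousLinearMap.snd ℂ _ _)
  have h := ddcMap_comp (T := L) (u := p) L.contDiff.contDiffAt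
    ((contDiffAt_log_norm (v := L p) hp).of_le (by norm_cast)) X Y
  have hL : fderiv ℝ L p = L.restrictScalars ℝ := (L.restrictScalars ℝ).fderiv
  rw [hL, ddcMap_log_norm (v := L p) hp] at h
  exact h

theorem contDiffAt_φ_sub {p : D.Coord} (hp : p.1 ∈ τ.ψ.target) : ContDiffAt ℝ ∞
    (fun p : D.Coord => τ.φ₀ (τ.ψ.symm p.1) - τ.φ₁ (τ.ψ.symm p.1)) p :=
  ((contDiffAt_φ₀ hp).comp p contDiffAt_fst).sub ((contDiffAt_φ₁ hp).comp p contDiffAt_fst)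

theorem ddcMap_φ_sub {p : D.Coord} (hp : p.1 ∈ τ.ψ.target) (X Y : D.Coord) :
    ddcMap (fun p : D.Coord => τ.φ₀ (τ.ψ.symm p.1) - τ.φ₁ (τ.ψ.symm p.1)) p X Y
      = ∑ a, pullback (D.g a) τ.ψ.symm p.1 (Complex.I • X.1) Y.1 := by
  let L : D.Coord →L[ℂ] P.Base := ContinuousLinearMap.fst ℂ _ _
  have h := ddcMap_comp (T := L) (u := p) L.contDiff.contDiffAt
    (K := fun y => τ.φ₀ (τ.ψ.symm y) - τ.φ₁ (τ.ψ.symm y))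
    (((contDiffAt_φ₀ hp).sub (contDiffAt_φ₁ hp)).of_le (by norm_cast)) X Y
  have hL : fderiv ℝ L p = L.restrictScalars ℝ := (L.restrictScalars ℝ).fderiv
  rw [hL] at h
  exact h.trans (D.curvature τ p.1 hp X.1 Y.1)

theorem ddcMap_logRatio {p : D.Coord} (hp : p ∈ D.dom τ) (X Y : D.Coord) :
    ddcMap (D.logRatio τ) p X Y
      = (∑ a, pullback (D.g a) τ.ψ.symm p.1 (Complex.I • X.1) Y.1)
        + fubiniStudy p.2.1 (Complex.I • X.2.1) Y.2.1
        - fubiniStudy p.2.2 (Complex.I • X.2.2) Y.2.2 := by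
  have h0 : ContDiffAt ℝ 2 (fun p : D.Coord => τ.φ₀ (τ.ψ.symm p.1) - τ.φ₁ (τ.ψ.symm p.1)) p :=
    (contDiffAt_φ_sub hp.1).of_le (by norm_cast)
  have h1 : ContDiffAt ℝ 2 (fun p : D.Coord => Real.log ‖p.2.1‖) p :=
    (contDiffAt_log_norm_fst hp.2.1).of_le (by norm_cast)
  have h2 : ContDiffAt ℝ 2 (fun p : D.Coord => Real.log ‖p.2.2‖) p :=
    (contDiffAt_log_norm_snd hp.2.2).of_le (by norm_cast)
  have h3 : D.logRatio τ = fun p => (τ.φ₀ (τ.ψ.symm p.1) - τ.φ₁ (τ.ψ.symm p.1))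
      + Real.log ‖p.2.1‖ + (-1) * Real.log ‖p.2.2‖ := by
    funext p
    rw [logRatio]
    ring
  rw [h3, ddcMap_add (h0.add h1) (contDiffAt_const.mul h2), ddcMap_add h0 h1, ddcMap_const_mul h2,
    add_apply, add_apply, add_apply, add_apply, smul_apply, smul_apply, ddcMap_φ_sub hp.1,
    ddcMap_log_norm_fst hp.2.1, ddcMap_log_norm_snd hp.2.2, smul_eq_mul]
  ring

theorem hasDerivAt_log_two_cosh (t : ℝ) :
    HasDerivAt (fun t => Real.log (2 * Real.cosh t)) (Real.tanh t) t := by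
  have hc := (Real.cosh_pos t).ne'
  refine (((Real.hasDerivAt_cosh t).const_mul 2).log (by positivity)).congr_deriv ?_
  rw [Real.tanh_eq_sinh_div_cosh, mul_div_mul_left _ _ two_ne_zero]

theorem hasDerivAt_tanh (t : ℝ) : HasDerivAt Real.tanh (1 - Real.tanh t ^ 2) t := by
  have hc := (Real.cosh_pos t).ne'
  have h : Real.tanh = fun t => Real.sinh t / Real.cosh t := funext Real.tanh_eq_sinh_div_cosh
  rw [h]
  refine ((Real.hasDerivAt_sinh t).div (Real.hasDerivAt_cosh t) hc).congr_deriv ?_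
  field_simp

theorem fderiv_mom_eq {p : D.Coord} (hp : p ∈ D.dom τ) (X : D.Coord) :
    fderiv ℝ (mom τ) p X = (1 - mom τ p ^ 2) * fderiv ℝ (D.logRatio τ) p X := by
  have h1 : mom τ =ᶠ[𝓝 p] fun p => Real.tanh (D.logRatio τ p) := by
    filter_upwards [isOpen_dom.mem_nhds hp] with r hr using mom_eq_tanh hr
  have h2 := (hasDerivAt_tanh (D.logRatio τ p)).comp_hasFDerivAt p
    ((contDiffAt_logRatio hp).differentiableAt (by simp)).hasFDerivAt
  rw [h1.fderiv_eq, mom_eq_tanh hp]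
  exact congrArg (fun A => A X) h2.fderiv

theorem one_sub_mom_sq_pos {p : D.Coord} (hp : p ∈ D.dom τ) : 0 < 1 - mom τ p ^ 2 := by
  have hc := Real.cosh_pos (D.logRatio τ p)
  have h := Real.cosh_sq_sub_sinh_sq (D.logRatio τ p)
  rw [mom_eq_tanh hp, Real.tanh_eq_sinh_div_cosh, div_pow, sub_pos, div_lt_one (by positivity)]
  linarith

/-- The admissible form in homogeneous coordinates. -/
theorem formMap_eq {p : D.Coord} (hp : p ∈ D.dom τ) (X Y : D.Coord) :
    formMap τ p X Y = D.horizontal τ p (Complex.I • X) Y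
      + (D.dz τ p X * D.theta τ p Y - D.dz τ p Y * D.theta τ p X) := by
  have hp' := dom_subset_punctured hp
  have h1 : ContDiffAt ℝ 2 (fun p : D.Coord => Real.log ‖p.2.1‖) p :=
    (contDiffAt_log_norm_fst hp.2.1).of_le (by norm_cast)
  have h2 : ContDiffAt ℝ 2 (fun p : D.Coord => Real.log ‖p.2.2‖) p :=
    (contDiffAt_log_norm_snd hp.2.2).of_le (by norm_cast)
  have hk : ContDiff ℝ 2 fun t => Real.log (2 * Real.cosh t) :=
    (contDiff_const.mul Real.contDiff_cosh).log fun t => by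
      have := Real.cosh_pos t
      positivity
  have hu : ContDiffAt ℝ 2 (D.logRatio τ) p := (contDiffAt_logRatio hp).of_le (by norm_cast)
  have hku : ContDiffAt ℝ 2 (fun p => Real.log (2 * Real.cosh (D.logRatio τ p))) p :=
    hk.contDiffAt.comp p hu
  have hdd := ddcMap_scalar_comp (k := fun t => Real.log (2 * Real.cosh t)) hu hk.contDiffAt X Y
  have hd1 : deriv (fun t => Real.log (2 * Real.cosh t)) = Real.tanh :=
    funext fun t => (hasDerivAt_log_two_cosh t).deriv
  have hpot : pot τ =ᶠ[𝓝 p] fun p => Real.log ‖p.2.1‖ + Real.log ‖p.2.2‖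
      + Real.log (2 * Real.cosh (D.logRatio τ p)) := by
    filter_upwards [isOpen_dom.mem_nhds hp] with r hr using pot_eq hr
  have hz : D.z (D.toM τ p) = mom τ p := z_toM hp'
  rw [formMap_apply, ddcMap_congr hpot, ddcMap_add (h1.add h2) hku,
    ddcMap_add h1 h2, add_apply, add_apply, add_apply, add_apply,
    hdd, hd1, (hasDerivAt_tanh _).deriv, ddcMap_logRatio hp,
    ddcMap_log_norm_fst hp.2.1, ddcMap_log_norm_snd hp.2.2, ← mom_eq_tanh hp, dz_eq hp', dz_eq hp',
    fderiv_mom_eq hp, fderiv_mom_eq hp, horizontal, hz, theta, theta]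
  have hs : ∑ a, (1 + P.x a * mom τ p) / P.x a
        * pullback (D.g a) τ.ψ.symm p.1 (Complex.I • X).1 Y.1
      = ∑ a, (P.x a)⁻¹ * pullback (D.g a) τ.ψ.symm p.1 (Complex.I • X.1) Y.1
        + mom τ p * ∑ a, pullback (D.g a) τ.ψ.symm p.1 (Complex.I • X.1) Y.1 := by
    rw [Finset.mul_sum, ← Finset.sum_add_distrib]
    refine Finset.sum_congr rfl fun a _ => ?_
    rcases eq_or_ne (P.x a) 0 with ha | ha
    · rw [pullback_eq_zero hp.1 ha, pullback_eq_zero hp.1 ha]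
      simp
    · rw [← add_mul, Prod.smul_fst]
      congr 1
      field_simp
  rw [hs]
  simp only [Prod.smul_fst, Prod.smul_snd]
  ring

theorem isAdmissibleForm_form : D.IsAdmissibleForm D.form := fun τ p hp X Y => by
  rw [pullback_form (dom_subset_punctured hp), formMap_eq hp]

variable (D) in
theorem theta_I (p X : D.Coord) : D.theta τ p (Complex.I • X) = fderiv ℝ (D.logRatio τ) p X := by
  rw [theta, smul_smul, Complex.I_mul_I, neg_one_smul, map_neg, neg_neg]

theorem pullback_I (y X Y : P.Base) (hy : y ∈ τ.ψ.target) (a : ι) :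
    pullback (D.g a) τ.ψ.symm y (Complex.I • X) (Complex.I • Y)
      = pullback (D.g a) τ.ψ.symm y X Y := by
  obtain ⟨τ', γ, hs, hτ⟩ := D.exists_isAdapted (τ.ψ.symm y)
  let f : P.Base → P.Base := fun y => τ'.ψ (τ.ψ.symm y)
  have h1 : ContMDiffAt 𝓘(ℂ, P.Base) 𝓘(ℂ, P.Base) ω f y :=
    ((contMDiffOn_of_mem_maximalAtlas τ'.mem_atlas).contMDiffAt
      (τ'.ψ.open_source.mem_nhds hs)).comp y
      ((contMDiffOn_symm_of_mem_maximalAtlas τ.mem_atlas).contMDiffAt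
        (τ.ψ.open_target.mem_nhds hy))
  have h1' : DifferentiableAt ℂ f y := h1.contDiffAt.differentiableAt (by simp)
  have h2 : DifferentiableAt ℝ f y := h1'.restrictScalars ℝ
  have hf : f y ∈ τ'.ψ.target := τ'.ψ.map_source hs
  have h3 : (τ.ψ.symm : P.Base → S) =ᶠ[𝓝 y] fun y => τ'.ψ.symm (f y) := by
    filter_upwards [(τ.ψ.symm.continuousAt hy).preimage_mem_nhds
      (τ'.ψ.open_source.mem_nhds hs)] with r hr
    exact (τ'.ψ.left_inv hr).symm
  have hI : ∀ X, fderiv ℝ f y (Complex.I • X) = Complex.I • fderiv ℝ f y X := fun X => by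
    rw [fderiv_real_eq h1']
    simp
  rw [pullback_congr _ h3]
  refine (pullback_comp (D.g a) (mdifferentiableAt_symm hf) h2 _ _).trans ?_
  refine Eq.trans ?_ (pullback_comp (D.g a) (mdifferentiableAt_symm hf) h2 _ _).symm
  rw [hτ.pull a _ hf, hτ.pull a _ hf, hI, hI]
  exact hτ.herm a _ hf _ _

theorem fubiniStudy_I {n : ℕ} (v X Y : EuclideanSpace ℂ (Fin n)) :
    fubiniStudy v (Complex.I • X) (Complex.I • Y) = fubiniStudy v X Y := by
  rw [fubiniStudy, fubiniStudy]
  congr 3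
  simp only [inner_smul_left, inner_smul_right, Complex.conj_I]
  linear_combination (-(inner ℂ X Y) * (‖v‖ : ℂ) ^ 2 + inner ℂ X v * inner ℂ v Y) * Complex.I_sq

theorem horizontal_I {p : D.Coord} (hp : p.1 ∈ τ.ψ.target) (X Y : D.Coord) :
    D.horizontal τ p (Complex.I • X) (Complex.I • Y) = D.horizontal τ p X Y := by
  simp only [horizontal, Prod.smul_fst, Prod.smul_snd, fubiniStudy_I, pullback_I _ _ _ hp]

/-- The metric in homogeneous coordinates. -/
theorem metricMap_eq (t : ℝ → ℝ) {p : D.Coord} (hp : p ∈ D.dom τ)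
    (ht : 0 < 1 + (1 - mom τ p ^ 2) * t (mom τ p)) (X Y : D.Coord) :
    metricMap t τ p X Y = D.horizontal τ p X Y
      + D.dz τ p X * D.dz τ p Y / ((1 - mom τ p ^ 2) * (1 + (1 - mom τ p ^ 2) * t (mom τ p)))
      + (1 - mom τ p ^ 2) * (1 + (1 - mom τ p ^ 2) * t (mom τ p))
        * (D.theta τ p X * D.theta τ p Y) := by
  have hp' := dom_subset_punctured hp
  have hz := one_sub_mom_sq_pos hp
  rw [metricMap_apply, formMap_eq hp, horizontal_I hp.1, theta_I, dz_eq hp', dz_eq hp', dz_eq hp',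
    fderiv_mom_eq hp, fderiv_mom_eq hp, fderiv_mom_eq hp, fderiv_mom_eq hp, theta, theta]
  generalize t (mom τ p) = t at ht
  generalize 1 - mom τ p ^ 2 = s at hz ht
  have hz' := hz.ne'
  have ht' := ht.ne'
  field_simp
  ring

theorem isAdmissibleMetric_metric {t Θ : ℝ → ℝ}
    (ht : ∀ z ∈ Ioo (-1 : ℝ) 1, 0 < 1 + (1 - z ^ 2) * t z)
    (hΘ : ∀ z, Θ z = (1 - z ^ 2) * (1 + (1 - z ^ 2) * t z)) :
    D.IsAdmissibleMetric Θ (D.metric t) := fun τ p hp X Y => by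
  have hz : D.z (D.toM τ p) = mom τ p := z_toM (dom_subset_punctured hp)
  have hm : mom τ p ∈ Ioo (-1 : ℝ) 1 := abs_lt.1 ((sq_lt_one_iff_abs_lt_one _).1
    (sub_pos.1 (one_sub_mom_sq_pos hp)))
  rw [pullback_metric t (dom_subset_punctured hp), metricMap_eq t hp (ht _ hm), hz, hΘ]

end AdmissibleData

end Admissible

namespace LocalGeometry

section

variable {V : Type*} [NormedAddCommGroup V] [NormedSpace ℝ V] {W : Type*} [NormedAddCommGroup W]
  [NormedSpace ℝ W]

theorem contDiffAt_smul_bilinearComp {G : W → W →L[ℝ] W →L[ℝ] ℝ} (c : ℝ) (L A B : V →L[ℝ] W)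
    {p : V} (hG : ContDiffAt ℝ ∞ G (L p)) :
    ContDiffAt ℝ ∞ (fun p => c • (G (L p)).bilinearComp A B) p :=
  contDiffAt_const.smul (f := fun _ => c)
    ((contDiff_bilinearComp A B).contDiffAt.comp p (hG.comp p L.contDiff.contDiffAt))

variable [NormedSpace ℂ V] [IsScalarTower ℝ ℂ V]

theorem contDiffAt_add_sum {ι : Type*} [Fintype ι] {W : ι → Type*} [∀ a, NormedAddCommGroup (W a)]
    [∀ a, NormedSpace ℝ (W a)] [∀ a, NormedSpace ℂ (W a)] [∀ a, IsScalarTower ℝ ℂ (W a)]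
    {f : V → ℝ} {G : ∀ a, W a → W a →L[ℝ] W a →L[ℝ] ℝ}
    (c : ι → ℝ) (L : ∀ a, V →L[ℝ] W a) {p : V} (hf : ContDiffAt ℝ ∞ f p)
    (hG : ∀ a, ContDiffAt ℝ ∞ (G a) (L a p)) :
    ContDiffAt ℝ ∞ (fun p => ddcMap f p + ∑ a, c a •
      (G a (L a p)).bilinearComp ((mulI _).comp (L a)) (L a)) p :=
  (ContDiffAt.ddcMap hf).add (ContDiffAt.sum fun a _ => contDiffAt_smul_bilinearComp _ _ _ _ (hG a))

theorem add_sum_apply {ι : Type*} [Fintype ι] {W : ι → Type*} [∀ a, NormedAddCommGroup (W a)]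
    [∀ a, NormedSpace ℝ (W a)] [∀ a, NormedSpace ℂ (W a)] [∀ a, IsScalarTower ℝ ℂ (W a)]
    {f : V → ℝ} {G : ∀ a, W a → W a →L[ℝ] W a →L[ℝ] ℝ}
    (c : ι → ℝ) (L : ∀ a, V →L[ℝ] W a) (p X Y : V) :
    (ddcMap f p + ∑ a, c a • (G a (L a p)).bilinearComp ((mulI _).comp (L a)) (L a)) X Y
      = ddcMap f p X Y + ∑ a, c a * G a (L a p) (Complex.I • L a X) (L a Y) := by
  simp only [add_apply, sum_apply, smul_apply, smul_eq_mul]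
  rfl

theorem contDiffAt_metric_aux {F : V → V →L[ℝ] V →L[ℝ] ℝ} {d : V → V →L[ℝ] ℝ} {f k : V → ℝ} {p : V}
    (hF : ContDiffAt ℝ ∞ F p) (hd : ContDiffAt ℝ ∞ d p) (hf : ContDiffAt ℝ ∞ f p)
    (hk : ContDiffAt ℝ ∞ k p) : ContDiffAt ℝ ∞ (fun p => (F p).bilinearComp
      (ContinuousLinearMap.id ℝ V) (mulI V)
      + f p • ((d p).comp (mulI V)).smulRight ((d p).comp (mulI V))
      - k p • (d p).smulRight (d p)) p := by
  have hdI : ContDiffAt ℝ ∞ (fun p => (d p).comp (mulI V)) p := hd.clm_comp contDiffAt_const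
  have h1 : ContDiffAt ℝ ∞ (fun p => (F p).bilinearComp
      (ContinuousLinearMap.id ℝ V) (mulI V)) p :=
    (contDiff_bilinearComp _ _).contDiffAt.comp p hF
  exact (h1.add (hf.smul (hdI.smulRight hdI))).sub (hk.smul (hd.smulRight hd))

end

end LocalGeometry

section Admissible

variable {ι : Type*} [Fintype ι] {P : AdmissibleParams ι}
  {S : Type*} [TopologicalSpace S] [ChartedSpace P.Base S]
  {E₀ E₁ : S → Type*}
  [∀ s, AddCommGroup (E₀ s)] [∀ s, Module ℂ (E₀ s)] [∀ s, TopologicalSpace (E₀ s)]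
  [TopologicalSpace (TotalSpace P.Fib₀ E₀)] [FiberBundle P.Fib₀ E₀]
  [∀ s, AddCommGroup (E₁ s)] [∀ s, Module ℂ (E₁ s)] [∀ s, TopologicalSpace (E₁ s)]
  [TopologicalSpace (TotalSpace P.Fib₁ E₁)] [FiberBundle P.Fib₁ E₁]
  {M : Type*} [TopologicalSpace M] [ChartedSpace P.Tot M]
  [VectorBundle ℂ P.Fib₀ E₀] [VectorBundle ℂ P.Fib₁ E₁] [IsManifold 𝓘(ℂ, P.Base) ω S]
  [IsManifold 𝓘(ℂ, P.Tot) ω M]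

open ManifoldGeometry LocalGeometry

namespace AdmissibleData

variable {D : AdmissibleData P E₀ E₁ M} {τ τ' : Gauge P E₀ E₁ D.h₀ D.h₁}
  {γ : ∀ a, EuclideanSpace ℂ (Fin (P.d a)) →
      EuclideanSpace ℂ (Fin (P.d a)) →L[ℝ] EuclideanSpace ℂ (Fin (P.d a)) →L[ℝ] ℝ}

theorem IsAdapted.contDiffAt_formMap (hτ : IsAdapted τ γ) {p : D.Coord} (hp : p ∈ punctured τ) :
    ContDiffAt ℝ ∞ (formMap τ) p := by
  let L : ∀ a, D.Coord →L[ℝ] EuclideanSpace ℂ (Fin (P.d a)) := fun a =>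
    (ContinuousLinearMap.proj (R := ℝ) (φ := fun a => EuclideanSpace ℂ (Fin (P.d a))) a).comp
      (ContinuousLinearMap.fst ℝ _ _)
  have h2 := contDiffAt_add_sum (f := pot τ) (G := γ) (fun a => (P.x a)⁻¹) L (contDiffAt_pot hp)
    fun a => hτ.smooth a p.1 hp.1
  refine h2.congr_of_eventuallyEq ?_
  filter_upwards [isOpen_punctured.mem_nhds hp] with r hr
  refine ContinuousLinearMap.ext fun X => ContinuousLinearMap.ext fun Y => ?_
  refine Eq.trans ?_ (add_sum_apply _ L r X Y).symm
  rw [formMap_apply]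
  congr 1
  refine Finset.sum_congr rfl fun a _ => ?_
  rw [hτ.pull a r.1 hr.1]
  rfl

theorem mom_mem_Icc {p : D.Coord} (hp : p.2 ≠ 0) : mom τ p ∈ Icc (-1 : ℝ) 1 := by
  have h := sq_pos (τ := τ) hp
  have h0 : 0 ≤ sq₀ τ p := by unfold sq₀; positivity
  have h1 : 0 ≤ sq₁ τ p := by unfold sq₁; positivity
  rw [mom, mem_Icc, le_div_iff₀ h, div_le_iff₀ h]
  constructor <;> linarith

theorem IsAdapted.contDiffAt_metricMap (hτ : IsAdapted τ γ) {t : ℝ → ℝ} (ht : ContDiff ℝ ∞ t)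
    (hpos : ∀ z ∈ Icc (-1 : ℝ) 1, 0 < 1 + (1 - z ^ 2) * t z) {p : D.Coord}
    (hp : p ∈ punctured τ) : ContDiffAt ℝ ∞ (metricMap t τ) p := by
  have hm := contDiffAt_mom hp
  have hd : ContDiffAt ℝ ∞ (fderiv ℝ (mom τ)) p := hm.fderiv_right (m := ∞) (by simp)
  have htm : ContDiffAt ℝ ∞ (fun p => t (mom τ p)) p := ht.contDiffAt.comp p hm
  have hq : ContDiffAt ℝ ∞ (fun p => t (mom τ p) / (1 + (1 - mom τ p ^ 2) * t (mom τ p))) p :=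
    htm.div (contDiffAt_const.add ((contDiffAt_const.sub (hm.pow 2)).mul htm))
      (hpos _ (mom_mem_Icc hp.2)).ne'
  exact contDiffAt_metric_aux (hτ.contDiffAt_formMap hp) hd htm hq

theorem contDiffAt_inChart_form {x : M} {u : P.Tot} (hu : u ∈ (chartAt P.Tot x).target) :
    ContDiffAt ℝ ∞ (inChart D.form x) u := by
  obtain ⟨τ, γ, p, hτ, hp, rfl⟩ := D.exists_overChart hu
  exact contDiffAt_inChart hp (hτ.contDiffAt_formMap hp.1) fun p hp X Y => pullback_form hp.1 X Y

theorem contDiffAt_inChart_metric {t : ℝ → ℝ} (ht : ContDiff ℝ ∞ t)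
    (hpos : ∀ z ∈ Icc (-1 : ℝ) 1, 0 < 1 + (1 - z ^ 2) * t z) {x : M} {u : P.Tot}
    (hu : u ∈ (chartAt P.Tot x).target) : ContDiffAt ℝ ∞ (inChart (D.metric t) x) u := by
  obtain ⟨τ, γ, p, hτ, hp, rfl⟩ := D.exists_overChart hu
  exact contDiffAt_inChart hp (hτ.contDiffAt_metricMap ht hpos hp.1)
    fun p hp X Y => pullback_metric t hp.1 X Y

theorem ddcMap_pot_zero₁ {p : D.Coord} (hp : p.1 ∈ τ.ψ.target) (hv : p.2.1 ≠ 0) (hw : p.2.2 = 0)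
    (X : D.Coord) : ddcMap (pot τ) p X (Complex.I • X)
      = (∑ a, pullback (D.g a) τ.ψ.symm p.1 X.1 X.1) + 2 * fubiniStudy p.2.1 X.2.1 X.2.1
        + 4 * (Real.exp (2 * τ.φ₁ (τ.ψ.symm p.1)) / sq₀ τ p) * ‖X.2.2‖ ^ 2 := by
  have hs : ∀ {r : D.Coord}, r.2.1 ≠ 0 → 0 < sq₀ τ r := fun h => by
    have := norm_pos_iff.2 h
    unfold sq₀
    positivity
  let L : D.Coord →L[ℝ] P.Fib₁ := (ContinuousLinearMap.snd ℝ _ _).comp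
    (ContinuousLinearMap.snd ℝ _ _)
  set e : D.Coord → ℝ := fun p => Real.exp (2 * τ.φ₁ (τ.ψ.symm p.1)) / sq₀ τ p with he_def
  have he : ContDiffAt ℝ ∞ e p :=
    (contDiffAt_const.mul ((contDiffAt_φ₁ hp).comp p contDiffAt_fst)).exp.div
      (contDiffAt_sq₀ hp) (hs hv).ne'
  have hnhds : ∀ᶠ r : D.Coord in 𝓝 p, r.2.1 ≠ 0 :=
    (continuous_fst.comp continuous_snd).continuousAt.preimage_mem_nhds (isOpen_ne.mem_nhds hv)
  have he0 : ∀ᶠ r in 𝓝 p, 0 ≤ e r := hnhds.mono fun r hr =>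
    div_nonneg (Real.exp_pos _).le (hs hr).le
  have hpot : pot τ =ᶠ[𝓝 p] fun p => ((τ.φ₀ (τ.ψ.symm p.1) - τ.φ₁ (τ.ψ.symm p.1))
      + 2 * Real.log ‖p.2.1‖) + Real.log (1 + e p * ‖L p‖ ^ 2) := by
    filter_upwards [hnhds, he0] with r hr he0
    have h1 : sq₀ τ r + sq₁ τ r = sq₀ τ r * (1 + e r * ‖L r‖ ^ 2) := by
      have := (hs hr).ne'
      simp only [he_def]
      rw [mul_add, mul_one, ← mul_assoc, mul_div_cancel₀ _ this]
      rfl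
    have h2 := norm_pos_iff.2 hr
    rw [pot, h1, Real.log_mul (hs hr).ne' (by positivity), sq₀,
      Real.log_mul (Real.exp_pos _).ne' (by positivity), Real.log_exp, Real.log_pow]
    push_cast
    ring
  have c1 : ContDiffAt ℝ 2 (fun p : D.Coord => τ.φ₀ (τ.ψ.symm p.1) - τ.φ₁ (τ.ψ.symm p.1)) p :=
    (contDiffAt_φ_sub hp).of_le (by norm_cast)
  have c2 : ContDiffAt ℝ 2 (fun p : D.Coord => Real.log ‖p.2.1‖) p :=
    (contDiffAt_log_norm_fst hv).of_le (by norm_cast)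
  have c3 : ContDiffAt ℝ 2 (fun p : D.Coord => Real.log (1 + e p * ‖L p‖ ^ 2)) p := by
    have h3 : ContDiff ℝ ∞ fun p => ‖L p‖ ^ 2 := (contDiff_norm_sq _).comp L.contDiff
    have h4 := he0.self_of_nhds
    exact ((contDiffAt_const.add (he.mul h3.contDiffAt)).log (by positivity)).of_le (by norm_cast)
  rw [ddcMap_congr hpot, ddcMap_add (c1.add (contDiffAt_const.mul c2)) c3,
    ddcMap_add c1 (contDiffAt_const.mul c2), ddcMap_const_mul c2, add_apply, add_apply, add_apply,
    add_apply, smul_apply, smul_apply, ddcMap_φ_sub hp, ddcMap_log_norm_fst hv,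
    ddcMap_log_one_add L (fun _ => rfl) he hw he0]
  simp only [Prod.smul_fst, Prod.smul_snd, fubiniStudy_I, pullback_I _ _ _ hp, smul_eq_mul]
  rfl

theorem ddcMap_pot_zero₀ {p : D.Coord} (hp : p.1 ∈ τ.ψ.target) (hv : p.2.2 ≠ 0) (hw : p.2.1 = 0)
    (X : D.Coord) : ddcMap (pot τ) p X (Complex.I • X)
      = -(∑ a, pullback (D.g a) τ.ψ.symm p.1 X.1 X.1) + 2 * fubiniStudy p.2.2 X.2.2 X.2.2
        + 4 * (Real.exp (2 * τ.φ₀ (τ.ψ.symm p.1)) / sq₁ τ p) * ‖X.2.1‖ ^ 2 := by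
  have hs : ∀ {r : D.Coord}, r.2.2 ≠ 0 → 0 < sq₁ τ r := fun h => by
    have := norm_pos_iff.2 h
    unfold sq₁
    positivity
  let L : D.Coord →L[ℝ] P.Fib₀ := (ContinuousLinearMap.fst ℝ _ _).comp
    (ContinuousLinearMap.snd ℝ _ _)
  set e : D.Coord → ℝ := fun p => Real.exp (2 * τ.φ₀ (τ.ψ.symm p.1)) / sq₁ τ p with he_def
  have he : ContDiffAt ℝ ∞ e p :=
    (contDiffAt_const.mul ((contDiffAt_φ₀ hp).comp p contDiffAt_fst)).exp.div
      (contDiffAt_sq₁ hp) (hs hv).ne'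
  have hnhds : ∀ᶠ r : D.Coord in 𝓝 p, r.2.2 ≠ 0 :=
    (continuous_snd.comp continuous_snd).continuousAt.preimage_mem_nhds (isOpen_ne.mem_nhds hv)
  have he0 : ∀ᶠ r in 𝓝 p, 0 ≤ e r := hnhds.mono fun r hr =>
    div_nonneg (Real.exp_pos _).le (hs hr).le
  have hpot : pot τ =ᶠ[𝓝 p] fun p => ((-1) * (τ.φ₀ (τ.ψ.symm p.1) - τ.φ₁ (τ.ψ.symm p.1))
      + 2 * Real.log ‖p.2.2‖) + Real.log (1 + e p * ‖L p‖ ^ 2) := by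
    filter_upwards [hnhds, he0] with r hr he0
    have h1 : sq₀ τ r + sq₁ τ r = sq₁ τ r * (1 + e r * ‖L r‖ ^ 2) := by
      have := (hs hr).ne'
      simp only [he_def]
      rw [mul_add, mul_one, ← mul_assoc, mul_div_cancel₀ _ this, add_comm]
      rfl
    have h2 := norm_pos_iff.2 hr
    rw [pot, h1, Real.log_mul (hs hr).ne' (by positivity), sq₁,
      Real.log_mul (Real.exp_pos _).ne' (by positivity), Real.log_exp, Real.log_pow]
    push_cast
    ring
  have c1 : ContDiffAt ℝ 2 (fun p : D.Coord => τ.φ₀ (τ.ψ.symm p.1) - τ.φ₁ (τ.ψ.symm p.1)) p :=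
    (contDiffAt_φ_sub hp).of_le (by norm_cast)
  have c2 : ContDiffAt ℝ 2 (fun p : D.Coord => Real.log ‖p.2.2‖) p :=
    (contDiffAt_log_norm_snd hv).of_le (by norm_cast)
  have c3 : ContDiffAt ℝ 2 (fun p : D.Coord => Real.log (1 + e p * ‖L p‖ ^ 2)) p := by
    have h3 : ContDiff ℝ ∞ fun p => ‖L p‖ ^ 2 := (contDiff_norm_sq _).comp L.contDiff
    have h4 := he0.self_of_nhds
    exact ((contDiffAt_const.add (he.mul h3.contDiffAt)).log (by positivity)).of_le (by norm_cast)
  rw [ddcMap_congr hpot, ddcMap_add ((contDiffAt_const.mul c1).add (contDiffAt_const.mul c2)) c3,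
    ddcMap_add (contDiffAt_const.mul c1) (contDiffAt_const.mul c2), ddcMap_const_mul c2,
    ddcMap_const_mul c1, add_apply, add_apply, add_apply,
    add_apply, smul_apply, smul_apply, smul_apply, smul_apply, ddcMap_φ_sub hp,
    ddcMap_log_norm_snd hv, ddcMap_log_one_add L (fun _ => rfl) he hw he0]
  simp only [Prod.smul_fst, Prod.smul_snd, fubiniStudy_I, pullback_I _ _ _ hp, smul_eq_mul,
    neg_one_mul]
  rfl

theorem abs_x_lt_one (D : AdmissibleData P E₀ E₁ M) (a : ι) : -1 < P.x a ∧ P.x a < 1 := abs_lt.1 (D.abs_x_lt a)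

theorem IsAdapted.eq_zero_of_sum (hτ : IsAdapted τ γ) {y : P.Base} (hy : y ∈ τ.ψ.target)
    {κ : ι → ℝ} (hκ : ∀ a, P.x a ≠ 0 → 0 < κ a * P.x a) {X : P.Base} :
    0 ≤ ∑ a, κ a * pullback (D.g a) τ.ψ.symm y X X ∧
      (∑ a, κ a * pullback (D.g a) τ.ψ.symm y X X = 0 → X = 0) := by
  have h1 : ∀ a, X a ≠ 0 → 0 < κ a * pullback (D.g a) τ.ψ.symm y X X := fun a ha => by
    have hx : P.x a ≠ 0 := fun hx => ha (hτ.eq_zero hy hx _)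
    rw [hτ.pull a y hy]
    have h2 := mul_pos (hκ a hx) (hτ.pos a y hy _ ha)
    have h3 : 0 < P.x a ^ 2 := by positivity
    refine (mul_pos_iff_of_pos_left h3).1 ?_
    linarith
  have h2 : ∀ a, 0 ≤ κ a * pullback (D.g a) τ.ψ.symm y X X := fun a => by
    by_cases ha : X a = 0
    · rw [hτ.pull a y hy, ha, map_zero]
      simp
    · exact (h1 a ha).le
  refine ⟨Finset.sum_nonneg fun a _ => h2 a, fun h => ?_⟩
  funext a
  by_contra ha
  have h3 := (Finset.sum_eq_zero_iff_of_nonneg fun a _ => h2 a).1 h a (Finset.mem_univ a)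
  exact (h1 a ha).ne' h3

/-- The metric is positive over the zero and infinity sections. -/
theorem IsAdapted.metricMap_pos_of_notMem_dom (hτ : IsAdapted τ γ) (t : ℝ → ℝ) {p : D.Coord}
    (hp : p ∈ punctured τ) (hp' : p ∉ D.dom τ) {X : D.Coord} (hX : ∀ c : ℂ, X ≠ c • (0, p.2)) :
    0 < metricMap t τ p X X := by
  have hd : fderiv ℝ (mom τ) p = 0 ∧ 0 < formMap τ p X (Complex.I • X) := by
    have hform : formMap τ p X (Complex.I • X) = ddcMap (pot τ) p X (Complex.I • X)
        + ∑ a, (P.x a)⁻¹ * pullback (D.g a) τ.ψ.symm p.1 X.1 X.1 := by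
      rw [formMap_apply]
      simp only [Prod.smul_fst, pullback_I _ _ _ hp.1]
    by_cases hw : p.2.2 = 0
    · have hv : p.2.1 ≠ 0 := fun hv => hp.2 (Prod.ext hv hw)
      have hs : 0 < sq₀ τ p := by
        have := norm_pos_iff.2 hv
        unfold sq₀
        positivity
      have hm : mom τ p = 1 := by
        have h1 : sq₁ τ p = 0 := by simp [sq₁, hw]
        rw [mom, h1, sub_zero, add_zero, div_self hs.ne']
      constructor
      · refine IsLocalMax.fderiv_eq_zero ?_
        filter_upwards [isOpen_punctured.mem_nhds hp] with r hr
        rw [hm]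
        exact (mom_mem_Icc hr.2).2
      · rw [hform, ddcMap_pot_zero₁ hp.1 hv hw]
        obtain ⟨h1, h2⟩ := hτ.eq_zero_of_sum (κ := fun a => 1 + (P.x a)⁻¹) (X := X.1) hp.1
          (fun a ha => by
            rw [add_mul, inv_mul_cancel₀ ha]
            linarith [(D.abs_x_lt_one a).1])
        have h3 := fubiniStudy_nonneg p.2.1 X.2.1
        have he := div_pos (Real.exp_pos (2 * τ.φ₁ (τ.ψ.symm p.1))) hs
        set e := Real.exp (2 * τ.φ₁ (τ.ψ.symm p.1)) / sq₀ τ p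
        have h4 : 0 ≤ 4 * e * ‖X.2.2‖ ^ 2 := by positivity
        simp only [add_mul, one_mul, Finset.sum_add_distrib] at h1 h2
        by_contra hle
        have h5 : ‖X.2.2‖ ^ 2 = 0 := by
          have : 4 * e * ‖X.2.2‖ ^ 2 = 0 := by linarith
          exact (mul_eq_zero.1 this).resolve_left (by positivity)
        obtain ⟨c, hc⟩ := exists_smul_of_fubiniStudy_eq_zero hv
          (show fubiniStudy p.2.1 X.2.1 X.2.1 = 0 by linarith)
        refine hX c (Prod.ext ?_ (Prod.ext hc ?_))
        · rw [h2 (by linarith)]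
          exact (smul_zero c).symm
        · rw [norm_eq_zero.1 (pow_eq_zero_iff two_ne_zero |>.1 h5)]
          exact (congrArg (fun w => c • w) hw |>.trans (smul_zero c)).symm
    · have hv : p.2.1 = 0 := by
        by_contra hv
        exact hp' ⟨hp.1, hv, hw⟩
      have hs : 0 < sq₁ τ p := by
        have := norm_pos_iff.2 hw
        unfold sq₁
        positivity
      have hm : mom τ p = -1 := by
        have h1 : sq₀ τ p = 0 := by simp [sq₀, hv]
        rw [mom, h1, zero_sub, zero_add, neg_div, div_self hs.ne']
      constructor
      · refine IsLocalMin.fderiv_eq_zero ?_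
        filter_upwards [isOpen_punctured.mem_nhds hp] with r hr
        rw [hm]
        exact (mom_mem_Icc hr.2).1
      · rw [hform, ddcMap_pot_zero₀ hp.1 hw hv]
        obtain ⟨h1, h2⟩ := hτ.eq_zero_of_sum (κ := fun a => -1 + (P.x a)⁻¹) (X := X.1) hp.1
          (fun a ha => by
            rw [add_mul, inv_mul_cancel₀ ha]
            linarith [(D.abs_x_lt_one a).2])
        have h3 := fubiniStudy_nonneg p.2.2 X.2.2
        have he := div_pos (Real.exp_pos (2 * τ.φ₀ (τ.ψ.symm p.1))) hs
        set e := Real.exp (2 * τ.φ₀ (τ.ψ.symm p.1)) / sq₁ τ p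
        have h4 : 0 ≤ 4 * e * ‖X.2.1‖ ^ 2 := by positivity
        simp only [add_mul, neg_one_mul, Finset.sum_add_distrib, Finset.sum_neg_distrib] at h1 h2
        by_contra hle
        have h5 : ‖X.2.1‖ ^ 2 = 0 := by
          have : 4 * e * ‖X.2.1‖ ^ 2 = 0 := by linarith
          exact (mul_eq_zero.1 this).resolve_left (by positivity)
        obtain ⟨c, hc⟩ := exists_smul_of_fubiniStudy_eq_zero hw
          (show fubiniStudy p.2.2 X.2.2 X.2.2 = 0 by linarith)
        refine hX c (Prod.ext ?_ (Prod.ext ?_ hc))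
        · rw [h2 (by linarith)]
          exact (smul_zero c).symm
        · rw [norm_eq_zero.1 (pow_eq_zero_iff two_ne_zero |>.1 h5)]
          exact (congrArg (fun w => c • w) hv |>.trans (smul_zero c)).symm
  rw [metricMap_apply, hd.1]
  simpa using hd.2

/-- Properties of points of a chart hold frequently near any point if they hold over the dense part
of `M` on which the momentum map is regular. -/
theorem frequently_of_dom {x : M} {Q : P.Tot → Prop}
    (hQ : ∀ (τ : Gauge P E₀ E₁ D.h₀ D.h₁) (γ : _), IsAdapted τ γ → ∀ p ∈ overChart τ x,
      p ∈ D.dom τ → Q (toChart τ x p))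
    {u : P.Tot} (hu : u ∈ (chartAt P.Tot x).target) : ∃ᶠ u' in 𝓝 u, Q u' := by
  obtain ⟨τ, γ, p, hτ, hp, rfl⟩ := D.exists_overChart hu
  have h1 : Dense ((univ : Set P.Base) ×ˢ (({0}ᶜ : Set P.Fib₀) ×ˢ ({0}ᶜ : Set P.Fib₁))) :=
    dense_univ.prod ((dense_compl_singleton _).prod (dense_compl_singleton _))
  have h2 : ∃ᶠ r in 𝓝 p, r ∈ (univ : Set P.Base) ×ˢ (({0}ᶜ : Set P.Fib₀) ×ˢ ({0}ᶜ : Set P.Fib₁)) :=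
    mem_closure_iff_frequently.1 (h1 p)
  have h3 : ∃ᶠ r in 𝓝 p, Q (toChart τ x r) := by
    refine (h2.and_eventually ((isOpen_overChart x).mem_nhds hp)).mono ?_
    rintro r ⟨⟨-, h4, h5⟩, h6⟩
    exact hQ τ γ hτ r h6 ⟨h6.1.1, h4, h5⟩
  exact (contDiffAt_toChart hp).continuousAt.tendsto.frequently h3

end AdmissibleData

end Admissible

/-- Local solutions of an autonomous scalar equation, with fixed initial point. -/
theorem exists_reparametrization {K : ℝ → ℝ} (hK : ContDiff ℝ ∞ K) (hpos : ∀ t, 0 < K t) (c : ℝ) :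
    ∃ T : ℝ → ℝ, T c = c ∧ ∀ᶠ s in 𝓝 c, ContDiffAt ℝ ∞ T s ∧ HasDerivAt T (K (T s)) s := by
  let U : ℝ → ℝ := fun t => c + ∫ s in c..t, (K s)⁻¹
  have hKi : ContDiff ℝ ∞ fun s => (K s)⁻¹ := hK.inv fun t => (hpos t).ne'
  have hU : ∀ t, HasDerivAt U (K t)⁻¹ t := fun t =>
    (intervalIntegral.integral_hasDerivAt_right (hKi.continuous.intervalIntegrable _ _)
      (hKi.continuous.stronglyMeasurableAtFilter _ _) hKi.continuous.continuousAt).const_add c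
  have hUs : ContDiff ℝ ∞ U := by
    rw [contDiff_infty_iff_deriv]
    refine ⟨fun t => (hU t).differentiableAt, ?_⟩
    rw [funext fun t => (hU t).deriv]
    exact hKi
  have hUc : U c = c := by simp [U]
  have hne : ∀ t, (K t)⁻¹ ≠ 0 := fun t => inv_ne_zero (hpos t).ne'
  let f' : ℝ ≃L[ℝ] ℝ := ContinuousLinearEquiv.unitsEquivAut ℝ (Units.mk0 _ (hne c))
  have hf' : HasFDerivAt U (f' : ℝ →L[ℝ] ℝ) c := by
    refine (hU c).hasFDerivAt.congr_fderiv ?_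
    ext
    simp [f']
  let e := hUs.contDiffAt.toOpenPartialHomeomorph U hf' (by simp)
  have he : ∀ t, e t = U t := fun t => rfl
  have hc : c ∈ e.source := hUs.contDiffAt.mem_toOpenPartialHomeomorph_source hf' (by simp)
  have hct : c ∈ e.target := by
    have := e.map_source hc
    rwa [he, hUc] at this
  refine ⟨e.symm, ?_, ?_⟩
  · have := e.left_inv hc
    rwa [he, hUc] at this
  · filter_upwards [e.open_target.mem_nhds hct] with s hs
    constructor
    · exact e.contDiffAt_symm_deriv (hne _) hs (hU _) hUs.contDiffAt
    · have := e.hasDerivAt_symm hs (hne _) (hU _)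
      rwa [inv_inv] at this

namespace LocalGeometry

theorem fubiniStudy_smul {n : ℕ} {c : ℂ} (hc : c ≠ 0) (v X Y : EuclideanSpace ℂ (Fin n)) :
    fubiniStudy (c • v) (c • X) (c • Y) = fubiniStudy v X Y := by
  have hn : ‖c‖ ≠ 0 := norm_ne_zero_iff.2 hc
  have h1 : (starRingEnd ℂ) c * c = ((‖c‖ ^ 2 : ℝ) : ℂ) := by
    rw [Complex.conj_mul']
    norm_cast
  have h2 : inner ℂ (c • X) (c • Y) * (‖c • v‖ : ℂ) ^ 2
      - inner ℂ (c • X) (c • v) * inner ℂ (c • v) (c • Y)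
      = ((‖c‖ ^ 4 : ℝ) : ℂ) * (inner ℂ X Y * (‖v‖ : ℂ) ^ 2 - inner ℂ X v * inner ℂ v Y) := by
    simp only [inner_smul_left, inner_smul_right, norm_smul]
    push_cast at h1 ⊢
    linear_combination (inner ℂ X Y * ‖v‖ ^ 2 * ‖c‖ ^ 2
      - inner ℂ X v * inner ℂ v Y * (((starRingEnd ℂ) c * c) + ‖c‖ ^ 2)) * h1
  rw [fubiniStudy, h2, Complex.re_ofReal_mul, fubiniStudy, norm_smul, mul_pow]
  rcases eq_or_ne v 0 with rfl | hv
  · simp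
  have hv' : ‖v‖ ≠ 0 := norm_ne_zero_iff.2 hv
  field_simp

theorem fubiniStudy_add_smul {n : ℕ} (v X Y : EuclideanSpace ℂ (Fin n)) (b b' : ℂ) :
    fubiniStudy v (X + b • v) (Y + b' • v) = fubiniStudy v X Y := by
  rw [fubiniStudy, fubiniStudy]
  congr 3
  simp only [inner_add_left, inner_add_right, inner_smul_left, inner_smul_right,
    inner_self_eq_norm_sq_to_K, Complex.coe_algebraMap]
  ring

/-- A slice of the action of the scalars through a given vector. -/
theorem exists_slice {n : ℕ} {v : EuclideanSpace ℂ (Fin (n + 1))} (hv : v ≠ 0) :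
    ∃ L : EuclideanSpace ℂ (Fin n) →ₗᵢ[ℂ] EuclideanSpace ℂ (Fin (n + 1)),
      ∀ m, inner ℂ v (L m) = 0 := by
  have : Fact (Module.finrank ℂ (EuclideanSpace ℂ (Fin (n + 1))) = n + 1) := ⟨by simp⟩
  let b := OrthonormalBasis.fromOrthogonalSpanSingleton (𝕜 := ℂ) n hv
  refine ⟨(Submodule.subtypeₗᵢ _).comp b.repr.symm.toLinearIsometry, fun m => ?_⟩
  exact Submodule.mem_orthogonal_singleton_iff_inner_right.1 (b.repr.symm m).2

theorem fubiniStudy_symm {n : ℕ} (v X Y : EuclideanSpace ℂ (Fin n)) :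
    fubiniStudy v X Y = fubiniStudy v Y X := by
  rw [← fsMetric_reInner, ← fsMetric_reInner, fsMetric_apply, fsMetric_apply,
    (isHermitianInner_reInner n).symm X Y]
  ring

section Slice

variable {n : ℕ} {v : EuclideanSpace ℂ (Fin (n + 1))}
  {L : EuclideanSpace ℂ (Fin n) →ₗᵢ[ℂ] EuclideanSpace ℂ (Fin (n + 1))}

theorem norm_slice_sq (hL : ∀ m, inner ℂ v (L m) = 0) (m : EuclideanSpace ℂ (Fin n)) :
    ‖v + L m‖ ^ 2 = ‖v‖ ^ 2 + reInner n m m := by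
  rw [reInner_self, ← L.norm_map m, sq, sq, sq]
  exact norm_add_sq_eq_norm_sq_add_norm_sq_of_inner_eq_zero v (L m) (hL m)

theorem slice_ne_zero (hL : ∀ m, inner ℂ v (L m) = 0) (hv : v ≠ 0) (m : EuclideanSpace ℂ (Fin n)) :
    v + L m ≠ 0 := by
  have h := norm_slice_sq hL m
  have h1 := norm_pos_iff.2 hv
  rw [reInner_self] at h
  intro h0
  rw [h0, norm_zero] at h
  have : 0 < ‖v‖ ^ 2 + ‖m‖ ^ 2 := by positivity
  linarith

theorem log_norm_slice (hL : ∀ m, inner ℂ v (L m) = 0) (m : EuclideanSpace ℂ (Fin n)) :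
    Real.log ‖v + L m‖ = fsPot (reInner n) (‖v‖ ^ 2) m := by
  rw [fsPot, ← norm_slice_sq hL, Real.log_pow]
  push_cast
  ring

theorem fubiniStudy_slice (hL : ∀ m, inner ℂ v (L m) = 0) (m X Y : EuclideanSpace ℂ (Fin n)) :
    fubiniStudy (v + L m) (L X) (L Y) = fsMetric (reInner n) (‖v‖ ^ 2) m X Y := by
  have h1 : ∀ Z, reInner (n + 1) (v + L m) (L Z) = reInner n m Z := fun Z => by
    rw [reInner_apply, inner_add_left, hL, zero_add, L.inner_map_map, reInner_apply]
  have h2 : ∀ Z, reInner (n + 1) (v + L m) (Complex.I • L Z) = reInner n m (Complex.I • Z) :=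
    fun Z => by rw [← map_smul, h1]
  rw [← fsMetric_reInner, fsMetric_apply, fsMetric_apply, h1, h1, h2, h2, reInner_self, zero_add,
    norm_slice_sq hL, reInner_apply (L X), L.inner_map_map, ← reInner_apply]

end Slice

end LocalGeometry

section Admissible

variable {ι : Type*} [Fintype ι] {P : AdmissibleParams ι}
  {S : Type*} [TopologicalSpace S] [ChartedSpace P.Base S]
  {E₀ E₁ : S → Type*}
  [∀ s, AddCommGroup (E₀ s)] [∀ s, Module ℂ (E₀ s)] [∀ s, TopologicalSpace (E₀ s)]
  [TopologicalSpace (TotalSpace P.Fib₀ E₀)] [FiberBundle P.Fib₀ E₀]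
  [∀ s, AddCommGroup (E₁ s)] [∀ s, Module ℂ (E₁ s)] [∀ s, TopologicalSpace (E₁ s)]
  [TopologicalSpace (TotalSpace P.Fib₁ E₁)] [FiberBundle P.Fib₁ E₁]
  {M : Type*} [TopologicalSpace M] [ChartedSpace P.Tot M]
  [VectorBundle ℂ P.Fib₀ E₀] [VectorBundle ℂ P.Fib₁ E₁] [IsManifold 𝓘(ℂ, P.Base) ω S]
  [IsManifold 𝓘(ℂ, P.Tot) ω M]

open ManifoldGeometry LocalGeometry

namespace AdmissibleData

variable {D : AdmissibleData P E₀ E₁ M} {τ τ' : Gauge P E₀ E₁ D.h₀ D.h₁}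
  {γ : ∀ a, EuclideanSpace ℂ (Fin (P.d a)) →
      EuclideanSpace ℂ (Fin (P.d a)) →L[ℝ] EuclideanSpace ℂ (Fin (P.d a)) →L[ℝ] ℝ}

theorem hasFDerivAt_log_norm {n : ℕ} {v : EuclideanSpace ℂ (Fin n)} (hv : v ≠ 0) :
    HasFDerivAt (fun v : EuclideanSpace ℂ (Fin n) => Real.log ‖v‖)
      ((‖v‖ ^ 2)⁻¹ • reInner n v) v := by
  have h := (isHermitianInner_reInner n).hasFDerivAt_fsPot (r := 0) (m := v) (by
    rw [reInner_self]
    simpa using hv)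
  rw [reInner_self, zero_add] at h
  exact h.congr_of_eventuallyEq (.of_forall fun v => (fsPot_reInner v).symm)

theorem fderiv_logRatio {p : D.Coord} (hp : p ∈ D.dom τ) (X : D.Coord) :
    fderiv ℝ (D.logRatio τ) p X
      = fderiv ℝ (fun y => τ.φ₀ (τ.ψ.symm y) - τ.φ₁ (τ.ψ.symm y)) p.1 X.1
        + (‖p.2.1‖ ^ 2)⁻¹ * reInner _ p.2.1 X.2.1 - (‖p.2.2‖ ^ 2)⁻¹ * reInner _ p.2.2 X.2.2 := by
  have h0 : HasFDerivAt (fun p : D.Coord => τ.φ₀ (τ.ψ.symm p.1) - τ.φ₁ (τ.ψ.symm p.1)) _ p :=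
    (((contDiffAt_φ₀ hp.1).sub (contDiffAt_φ₁ hp.1)).differentiableAt
      (by simp)).hasFDerivAt.comp p hasFDerivAt_fst
  have h1 : HasFDerivAt (fun p : D.Coord => Real.log ‖p.2.1‖) _ p :=
    HasFDerivAt.comp (f := fun p : D.Coord => p.2.1) p (hasFDerivAt_log_norm hp.2.1)
      (hasFDerivAt_fst.comp p hasFDerivAt_snd)
  have h2 : HasFDerivAt (fun p : D.Coord => Real.log ‖p.2.2‖) _ p :=
    HasFDerivAt.comp (f := fun p : D.Coord => p.2.2) p (hasFDerivAt_log_norm hp.2.2)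
      (hasFDerivAt_snd.comp p hasFDerivAt_snd)
  exact congrArg (fun A => A X) ((h0.add h1).sub h2).fderiv

theorem mom_mem_Ioo {p : D.Coord} (hp : p ∈ D.dom τ) : mom τ p ∈ Ioo (-1 : ℝ) 1 :=
  abs_lt.1 ((sq_lt_one_iff_abs_lt_one _).1 (sub_pos.1 (one_sub_mom_sq_pos hp)))

theorem IsAdapted.horizontal_symm (hτ : IsAdapted τ γ) {p : D.Coord} (hp : p.1 ∈ τ.ψ.target)
    (X Y : D.Coord) : D.horizontal τ p X Y = D.horizontal τ p Y X := by
  simp only [horizontal]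
  rw [fubiniStudy_symm, fubiniStudy_symm p.2.2]
  congr 2
  refine Finset.sum_congr rfl fun a _ => ?_
  rw [hτ.pull a _ hp, hτ.pull a _ hp, hτ.symm a _ hp]

theorem IsAdapted.metricMap_symm (hτ : IsAdapted τ γ) {t : ℝ → ℝ}
    (ht : ∀ z ∈ Icc (-1 : ℝ) 1, 0 < 1 + (1 - z ^ 2) * t z) {p : D.Coord} (hp : p ∈ D.dom τ)
    (X Y : D.Coord) : metricMap t τ p X Y = metricMap t τ p Y X := by
  have h := ht _ (mom_mem_Icc (τ := τ) (dom_subset_punctured hp).2)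
  rw [metricMap_eq t hp h, metricMap_eq t hp h, hτ.horizontal_symm hp.1]
  ring

theorem coeff_pos (D : AdmissibleData P E₀ E₁ M) {z : ℝ} (hz : z ∈ Icc (-1 : ℝ) 1) (a : ι) :
    0 < 1 + P.x a * z := by
  have h : |P.x a * z| < 1 := by
    rw [abs_mul]
    have h1 := D.abs_x_lt a
    have h2 := abs_le.2 hz
    have h3 := abs_nonneg (P.x a)
    nlinarith
  linarith [(abs_lt.1 h).1]

/-- The metric is positive over the dense part of `M`. -/
theorem IsAdapted.metricMap_pos_of_mem_dom (hτ : IsAdapted τ γ) {t : ℝ → ℝ}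
    (ht : ∀ z ∈ Icc (-1 : ℝ) 1, 0 < 1 + (1 - z ^ 2) * t z) {p : D.Coord}
    (hp : p ∈ D.dom τ) {X : D.Coord} (hX : ∀ c : ℂ, X ≠ c • (0, p.2)) :
    0 < metricMap t τ p X X := by
  have hp' := dom_subset_punctured hp
  have h := ht _ (mom_mem_Icc (τ := τ) hp'.2)
  have hz := one_sub_mom_sq_pos hp
  have hzI := mom_mem_Ioo hp
  have hzM : D.z (D.toM τ p) = mom τ p := z_toM hp'
  rw [metricMap_eq t hp h, horizontal, hzM, dz_eq hp', fderiv_mom_eq hp]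
  obtain ⟨h1, h2⟩ := hτ.eq_zero_of_sum (κ := fun a => (1 + P.x a * mom τ p) / P.x a)
    (X := X.1) hp.1 (fun a ha => by
      rw [div_mul_cancel₀ _ ha]
      exact D.coeff_pos (mom_mem_Icc hp'.2) a)
  have hA : 0 ≤ (1 + mom τ p) * fubiniStudy p.2.1 X.2.1 X.2.1 :=
    mul_nonneg (by linarith [hzI.1]) (fubiniStudy_nonneg _ _)
  have hB : 0 ≤ (1 - mom τ p) * fubiniStudy p.2.2 X.2.2 X.2.2 :=
    mul_nonneg (by linarith [hzI.2]) (fubiniStudy_nonneg _ _)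
  have hC : 0 ≤ (1 - mom τ p ^ 2) * fderiv ℝ (D.logRatio τ) p X
      * ((1 - mom τ p ^ 2) * fderiv ℝ (D.logRatio τ) p X)
        / ((1 - mom τ p ^ 2) * (1 + (1 - mom τ p ^ 2) * t (mom τ p))) :=
    div_nonneg (mul_self_nonneg _) (by positivity)
  have hE : 0 ≤ (1 - mom τ p ^ 2) * (1 + (1 - mom τ p ^ 2) * t (mom τ p))
      * (D.theta τ p X * D.theta τ p X) :=
    mul_nonneg (by positivity) (mul_self_nonneg _)
  by_contra hle
  have e1 := h2 (by linarith)
  obtain ⟨c₀, hc₀⟩ := exists_smul_of_fubiniStudy_eq_zero hp.2.1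
    ((mul_eq_zero.1 (show (1 + mom τ p) * fubiniStudy p.2.1 X.2.1 X.2.1 = 0 by
      linarith)).resolve_left (by linarith [hzI.1]))
  obtain ⟨c₁, hc₁⟩ := exists_smul_of_fubiniStudy_eq_zero hp.2.2
    ((mul_eq_zero.1 (show (1 - mom τ p) * fubiniStudy p.2.2 X.2.2 X.2.2 = 0 by
      linarith)).resolve_left (by linarith [hzI.2]))
  have e2 : fderiv ℝ (D.logRatio τ) p X = 0 := by
    have h3 : (1 - mom τ p ^ 2) * fderiv ℝ (D.logRatio τ) p X
      * ((1 - mom τ p ^ 2) * fderiv ℝ (D.logRatio τ) p X)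
        / ((1 - mom τ p ^ 2) * (1 + (1 - mom τ p ^ 2) * t (mom τ p))) = 0 := by linarith
    have h4 : (1 - mom τ p ^ 2) * (1 + (1 - mom τ p ^ 2) * t (mom τ p)) ≠ 0 := by positivity
    rw [div_eq_zero_iff, or_iff_left h4, mul_self_eq_zero] at h3
    exact (mul_eq_zero.1 h3).resolve_left hz.ne'
  have e3 : fderiv ℝ (D.logRatio τ) p (Complex.I • X) = 0 := by
    have h3 : (1 - mom τ p ^ 2) * (1 + (1 - mom τ p ^ 2) * t (mom τ p))
      * (D.theta τ p X * D.theta τ p X) = 0 := by linarith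
    have h4 : (1 - mom τ p ^ 2) * (1 + (1 - mom τ p ^ 2) * t (mom τ p)) ≠ 0 := by positivity
    have h5 := mul_self_eq_zero.1 ((mul_eq_zero.1 h3).resolve_left h4)
    rwa [theta, neg_eq_zero] at h5
  have hre : ∀ {n : ℕ} {v : EuclideanSpace ℂ (Fin n)} (c : ℂ), v ≠ 0 →
      (‖v‖ ^ 2)⁻¹ * reInner n v (c • v) = c.re := fun {n v} c hv => by
    have hv' : ‖v‖ ≠ 0 := norm_ne_zero_iff.2 hv
    have h3 : (inner ℂ v v : ℂ) = ((‖v‖ ^ 2 : ℝ) : ℂ) := by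
      rw [inner_self_eq_norm_sq_to_K]
      norm_cast
    rw [reInner_apply, inner_smul_right, h3, mul_comm c, Complex.re_ofReal_mul,
      inv_mul_cancel_left₀ (pow_ne_zero 2 hv')]
  rw [fderiv_logRatio hp, e1, map_zero, hc₀, hc₁, hre _ hp.2.1, hre _ hp.2.2] at e2
  rw [fderiv_logRatio hp, Prod.smul_fst, e1, smul_zero, map_zero, Prod.smul_snd, Prod.smul_fst,
    Prod.smul_snd, hc₀, hc₁, smul_smul, smul_smul, hre _ hp.2.1, hre _ hp.2.2] at e3
  have hc : c₀ = c₁ := by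
    refine Complex.ext (by linarith) ?_
    simp only [Complex.mul_re, Complex.I_re, Complex.I_im] at e3
    linarith
  refine hX c₀ (Prod.ext ?_ (Prod.ext hc₀ ?_))
  · rw [e1]
    exact (smul_zero c₀).symm
  · rw [hc₁, hc]
    rfl

theorem inChart_metric_pos {t : ℝ → ℝ}
    (ht : ∀ z ∈ Icc (-1 : ℝ) 1, 0 < 1 + (1 - z ^ 2) * t z) {x : M} {u : P.Tot}
    (hu : u ∈ (chartAt P.Tot x).target) {v : P.Tot} (hv : v ≠ 0) :
    0 < inChart (D.metric t) x u v v := by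
  obtain ⟨τ, γ, p, hτ, hp, rfl⟩ := D.exists_overChart hu
  obtain ⟨X, rfl⟩ := surjective_fderiv_real_toChart hp v
  have hX : ∀ c : ℂ, X ≠ c • (0, p.2) := by
    rintro c rfl
    refine hv ?_
    rw [fderiv_real_toChart hp]
    change fderiv ℂ (toChart τ x) p (c • (0, p.2)) = 0
    rw [map_smul, fderiv_toChart_vertical hp, smul_zero]
  rw [inChart_metric t hp]
  by_cases hd : p ∈ D.dom τ
  · exact hτ.metricMap_pos_of_mem_dom ht hd hX
  · exact hτ.metricMap_pos_of_notMem_dom t hp.1 hd hX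

/-- A continuous function vanishing over the dense part of `M` vanishes. -/
theorem eq_zero_of_dom {F : Type*} [NormedAddCommGroup F] {x : M} {f : P.Tot → F}
    (hQ : ∀ (τ : Gauge P E₀ E₁ D.h₀ D.h₁) (γ : _), IsAdapted τ γ → ∀ p ∈ overChart τ x,
      p ∈ D.dom τ → f (toChart τ x p) = 0) {u : P.Tot} (hu : u ∈ (chartAt P.Tot x).target)
    (hf : ContinuousAt f u) : f u = 0 := by
  have h := frequently_of_dom (D := D) (Q := fun u => f u = 0) hQ hu
  by_contra hne
  exact h (hf.eventually_ne hne)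

theorem inChart_metric_symm {t : ℝ → ℝ} (hts : ContDiff ℝ ∞ t)
    (ht : ∀ z ∈ Icc (-1 : ℝ) 1, 0 < 1 + (1 - z ^ 2) * t z) {x : M} {u : P.Tot}
    (hu : u ∈ (chartAt P.Tot x).target) (v w : P.Tot) :
    inChart (D.metric t) x u v w = inChart (D.metric t) x u w v := by
  have hc := (contDiffAt_inChart_metric (D := D) hts ht hu).continuousAt
  have h := eq_zero_of_dom (D := D) (f := fun u => inChart (D.metric t) x u v w
    - inChart (D.metric t) x u w v) (fun τ γ hτ p hp hd => by
      obtain ⟨X, rfl⟩ := surjective_fderiv_real_toChart hp v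
      obtain ⟨Y, rfl⟩ := surjective_fderiv_real_toChart hp w
      rw [inChart_metric t hp, inChart_metric t hp, hτ.metricMap_symm ht hd, sub_self]) hu
    (((hc.clm_apply continuousAt_const).clm_apply continuousAt_const).sub
      ((hc.clm_apply continuousAt_const).clm_apply continuousAt_const))
  exact sub_eq_zero.1 h

theorem isMetricAt_inChart {t : ℝ → ℝ} (hts : ContDiff ℝ ∞ t)
    (ht : ∀ z ∈ Icc (-1 : ℝ) 1, 0 < 1 + (1 - z ^ 2) * t z) {x : M} {u : P.Tot}
    (hu : u ∈ (chartAt P.Tot x).target) : IsMetricAt (inChart (D.metric t) x) u where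
  smooth := contDiffAt_inChart_metric hts ht hu
  nondeg := by
    filter_upwards [(chartAt P.Tot x).open_target.mem_nhds hu] with u' hu'
    refine isNondegSymm_of_nondeg (inChart_metric_symm hts ht hu') fun v hv => ?_
    by_contra hne
    exact (inChart_metric_pos ht hu' hne).ne' (hv v)

end AdmissibleData

end Admissible

namespace AdmissibleParams

variable {ι : Type*} (P : AdmissibleParams ι)

/-- The dimensions of the factors over the extended index set. -/
def facDim : Option (Option ι) → ℕ
  | none => P.d₀
  | some none => P.d₁
  | some (some a) => P.d a

/-- The factors over the extended index set. -/
abbrev Fac (a : Option (Option ι)) : Type := EuclideanSpace ℂ (Fin (P.facDim a))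

variable [Fintype ι]

/-- The projection to the coordinates of the base. -/
def basePart : (∀ a, P.Fac a) →L[ℂ] P.Base :=
  ContinuousLinearMap.pi fun a => ContinuousLinearMap.proj (φ := P.Fac) (some (some a))

/-- The projection to the factor with index zero. -/
def part₀ : (∀ a, P.Fac a) →L[ℂ] EuclideanSpace ℂ (Fin P.d₀) :=
  ContinuousLinearMap.proj (φ := P.Fac) none

/-- The projection to the factor with index infinity. -/
def part₁ : (∀ a, P.Fac a) →L[ℂ] EuclideanSpace ℂ (Fin P.d₁) :=
  ContinuousLinearMap.proj (φ := P.Fac) (some none)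

end AdmissibleParams

section Admissible

variable {ι : Type*} [Fintype ι] {P : AdmissibleParams ι}
  {S : Type*} [TopologicalSpace S] [ChartedSpace P.Base S]
  {E₀ E₁ : S → Type*}
  [∀ s, AddCommGroup (E₀ s)] [∀ s, Module ℂ (E₀ s)] [∀ s, TopologicalSpace (E₀ s)]
  [TopologicalSpace (TotalSpace P.Fib₀ E₀)] [FiberBundle P.Fib₀ E₀]
  [∀ s, AddCommGroup (E₁ s)] [∀ s, Module ℂ (E₁ s)] [∀ s, TopologicalSpace (E₁ s)]
  [TopologicalSpace (TotalSpace P.Fib₁ E₁)] [FiberBundle P.Fib₁ E₁]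
  {M : Type*} [TopologicalSpace M] [ChartedSpace P.Tot M]
  [VectorBundle ℂ P.Fib₀ E₀] [VectorBundle ℂ P.Fib₁ E₁] [IsManifold 𝓘(ℂ, P.Base) ω S]
  [IsManifold 𝓘(ℂ, P.Tot) ω M]

open ManifoldGeometry LocalGeometry

namespace AdmissibleData

variable {D : AdmissibleData P E₀ E₁ M} {τ τ' : Gauge P E₀ E₁ D.h₀ D.h₁}
  {γ : ∀ a, EuclideanSpace ℂ (Fin (P.d a)) →
      EuclideanSpace ℂ (Fin (P.d a)) →L[ℝ] EuclideanSpace ℂ (Fin (P.d a)) →L[ℝ] ℝ}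

theorem IsAdapted.isHolKahlerAt (hτ : IsAdapted τ γ) {y : P.Base} (hy : y ∈ τ.ψ.target) (a : ι) :
    IsHolKahlerAt (γ a) (y a) := by
  classical
  have h1 : ∀ᶠ m in 𝓝 (y a), Function.update y a m ∈ τ.ψ.target := by
    have h2 : ContinuousAt (fun m => Function.update y a m) (y a) :=
      (continuous_const.update a continuous_id).continuousAt
    refine h2.preimage_mem_nhds (τ.ψ.open_target.mem_nhds ?_)
    rwa [Function.update_eq_self]
  have h3 : ∀ m, Function.update y a m a = m := fun m => Function.update_self a m y
  refine ⟨⟨hτ.smooth a y hy, ?_⟩, ?_, ?_⟩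
  · filter_upwards [h1] with m hm
    have hs := hτ.symm a _ hm
    have hp := hτ.pos a _ hm
    rw [h3] at hs hp
    refine isNondegSymm_of_nondeg hs fun v hv => ?_
    by_contra hne
    have := hp v hne
    rw [hv v, mul_zero] at this
    exact lt_irrefl _ this
  · filter_upwards [h1] with m hm
    have := hτ.herm a _ hm
    rwa [h3] at this
  · filter_upwards [h1] with m hm
    have := hτ.closed a _ hm
    rwa [h3] at this

/-- The local model of an admissible metric. -/
def model (τ : Gauge P E₀ E₁ D.h₀ D.h₁) (γ : ∀ a, EuclideanSpace ℂ (Fin (P.d a)) →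
      EuclideanSpace ℂ (Fin (P.d a)) →L[ℝ] EuclideanSpace ℂ (Fin (P.d a)) →L[ℝ] ℝ)
    (r₀ r₁ : ℝ) (T Θ : ℝ → ℝ) : Calabi P.Fac where
  γ := fun
    | none => fun m => (1 : ℝ) • fsMetric (reInner P.d₀) r₀ m
    | some none => fun m => (-1 : ℝ) • fsMetric (reInner P.d₁) r₁ m
    | some (some a) => γ a
  k := fun
    | none => 1
    | some none => -1
    | some (some a) => if P.x a = 0 then 2 else (P.x a)⁻¹
  h := fun y => (τ.φ₀ (τ.ψ.symm (P.basePart y)) - τ.φ₁ (τ.ψ.symm (P.basePart y)))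
    + fsPot (reInner P.d₀) r₀ (P.part₀ y) - fsPot (reInner P.d₁) r₁ (P.part₁ y)
  Z := fun s => Real.tanh (T s)
  Θ := Θ

theorem contDiff_tanh : ContDiff ℝ ∞ Real.tanh := by
  have h : Real.tanh = fun t => Real.sinh t / Real.cosh t := funext Real.tanh_eq_sinh_div_cosh
  rw [h]
  exact Real.contDiff_sinh.div Real.contDiff_cosh fun t => (Real.cosh_pos t).ne'

theorem tanh_mem_Ioo (t : ℝ) : Real.tanh t ∈ Ioo (-1 : ℝ) 1 :=
  ⟨Real.neg_one_lt_tanh t, Real.tanh_lt_one t⟩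

theorem reInner_add_ne {n : ℕ} {r : ℝ} (hr : 0 < r) (m : EuclideanSpace ℂ (Fin n)) :
    r + reInner n m m ≠ 0 := (add_pos_of_pos_of_nonneg hr ((isHermitianInner_reInner n).nonneg m)).ne'

variable {r₀ r₁ : ℝ} {T Θ : ℝ → ℝ}

theorem contDiffAt_model_h (hr₀ : 0 < r₀) (hr₁ : 0 < r₁) {y : ∀ a, P.Fac a}
    (hy : P.basePart y ∈ τ.ψ.target) : ContDiffAt ℝ ∞ (model τ γ r₀ r₁ T Θ).h y := by
  have h0 : ContDiffAt ℝ ∞ (fun y => τ.φ₀ (τ.ψ.symm (P.basePart y))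
      - τ.φ₁ (τ.ψ.symm (P.basePart y))) y :=
    ((contDiffAt_φ₀ hy).sub (contDiffAt_φ₁ hy)).comp y
      ((P.basePart.restrictScalars ℝ).contDiff.contDiffAt)
  have h1 : ContDiffAt ℝ ∞ (fun y : ∀ a, P.Fac a => fsPot (reInner P.d₀) r₀ (P.part₀ y)) y :=
    ContDiffAt.comp (g := fsPot (reInner P.d₀) r₀) y (contDiffAt_fsPot (reInner_add_ne hr₀ _))
      (P.part₀.restrictScalars ℝ).contDiff.contDiffAt
  have h2 : ContDiffAt ℝ ∞ (fun y : ∀ a, P.Fac a => fsPot (reInner P.d₁) r₁ (P.part₁ y)) y :=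
    ContDiffAt.comp (g := fsPot (reInner P.d₁) r₁) y (contDiffAt_fsPot (reInner_add_ne hr₁ _))
      (P.part₁.restrictScalars ℝ).contDiff.contDiffAt
  exact (h0.add h1).sub h2

theorem IsAdapted.ddcMap_model_h (hτ : IsAdapted τ γ) (hr₀ : 0 < r₀) (hr₁ : 0 < r₁)
    {y : ∀ a, P.Fac a} (hy : P.basePart y ∈ τ.ψ.target) (Y Y' : ∀ a, P.Fac a) :
    ddcMap (model τ γ r₀ r₁ T Θ).h y Y Y'
      = ∑ a, (model τ γ r₀ r₁ T Θ).γ a (y a) (Complex.I • Y a) (Y' a) := by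
  have c0 : ContDiffAt ℝ 2 (fun y => τ.φ₀ (τ.ψ.symm y) - τ.φ₁ (τ.ψ.symm y)) (P.basePart y) :=
    ((contDiffAt_φ₀ hy).sub (contDiffAt_φ₁ hy)).of_le (by norm_cast)
  have c1 : ContDiffAt ℝ 2 (fsPot (reInner P.d₀) r₀) (P.part₀ y) :=
    (contDiffAt_fsPot (reInner_add_ne hr₀ _)).of_le (by norm_cast)
  have c2 : ContDiffAt ℝ 2 (fsPot (reInner P.d₁) r₁) (P.part₁ y) :=
    (contDiffAt_fsPot (reInner_add_ne hr₁ _)).of_le (by norm_cast)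
  let p₀ := P.part₀
  let p₁ := P.part₁
  have hd : ∀ {W : Type} [NormedAddCommGroup W] [NormedSpace ℂ W]
      (A : (∀ a, P.Fac a) →L[ℂ] W) (Y : ∀ a, P.Fac a), fderiv ℝ A y Y = A Y :=
    fun A Y => congrArg (fun B => B Y) (A.restrictScalars ℝ).fderiv
  have e0 := ddcMap_comp (T := P.basePart) P.basePart.contDiff.contDiffAt c0 Y Y'
  have e1 := ddcMap_comp (T := p₀) p₀.contDiff.contDiffAt c1 Y Y'
  have e2 := ddcMap_comp (T := p₁) p₁.contDiff.contDiffAt c2 Y Y'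
  have d0 : ContDiffAt ℝ 2 (fun y => τ.φ₀ (τ.ψ.symm (P.basePart y))
      - τ.φ₁ (τ.ψ.symm (P.basePart y))) y :=
    c0.comp y ((P.basePart.restrictScalars ℝ).contDiff.contDiffAt)
  have d1 : ContDiffAt ℝ 2 (fun y => fsPot (reInner P.d₀) r₀ (p₀ y)) y :=
    ContDiffAt.comp (g := fsPot (reInner P.d₀) r₀) y c1 ((p₀.restrictScalars ℝ).contDiff.contDiffAt)
  have d2 : ContDiffAt ℝ 2 (fun y => fsPot (reInner P.d₁) r₁ (p₁ y)) y :=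
    ContDiffAt.comp (g := fsPot (reInner P.d₁) r₁) y c2 ((p₁.restrictScalars ℝ).contDiff.contDiffAt)
  rw [hd, hd] at e1 e2
  have hdb : ∀ Y, fderiv ℝ P.basePart y Y = P.basePart Y :=
    fun Y => congrArg (fun B => B Y) (P.basePart.restrictScalars ℝ).fderiv
  rw [hdb, hdb] at e0
  have f0 : ddcMap (fun y => τ.φ₀ (τ.ψ.symm y) - τ.φ₁ (τ.ψ.symm y)) (P.basePart y)
      (P.basePart Y) (P.basePart Y') = ∑ a, γ a (y (some (some a)))
        (Complex.I • Y (some (some a))) (Y' (some (some a))) :=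
    (D.curvature τ _ hy _ _).trans (Finset.sum_congr rfl fun a _ => hτ.pull a _ hy _ _)
  have f1 : ddcMap (fsPot (reInner P.d₀) r₀) (p₀ y) (p₀ Y) (p₀ Y')
      = fsMetric (reInner P.d₀) r₀ (P.part₀ y) (Complex.I • P.part₀ Y) (P.part₀ Y') :=
    (isHermitianInner_reInner P.d₀).ddc_fsPot (reInner_add_ne hr₀ _) _ _
  have f2 : ddcMap (fsPot (reInner P.d₁) r₁) (p₁ y) (p₁ Y) (p₁ Y')
      = fsMetric (reInner P.d₁) r₁ (P.part₁ y) (Complex.I • P.part₁ Y) (P.part₁ Y') :=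
    (isHermitianInner_reInner P.d₁).ddc_fsPot (reInner_add_ne hr₁ _) _ _
  have hh : (model τ γ r₀ r₁ T Θ).h = fun y => (τ.φ₀ (τ.ψ.symm (P.basePart y))
      - τ.φ₁ (τ.ψ.symm (P.basePart y))) + fsPot (reInner P.d₀) r₀ (p₀ y)
      + (-1) * fsPot (reInner P.d₁) r₁ (p₁ y) := by
    funext y
    rw [neg_one_mul, ← sub_eq_add_neg]
    rfl
  rw [hh, ddcMap_add (d0.add d1) (contDiffAt_const.mul d2), ddcMap_add d0 d1, ddcMap_const_mul d2,
    add_apply, add_apply, add_apply, add_apply, smul_apply, smul_apply, e0, e1, e2, f0, f1, f2,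
    Fintype.sum_option, Fintype.sum_option]
  have key : ∀ A B C A' B' C' : ℝ, A = A' → B = B' → C = C' →
      A + B + -1 * C = 1 * B' + (-1 * C' + A') := by
    intro A B C A' B' C' h1 h2 h3
    rw [h1, h2, h3]
    ring
  exact key _ _ _ _ _ _ rfl rfl rfl

theorem IsAdapted.regular_model (hτ : IsAdapted τ γ) (hr₀ : 0 < r₀) (hr₁ : 0 < r₁)
    (hΘ : ContDiff ℝ ∞ Θ) (hpos : ∀ z ∈ Ioo (-1 : ℝ) 1, 0 < Θ z)
    {n : (∀ a, P.Fac a) × ℂ} (hn : P.basePart n.1 ∈ τ.ψ.target)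
    (hT : ContDiffAt ℝ ∞ T ((model τ γ r₀ r₁ T Θ).u n))
    (hZ : ∀ᶠ s in 𝓝 ((model τ γ r₀ r₁ T Θ).u n),
      HasDerivAt (fun s => Real.tanh (T s)) (Θ (Real.tanh (T s))) s) :
    (model τ γ r₀ r₁ T Θ).Regular n where
  kahler a := match a with
    | none => (isHermitianInner_reInner P.d₀).isHolKahlerAt hr₀ _ one_ne_zero
    | some none => (isHermitianInner_reInner P.d₁).isHolKahlerAt hr₁ _ (by norm_num)
    | some (some a) => hτ.isHolKahlerAt hn a
  h_smooth := contDiffAt_model_h hr₀ hr₁ hn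
  h_ddc := by
    filter_upwards [P.basePart.continuous.continuousAt.preimage_mem_nhds
      (τ.ψ.open_target.mem_nhds hn)] with y hy Y Y'
    exact hτ.ddcMap_model_h hr₀ hr₁ hy Y Y'
  Z_smooth := contDiff_tanh.contDiffAt.comp _ hT
  Z_deriv := hZ
  Θ_smooth := hΘ.contDiffAt
  Θ_pos := hpos _ (tanh_mem_Ioo _)
  k_ne a := by
    have h := tanh_mem_Ioo (T ((model τ γ r₀ r₁ T Θ).u n))
    have hz : (model τ γ r₀ r₁ T Θ).z n = Real.tanh (T ((model τ γ r₀ r₁ T Θ).u n)) := rfl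
    rw [hz]
    match a with
    | none =>
      change _ + (1 : ℝ) ≠ 0
      linarith [h.1]
    | some none =>
      change _ + (-1 : ℝ) ≠ 0
      linarith [h.2]
    | some (some a) =>
      change _ + (if P.x a = 0 then 2 else (P.x a)⁻¹) ≠ 0
      have h1 := D.coeff_pos (Ioo_subset_Icc_self h) a
      split_ifs with hx
      · linarith [h.1]
      · intro h2
        field_simp at h2
        linarith

end AdmissibleData

end Admissible

namespace AdmissibleParams

open LocalGeometry

variable {ι : Type*} [Fintype ι] {P : AdmissibleParams ι} {C : Calabi P.Fac} {T : ℝ → ℝ}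
  {v : P.Fib₀} {w : P.Fib₁} {L₀ : EuclideanSpace ℂ (Fin P.d₀) →ₗᵢ[ℂ] P.Fib₀}
  {L₁ : EuclideanSpace ℂ (Fin P.d₁) →ₗᵢ[ℂ] P.Fib₁} {n : (∀ a, P.Fac a) × ℂ}

/-- The factor of the reparametrized fibre coordinate. -/
def modelScale (C : Calabi P.Fac) (T : ℝ → ℝ) (n : (∀ a, P.Fac a) × ℂ) : ℂ :=
  Complex.exp (n.2 + ((T (C.u n) - C.u n : ℝ) : ℂ))

/-- The coordinates of an admissible manifold provided by the local model. -/
def modelMap (C : Calabi P.Fac) (T : ℝ → ℝ) (v : P.Fib₀) (w : P.Fib₁)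
    (L₀ : EuclideanSpace ℂ (Fin P.d₀) →ₗᵢ[ℂ] P.Fib₀)
    (L₁ : EuclideanSpace ℂ (Fin P.d₁) →ₗᵢ[ℂ] P.Fib₁) (n : (∀ a, P.Fac a) × ℂ) :
    P.Base × P.Fib₀ × P.Fib₁ :=
  (P.basePart n.1, modelScale C T n • (v + L₀ (P.part₀ n.1)), w + L₁ (P.part₁ n.1))

theorem modelScale_ne_zero : modelScale C T n ≠ 0 := Complex.exp_ne_zero _

theorem norm_modelScale : ‖modelScale C T n‖ = Real.exp (n.2.re + (T (C.u n) - C.u n)) := by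
  rw [modelScale, Complex.norm_exp, Complex.add_re, Complex.ofReal_re]

theorem contDiffAt_modelMap (hh : ContDiffAt ℝ ∞ C.h n.1) (hT : ContDiffAt ℝ ∞ T (C.u n)) :
    ContDiffAt ℝ ∞ (modelMap C T v w L₀ L₁) n := by
  have hu : ContDiffAt ℝ ∞ C.u n :=
    (hh.comp n contDiffAt_fst).add (Complex.reCLM.contDiff.contDiffAt.comp n contDiffAt_snd)
  have hs : ContDiffAt ℝ ∞ (fun n => T (C.u n) - C.u n) n := (hT.comp n hu).sub hu
  have he : ContDiffAt ℝ ∞ (modelScale C T) n :=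
    ((contDiffAt_snd (𝕜 := ℝ)).add (Complex.ofRealCLM.contDiff.contDiffAt.comp n hs)).cexp
  have hf : ContDiffAt ℝ ∞ (fun n : (∀ a, P.Fac a) × ℂ => n.1) n := contDiffAt_fst
  have h0 : ContDiffAt ℝ ∞ (fun n : (∀ a, P.Fac a) × ℂ => L₀ (P.part₀ n.1)) n :=
    ((L₀.toContinuousLinearMap.comp P.part₀).restrictScalars ℝ).contDiff.contDiffAt.comp n hf
  have h1 : ContDiffAt ℝ ∞ (fun n : (∀ a, P.Fac a) × ℂ => L₁ (P.part₁ n.1)) n :=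
    ((L₁.toContinuousLinearMap.comp P.part₁).restrictScalars ℝ).contDiff.contDiffAt.comp n hf
  have hb : ContDiffAt ℝ ∞ (fun n : (∀ a, P.Fac a) × ℂ => P.basePart n.1) n :=
    (P.basePart.restrictScalars ℝ).contDiff.contDiffAt.comp n hf
  exact hb.prodMk ((he.smul (contDiffAt_const.add h0)).prodMk (contDiffAt_const.add h1))

theorem fderiv_modelMap (hh : DifferentiableAt ℝ C.h n.1) {T' : ℝ} (hT : HasDerivAt T T' (C.u n))
    (X : (∀ a, P.Fac a) × ℂ) :
    fderiv ℝ (modelMap C T v w L₀ L₁) n X = (P.basePart X.1,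
      modelScale C T n • (L₀ (P.part₀ X.1)
        + (X.2 + ((T' * C.du n X - C.du n X : ℝ) : ℂ)) • (v + L₀ (P.part₀ n.1))),
      L₁ (P.part₁ X.1)) := by
  have hu : HasFDerivAt C.u (C.du n) n := (hh.hasFDerivAt.comp n hasFDerivAt_fst).add
    (Complex.reCLM.hasFDerivAt.comp n hasFDerivAt_snd)
  have hs : HasFDerivAt (fun n => T (C.u n) - C.u n) (T' • C.du n - C.du n) n :=
    (hT.comp_hasFDerivAt n hu).sub hu
  have he : HasFDerivAt (modelScale C T) (modelScale C T n •
      (ContinuousLinearMap.snd ℝ (∀ a, P.Fac a) ℂ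
        + Complex.ofRealCLM.comp (T' • C.du n - C.du n))) n :=
    (hasFDerivAt_snd.add (Complex.ofRealCLM.hasFDerivAt.comp n hs)).cexp
  have hf : HasFDerivAt (fun n : (∀ a, P.Fac a) × ℂ => n.1)
    (ContinuousLinearMap.fst ℝ _ _) n := hasFDerivAt_fst
  have h0 : HasFDerivAt (fun n : (∀ a, P.Fac a) × ℂ => L₀ (P.part₀ n.1)) _ n :=
    ((L₀.toContinuousLinearMap.comp P.part₀).restrictScalars ℝ).hasFDerivAt.comp n hf
  have h1 : HasFDerivAt (fun n : (∀ a, P.Fac a) × ℂ => L₁ (P.part₁ n.1)) _ n :=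
    ((L₁.toContinuousLinearMap.comp P.part₁).restrictScalars ℝ).hasFDerivAt.comp n hf
  have hb : HasFDerivAt (fun n : (∀ a, P.Fac a) × ℂ => P.basePart n.1) _ n :=
    (P.basePart.restrictScalars ℝ).hasFDerivAt.comp n hf
  have h : HasFDerivAt (modelMap C T v w L₀ L₁) _ n := hb.prodMk ((he.smul (h0.const_add v)).prodMk (h1.const_add w))
  refine (congrArg (fun A => A X) h.fderiv).trans ?_
  refine congrArg₂ Prod.mk rfl (congrArg₂ Prod.mk ?_ rfl)
  change modelScale C T n • L₀ (P.part₀ X.1) + (modelScale C T n •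
    (X.2 + ((T' * C.du n X - C.du n X : ℝ) : ℂ))) • (v + L₀ (P.part₀ n.1)) = _
  rw [smul_assoc, ← smul_add]

end AdmissibleParams

section Admissible

variable {ι : Type*} [Fintype ι] {P : AdmissibleParams ι}
  {S : Type*} [TopologicalSpace S] [ChartedSpace P.Base S]
  {E₀ E₁ : S → Type*}
  [∀ s, AddCommGroup (E₀ s)] [∀ s, Module ℂ (E₀ s)] [∀ s, TopologicalSpace (E₀ s)]
  [TopologicalSpace (TotalSpace P.Fib₀ E₀)] [FiberBundle P.Fib₀ E₀]
  [∀ s, AddCommGroup (E₁ s)] [∀ s, Module ℂ (E₁ s)] [∀ s, TopologicalSpace (E₁ s)]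
  [TopologicalSpace (TotalSpace P.Fib₁ E₁)] [FiberBundle P.Fib₁ E₁]
  {M : Type*} [TopologicalSpace M] [ChartedSpace P.Tot M]
  [VectorBundle ℂ P.Fib₀ E₀] [VectorBundle ℂ P.Fib₁ E₁] [IsManifold 𝓘(ℂ, P.Base) ω S]
  [IsManifold 𝓘(ℂ, P.Tot) ω M]

open ManifoldGeometry LocalGeometry

namespace AdmissibleData

open AdmissibleParams

variable {D : AdmissibleData P E₀ E₁ M} {τ : Gauge P E₀ E₁ D.h₀ D.h₁}
  {γ : ∀ a, EuclideanSpace ℂ (Fin (P.d a)) →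
      EuclideanSpace ℂ (Fin (P.d a)) →L[ℝ] EuclideanSpace ℂ (Fin (P.d a)) →L[ℝ] ℝ}
  {T Θ : ℝ → ℝ} {v : P.Fib₀} {w : P.Fib₁} {L₀ : EuclideanSpace ℂ (Fin P.d₀) →ₗᵢ[ℂ] P.Fib₀}
  {L₁ : EuclideanSpace ℂ (Fin P.d₁) →ₗᵢ[ℂ] P.Fib₁} {n : (∀ a, P.Fac a) × ℂ}

/-- The map from the local model to the homogeneous coordinates. -/
def modelCoord (τ : Gauge P E₀ E₁ D.h₀ D.h₁) (γ : ∀ a, EuclideanSpace ℂ (Fin (P.d a)) →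
      EuclideanSpace ℂ (Fin (P.d a)) →L[ℝ] EuclideanSpace ℂ (Fin (P.d a)) →L[ℝ] ℝ)
    (T Θ : ℝ → ℝ) (v : P.Fib₀) (w : P.Fib₁) (L₀ : EuclideanSpace ℂ (Fin P.d₀) →ₗᵢ[ℂ] P.Fib₀)
    (L₁ : EuclideanSpace ℂ (Fin P.d₁) →ₗᵢ[ℂ] P.Fib₁) : (∀ a, P.Fac a) × ℂ → D.Coord :=
  modelMap (model τ γ (‖v‖ ^ 2) (‖w‖ ^ 2) T Θ) T v w L₀ L₁

theorem modelCoord_mem_dom (hv : v ≠ 0) (hw : w ≠ 0) (hL₀ : ∀ m, inner ℂ v (L₀ m) = 0)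
    (hL₁ : ∀ m, inner ℂ w (L₁ m) = 0) (hn : P.basePart n.1 ∈ τ.ψ.target) :
    modelCoord τ γ T Θ v w L₀ L₁ n ∈ D.dom τ :=
  ⟨hn, smul_ne_zero modelScale_ne_zero (slice_ne_zero hL₀ hv _), slice_ne_zero hL₁ hw _⟩

theorem logRatio_modelCoord (hv : v ≠ 0) (hL₀ : ∀ m, inner ℂ v (L₀ m) = 0)
    (hL₁ : ∀ m, inner ℂ w (L₁ m) = 0) :
    D.logRatio τ (modelCoord τ γ T Θ v w L₀ L₁ n)
      = T ((model τ γ (‖v‖ ^ 2) (‖w‖ ^ 2) T Θ).u n) := by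
  have h0 : Real.log ‖modelScale (model τ γ (‖v‖ ^ 2) (‖w‖ ^ 2) T Θ) T n
      • (v + L₀ (P.part₀ n.1))‖ = n.2.re + (T ((model τ γ (‖v‖ ^ 2) (‖w‖ ^ 2) T Θ).u n)
        - (model τ γ (‖v‖ ^ 2) (‖w‖ ^ 2) T Θ).u n)
        + fsPot (reInner P.d₀) (‖v‖ ^ 2) (P.part₀ n.1) := by
    rw [norm_smul, Real.log_mul (norm_ne_zero_iff.2 modelScale_ne_zero)
      (norm_ne_zero_iff.2 (slice_ne_zero hL₀ hv _)), norm_modelScale, Real.log_exp,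
      log_norm_slice hL₀]
  have h1 := log_norm_slice hL₁ (P.part₁ n.1)
  have hu : (model τ γ (‖v‖ ^ 2) (‖w‖ ^ 2) T Θ).u n
      = τ.φ₀ (τ.ψ.symm (P.basePart n.1)) - τ.φ₁ (τ.ψ.symm (P.basePart n.1))
        + fsPot (reInner P.d₀) (‖v‖ ^ 2) (P.part₀ n.1)
        - fsPot (reInner P.d₁) (‖w‖ ^ 2) (P.part₁ n.1) + n.2.re := rfl
  change τ.φ₀ (τ.ψ.symm (P.basePart n.1)) - τ.φ₁ (τ.ψ.symm (P.basePart n.1))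
    + Real.log ‖modelScale (model τ γ (‖v‖ ^ 2) (‖w‖ ^ 2) T Θ) T n • (v + L₀ (P.part₀ n.1))‖
    - Real.log ‖w + L₁ (P.part₁ n.1)‖ = _
  rw [h0, h1]
  linarith

theorem mom_modelCoord (hv : v ≠ 0) (hw : w ≠ 0) (hL₀ : ∀ m, inner ℂ v (L₀ m) = 0)
    (hL₁ : ∀ m, inner ℂ w (L₁ m) = 0) (hn : P.basePart n.1 ∈ τ.ψ.target) :
    mom τ (modelCoord τ γ T Θ v w L₀ L₁ n)
      = (model τ γ (‖v‖ ^ 2) (‖w‖ ^ 2) T Θ).z n := by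
  rw [mom_eq_tanh (modelCoord_mem_dom hv hw hL₀ hL₁ hn), logRatio_modelCoord hv hL₀ hL₁]
  rfl

theorem IsAdapted.horizontal_modelCoord (hτ : IsAdapted τ γ) (hv : v ≠ 0) (hw : w ≠ 0)
    (hL₀ : ∀ m, inner ℂ v (L₀ m) = 0) (hL₁ : ∀ m, inner ℂ w (L₁ m) = 0)
    (hn : P.basePart n.1 ∈ τ.ψ.target) (Y Y' : ∀ a, P.Fac a) (b b' : ℂ) :
    D.horizontal τ (modelCoord τ γ T Θ v w L₀ L₁ n)
      (P.basePart Y, modelScale (model τ γ (‖v‖ ^ 2) (‖w‖ ^ 2) T Θ) T n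
        • (L₀ (P.part₀ Y) + b • (v + L₀ (P.part₀ n.1))), L₁ (P.part₁ Y))
      (P.basePart Y', modelScale (model τ γ (‖v‖ ^ 2) (‖w‖ ^ 2) T Θ) T n
        • (L₀ (P.part₀ Y') + b' • (v + L₀ (P.part₀ n.1))), L₁ (P.part₁ Y'))
      = ∑ a, ((model τ γ (‖v‖ ^ 2) (‖w‖ ^ 2) T Θ).z n + (model τ γ (‖v‖ ^ 2) (‖w‖ ^ 2) T Θ).k a)
        * (model τ γ (‖v‖ ^ 2) (‖w‖ ^ 2) T Θ).γ a (n.1 a) (Y a) (Y' a) := by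
  have hd := modelCoord_mem_dom (γ := γ) (T := T) (Θ := Θ) hv hw hL₀ hL₁ hn
  have hz : D.z (D.toM τ (modelCoord τ γ T Θ v w L₀ L₁ n))
      = (model τ γ (‖v‖ ^ 2) (‖w‖ ^ 2) T Θ).z n :=
    (z_toM (dom_subset_punctured hd)).trans (mom_modelCoord hv hw hL₀ hL₁ hn)
  set C := model τ γ (‖v‖ ^ 2) (‖w‖ ^ 2) T Θ with hC
  have hF0 : fubiniStudy (modelCoord τ γ T Θ v w L₀ L₁ n).2.1
      (modelScale C T n • (L₀ (P.part₀ Y) + b • (v + L₀ (P.part₀ n.1))))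
      (modelScale C T n • (L₀ (P.part₀ Y') + b' • (v + L₀ (P.part₀ n.1))))
      = fsMetric (reInner P.d₀) (‖v‖ ^ 2) (P.part₀ n.1) (P.part₀ Y) (P.part₀ Y') :=
    ((fubiniStudy_smul modelScale_ne_zero _ _ _).trans (fubiniStudy_add_smul _ _ _ _ _)).trans
      (fubiniStudy_slice hL₀ _ _ _)
  have hF1 : fubiniStudy (modelCoord τ γ T Θ v w L₀ L₁ n).2.2 (L₁ (P.part₁ Y)) (L₁ (P.part₁ Y'))
      = fsMetric (reInner P.d₁) (‖w‖ ^ 2) (P.part₁ n.1) (P.part₁ Y) (P.part₁ Y') :=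
    fubiniStudy_slice hL₁ _ _ _
  have hB : ∀ a, (1 + P.x a * C.z n) / P.x a * pullback (D.g a) τ.ψ.symm
      (modelCoord τ γ T Θ v w L₀ L₁ n).1 (P.basePart Y) (P.basePart Y')
      = (C.z n + C.k (some (some a))) * C.γ (some (some a)) (n.1 (some (some a)))
        (Y (some (some a))) (Y' (some (some a))) := by
    intro a
    have h1 : pullback (D.g a) τ.ψ.symm (modelCoord τ γ T Θ v w L₀ L₁ n).1 (P.basePart Y)
      (P.basePart Y') = γ a (n.1 (some (some a))) (Y (some (some a))) (Y' (some (some a))) :=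
      hτ.pull a _ hn _ _
    rw [h1]
    by_cases hx : P.x a = 0
    · have h0 : Y (some (some a)) = 0 := hτ.eq_zero hn hx _
      have h2 : C.γ (some (some a)) (n.1 (some (some a))) (Y (some (some a)))
          (Y' (some (some a))) = 0 :=
        congrArg (fun A => A (Y' (some (some a))))
          ((congrArg (γ a (n.1 (some (some a)))) h0).trans (map_zero _))
      rw [h2, hx, div_zero, zero_mul, mul_zero]
    · have hk : C.k (some (some a)) = (P.x a)⁻¹ := if_neg hx
      rw [hk]
      have h2 : (1 + P.x a * C.z n) / P.x a = C.z n + (P.x a)⁻¹ := by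
        field_simp
        ring
      rw [h2]
      rfl
  have key : ∀ A z F0 F1 : ℝ, A + (1 + z) * F0 + (1 - z) * F1
      = (z + 1) * (1 * F0) + ((z + -1) * (-1 * F1) + A) := by
    intro A z F0 F1
    ring
  rw [horizontal, hz, Fintype.sum_option, Fintype.sum_option, ← Finset.sum_congr rfl fun a _ => hB a]
  change _ + (1 + C.z n) * fubiniStudy (modelCoord τ γ T Θ v w L₀ L₁ n).2.1
      (modelScale C T n • (L₀ (P.part₀ Y) + b • (v + L₀ (P.part₀ n.1))))
      (modelScale C T n • (L₀ (P.part₀ Y') + b' • (v + L₀ (P.part₀ n.1))))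
    + (1 - C.z n) * fubiniStudy (modelCoord τ γ T Θ v w L₀ L₁ n).2.2 (L₁ (P.part₁ Y))
      (L₁ (P.part₁ Y')) = _
  rw [hF0, hF1]
  exact key _ _ _ _

end AdmissibleData

namespace AdmissibleData

open AdmissibleParams

variable {D : AdmissibleData P E₀ E₁ M} {τ : Gauge P E₀ E₁ D.h₀ D.h₁}
  {γ : ∀ a, EuclideanSpace ℂ (Fin (P.d a)) →
      EuclideanSpace ℂ (Fin (P.d a)) →L[ℝ] EuclideanSpace ℂ (Fin (P.d a)) →L[ℝ] ℝ}
  {T Θ t : ℝ → ℝ} {v : P.Fib₀} {w : P.Fib₁} {L₀ : EuclideanSpace ℂ (Fin P.d₀) →ₗᵢ[ℂ] P.Fib₀}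
  {L₁ : EuclideanSpace ℂ (Fin P.d₁) →ₗᵢ[ℂ] P.Fib₁} {n : (∀ a, P.Fac a) × ℂ}

theorem fderiv_logRatio_scale {p : D.Coord} (hp : p ∈ D.dom τ) (c : ℂ) :
    fderiv ℝ (D.logRatio τ) p (0, c • p.2.1, 0) = c.re := by
  have hne : ‖p.2.1‖ ^ 2 ≠ 0 := pow_ne_zero _ (norm_ne_zero_iff.2 hp.2.1)
  have h1 : reInner _ p.2.1 (c • p.2.1) = c.re * ‖p.2.1‖ ^ 2 := by
    rw [reInner_apply, inner_smul_right, inner_self_eq_norm_sq_to_K]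
    have : c * ((‖p.2.1‖ : ℝ) : ℂ) ^ 2 = ((‖p.2.1‖ ^ 2 : ℝ) : ℂ) * c := by
      push_cast
      ring
    exact (congrArg Complex.re this).trans ((Complex.re_ofReal_mul _ _).trans (mul_comm _ _))
  rw [fderiv_logRatio hp]
  change fderiv ℝ _ p.1 0 + (‖p.2.1‖ ^ 2)⁻¹ * reInner _ p.2.1 (c • p.2.1)
    - (‖p.2.2‖ ^ 2)⁻¹ * reInner _ p.2.2 0 = c.re
  rw [h1, map_zero, map_zero, mul_zero, sub_zero, zero_add, mul_comm, mul_assoc,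
    mul_inv_cancel₀ hne, mul_one]

theorem sq_norm_pos {n : ℕ} {v : EuclideanSpace ℂ (Fin n)} (hv : v ≠ 0) : 0 < ‖v‖ ^ 2 :=
  pow_pos (norm_pos_iff.2 hv) 2

theorem fderiv_modelCoord (hv : v ≠ 0) (hw : w ≠ 0) (hn : P.basePart n.1 ∈ τ.ψ.target) {T' : ℝ}
    (hT : HasDerivAt T T' ((model τ γ (‖v‖ ^ 2) (‖w‖ ^ 2) T Θ).u n)) (X : (∀ a, P.Fac a) × ℂ) :
    fderiv ℝ (modelCoord τ γ T Θ v w L₀ L₁) n X = (P.basePart X.1,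
      modelScale (model τ γ (‖v‖ ^ 2) (‖w‖ ^ 2) T Θ) T n • (L₀ (P.part₀ X.1)
        + (X.2 + ((T' * (model τ γ (‖v‖ ^ 2) (‖w‖ ^ 2) T Θ).du n X
          - (model τ γ (‖v‖ ^ 2) (‖w‖ ^ 2) T Θ).du n X : ℝ) : ℂ)) • (v + L₀ (P.part₀ n.1))),
      L₁ (P.part₁ X.1)) :=
  fderiv_modelMap ((contDiffAt_model_h (sq_norm_pos hv) (sq_norm_pos hw) hn).differentiableAt
    (by simp)) hT X

theorem contDiffAt_modelCoord (hv : v ≠ 0) (hw : w ≠ 0) (hn : P.basePart n.1 ∈ τ.ψ.target)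
    (hT : ContDiffAt ℝ ∞ T ((model τ γ (‖v‖ ^ 2) (‖w‖ ^ 2) T Θ).u n)) :
    ContDiffAt ℝ ∞ (modelCoord τ γ T Θ v w L₀ L₁) n :=
  contDiffAt_modelMap (contDiffAt_model_h (sq_norm_pos hv) (sq_norm_pos hw) hn) hT

theorem fderiv_logRatio_modelCoord (hv : v ≠ 0) (hw : w ≠ 0) (hL₀ : ∀ m, inner ℂ v (L₀ m) = 0)
    (hL₁ : ∀ m, inner ℂ w (L₁ m) = 0) (hn : P.basePart n.1 ∈ τ.ψ.target)
    (hTs : ContDiffAt ℝ ∞ T ((model τ γ (‖v‖ ^ 2) (‖w‖ ^ 2) T Θ).u n)) {T' : ℝ}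
    (hT : HasDerivAt T T' ((model τ γ (‖v‖ ^ 2) (‖w‖ ^ 2) T Θ).u n)) (X : (∀ a, P.Fac a) × ℂ) :
    fderiv ℝ (D.logRatio τ) (modelCoord τ γ T Θ v w L₀ L₁ n)
      (fderiv ℝ (modelCoord τ γ T Θ v w L₀ L₁) n X)
      = T' * (model τ γ (‖v‖ ^ 2) (‖w‖ ^ 2) T Θ).du n X := by
  set C := model τ γ (‖v‖ ^ 2) (‖w‖ ^ 2) T Θ with hC
  have hd := modelCoord_mem_dom (γ := γ) (T := T) (Θ := Θ) hv hw hL₀ hL₁ hn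
  have h1 := HasFDerivAt.comp (g := D.logRatio τ) n
    ((contDiffAt_logRatio hd).differentiableAt (by simp)).hasFDerivAt
    ((contDiffAt_modelCoord (γ := γ) (Θ := Θ) (L₀ := L₀) (L₁ := L₁) hv hw hn hTs).differentiableAt
      (by simp)).hasFDerivAt
  have hh : DifferentiableAt ℝ C.h n.1 :=
    (contDiffAt_model_h (sq_norm_pos hv) (sq_norm_pos hw) hn).differentiableAt (by simp)
  have hu : HasFDerivAt C.u (C.du n) n := (hh.hasFDerivAt.comp n hasFDerivAt_fst).add
    (Complex.reCLM.hasFDerivAt.comp n hasFDerivAt_snd)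
  have h2 := hT.comp_hasFDerivAt n hu
  have h3 : D.logRatio τ ∘ modelCoord τ γ T Θ v w L₀ L₁ = T ∘ C.u :=
    funext fun n => logRatio_modelCoord hv hL₀ hL₁
  rw [h3] at h1
  exact congrArg (fun A => A X) (h1.unique h2)

theorem fderiv_logRatio_I_modelCoord (hv : v ≠ 0) (hw : w ≠ 0) (hL₀ : ∀ m, inner ℂ v (L₀ m) = 0)
    (hL₁ : ∀ m, inner ℂ w (L₁ m) = 0) (hn : P.basePart n.1 ∈ τ.ψ.target)
    (hTs : ContDiffAt ℝ ∞ T ((model τ γ (‖v‖ ^ 2) (‖w‖ ^ 2) T Θ).u n)) {T' : ℝ}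
    (hT : HasDerivAt T T' ((model τ γ (‖v‖ ^ 2) (‖w‖ ^ 2) T Θ).u n)) (X : (∀ a, P.Fac a) × ℂ) :
    fderiv ℝ (D.logRatio τ) (modelCoord τ γ T Θ v w L₀ L₁ n)
      (Complex.I • fderiv ℝ (modelCoord τ γ T Θ v w L₀ L₁) n X)
      = (model τ γ (‖v‖ ^ 2) (‖w‖ ^ 2) T Θ).du n (Complex.I • X) := by
  have h1 := fderiv_logRatio_modelCoord (γ := γ) (Θ := Θ) hv hw hL₀ hL₁ hn hTs hT (Complex.I • X)
  have hd := modelCoord_mem_dom (γ := γ) (T := T) (Θ := Θ) hv hw hL₀ hL₁ hn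
  have e1 := fderiv_modelCoord (γ := γ) (L₀ := L₀) (L₁ := L₁) (Θ := Θ) hv hw hn hT X
  have e2 := fderiv_modelCoord (γ := γ) (L₀ := L₀) (L₁ := L₁) (Θ := Θ) hv hw hn hT (Complex.I • X)
  set C := model τ γ (‖v‖ ^ 2) (‖w‖ ^ 2) T Θ with hC
  let c : ℂ := Complex.I * ((T' * C.du n X - C.du n X : ℝ) : ℂ)
    - ((T' * C.du n (Complex.I • X) - C.du n (Complex.I • X) : ℝ) : ℂ)
  have h2 := fderiv_logRatio_scale hd c
  have hc : c.re = - (T' * C.du n (Complex.I • X) - C.du n (Complex.I • X)) := by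
    simp only [c, Complex.sub_re, Complex.mul_re, Complex.I_re, Complex.I_im, Complex.ofReal_re,
      Complex.ofReal_im]
    ring
  have h3 : (Complex.I • fderiv ℝ (modelCoord τ γ T Θ v w L₀ L₁) n X : D.Coord)
      = fderiv ℝ (modelCoord τ γ T Θ v w L₀ L₁) n (Complex.I • X)
        + (0, c • (modelCoord τ γ T Θ v w L₀ L₁ n).2.1, 0) := by
    rw [e1, e2]
    refine Prod.ext ?_ (Prod.ext ?_ ?_)
    · exact (P.basePart.map_smul Complex.I X.1).symm.trans (add_zero _).symm
    · change Complex.I • modelScale C T n • (L₀ (P.part₀ X.1) + _ • _)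
        = modelScale C T n • (L₀ (P.part₀ (Complex.I • X.1)) + (Complex.I • X.2 + _) • _)
          + c • modelScale C T n • (v + L₀ (P.part₀ n.1))
      rw [map_smul, map_smul]
      simp only [c]
      module
    · change Complex.I • L₁ (P.part₁ X.1) = L₁ (P.part₁ (Complex.I • X.1)) + 0
      rw [map_smul, map_smul, add_zero]
  rw [h3, map_add, h1, h2, hc]
  ring

end AdmissibleData

namespace AdmissibleData
open AdmissibleParams

variable {D : AdmissibleData P E₀ E₁ M} {τ : Gauge P E₀ E₁ D.h₀ D.h₁}
  {γ : ∀ a, EuclideanSpace ℂ (Fin (P.d a)) →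
      EuclideanSpace ℂ (Fin (P.d a)) →L[ℝ] EuclideanSpace ℂ (Fin (P.d a)) →L[ℝ] ℝ}
  {T Θ t : ℝ → ℝ} {v : P.Fib₀} {w : P.Fib₁} {L₀ : EuclideanSpace ℂ (Fin P.d₀) →ₗᵢ[ℂ] P.Fib₀}
  {L₁ : EuclideanSpace ℂ (Fin P.d₁) →ₗᵢ[ℂ] P.Fib₁} {n : (∀ a, P.Fac a) × ℂ}

theorem IsAdapted.horizontal_fderiv_modelCoord (hτ : IsAdapted τ γ) (hv : v ≠ 0) (hw : w ≠ 0)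
    (hL₀ : ∀ m, inner ℂ v (L₀ m) = 0) (hL₁ : ∀ m, inner ℂ w (L₁ m) = 0)
    (hn : P.basePart n.1 ∈ τ.ψ.target) {T' : ℝ}
    (hT : HasDerivAt T T' ((model τ γ (‖v‖ ^ 2) (‖w‖ ^ 2) T Θ).u n)) (X Y : (∀ a, P.Fac a) × ℂ) :
    D.horizontal τ (modelCoord τ γ T Θ v w L₀ L₁ n)
      (fderiv ℝ (modelCoord τ γ T Θ v w L₀ L₁) n X) (fderiv ℝ (modelCoord τ γ T Θ v w L₀ L₁) n Y)
      = ∑ a, ((model τ γ (‖v‖ ^ 2) (‖w‖ ^ 2) T Θ).z n + (model τ γ (‖v‖ ^ 2) (‖w‖ ^ 2) T Θ).k a)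
        * (model τ γ (‖v‖ ^ 2) (‖w‖ ^ 2) T Θ).γ a (n.1 a) (X.1 a) (Y.1 a) := by
  rw [fderiv_modelCoord hv hw hn hT, fderiv_modelCoord hv hw hn hT]
  exact hτ.horizontal_modelCoord hv hw hL₀ hL₁ hn X.1 Y.1 _ _

theorem IsAdapted.horizontal_I_fderiv_modelCoord (hτ : IsAdapted τ γ) (hv : v ≠ 0) (hw : w ≠ 0)
    (hL₀ : ∀ m, inner ℂ v (L₀ m) = 0) (hL₁ : ∀ m, inner ℂ w (L₁ m) = 0)
    (hn : P.basePart n.1 ∈ τ.ψ.target) {T' : ℝ}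
    (hT : HasDerivAt T T' ((model τ γ (‖v‖ ^ 2) (‖w‖ ^ 2) T Θ).u n)) (X Y : (∀ a, P.Fac a) × ℂ) :
    D.horizontal τ (modelCoord τ γ T Θ v w L₀ L₁ n)
      (Complex.I • fderiv ℝ (modelCoord τ γ T Θ v w L₀ L₁) n X)
      (fderiv ℝ (modelCoord τ γ T Θ v w L₀ L₁) n Y)
      = ∑ a, ((model τ γ (‖v‖ ^ 2) (‖w‖ ^ 2) T Θ).z n + (model τ γ (‖v‖ ^ 2) (‖w‖ ^ 2) T Θ).k a)
        * (model τ γ (‖v‖ ^ 2) (‖w‖ ^ 2) T Θ).γ a (n.1 a) (Complex.I • X.1 a) (Y.1 a) := by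
  rw [fderiv_modelCoord hv hw hn hT, fderiv_modelCoord hv hw hn hT]
  refine Eq.trans ?_ (hτ.horizontal_modelCoord hv hw hL₀ hL₁ hn (Complex.I • X.1) Y.1
    (Complex.I • (X.2 + ((T' * (model τ γ (‖v‖ ^ 2) (‖w‖ ^ 2) T Θ).du n X
          - (model τ γ (‖v‖ ^ 2) (‖w‖ ^ 2) T Θ).du n X : ℝ) : ℂ)))
    (Y.2 + ((T' * (model τ γ (‖v‖ ^ 2) (‖w‖ ^ 2) T Θ).du n Y
          - (model τ γ (‖v‖ ^ 2) (‖w‖ ^ 2) T Θ).du n Y : ℝ) : ℂ)))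
  refine congrArg (fun A => D.horizontal τ _ A _) (Prod.ext ?_ (Prod.ext ?_ ?_))
  · exact (P.basePart.map_smul Complex.I X.1).symm
  · change Complex.I • modelScale _ T n • (L₀ (P.part₀ X.1) + _ • _)
      = modelScale _ T n • (L₀ (P.part₀ (Complex.I • X.1)) + (Complex.I • _) • _)
    rw [map_smul, map_smul]
    module
  · change Complex.I • L₁ (P.part₁ X.1) = L₁ (P.part₁ (Complex.I • X.1))
    rw [map_smul, map_smul]

section

variable {κ : ℝ → ℝ}

theorem dz_fderiv_modelCoord (hv : v ≠ 0) (hw : w ≠ 0)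
    (hL₀ : ∀ m, inner ℂ v (L₀ m) = 0) (hL₁ : ∀ m, inner ℂ w (L₁ m) = 0)
    (hn : P.basePart n.1 ∈ τ.ψ.target) (hΘ : ∀ z, Θ z = (1 - z ^ 2) * κ z)
    (hTs : ContDiffAt ℝ ∞ T ((model τ γ (‖v‖ ^ 2) (‖w‖ ^ 2) T Θ).u n))
    (hT : HasDerivAt T (κ (Real.tanh (T ((model τ γ (‖v‖ ^ 2) (‖w‖ ^ 2) T Θ).u n))))
      ((model τ γ (‖v‖ ^ 2) (‖w‖ ^ 2) T Θ).u n)) (X : (∀ a, P.Fac a) × ℂ) :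
    D.dz τ (modelCoord τ γ T Θ v w L₀ L₁ n) (fderiv ℝ (modelCoord τ γ T Θ v w L₀ L₁) n X)
      = Θ ((model τ γ (‖v‖ ^ 2) (‖w‖ ^ 2) T Θ).z n)
        * (model τ γ (‖v‖ ^ 2) (‖w‖ ^ 2) T Θ).du n X := by
  have hd := modelCoord_mem_dom (γ := γ) (T := T) (Θ := Θ) hv hw hL₀ hL₁ hn
  rw [dz_eq (dom_subset_punctured hd), fderiv_mom_eq hd,
    fderiv_logRatio_modelCoord hv hw hL₀ hL₁ hn hTs hT, mom_modelCoord hv hw hL₀ hL₁ hn, hΘ,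
    mul_assoc]
  rfl

theorem theta_fderiv_modelCoord (hv : v ≠ 0) (hw : w ≠ 0)
    (hL₀ : ∀ m, inner ℂ v (L₀ m) = 0) (hL₁ : ∀ m, inner ℂ w (L₁ m) = 0)
    (hn : P.basePart n.1 ∈ τ.ψ.target)
    (hTs : ContDiffAt ℝ ∞ T ((model τ γ (‖v‖ ^ 2) (‖w‖ ^ 2) T Θ).u n)) {T' : ℝ}
    (hT : HasDerivAt T T' ((model τ γ (‖v‖ ^ 2) (‖w‖ ^ 2) T Θ).u n)) (X : (∀ a, P.Fac a) × ℂ) :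
    D.theta τ (modelCoord τ γ T Θ v w L₀ L₁ n) (fderiv ℝ (modelCoord τ γ T Θ v w L₀ L₁) n X)
      = -(model τ γ (‖v‖ ^ 2) (‖w‖ ^ 2) T Θ).du n (Complex.I • X) :=
  congrArg Neg.neg (fderiv_logRatio_I_modelCoord hv hw hL₀ hL₁ hn hTs hT X)

theorem IsAdapted.metricMap_modelCoord (hτ : IsAdapted τ γ) (hv : v ≠ 0) (hw : w ≠ 0)
    (hL₀ : ∀ m, inner ℂ v (L₀ m) = 0) (hL₁ : ∀ m, inner ℂ w (L₁ m) = 0)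
    (hn : P.basePart n.1 ∈ τ.ψ.target)
    (ht : ∀ z ∈ Icc (-1 : ℝ) 1, 0 < 1 + (1 - z ^ 2) * t z)
    (hΘ : ∀ z, Θ z = (1 - z ^ 2) * (1 + (1 - z ^ 2) * t z))
    (hTs : ContDiffAt ℝ ∞ T ((model τ γ (‖v‖ ^ 2) (‖w‖ ^ 2) T Θ).u n))
    (hT : HasDerivAt T ((fun z => 1 + (1 - z ^ 2) * t z)
      (Real.tanh (T ((model τ γ (‖v‖ ^ 2) (‖w‖ ^ 2) T Θ).u n))))
      ((model τ γ (‖v‖ ^ 2) (‖w‖ ^ 2) T Θ).u n)) (X Y : (∀ a, P.Fac a) × ℂ) :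
    metricMap t τ (modelCoord τ γ T Θ v w L₀ L₁ n)
      (fderiv ℝ (modelCoord τ γ T Θ v w L₀ L₁) n X) (fderiv ℝ (modelCoord τ γ T Θ v w L₀ L₁) n Y)
      = (model τ γ (‖v‖ ^ 2) (‖w‖ ^ 2) T Θ).G n X Y := by
  have hd := modelCoord_mem_dom (γ := γ) (T := T) (Θ := Θ) hv hw hL₀ hL₁ hn
  have hz := mom_mem_Ioo hd
  have hm := mom_modelCoord (γ := γ) (T := T) (Θ := Θ) hv hw hL₀ hL₁ hn
  have hpos : Θ ((model τ γ (‖v‖ ^ 2) (‖w‖ ^ 2) T Θ).z n) ≠ 0 := by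
    rw [← hm, hΘ]
    exact (mul_pos (one_sub_mom_sq_pos hd) (ht _ (Ioo_subset_Icc_self hz))).ne'
  rw [metricMap_eq t hd (ht _ (Ioo_subset_Icc_self hz)),
    hτ.horizontal_fderiv_modelCoord hv hw hL₀ hL₁ hn hT,
    dz_fderiv_modelCoord hv hw hL₀ hL₁ hn hΘ hTs hT,
    dz_fderiv_modelCoord hv hw hL₀ hL₁ hn hΘ hTs hT,
    theta_fderiv_modelCoord hv hw hL₀ hL₁ hn hTs hT,
    theta_fderiv_modelCoord hv hw hL₀ hL₁ hn hTs hT, ← hΘ, hm, Calabi.G_apply]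
  change _ = _ + Θ _ * _
  field_simp
  ring

theorem IsAdapted.formMap_modelCoord (hτ : IsAdapted τ γ) (hv : v ≠ 0) (hw : w ≠ 0)
    (hL₀ : ∀ m, inner ℂ v (L₀ m) = 0) (hL₁ : ∀ m, inner ℂ w (L₁ m) = 0)
    (hn : P.basePart n.1 ∈ τ.ψ.target) (hΘ : ∀ z, Θ z = (1 - z ^ 2) * κ z)
    (hTs : ContDiffAt ℝ ∞ T ((model τ γ (‖v‖ ^ 2) (‖w‖ ^ 2) T Θ).u n))
    (hT : HasDerivAt T (κ (Real.tanh (T ((model τ γ (‖v‖ ^ 2) (‖w‖ ^ 2) T Θ).u n))))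
      ((model τ γ (‖v‖ ^ 2) (‖w‖ ^ 2) T Θ).u n)) (X Y : (∀ a, P.Fac a) × ℂ) :
    formMap τ (modelCoord τ γ T Θ v w L₀ L₁ n)
      (fderiv ℝ (modelCoord τ γ T Θ v w L₀ L₁) n X) (fderiv ℝ (modelCoord τ γ T Θ v w L₀ L₁) n Y)
      = (model τ γ (‖v‖ ^ 2) (‖w‖ ^ 2) T Θ).G n (Complex.I • X) Y := by
  have hd := modelCoord_mem_dom (γ := γ) (T := T) (Θ := Θ) hv hw hL₀ hL₁ hn
  rw [formMap_eq hd, hτ.horizontal_I_fderiv_modelCoord hv hw hL₀ hL₁ hn hT,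
    dz_fderiv_modelCoord hv hw hL₀ hL₁ hn hΘ hTs hT,
    dz_fderiv_modelCoord hv hw hL₀ hL₁ hn hΘ hTs hT,
    theta_fderiv_modelCoord hv hw hL₀ hL₁ hn hTs hT,
    theta_fderiv_modelCoord hv hw hL₀ hL₁ hn hTs hT, Calabi.G_apply, I_smul_I_smul, map_neg]
  refine congrArg₂ (· + ·) rfl ?_
  change _ = Θ _ * _
  ring

end

end AdmissibleData

end Admissible

namespace AdmissibleParams

open LocalGeometry

variable {ι : Type*} [Fintype ι] {P : AdmissibleParams ι}

/-- A point of the local model over a given point of the base. -/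
def basePoint (y : P.Base) : ∀ a, P.Fac a := fun
  | none => (0 : EuclideanSpace ℂ (Fin P.d₀))
  | some none => (0 : EuclideanSpace ℂ (Fin P.d₁))
  | some (some a) => y a

theorem finrank_fac (a : Option (Option ι)) : Module.finrank ℝ (P.Fac a) = 2 * P.facDim a := by
  rw [finrank_real_of_complex, finrank_euclideanSpace_fin]

theorem finrank_model :
    Module.finrank ℝ ((∀ a, P.Fac a) × ℂ) = Module.finrank ℝ P.Tot := by
  rw [finrank_real_of_complex, finrank_real_of_complex P.Tot, Module.finrank_prod,
    Module.finrank_pi_fintype, finrank_euclideanSpace_fin, Module.finrank_self,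
    Fintype.sum_option, Fintype.sum_option]
  simp only [finrank_euclideanSpace_fin, facDim]
  ring

end AdmissibleParams

section Admissible

variable {ι : Type*} [Fintype ι] {P : AdmissibleParams ι}
  {S : Type*} [TopologicalSpace S] [ChartedSpace P.Base S]
  {E₀ E₁ : S → Type*}
  [∀ s, AddCommGroup (E₀ s)] [∀ s, Module ℂ (E₀ s)] [∀ s, TopologicalSpace (E₀ s)]
  [TopologicalSpace (TotalSpace P.Fib₀ E₀)] [FiberBundle P.Fib₀ E₀]
  [∀ s, AddCommGroup (E₁ s)] [∀ s, Module ℂ (E₁ s)] [∀ s, TopologicalSpace (E₁ s)]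
  [TopologicalSpace (TotalSpace P.Fib₁ E₁)] [FiberBundle P.Fib₁ E₁]
  {M : Type*} [TopologicalSpace M] [ChartedSpace P.Tot M]
  [VectorBundle ℂ P.Fib₀ E₀] [VectorBundle ℂ P.Fib₁ E₁] [IsManifold 𝓘(ℂ, P.Base) ω S]
  [IsManifold 𝓘(ℂ, P.Tot) ω M]

open ManifoldGeometry LocalGeometry

namespace AdmissibleData
open AdmissibleParams

variable {D : AdmissibleData P E₀ E₁ M} {τ : Gauge P E₀ E₁ D.h₀ D.h₁}
  {γ : ∀ a, EuclideanSpace ℂ (Fin (P.d a)) →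
      EuclideanSpace ℂ (Fin (P.d a)) →L[ℝ] EuclideanSpace ℂ (Fin (P.d a)) →L[ℝ] ℝ}
  {T Θ t : ℝ → ℝ} {v : P.Fib₀} {w : P.Fib₁} {L₀ : EuclideanSpace ℂ (Fin P.d₀) →ₗᵢ[ℂ] P.Fib₀}
  {L₁ : EuclideanSpace ℂ (Fin P.d₁) →ₗᵢ[ℂ] P.Fib₁} {n : (∀ a, P.Fac a) × ℂ}

theorem IsAdapted.model_S_eq (hτ : IsAdapted τ γ) {y : P.Base} (hy : y ∈ τ.ψ.target) {r₀ r₁ : ℝ}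
    {z : ℝ} (hz : z ∈ Ioo (-1 : ℝ) 1) : (model τ γ r₀ r₁ T Θ).S z = P.logDerivPc z := by
  have h0 : z + 1 ≠ 0 := by linarith [hz.1]
  have h1 : 1 - z ≠ 0 := by linarith [hz.2]
  rw [Calabi.S, Fintype.sum_option, Fintype.sum_option]
  simp only [finrank_fac]
  change ((2 * P.d₀ : ℕ) : ℝ) / 2 / (z + 1) + (((2 * P.d₁ : ℕ) : ℝ) / 2 / (z + -1)
    + ∑ a, ((2 * P.d a : ℕ) : ℝ) / 2 / (z + if P.x a = 0 then 2 else (P.x a)⁻¹)) = _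
  have e : ∀ a, ((2 * P.d a : ℕ) : ℝ) / 2 / (z + if P.x a = 0 then 2 else (P.x a)⁻¹)
      = P.d a * P.x a / (1 + P.x a * z) := by
    intro a
    have hc := (D.coeff_pos (Ioo_subset_Icc_self hz) a).ne'
    by_cases hx : P.x a = 0
    · have hd : P.d a = 0 := by
        by_contra hd
        have : NeZero (P.d a) := ⟨hd⟩
        have h2 := hτ.eq_zero hy hx (EuclideanSpace.single 0 1)
        simpa using congrArg (fun v : EuclideanSpace ℂ (Fin (P.d a)) => v 0) h2
      simp [hd]
    · rw [if_neg hx]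
      have h2 : z + (P.x a)⁻¹ ≠ 0 := fun h2 => hc (by field_simp at h2; linarith)
      push_cast
      field_simp
      ring
  rw [Finset.sum_congr rfl fun a _ => e a, AdmissibleParams.logDerivPc]
  have h2 : z + -1 ≠ 0 := by linarith [hz.2]
  have h3 : 1 + z ≠ 0 := by linarith [hz.1]
  have e1 : ((2 * P.d₁ : ℕ) : ℝ) / 2 / (z + -1) = - (P.d₁ / (1 - z)) := by
    push_cast
    field_simp
    ring
  rw [e1, add_comm z 1]
  push_cast
  ring

theorem IsAdapted.sum_scal_model (hτ : IsAdapted τ γ) {y : P.Base} (hy : y ∈ τ.ψ.target)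
    {r₀ r₁ : ℝ} (hr₀ : 0 < r₀) (hr₁ : 0 < r₁) {z : ℝ} (hz : z ∈ Ioo (-1 : ℝ) 1) :
    ∑ a, scal ((model τ γ r₀ r₁ T Θ).γ a) (basePoint y a) / (z + (model τ γ r₀ r₁ T Θ).k a)
      = 2 * P.curvSum z := by
  have s0 : scal ((model τ γ r₀ r₁ T Θ).γ none) (basePoint y none) = 2 * P.d₀ * (P.d₀ + 1) := by
    refine ((isHermitianInner_reInner P.d₀).scal_eq hr₀ one_ne_zero).trans ?_
    rw [finrank_real_of_complex, finrank_euclideanSpace_fin]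
    push_cast
    ring
  have s1 : scal ((model τ γ r₀ r₁ T Θ).γ (some none)) (basePoint y (some none))
      = -(2 * P.d₁ * (P.d₁ + 1)) := by
    refine ((isHermitianInner_reInner P.d₁).scal_eq hr₁ (by norm_num)).trans ?_
    rw [finrank_real_of_complex, finrank_euclideanSpace_fin]
    push_cast
    ring
  have s2 : ∀ a, scal ((model τ γ r₀ r₁ T Θ).γ (some (some a))) (basePoint y (some (some a)))
      = 2 * P.d a * P.s a := fun a => hτ.scal_eq a y hy
  have h2 : 1 - z ≠ 0 := by linarith [hz.2]
  have h3 : 1 + z ≠ 0 := by linarith [hz.1]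
  have h4 : z + -1 ≠ 0 := by linarith [hz.2]
  rw [Fintype.sum_option, Fintype.sum_option, s0, s1]
  change _ / (z + 1) + (_ / (z + -1) + ∑ a, scal ((model τ γ r₀ r₁ T Θ).γ (some (some a)))
    (basePoint y (some (some a))) / (z + if P.x a = 0 then 2 else (P.x a)⁻¹)) = _
  have e : ∀ a, scal ((model τ γ r₀ r₁ T Θ).γ (some (some a)))
    (basePoint y (some (some a))) / (z + if P.x a = 0 then 2 else (P.x a)⁻¹)
      = 2 * (P.x a * P.d a * P.s a / (1 + P.x a * z)) := by
    intro a
    have hc := (D.coeff_pos (Ioo_subset_Icc_self hz) a).ne'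
    rw [s2]
    by_cases hx : P.x a = 0
    · have hd : P.d a = 0 := by
        by_contra hd
        have : NeZero (P.d a) := ⟨hd⟩
        have h2 := hτ.eq_zero hy hx (EuclideanSpace.single 0 1)
        simpa using congrArg (fun v : EuclideanSpace ℂ (Fin (P.d a)) => v 0) h2
      simp [hd]
    · rw [if_neg hx]
      have h2 : z + (P.x a)⁻¹ ≠ 0 := fun h2 => hc (by field_simp at h2; linarith)
      field_simp
      ring
  have e1 : -(2 * P.d₁ * (P.d₁ + 1) : ℝ) / (z + -1) = 2 * (P.d₁ * (P.d₁ + 1) / (1 - z)) := by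
    field_simp
    ring
  rw [Finset.sum_congr rfl fun a _ => e a, AdmissibleParams.curvSum, e1, ← Finset.mul_sum,
    add_comm z 1]
  ring

theorem IsAdapted.model_pos (hτ : IsAdapted τ γ) {r₀ r₁ : ℝ} (hr₀ : 0 < r₀) (hr₁ : 0 < r₁)
    (hn : P.basePart n.1 ∈ τ.ψ.target) (hg : (model τ γ r₀ r₁ T Θ).Good n)
    (X : (∀ a, P.Fac a) × ℂ) (hX : X ≠ 0) : 0 < (model τ γ r₀ r₁ T Θ).G n X X := by
  have hz : (model τ γ r₀ r₁ T Θ).z n ∈ Ioo (-1 : ℝ) 1 := tanh_mem_Ioo _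
  set C := model τ γ r₀ r₁ T Θ with hC
  refine hg.pos (fun a => ?_) X hX
  match a with
  | none =>
    intro v hv
    have h1 : C.γ none (n.1 none) v v
        = 1 * fsMetric (reInner P.d₀) r₀ (P.part₀ n.1) v v := rfl
    rw [h1, one_mul]
    exact mul_pos (show 0 < C.z n + 1 by linarith [hz.1])
      ((isHermitianInner_reInner P.d₀).fsMetric_pos hr₀ _ hv)
  | some none =>
    intro v hv
    have h1 : C.γ (some none) (n.1 (some none)) v v
        = -1 * fsMetric (reInner P.d₁) r₁ (P.part₁ n.1) v v := rfl
    rw [h1, neg_one_mul]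
    exact mul_pos_of_neg_of_neg (show C.z n + -1 < 0 by linarith [hz.2])
      (neg_neg_of_pos ((isHermitianInner_reInner P.d₁).fsMetric_pos hr₁ _ hv))
  | some (some a) =>
    intro v hv
    have hx : P.x a ≠ 0 := fun hx => hv (hτ.eq_zero hn hx v)
    have hk : C.k (some (some a)) = (P.x a)⁻¹ := if_neg hx
    have h1 := hτ.pos a _ hn v hv
    have h2 := D.coeff_pos (Ioo_subset_Icc_self hz) a
    have h3 : (C.z n + C.k (some (some a))) * C.γ (some (some a)) (n.1 (some (some a))) v v
        = (1 + P.x a * C.z n) * (P.x a * γ a (P.basePart n.1 a) v v) * (P.x a ^ 2)⁻¹ := by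
      rw [hk]
      change (C.z n + (P.x a)⁻¹) * γ a (P.basePart n.1 a) v v = _
      field_simp
      ring
    rw [h3]
    exact mul_pos (mul_pos h2 h1) (inv_pos.2 (by positivity))

theorem model_u_basePoint {p : D.Coord} :
    (model τ γ (‖p.2.1‖ ^ 2) (‖p.2.2‖ ^ 2) T Θ).u (basePoint p.1, 0) = D.logRatio τ p := by
  have h : ∀ {n k : ℕ} (v : EuclideanSpace ℂ (Fin n)),
      fsPot (reInner k) (‖v‖ ^ 2) 0 = Real.log ‖v‖ := by
    intro n k v
    rw [fsPot, map_zero, add_zero, Real.log_pow]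
    push_cast
    ring
  change (τ.φ₀ (τ.ψ.symm p.1) - τ.φ₁ (τ.ψ.symm p.1)) + fsPot (reInner P.d₀) (‖p.2.1‖ ^ 2) 0
    - fsPot (reInner P.d₁) (‖p.2.2‖ ^ 2) 0 + 0 = _
  rw [h, h, add_zero]
  rfl

end AdmissibleData

namespace AdmissibleData
open AdmissibleParams

variable {D : AdmissibleData P E₀ E₁ M} {τ : Gauge P E₀ E₁ D.h₀ D.h₁}
  {γ : ∀ a, EuclideanSpace ℂ (Fin (P.d a)) →
      EuclideanSpace ℂ (Fin (P.d a)) →L[ℝ] EuclideanSpace ℂ (Fin (P.d a)) →L[ℝ] ℝ}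
  {T Θ t : ℝ → ℝ} {v : P.Fib₀} {w : P.Fib₁} {L₀ : EuclideanSpace ℂ (Fin P.d₀) →ₗᵢ[ℂ] P.Fib₀}
  {L₁ : EuclideanSpace ℂ (Fin P.d₁) →ₗᵢ[ℂ] P.Fib₁} {n : (∀ a, P.Fac a) × ℂ}

theorem modelCoord_basePoint {p : D.Coord} (hT : T (D.logRatio τ p) = D.logRatio τ p)
    {L₀ : EuclideanSpace ℂ (Fin P.d₀) →ₗᵢ[ℂ] P.Fib₀}
    {L₁ : EuclideanSpace ℂ (Fin P.d₁) →ₗᵢ[ℂ] P.Fib₁} :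
    modelCoord τ γ T Θ p.2.1 p.2.2 L₀ L₁ (basePoint p.1, 0) = p := by
  have hs : modelScale (model τ γ (‖p.2.1‖ ^ 2) (‖p.2.2‖ ^ 2) T Θ) T (basePoint p.1, 0) = 1 := by
    rw [modelScale, model_u_basePoint, hT, sub_self]
    simp
  refine Prod.ext rfl (Prod.ext ?_ ?_)
  · change modelScale _ T _ • (p.2.1 + L₀ 0) = p.2.1
    rw [hs, map_zero, add_zero, one_smul]
  · change p.2.2 + L₁ 0 = p.2.2
    rw [map_zero, add_zero]

/-- Near `n`, the map `δ` identifies the local model `C` with the metric of momentum profile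
`(1 - z²) (1 + (1 - z²) t(z))` in the chart at `x`. -/
structure IsModelAt (D : AdmissibleData P E₀ E₁ M) (t : ℝ → ℝ) (x : M) (C : Calabi P.Fac)
    (δ : (∀ a, P.Fac a) × ℂ → P.Tot) (n : (∀ a, P.Fac a) × ℂ) : Prop where
  regular : ∀ᶠ n' in 𝓝 n, C.Regular n'
  pos : ∀ X, X ≠ 0 → 0 < C.G n X X
  isometry : IsLocalIsometryAt δ C.G (inChart (D.metric t) x) n
  form : ∀ᶠ n' in 𝓝 n, ∀ X Y,
    inChart D.form x (δ n') (fderiv ℝ δ n' X) (fderiv ℝ δ n' Y) = C.G n' (Complex.I • X) Y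
  z_eq : ∀ᶠ n' in 𝓝 n, D.zChart x (δ n') = C.z n'
  z_mem : C.z n ∈ Ioo (-1 : ℝ) 1
  profile : ∀ z, C.Θ z = (1 - z ^ 2) * (1 + (1 - z ^ 2) * t z)
  S_eq : ∀ z ∈ Ioo (-1 : ℝ) 1, C.S z = P.logDerivPc z
  sum_scal : ∑ a, scal (C.γ a) (n.1 a) / (C.z n + C.k a) = 2 * P.curvSum (C.z n)

theorem IsAdapted.exists_isModelAt (hτ : IsAdapted τ γ) (hts : ContDiff ℝ ∞ t)
    (ht : ∀ z ∈ Icc (-1 : ℝ) 1, 0 < 1 + (1 - z ^ 2) * t z) {x : M} {p : D.Coord}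
    (hp : p ∈ overChart τ x) (hd : p ∈ D.dom τ) :
    ∃ C δ n, IsModelAt D t x C δ n ∧ δ n = toChart τ x p := by
  let κ : ℝ → ℝ := fun z => 1 + (1 - z ^ 2) * t z
  let Θ : ℝ → ℝ := fun z => (1 - z ^ 2) * κ z
  have hκ : ContDiff ℝ ∞ κ :=
    contDiff_const.add ((contDiff_const.sub (contDiff_id.pow 2)).mul hts)
  have hΘs : ContDiff ℝ ∞ Θ := (contDiff_const.sub (contDiff_id.pow 2)).mul hκ
  have hΘpos : ∀ z ∈ Ioo (-1 : ℝ) 1, 0 < Θ z := fun z hz =>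
    mul_pos (by nlinarith [hz.1, hz.2]) (ht z (Ioo_subset_Icc_self hz))
  obtain ⟨T, hTc, hT⟩ := exists_reparametrization (hκ.comp contDiff_tanh)
    (fun s => ht _ (Ioo_subset_Icc_self (tanh_mem_Ioo s))) (D.logRatio τ p)
  obtain ⟨L₀, hL₀⟩ := exists_slice hd.2.1
  obtain ⟨L₁, hL₁⟩ := exists_slice hd.2.2
  let n : (∀ a, P.Fac a) × ℂ := (basePoint p.1, 0)
  have hu : (model τ γ (‖p.2.1‖ ^ 2) (‖p.2.2‖ ^ 2) T Θ).u n = D.logRatio τ p := model_u_basePoint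
  have hr₀ := sq_norm_pos hd.2.1
  have hr₁ := sq_norm_pos hd.2.2
  have hn : P.basePart n.1 ∈ τ.ψ.target := hd.1
  have hρn : modelCoord τ γ T Θ p.2.1 p.2.2 L₀ L₁ n = p := modelCoord_basePoint hTc
  set C := model τ γ (‖p.2.1‖ ^ 2) (‖p.2.2‖ ^ 2) T Θ with hC
  set ρ := modelCoord τ γ T Θ p.2.1 p.2.2 L₀ L₁ with hρ
  have huc : ContinuousAt C.u n := by
    have h1 : ContinuousAt C.h n.1 := (contDiffAt_model_h hr₀ hr₁ hn).continuousAt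
    exact (h1.comp continuousAt_fst).add
      (Complex.continuous_re.continuousAt.comp continuousAt_snd)
  have hTu : ∀ᶠ n' in 𝓝 n, ∀ᶠ s in 𝓝 (C.u n'), ContDiffAt ℝ ∞ T s ∧
      HasDerivAt T (κ (Real.tanh (T s))) s := by
    rw [← hu] at hT
    exact huc.eventually hT.eventually_nhds
  have hbase : ∀ᶠ n' in 𝓝 n, P.basePart n'.1 ∈ τ.ψ.target :=
    ((P.basePart.continuous.comp continuous_fst).continuousAt (x := n)).preimage_mem_nhds
      (τ.ψ.open_target.mem_nhds hn)
  have hρs : ContDiffAt ℝ ∞ ρ n :=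
    contDiffAt_modelCoord hd.2.1 hd.2.2 hn hTu.self_of_nhds.self_of_nhds.1
  have hover : ∀ᶠ n' in 𝓝 n, ρ n' ∈ overChart τ x := by
    refine hρs.continuousAt.preimage_mem_nhds ((isOpen_overChart x).mem_nhds ?_)
    rwa [hρn]
  have hreg : ∀ᶠ n' in 𝓝 n, C.Regular n' := by
    filter_upwards [hTu, hbase] with n' h1 h2
    refine hτ.regular_model hr₀ hr₁ hΘs hΘpos h2 h1.self_of_nhds.1 ?_
    filter_upwards [h1] with s hs
    refine ((hasDerivAt_tanh (T s)).comp s hs.2).congr_deriv ?_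
    rfl
  have hpos : ∀ X, X ≠ 0 → 0 < C.G n X X :=
    hτ.model_pos hr₀ hr₁ hn hreg.self_of_nhds.eventually_good.self_of_nhds
  let δ : (∀ a, P.Fac a) × ℂ → P.Tot := fun n => toChart τ x (ρ n)
  have hδ : ∀ᶠ n' in 𝓝 n, ∀ X, fderiv ℝ δ n' X
      = fderiv ℝ (toChart τ x) (ρ n') (fderiv ℝ ρ n' X) := by
    filter_upwards [hover, hbase, hTu] with n' h1 h2 h3 X
    have h4 := HasFDerivAt.comp (g := toChart τ x) n'
      ((contDiffAt_real_toChart h1).differentiableAt (by simp)).hasFDerivAt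
      ((contDiffAt_modelCoord (γ := γ) (Θ := Θ) (L₀ := L₀) (L₁ := L₁) hd.2.1 hd.2.2 h2
        h3.self_of_nhds.1).differentiableAt (by simp)).hasFDerivAt
    exact congrArg (fun A => A X) h4.fderiv
  have hpull : ∀ᶠ n' in 𝓝 n, ∀ X Y, C.G n' X Y
      = inChart (D.metric t) x (δ n') (fderiv ℝ δ n' X) (fderiv ℝ δ n' Y) := by
    filter_upwards [hover, hbase, hTu, hδ] with n' h1 h2 h3 h4 X Y
    rw [h4, h4]
    exact ((inChart_metric t h1 _ _).trans (hτ.metricMap_modelCoord hd.2.1 hd.2.2 hL₀ hL₁ h2 ht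
      (fun _ => rfl) h3.self_of_nhds.1 h3.self_of_nhds.2 X Y)).symm
  have hpx : δ n = toChart τ x p := congrArg (toChart τ x) hρn
  refine ⟨C, δ, n, ⟨hreg, hpos, ⟨?_, ?_, ?_, ?_, hpull⟩, ?_, ?_, ?_, fun _ => rfl, ?_, ?_⟩, hpx⟩
  · refine ContDiffAt.comp (g := toChart τ x) n ?_ hρs
    exact contDiffAt_real_toChart hover.self_of_nhds
  · refine isInvertible_of_injective (fun X hX => ?_) finrank_model
    by_contra hne
    have h1 := hpull.self_of_nhds X X
    rw [hX, map_zero] at h1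
    exact (hpos X hne).ne' h1
  · exact hreg.self_of_nhds.isHolKahlerAt.toIsMetricAt
  · rw [hpx]
    exact isMetricAt_inChart hts ht (toChart_mem_target hp)
  · filter_upwards [hover, hbase, hTu, hδ] with n' h1 h2 h3 h4 X Y
    rw [h4, h4]
    exact (inChart_form h1 _ _).trans (hτ.formMap_modelCoord hd.2.1 hd.2.2 hL₀ hL₁ h2
      (fun _ => rfl) h3.self_of_nhds.1 h3.self_of_nhds.2 X Y)
  · filter_upwards [hover, hbase] with n' h1 h2
    exact (zChart_toChart h1).trans (mom_modelCoord hd.2.1 hd.2.2 hL₀ hL₁ h2)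
  · exact tanh_mem_Ioo _
  · exact fun z hz => hτ.model_S_eq hd.1 hz
  · exact hτ.sum_scal_model hd.1 hr₀ hr₁ (tanh_mem_Ioo _)

end AdmissibleData

end Admissible

namespace LocalGeometry

section Smooth

variable {V : Type*} [NormedAddCommGroup V] [NormedSpace ℝ V] [FiniteDimensional ℝ V]
  {G W : V → V →L[ℝ] V →L[ℝ] ℝ} {f g : V → ℝ} {u : V}

theorem IsMetricAt.contDiffAt_complexStr (hG : IsMetricAt G u) (hW : ContDiffAt ℝ ∞ W u) :
    ContDiffAt ℝ ∞ (complexStr G W) u :=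
  hG.contDiffAt_inverse.clm_comp hW

theorem IsMetricAt.contDiffAt_complexStr_sharp (hG : IsMetricAt G u) (hW : ContDiffAt ℝ ∞ W u)
    (hf : ContDiffAt ℝ ∞ f u) :
    ContDiffAt ℝ ∞ (fun u' => complexStr G W u' (sharp G u' (fderiv ℝ f u'))) u :=
  (hG.contDiffAt_complexStr hW).clm_apply
    (hG.contDiffAt_inverse.clm_apply (hf.fderiv_right (m := ∞) (by simp)))

theorem continuousAt_fderiv {F : Type*} [NormedAddCommGroup F] [NormedSpace ℝ F] {T : V → F}
    (hT : ContDiffAt ℝ ∞ T u) : ContinuousAt (fderiv ℝ T) u :=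
  (hT.fderiv_right (m := ∞) (by simp)).continuousAt

theorem IsMetricAt.continuousAt_nijenhuis (hG : IsMetricAt G u) (hW : ContDiffAt ℝ ∞ W u)
    (v w : V) : ContinuousAt (fun u => nijenhuis (complexStr G W) u v w) u := by
  have h := hG.contDiffAt_complexStr hW
  have h0 := h.continuousAt
  have h1 := continuousAt_fderiv h
  have : (fun u => nijenhuis (complexStr G W) u v w) = fun u =>
    fderiv ℝ (complexStr G W) u (complexStr G W u v) w
      - fderiv ℝ (complexStr G W) u (complexStr G W u w) v
      + complexStr G W u (fderiv ℝ (complexStr G W) u w v)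
      - complexStr G W u (fderiv ℝ (complexStr G W) u v w) := rfl
  rw [this]
  fun_prop

theorem weightedScal_congr (h : f =ᶠ[𝓝 u] g) (p : ℝ) :
    weightedScal G f p u = weightedScal G g p u := by
  have h1 : fderiv ℝ f =ᶠ[𝓝 u] fderiv ℝ g := h.fderiv
  have h2 : fderiv ℝ (fderiv ℝ f) u = fderiv ℝ (fderiv ℝ g) u := h1.fderiv_eq
  have h3 : fderiv ℝ f u = fderiv ℝ g u := h.fderiv_eq
  simp only [weightedScal, laplacian, hessian, normSqDiff, h2, h3, h.self_of_nhds]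

end Smooth

end LocalGeometry

section Admissible

variable {ι : Type*} [Fintype ι] {P : AdmissibleParams ι}
  {S : Type*} [TopologicalSpace S] [ChartedSpace P.Base S]
  {E₀ E₁ : S → Type*}
  [∀ s, AddCommGroup (E₀ s)] [∀ s, Module ℂ (E₀ s)] [∀ s, TopologicalSpace (E₀ s)]
  [TopologicalSpace (TotalSpace P.Fib₀ E₀)] [FiberBundle P.Fib₀ E₀]
  [∀ s, AddCommGroup (E₁ s)] [∀ s, Module ℂ (E₁ s)] [∀ s, TopologicalSpace (E₁ s)]
  [TopologicalSpace (TotalSpace P.Fib₁ E₁)] [FiberBundle P.Fib₁ E₁]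
  {M : Type*} [TopologicalSpace M] [ChartedSpace P.Tot M]
  [VectorBundle ℂ P.Fib₀ E₀] [VectorBundle ℂ P.Fib₁ E₁] [IsManifold 𝓘(ℂ, P.Base) ω S]
  [IsManifold 𝓘(ℂ, P.Tot) ω M]

open ManifoldGeometry LocalGeometry

namespace AdmissibleData

open AdmissibleParams

variable {D : AdmissibleData P E₀ E₁ M} {t : ℝ → ℝ} {x : M} {C : Calabi P.Fac}
  {δ : (∀ a, P.Fac a) × ℂ → P.Tot} {n : (∀ a, P.Fac a) × ℂ}

namespace IsModelAt

theorem isKahlerAt (h : IsModelAt D t x C δ n) (hδ : δ n ∈ (chartAt P.Tot x).target) :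
    IsKahlerAt (inChart (D.metric t) x) (inChart D.form x) (δ n) :=
  h.isometry.isKahlerAt h.regular.self_of_nhds.isHolKahlerAt h.pos (contDiffAt_inChart_form hδ)
    h.form

theorem isKillingPotentialAt (h : IsModelAt D t x C δ n) (hδ : δ n ∈ (chartAt P.Tot x).target)
    (c₁ c₂ : ℝ) : IsKillingPotentialAt (inChart (D.metric t) x) (inChart D.form x)
      (fun u => c₁ * D.zChart x u + c₂) (δ n) := by
  have hg := h.regular.self_of_nhds.eventually_good
  refine h.isometry.isKillingPotentialAt (contDiffAt_inChart_form hδ) h.form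
    ((contDiffAt_const.mul (contDiffAt_zChart hδ)).add contDiffAt_const) (e := c₁ • (0, 1)) ?_
    (hg.self_of_nhds.fderiv_G_vert
      (h.regular.self_of_nhds.contDiffAt_G.differentiableAt (by simp)) c₁)
  filter_upwards [hg, h.z_eq.eventually_nhds] with n' h1 h2 k
  have h3 : (fun u => c₁ * D.zChart x u + c₂) ∘ δ =ᶠ[𝓝 n'] fun n => c₁ * C.z n + c₂ :=
    h2.mono fun m hm => congrArg (fun z => c₁ * z + c₂) hm
  rw [h3.fderiv_eq]
  exact h1.fderiv_affine c₁ c₂ k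

theorem weightedScal_eq (h : IsModelAt D t x C δ n) (hδ : δ n ∈ (chartAt P.Tot x).target)
    (hts : ContDiff ℝ ∞ t) {a : ℝ} (ha : 1 < a) {p A₁ A₂ : ℝ} (hA : P.SolvesSystem a p A₁ A₂)
    (hF : ∀ z ∈ Ioo (-1 : ℝ) 1,
      P.F a p A₁ A₂ z = P.pc z * ((1 - z ^ 2) * (1 + (1 - z ^ 2) * t z))) :
    LocalGeometry.weightedScal (inChart (D.metric t) x) (fun u => D.zChart x u + a) p (δ n)
      = A₁ * D.zChart x (δ n) + A₂ := by
  have hΘ : C.Θ = fun z => (1 - z ^ 2) * (1 + (1 - z ^ 2) * t z) := funext h.profile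
  have hs : ContDiff ℝ ∞ C.Θ := by
    rw [hΘ]
    have h1 : ContDiff ℝ ∞ fun z : ℝ => 1 - z ^ 2 := contDiff_const.sub (contDiff_id.pow 2)
    exact h1.mul (contDiff_const.add (h1.mul hts))
  have h3 : (fun u => D.zChart x u + a) ∘ δ =ᶠ[𝓝 n] fun n => C.z n + a :=
    h.z_eq.mono fun m hm => congrArg (fun z => z + a) hm
  have h4 := h.isometry.weightedScal_eq (f := fun u => D.zChart x u + a)
    ((contDiffAt_zChart hδ).add contDiffAt_const) p
  rw [weightedScal_congr h3, Calabi.Regular.weightedScal_eq h.regular, h.sum_scal,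
    h.S_eq _ h.z_mem] at h4
  have h5 := profile_ode D.abs_x_lt ha hA hs (fun z hz => (hF z hz).trans (by rw [h.profile]))
    (L := C.L) (fun z hz => by rw [Calabi.L, h.S_eq z hz]) h.z_mem
  rw [← h4, h5, h.z_eq.self_of_nhds]

end IsModelAt

end AdmissibleData

namespace AdmissibleData

variable {D : AdmissibleData P E₀ E₁ M} {t : ℝ → ℝ}

/-- A continuous function vanishing at the images of the local models vanishes. -/
theorem eq_zero_of_isModelAt {F : Type*} [NormedAddCommGroup F] (hts : ContDiff ℝ ∞ t)
    (ht : ∀ z ∈ Icc (-1 : ℝ) 1, 0 < 1 + (1 - z ^ 2) * t z) {x : M} {f : P.Tot → F}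
    (hQ : ∀ C δ n, IsModelAt D t x C δ n → δ n ∈ (chartAt P.Tot x).target → f (δ n) = 0)
    {u : P.Tot} (hu : u ∈ (chartAt P.Tot x).target) (hf : ContinuousAt f u) : f u = 0 :=
  eq_zero_of_dom (D := D) (fun _ _ hτ p hp hd => by
    obtain ⟨C, δ, n, h, hδ⟩ := hτ.exists_isModelAt hts ht hp hd
    rw [← hδ]
    exact hQ C δ n h (hδ ▸ toChart_mem_target hp)) hu hf

theorem isKahlerAt_inChart (hts : ContDiff ℝ ∞ t)
    (ht : ∀ z ∈ Icc (-1 : ℝ) 1, 0 < 1 + (1 - z ^ 2) * t z) {x : M} {u : P.Tot}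
    (hu : u ∈ (chartAt P.Tot x).target) :
    IsKahlerAt (inChart (D.metric t) x) (inChart D.form x) u := by
  have hG := isMetricAt_inChart (D := D) hts ht hu
  have hW := contDiffAt_inChart_form (D := D) hu
  have hWc := hW.continuousAt
  have hJ := (hG.contDiffAt_complexStr hW).continuousAt
  refine ⟨hG.smooth, hW, inChart_metric_symm hts ht hu, fun v => inChart_metric_pos ht hu,
    fun v => ?_, fun v w k => ?_, fun v => ?_, fun v w => ?_⟩
  · exact eq_zero_of_isModelAt (D := D) hts ht (f := fun u => inChart D.form x u v v)
      (fun C δ n h hδ => (h.isKahlerAt hδ).alt v) hu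
      ((hWc.clm_apply continuousAt_const).clm_apply continuousAt_const)
  · have hW' := continuousAt_fderiv hW
    have hc : ∀ v w k, ContinuousAt (fun u => fderiv ℝ (inChart D.form x) u v w k) u :=
      fun v w k => ((hW'.clm_apply continuousAt_const).clm_apply
        continuousAt_const).clm_apply continuousAt_const
    exact eq_zero_of_isModelAt (D := D) hts ht (f := fun u => fderiv ℝ (inChart D.form x) u v w k
        + fderiv ℝ (inChart D.form x) u w k v + fderiv ℝ (inChart D.form x) u k v w)
      (fun C δ n h hδ => (h.isKahlerAt hδ).closed v w k) hu
      (((hc v w k).add (hc w k v)).add (hc k v w))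
  · refine eq_neg_of_add_eq_zero_left (eq_zero_of_isModelAt (D := D) hts ht
      (f := fun u => complexStr (inChart (D.metric t) x) (inChart D.form x) u
        (complexStr (inChart (D.metric t) x) (inChart D.form x) u v) + v)
      (fun C δ n h hδ => ?_) hu
      ((hJ.clm_apply (hJ.clm_apply continuousAt_const)).add continuousAt_const))
    rw [(h.isKahlerAt hδ).sq, neg_add_cancel]
  · exact eq_zero_of_isModelAt (D := D) hts ht
      (f := fun u => nijenhuis (complexStr (inChart (D.metric t) x) (inChart D.form x)) u v w)
      (fun C δ n h hδ => (h.isKahlerAt hδ).integrable v w) hu (hG.continuousAt_nijenhuis hW v w)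

theorem isKillingPotentialAt_inChart (hts : ContDiff ℝ ∞ t)
    (ht : ∀ z ∈ Icc (-1 : ℝ) 1, 0 < 1 + (1 - z ^ 2) * t z) {x : M} {u : P.Tot}
    (hu : u ∈ (chartAt P.Tot x).target) (c₁ c₂ : ℝ) :
    IsKillingPotentialAt (inChart (D.metric t) x) (inChart D.form x)
      (fun u => c₁ * D.zChart x u + c₂) u := by
  intro v w
  let X : P.Tot → P.Tot := fun u' => complexStr (inChart (D.metric t) x) (inChart D.form x) u'
    (sharp (inChart (D.metric t) x) u' (fderiv ℝ (fun u => c₁ * D.zChart x u + c₂) u'))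
  have hG := isMetricAt_inChart (D := D) hts ht hu
  have hf : ContDiffAt ℝ ∞ (fun u => c₁ * D.zChart x u + c₂) u :=
    (contDiffAt_const.mul (contDiffAt_zChart hu)).add contDiffAt_const
  have hX : ContDiffAt ℝ ∞ X u :=
    hG.contDiffAt_complexStr_sharp (contDiffAt_inChart_form (D := D) hu) hf
  have hXc := hX.continuousAt
  have hX' := continuousAt_fderiv hX
  have hGc := hG.smooth.continuousAt
  have hG' := continuousAt_fderiv hG.smooth
  refine eq_zero_of_isModelAt (D := D) hts ht
    (f := fun u => fderiv ℝ (inChart (D.metric t) x) u (X u) v w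
      + inChart (D.metric t) x u (fderiv ℝ X u v) w + inChart (D.metric t) x u v (fderiv ℝ X u w))
    (fun C δ n h hδ => h.isKillingPotentialAt hδ c₁ c₂ v w) hu ?_
  exact ((((hG'.clm_apply hXc).clm_apply continuousAt_const).clm_apply continuousAt_const).add
    ((hGc.clm_apply (hX'.clm_apply continuousAt_const)).clm_apply continuousAt_const)).add
    ((hGc.clm_apply continuousAt_const).clm_apply (hX'.clm_apply continuousAt_const))

theorem weightedScal_inChart (hts : ContDiff ℝ ∞ t)
    (ht : ∀ z ∈ Icc (-1 : ℝ) 1, 0 < 1 + (1 - z ^ 2) * t z) {a : ℝ} (ha : 1 < a) {p A₁ A₂ : ℝ}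
    (hA : P.SolvesSystem a p A₁ A₂) (hF : ∀ z ∈ Ioo (-1 : ℝ) 1,
      P.F a p A₁ A₂ z = P.pc z * ((1 - z ^ 2) * (1 + (1 - z ^ 2) * t z))) {x : M} {u : P.Tot}
    (hu : u ∈ (chartAt P.Tot x).target) :
    LocalGeometry.weightedScal (inChart (D.metric t) x) (fun u => D.zChart x u + a) p u
      = A₁ * D.zChart x u + A₂ := by
  have hG : ∀ᶠ u' in 𝓝 u, IsMetricAt (inChart (D.metric t) x) u' := by
    filter_upwards [(chartAt P.Tot x).open_target.mem_nhds hu] with u' hu'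
    exact isMetricAt_inChart hts ht hu'
  have hz := contDiffAt_zChart (D := D) hu
  have hzc := hz.continuousAt
  refine sub_eq_zero.1 (eq_zero_of_isModelAt (D := D) hts ht
    (f := fun u => LocalGeometry.weightedScal (inChart (D.metric t) x)
      (fun u => D.zChart x u + a) p u - (A₁ * D.zChart x u + A₂))
    (fun C δ n h hδ => sub_eq_zero.2 (h.weightedScal_eq hδ hts ha hA hF)) hu ?_)
  exact (IsMetricAt.continuousAt_weightedScal hG (hz.add contDiffAt_const) p).sub
    ((continuousAt_const.mul hzc).add continuousAt_const)

variable (D) in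
theorem contMDiff_z : ContMDiff 𝓘(ℝ, P.Tot) 𝓘(ℝ) ∞ D.z := by
  intro x
  have hx := mem_chart_target P.Tot x
  have hz := contDiffAt_zChart (D := D) hx
  refine contMDiffAt_iff.2 ⟨?_, hz.contDiffWithinAt⟩
  have h1 : D.z =ᶠ[𝓝 x] fun x' => D.zChart x (chartAt P.Tot x x') := by
    filter_upwards [(chartAt P.Tot x).open_source.mem_nhds (mem_chart_source P.Tot x)] with x' hx'
    rw [zChart, (chartAt P.Tot x).left_inv hx']
  exact (ContinuousAt.comp (g := D.zChart x) hz.continuousAt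
    ((chartAt P.Tot x).continuousAt (mem_chart_source P.Tot x))).congr h1.symm

theorem isKahler_metric (hts : ContDiff ℝ ∞ t)
    (ht : ∀ z ∈ Icc (-1 : ℝ) 1, 0 < 1 + (1 - z ^ 2) * t z) : IsKahler (D.metric t) D.form :=
  fun x => isKahlerAt_inChart hts ht (mem_chart_target P.Tot x)

theorem isKillingPotential_affine (hts : ContDiff ℝ ∞ t)
    (ht : ∀ z ∈ Icc (-1 : ℝ) 1, 0 < 1 + (1 - z ^ 2) * t z) (c₁ c₂ : ℝ) :
    IsKillingPotential (D.metric t) D.form fun x => c₁ * D.z x + c₂ :=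
  ⟨(contMDiff_const.mul D.contMDiff_z).add contMDiff_const,
    fun x => isKillingPotentialAt_inChart hts ht (mem_chart_target P.Tot x) c₁ c₂⟩

variable (D) in
theorem z_mem_Icc (x : M) : D.z x ∈ Icc (-1 : ℝ) 1 := by
  obtain ⟨τ, γ, p, hτ, hp, rfl⟩ := D.exists_coord x
  rw [z_toM hp]
  exact mom_mem_Icc hp.2

variable (D) in
theorem exists_z_eq_one [Nonempty S] : ∃ x, D.z x = 1 := by
  obtain ⟨s⟩ := ‹Nonempty S›
  obtain ⟨τ, γ, hs, hτ⟩ := D.exists_isAdapted s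
  let p : D.Coord := (τ.ψ s, EuclideanSpace.single 0 1, 0)
  have hp : p ∈ punctured τ := ⟨τ.ψ.map_source hs, fun h => by
    have := congrArg (fun q : P.Fib₀ × P.Fib₁ => q.1 0) h
    simp [p] at this⟩
  have h1 : sq₁ τ p = 0 := by simp [sq₁, p]
  have h2 := sq_pos (τ := τ) hp.2
  refine ⟨D.toM τ p, ?_⟩
  rw [h1, add_zero] at h2
  rw [z_toM hp, h1, sub_zero, add_zero, div_self h2.ne']

variable (D) in
theorem exists_z_eq_neg_one [Nonempty S] : ∃ x, D.z x = -1 := by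
  obtain ⟨s⟩ := ‹Nonempty S›
  obtain ⟨τ, γ, hs, hτ⟩ := D.exists_isAdapted s
  let p : D.Coord := (τ.ψ s, 0, EuclideanSpace.single 0 1)
  have hp : p ∈ punctured τ := ⟨τ.ψ.map_source hs, fun h => by
    have := congrArg (fun q : P.Fib₀ × P.Fib₁ => q.2 0) h
    simp [p] at this⟩
  have h1 : sq₀ τ p = 0 := by simp [sq₀, p]
  have h2 := sq_pos (τ := τ) hp.2
  refine ⟨D.toM τ p, ?_⟩
  rw [h1, zero_add] at h2
  rw [z_toM hp, h1, zero_sub, zero_add, neg_div, div_self h2.ne']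

end AdmissibleData

end Admissible

end

theorem proposition2p2 {ι : Type*} [Fintype ι] (P : AdmissibleParams ι)
    {S : Type*} [TopologicalSpace S] [T2Space S] [CompactSpace S] [ConnectedSpace S]
    [ChartedSpace P.Base S] [IsManifold 𝓘(ℂ, P.Base) ω S]
    (E₀ : S → Type*) [∀ s, AddCommGroup (E₀ s)] [∀ s, Module ℂ (E₀ s)]
    [∀ s, TopologicalSpace (E₀ s)] [TopologicalSpace (TotalSpace P.Fib₀ E₀)]
    [FiberBundle P.Fib₀ E₀] [VectorBundle ℂ P.Fib₀ E₀]
    [ContMDiffVectorBundle ω P.Fib₀ E₀ 𝓘(ℂ, P.Base)]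
    (E₁ : S → Type*) [∀ s, AddCommGroup (E₁ s)] [∀ s, Module ℂ (E₁ s)]
    [∀ s, TopologicalSpace (E₁ s)] [TopologicalSpace (TotalSpace P.Fib₁ E₁)]
    [FiberBundle P.Fib₁ E₁] [VectorBundle ℂ P.Fib₁ E₁]
    [ContMDiffVectorBundle ω P.Fib₁ E₁ 𝓘(ℂ, P.Base)]
    (M : Type*) [TopologicalSpace M] [ChartedSpace P.Tot M] [IsManifold 𝓘(ℂ, P.Tot) ω M]
    (D : AdmissibleData P E₀ E₁ M) :
    ∃ om : ManifoldGeometry.Tensor2 P.Tot M, D.IsAdmissibleForm om ∧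
      ∀ a p : ℝ, 1 < a →
        P.alpha a 1 (-(1 + p)) ^ 2 < P.alpha a 0 (-(1 + p)) * P.alpha a 2 (-(1 + p)) ∧
        (∃! A : ℝ × ℝ, P.SolvesSystem a p A.1 A.2) ∧
        ∀ A₁ A₂ : ℝ, P.SolvesSystem a p A₁ A₂ →
          ContDiffOn ℝ ∞ (P.F a p A₁ A₂) (Icc (-1) 1) ∧
          (∀ z ∈ Ioo (-1 : ℝ) 1,
            deriv (deriv fun w => P.F a p A₁ A₂ w / (w + a) ^ (p - 1)) z = P.Q a p A₁ A₂ z) ∧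
          P.F a p A₁ A₂ (-1) = 0 ∧ P.F a p A₁ A₂ 1 = 0 ∧
          derivWithin (P.F a p A₁ A₂) (Icc (-1) 1) (-1) = 2 * P.pc (-1) ∧
          derivWithin (P.F a p A₁ A₂) (Icc (-1) 1) 1 = -2 * P.pc 1 ∧
          ((∀ z ∈ Ioo (-1 : ℝ) 1, 0 < P.F a p A₁ A₂ z) →
            ∃ (Θ : ℝ → ℝ) (g : ManifoldGeometry.Tensor2 P.Tot M),
              IsMomentumProfile Θ ∧
              (∀ z ∈ Ioo (-1 : ℝ) 1, Θ z = P.F a p A₁ A₂ z / P.pc z) ∧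
              D.IsAdmissibleMetric Θ g ∧
              ManifoldGeometry.IsKahler g om ∧
              ManifoldGeometry.IsWeightedExtremal g om (fun x => D.z x + a) p ∧
              (∀ x, ManifoldGeometry.weightedScal g (fun x => D.z x + a) p x
                = A₁ * D.z x + A₂) ∧
              (ManifoldGeometry.IsWeightedCSCK g om (fun x => D.z x + a) p ↔ A₁ = 0)) := by
  refine ⟨D.form, AdmissibleData.isAdmissibleForm_form, fun a p ha =>
    ⟨(AdmissibleParams.alpha_sq_lt D.abs_x_lt ha _).2,
      AdmissibleParams.existsUnique_solvesSystem D.abs_x_lt ha p, fun A₁ A₂ hA => ?_⟩⟩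
  obtain ⟨h1, h2, h3, h4, h5, h6⟩ := AdmissibleParams.F_properties D.abs_x_lt ha hA
  refine ⟨h1, h2, h3, h4, h5, h6, fun hpos => ?_⟩
  obtain ⟨t, hts, ht, hF⟩ := AdmissibleParams.exists_profile D.abs_x_lt ha hA hpos
  have hF' := fun z (hz : z ∈ Ioo (-1 : ℝ) 1) => hF z (Ioo_subset_Icc_self hz)
  have hK := AdmissibleData.isKahler_metric (D := D) hts ht
  have hf : ManifoldGeometry.IsKillingPotential (D.metric t) D.form fun x => D.z x + a := by
    simpa only [one_mul] using AdmissibleData.isKillingPotential_affine (D := D) hts ht 1 a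
  have hfpos : ∀ x, 0 < D.z x + a := fun x => by linarith [(D.z_mem_Icc x).1]
  have hs : ∀ x, ManifoldGeometry.weightedScal (D.metric t) (fun x => D.z x + a) p x
      = A₁ * D.z x + A₂ := fun x => by
    have h := AdmissibleData.weightedScal_inChart (D := D) hts ht ha hA hF'
      (mem_chart_target P.Tot x)
    rw [AdmissibleData.zChart, (chartAt P.Tot x).left_inv (mem_chart_source P.Tot x)] at h
    exact h
  refine ⟨fun z => (1 - z ^ 2) * (1 + (1 - z ^ 2) * t z), D.metric t,
    isMomentumProfile_of_smooth hts ht, fun z hz => ?_,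
    AdmissibleData.isAdmissibleMetric_metric (fun z hz => ht z (Ioo_subset_Icc_self hz))
      fun z => rfl, hK, ⟨hK, hf, hfpos, ?_⟩, hs, fun h => ?_, fun h => ?_⟩
  · rw [hF' z hz, mul_div_cancel_left₀ _ (AdmissibleParams.pc_pos D.abs_x_lt hz).ne']
  · rw [funext hs]
    exact AdmissibleData.isKillingPotential_affine hts ht A₁ A₂
  · obtain ⟨-, -, -, c, hc⟩ := h
    obtain ⟨x, hx⟩ := D.exists_z_eq_one
    obtain ⟨y, hy⟩ := D.exists_z_eq_neg_one
    have e1 := (hs x).symm.trans (hc x)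
    have e2 := (hs y).symm.trans (hc y)
    rw [hx] at e1
    rw [hy] at e2
    linarith
  · exact ⟨hK, hf, hfpos, A₂, fun x => by rw [hs, h, zero_mul, zero_add]⟩
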